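/- **Setting.** A compact smoothly stratified space $X$ of dimension $\ell$ with an iterated edge metric is a nonempty compact (Hausdorff, second countable) space $X=\bigsqcup_{j\le \ell}Y_j$ with $X^{\rm reg}=Y_\ell$ open and dense, $Y_{\ell-1}=\emptyset$, and a continuous Riemannian metric $g$ on the smooth $\ell$-manifold $X^{\rm reg}$, such that every $x\in Y_j$, $j<\ell$, has a neighbourhood homeomorphic, compatibly with the strata, to $\mathbb B^j(\delta)\times C_\delta(L)$, where $C_\delta(L)$ is the truncated cone over a compact smoothly stratified space $L$ of dimension $\ell-j-1$ and smaller depth with an iterated edge metric $k_L$; the homeomorphism sends $(0,\text{tip})$ to $x$, is a diffeomorphism between the regular parts, and for some $C$ and some $\gamma_0>0$ it satisfies $|\varphi^*g-g_0|_{g_0}\le C\rho^{\gamma_0}$ on $\mathbb B^j(\rho)\times C_\rho(L^{\rm reg})$ for all $\rho<\delta$, where $g_0=|dy|^2+dr^2+r^2k_L$. (Depth $0$: $X=X^{\rm reg}$.) The operator $-\Delta_g$ is the Friedrichs operator on $L^2(X^{\rm reg},d\mathrm{vol}_g)$ of the form $\int|du|_g^2\,d\mathrm{vol}_g$ on $C^1_0(X^{\rm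 reg})$, and $\lambda_1(X)$ is its first nonzero eigenvalue, that is, an eigenvalue which is the least nonzero point of the spectrum. Put $\nu_1(X)=1$ if $\lambda_1(X)\ge \ell$; otherwise $\nu_1(X)$ is the unique number in $(0,1)$ with $\lambda_1(X)=\nu_1(X)(\ell-1+\nu_1(X))$. **Statement.** Let $k\ge1$, $m\ge1$, $n=k+m+1$, and let $Z$ be a compact smoothly stratified space of dimension $m=n-k-1$ with an iterated edge metric $k_Z$ and with first nonzero eigenvalue $\lambda_1(Z)$. Let $S$ be the $k$-fold spherical suspension of $Z$, i.e. the unit sphere $\{|y|^2+r^2=1\}$ of $C(S)=\mathbb R^k\times C(Z)$, with regular set $\{r>0,\ z\in Z^{\rm reg}\}$ and the induced metric $$h=d\psi^2+\sin^2\psi\, g_{\mathbb S^{k-1}}+\cos^2\psi\, k_Z,\qquad |y|=\sin\psi,\ r=\cos\psi .$$ Then $-\Delta_h$ has a first nonzero eigenvalue $\lambda_1(S)$, and: - if $\lambda_1(Z)\ge \dim Z=n-k-1$, then $\lambda_1(S)=n-1$; - if $\lambda_1(Z)\le \dim Z$, then there is a unique $\gamma>0$ with $\lambda_1(Z)=\gamma(\gamma+n-k-2)$,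 and $\lambda_1(S)=\gamma(n-2+\gamma)$. Consequently $\nu_1(S)=\nu_1(Z)$, where $\dim S=n-1$. -/

import Mathlib

open Set Filter MeasureTheory
open scoped Manifold ContDiff Topology ENNReal RealInnerProductSpace

universe u

/-- Euclidean space `ℝⁿ`. -/
abbrev Euc (n : ℕ) : Type := EuclideanSpace ℝ (Fin n)

noncomputable section

/-! ### The Friedrichs Laplacian of a (possibly incomplete) Riemannian manifold -/

section Friedrichs

variable {E H M : Type*} [NormedAddCommGroup E] [NormedSpace ℝ E] [TopologicalSpace H]
  (I : ModelWithCorners ℝ E H) [TopologicalSpace M] [ChartedSpace H M]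

/-- The vector dual to the covector `β` with respect to the inner product `g`: the unique `w` with
`g w v = β v` for all `v`. -/
def dualVector {V : Type*} [AddCommGroup V] (g : V → V → ℝ) (β : V → ℝ) : V :=
  Classical.epsilon fun w => ∀ v, g w v = β v

/-- The pointwise product `⟨du, dv⟩_g = du (grad_g v)` of the differentials of two functions. -/
def diffInner (g : ∀ x : M, TangentSpace I x → TangentSpace I x → ℝ) (u v : M → ℝ) (x : M) : ℝ :=
  mfderiv I 𝓘(ℝ, ℝ) u x (dualVector (g x) fun w => mfderiv I 𝓘(ℝ, ℝ) v x w)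

/-- `C¹` functions with compact support in the open set `U`. -/
structure IsTestFunction (U : Set M) (u : M → ℝ) : Prop where
  contMDiff : ContMDiff I 𝓘(ℝ, ℝ) 1 u
  hasCompactSupport : HasCompactSupport u
  tsupport_subset : tsupport u ⊆ U

variable [MeasurableSpace M]

/-- The Dirichlet form `∫ ⟨du, dv⟩_g dμ`. -/
def dirichletForm (g : ∀ x : M, TangentSpace I x → TangentSpace I x → ℝ) (μ : Measure M)
    (u v : M → ℝ) : ℝ :=
  ∫ x, diffInner I g u v x ∂μ

/-- The graph of the Friedrichs operator `-Δ` of the open Riemannian manifold `(U, g)` with volume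
measure `μ` (carried by `U`): `f` lies in the domain and `-Δ f = h`.
That is, `f` lies in the closure of the test functions in the form norm (it is the `L²` limit of
test functions `u j` which are Cauchy for the Dirichlet form), and the (extended) Dirichlet form of
`f` against every test function `v` is the `L²` product of `h` and `v`. -/
def FriedrichsGraph (U : Set M) (g : ∀ x : M, TangentSpace I x → TangentSpace I x → ℝ)
    (μ : Measure M) (f h : Lp ℝ 2 μ) : Prop :=
  ∃ u : ℕ → M → ℝ,
    (∀ j, IsTestFunction I U (u j)) ∧
    Tendsto (fun j => eLpNorm (fun x => u j x - f x) 2 μ) atTop (𝓝 0) ∧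
    (∀ ε : ℝ, 0 < ε → ∃ N : ℕ, ∀ i ≥ N, ∀ j ≥ N,
      dirichletForm I g μ (u i - u j) (u i - u j) < ε) ∧
    ∀ v : M → ℝ, IsTestFunction I U v →
      Tendsto (fun j => dirichletForm I g μ (u j) v) atTop (𝓝 (∫ x, h x * v x ∂μ))

/-- `lam` is an eigenvalue of the Friedrichs operator `-Δ`. -/
def IsFriedrichsEigenvalue (U : Set M) (g : ∀ x : M, TangentSpace I x → TangentSpace I x → ℝ)
    (μ : Measure M) (lam : ℝ) : Prop :=
  ∃ f : Lp ℝ 2 μ, f ≠ 0 ∧ FriedrichsGraph I U g μ f (lam • f)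

/-- The spectrum of the (self-adjoint) Friedrichs operator `-Δ`: the set of `lam` for which
`-Δ - lam` is not a bijection from the domain onto `L²`. -/
def friedrichsSpectrum (U : Set M) (g : ∀ x : M, TangentSpace I x → TangentSpace I x → ℝ)
    (μ : Measure M) : Set ℝ :=
  {lam | ¬ ∀ h : Lp ℝ 2 μ, ∃! f : Lp ℝ 2 μ, FriedrichsGraph I U g μ f (h + lam • f)}

/-- `lam` is the first nonzero eigenvalue of `-Δ`: it is an eigenvalue, and it is the least nonzero
point of the spectrum. -/
def IsFirstNonzeroEigenvalue (U : Set M)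
    (g : ∀ x : M, TangentSpace I x → TangentSpace I x → ℝ) (μ : Measure M) (lam : ℝ) : Prop :=
  IsFriedrichsEigenvalue I U g μ lam ∧ IsLeast (friedrichsSpectrum I U g μ \ {0}) lam

end Friedrichs

/-! ### Truncated cones -/

/-- Two points `(r, z)`, `(s, w)` of `[0, δ) × L` are identified when `r = s = 0`. -/
def coneSetoid (δ : ℝ) (L : Type u) : Setoid (Ico (0 : ℝ) δ × L) where
  r p q := p = q ∨ ((p.1 : ℝ) = 0 ∧ (q.1 : ℝ) = 0)
  iseqv :=
    { refl := fun _ => Or.inl rfl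
      symm := by
        rintro p q (h | h)
        · exact Or.inl h.symm
        · exact Or.inr ⟨h.2, h.1⟩
      trans := by
        rintro p q s (rfl | h) (rfl | h')
        · exact Or.inl rfl
        · exact Or.inr h'
        · exact Or.inr h
        · exact Or.inr ⟨h.1, h'.2⟩ }

/-- The truncated cone `C_δ(L) = [0, δ) × L / {0} × L`, with the quotient topology. -/
def TruncCone (δ : ℝ) (L : Type u) : Type u := Quotient (coneSetoid δ L)

instance (δ : ℝ) (L : Type u) [TopologicalSpace L] : TopologicalSpace (TruncCone δ L) :=
  inferInstanceAs (TopologicalSpace (Quotient (coneSetoid δ L)))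

/-- The point `(r, z)` of the cone. -/
def TruncCone.mk {δ : ℝ} {L : Type u} (r : Ico (0 : ℝ) δ) (z : L) : TruncCone δ L :=
  Quotient.mk (coneSetoid δ L) (r, z)

/-! ### Compact stratified spaces with iterated edge metrics -/

/-- A nonempty compact `n`-dimensional space decomposed into strata: the stratum `Y_j` is
`{x | sdim x = j}`. The top stratum `Y_n` (the regular set) is open and dense and carries the
structure of a smooth manifold with a continuous Riemannian metric, and `Y_{n-1}` is empty.
The field `vol` is the Riemannian volume measure of the regular set. How the strata and the metric
fit together along the singular set is the content of `IsIteratedEdge` below. -/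
structure StratSpace (n : ℕ) where
  carrier : Type u
  [top : TopologicalSpace carrier]
  [compactSpace : CompactSpace carrier]
  [t2Space : T2Space carrier]
  [secondCountable : SecondCountableTopology carrier]
  [nonempty : Nonempty carrier]
  sdim : carrier → ℕ
  sdim_le : ∀ x, sdim x ≤ n
  sdim_codim : ∀ x, sdim x + 1 ≠ n
  isOpen_reg : IsOpen {x | sdim x = n}
  dense_reg : Dense {x | sdim x = n}
  [chartedSpace : ChartedSpace (Euc n) {x // sdim x = n}]
  [isManifold : IsManifold 𝓘(ℝ, Euc n) ∞ {x // sdim x = n}]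
  metric : Bundle.ContinuousRiemannianMetric (Euc n)
    (fun x : {x // sdim x = n} => TangentSpace 𝓘(ℝ, Euc n) x)
  vol : @Measure {x // sdim x = n} (borel {x // sdim x = n})
  /-- In every smooth chart the volume measure is `√(det g_{ij}) dp`. -/
  vol_chart : ∀ e ∈ IsManifold.maximalAtlas 𝓘(ℝ, Euc n) ∞ {x // sdim x = n},
    ∀ A : Set {x // sdim x = n}, MeasurableSet[borel {x // sdim x = n}] A → A ⊆ e.source →
      vol A = ∫⁻ p in e '' A, ENNReal.ofReal (Real.sqrt (Matrix.det (Matrix.of fun i j : Fin n =>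
        metric.inner (e.symm p)
          (mfderiv 𝓘(ℝ, Euc n) 𝓘(ℝ, Euc n) e.symm p (EuclideanSpace.single i 1))
          (mfderiv 𝓘(ℝ, Euc n) 𝓘(ℝ, Euc n) e.symm p (EuclideanSpace.single j 1)))))

namespace StratSpace

attribute [instance] StratSpace.top StratSpace.compactSpace StratSpace.t2Space
  StratSpace.secondCountable StratSpace.nonempty StratSpace.chartedSpace StratSpace.isManifold

variable {n : ℕ}

/-- The regular set. -/
def Reg (X : StratSpace.{u} n) : Type u := {x : X.carrier // X.sdim x = n}

instance (X : StratSpace.{u} n) : TopologicalSpace X.Reg :=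
  inferInstanceAs (TopologicalSpace {x : X.carrier // X.sdim x = n})

instance (X : StratSpace.{u} n) : ChartedSpace (Euc n) X.Reg := X.chartedSpace

instance (X : StratSpace.{u} n) : IsManifold 𝓘(ℝ, Euc n) ∞ X.Reg := X.isManifold

instance (X : StratSpace.{u} n) : MeasurableSpace X.Reg := borel X.Reg

instance (X : StratSpace.{u} n) : BorelSpace X.Reg := ⟨rfl⟩

/-- The Riemannian metric on the regular set. -/
def g (X : StratSpace.{u} n) (x : X.Reg) (v w : TangentSpace 𝓘(ℝ, Euc n) x) : ℝ :=
  X.metric.inner (show {x : X.carrier // X.sdim x = n} from x) v w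

/-- The Riemannian volume measure on the regular set. -/
def regVol (X : StratSpace.{u} n) : Measure X.Reg := X.vol

/-- The model metric `g₀ = |dy|² + dr² + r² k_L` on `ℝʲ × (0, ∞) × L^reg`, evaluated on the tangent
vector `(a, b, w)` at `(y, r, z)`, as a quadratic form. -/
def modelMetric {j l : ℕ} (L : StratSpace.{u} l) (r : ℝ) (z : L.Reg) (a : Euc j) (b : ℝ)
    (w : TangentSpace 𝓘(ℝ, Euc l) z) : ℝ :=
  ‖a‖ ^ 2 + b ^ 2 + r ^ 2 * L.g z w w

/-- Near the point `x` of a stratum of dimension `j`, the space is `𝔹ʲ(δ) × C_δ(L)`: there is a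
homeomorphism `φ` of this product onto an open neighbourhood of `x`, sending `(0, tip)` to `x` and
respecting the strata, whose restriction `ψ` to the regular sets is a diffeomorphism, and the metric
satisfies `|ψ^* g - g₀|_{g₀} ≤ C ρ^γ` on `𝔹ʲ(ρ) × C_ρ(L^reg)` for all `ρ < δ`. -/
def HasConeChart (X : StratSpace.{u} n) (x : X.carrier) (j : ℕ) {l : ℕ} (L : StratSpace.{u} l) :
    Prop :=
  ∃ δ : ℝ, 0 < δ ∧
  ∃ φ : Metric.ball (0 : Euc j) δ × TruncCone δ L.carrier → X.carrier,
    Topology.IsOpenEmbedding φ ∧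
    (∀ (y : Metric.ball (0 : Euc j) δ) (r : Ico (0 : ℝ) δ) (z : L.carrier),
      (y : Euc j) = 0 → (r : ℝ) = 0 → φ (y, TruncCone.mk r z) = x) ∧
    (∀ (y : Metric.ball (0 : Euc j) δ) (r : Ico (0 : ℝ) δ) (z : L.carrier),
      (r : ℝ) = 0 → X.sdim (φ (y, TruncCone.mk r z)) = j) ∧
    (∀ (y : Metric.ball (0 : Euc j) δ) (r : Ico (0 : ℝ) δ) (z : L.carrier),
      0 < (r : ℝ) → X.sdim (φ (y, TruncCone.mk r z)) = j + 1 + L.sdim z) ∧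
  ∃ ψ : PartialDiffeomorph (𝓘(ℝ, Euc j).prod (𝓘(ℝ, ℝ).prod 𝓘(ℝ, Euc l))) 𝓘(ℝ, Euc n)
      (Euc j × ℝ × L.Reg) X.Reg ∞,
    ψ.source = Metric.ball 0 δ ×ˢ Ioo 0 δ ×ˢ univ ∧
    (∀ (y : Metric.ball (0 : Euc j) δ) (r : Ico (0 : ℝ) δ) (z : L.Reg), 0 < (r : ℝ) →
      (ψ ((y : Euc j), (r : ℝ), z)).1 = φ (y, TruncCone.mk r z.1)) ∧
  ∃ C γ : ℝ, 0 < γ ∧ ∀ ρ < δ, ∀ y ∈ Metric.ball (0 : Euc j) ρ, ∀ r ∈ Ioo 0 ρ, ∀ z : L.Reg,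
    ∀ (a : Euc j) (b : ℝ) (w : TangentSpace 𝓘(ℝ, Euc l) z),
      let V := mfderiv (𝓘(ℝ, Euc j).prod (𝓘(ℝ, ℝ).prod 𝓘(ℝ, Euc l))) 𝓘(ℝ, Euc n) ψ (y, r, z)
        (a, b, w)
      |X.g (ψ (y, r, z)) V V - modelMetric L r z a b w| ≤ C * ρ ^ γ * modelMetric L r z a b w

/-- `X` is a compact smoothly stratified space of depth at most `d` with an iterated edge metric:
every singular point, in a stratum of dimension `j`, has a neighbourhood `𝔹ʲ(δ) × C_δ(L)` as in
`HasConeChart`, where the link `L` is a compact smoothly stratified space of dimension `n - j - 1`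
and smaller depth with an iterated edge metric. -/
def IsIteratedEdge : ℕ → ∀ {n : ℕ}, StratSpace.{u} n → Prop
  | 0, n, X => ∀ x, X.sdim x = n
  | d + 1, n, X => ∀ x, X.sdim x ≠ n → ∃ (l : ℕ) (L : StratSpace.{u} l),
      X.sdim x + 1 + l = n ∧ IsIteratedEdge d L ∧ X.HasConeChart x (X.sdim x) L

/-- `lam = λ₁(X)`, the first nonzero eigenvalue of `-Δ` on `X`. -/
def IsLambdaOne (X : StratSpace.{u} n) (lam : ℝ) : Prop :=
  IsFirstNonzeroEigenvalue 𝓘(ℝ, Euc n) univ X.g X.regVol lam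

/-! ### The `k`-fold spherical suspension

`S` is the unit sphere `|y|² + r² = 1` of `C(S) = ℝᵏ × C(Z)`. Its regular set
`{(y, r, z) | r > 0, z ∈ Z^reg}` is parametrized by `(y, z) ∈ 𝔹ᵏ(1) × Z^reg`, with
`r = √(1 - |y|²)`. In the coordinates `y = sin ψ · θ`, `r = cos ψ`, `θ ∈ 𝕊^{k-1}`, the metric below
is `dψ² + sin² ψ g_{𝕊^{k-1}} + cos² ψ k_Z` and the measure below is
`sin^{k-1} ψ cos^m ψ dψ dθ dvol_Z`. -/

/-- The regular set of the suspension, as an open set in `ℝᵏ × Z^reg`. -/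
def suspSet (k : ℕ) {m : ℕ} (Z : StratSpace.{u} m) : Set (Euc k × Z.Reg) :=
  Metric.ball 0 1 ×ˢ univ

/-- The function `r = √(1 - |y|²)`. -/
def suspRadius {k : ℕ} (y : Euc k) : ℝ := Real.sqrt (1 - ‖y‖ ^ 2)

/-- The metric induced on the suspension by `|dy|² + dr² + r² k_Z`; here `dr = - ⟨y, dy⟩ / r`. -/
def suspMetric (k : ℕ) {m : ℕ} (Z : StratSpace.{u} m) (p : Euc k × Z.Reg)
    (v w : TangentSpace (𝓘(ℝ, Euc k).prod 𝓘(ℝ, Euc m)) p) : ℝ :=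
  inner ℝ (v.1 : Euc k) (w.1 : Euc k)
    + (-(inner ℝ p.1 (v.1 : Euc k)) / suspRadius p.1)
      * (-(inner ℝ p.1 (w.1 : Euc k)) / suspRadius p.1)
    + suspRadius p.1 ^ 2 * Z.g p.2 v.2 w.2

/-- The Riemannian volume measure `r⁻¹ dy ⊗ r^m dvol_Z` of the suspension. -/
def suspVol (k : ℕ) {m : ℕ} (Z : StratSpace.{u} m) : Measure (Euc k × Z.Reg) :=
  (((volume : Measure (Euc k)).restrict (Metric.ball 0 1)).withDensity
    fun y => ENNReal.ofReal (suspRadius y ^ m / suspRadius y)).prod Z.regVol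

/-- `lam = λ₁(S)`, the first nonzero eigenvalue of `-Δ_h` on the `k`-fold suspension `S` of `Z`. -/
def IsSuspLambdaOne (k : ℕ) {m : ℕ} (Z : StratSpace.{u} m) (lam : ℝ) : Prop :=
  IsFirstNonzeroEigenvalue (𝓘(ℝ, Euc k).prod 𝓘(ℝ, Euc m)) (suspSet k Z) (suspMetric k Z)
    (suspVol k Z) lam

end StratSpace

/-- `ν` is the exponent `ν₁` of a space of dimension `l` with first nonzero eigenvalue `lam`: it is
`1` if `lam ≥ l`, and otherwise the number in `(0, 1)` with `lam = ν (l - 1 + ν)`. -/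
def IsNuOne (l : ℕ) (lam ν : ℝ) : Prop :=
  ((l : ℝ) ≤ lam ∧ ν = 1) ∨
    (lam < l ∧ ν ∈ Ioo (0 : ℝ) 1 ∧ lam = ν * (l - 1 + ν))

end

/-! Homogeneous functions explain the numbers. If `f` is an eigenfunction of `Z` with eigenvalue `γ
(γ + m - 1)`, then `r ^ γ f` is harmonic and homogeneous of degree `γ` on `C(Z)`, hence on `ℝᵏ ×
C(Z) = C(S)`, and it restricts to an eigenfunction of `S` with eigenvalue `γ (γ + k + m - 1) = γ (n
- 2 + γ)`. The coordinates `yᵢ` are harmonic of degree one and give `k + m = n - 1`. It remains to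
see that these functions lie in the Friedrichs domain and that the spectrum of `S` contains nothing
between `0` and the claimed value.

Lower bound. In the coordinates `(y, z)`, with `r² = 1 - |y|²`, the Dirichlet form of `S`
integrates, with weight `r ^ (m - 1)` over the ball, the hemisphere energy of the `L²(Z)`-valued
slice `u (y, ·)` plus `r⁻²` times the energy of that slice on `Z` (`SuspTest.dirichletForm_susp`).
Let `K` be the kernel of `Δ_Z`. Off `K` the gap of `Z` turns the second term into a potential at
least `γ (γ + m - 1) r⁻²`, and the ground state `r ^ γ` yields the bound `γ (k + m - 1 + γ)`
(`groundState_le`, `SuspTest.le_dirichletForm_susp`). On `L²(ball) ⊗ K` the operator is triangular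
on polynomials in `y`: with `λ_d = d (d + k + m - 1)`, the map `(1 + λ_d) R - 1` lowers the degree,
where `R = (1 - Δ)⁻¹` (`resolvent_ridge`). Orthogonal complements of consecutive degrees are
therefore eigenspaces (`inner_map_le_of_filtration`), and powers of linear forms are dense
(`exists_ridge_approx`). Since `γ ≤ 1`, the nonzero `λ_d` are at least `k + m ≥ γ (k + m - 1 + γ)`.
Both bounds meet in `isSuspLambdaOne_of_eigenfunction`.

Spectral theory enters only through `R`: the graph is `R (f + h) = f`, and `t` is in the spectrum
when `1 - (t + 1) R` is not bijective. A gap is converted into a quadratic inequality and back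
(`inner_le_of_gap`, `bijective_of_gap`). Neither compactness of `R` nor connectedness of `Z` is
used.

Friedrichs domain. Near `r = 0` products `φ ⊗ f` are cut off at scale `r² ~ δ`. The cutoffs have
bounded energy, and a sequence bounded in the form norm that converges weakly suffices
(`resolvent_suspTensor`).

The iterated edge structure is needed only when `m ≤ lam`: the eigenfunction is then `yᵢ ⊗ b` with
`b ∈ K`, so `K ≠ 0` is required. Induction on the depth produces a function with bounded
differential whose zero set is the singular set and whose sublevel sets `{F < ε}` have volume
`O(ε²)` (`IsIteratedEdge.exists_isTubeFunction`). Cutoffs built from it place the constants in the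
kernel (`IsTubeFunction.exists_resolvent_eq_self`). -/

/-! ### Resolvents of nonnegative forms -/

section FormResolvent

universe v w

variable {D : Type v} {H : Type w} [AddCommGroup D] [Module ℝ D] [NormedAddCommGroup H]
  [InnerProductSpace ℝ H]

/-- `R` is the resolvent `(1 + A)⁻¹` of the operator `A` defined by the form `B` on `D`, where `j`
maps the form core `D` to the Hilbert space `H`. -/
structure IsFormResolvent (j : D →ₗ[ℝ] H) (B : D →ₗ[ℝ] D →ₗ[ℝ] ℝ) (R : H →L[ℝ] H) : Prop where
  symm : ∀ x y, ⟪R x, y⟫ = ⟪x, R y⟫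
  approx : ∀ x, ∃ u : ℕ → D, Tendsto (fun n => j (u n)) atTop (𝓝 (R x)) ∧
    Tendsto (fun n => B (u n) (u n)) atTop (𝓝 (⟪R x, x⟫ - ‖R x‖ ^ 2)) ∧
    (∀ v, Tendsto (fun n => B (u n) v) atTop (𝓝 (⟪x, j v⟫ - ⟪R x, j v⟫))) ∧
    ∀ ε : ℝ, 0 < ε → ∃ N : ℕ, ∀ i ≥ N, ∀ l ≥ N, B (u i - u l) (u i - u l) < ε
  weak : ∀ (u : ℕ → D) (C : ℝ) (f h : H), (∀ n, B (u n) (u n) ≤ C) →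
    Tendsto (fun n => j (u n)) atTop (𝓝 f) →
    (∀ v, Tendsto (fun n => B (u n) v) atTop (𝓝 ⟪h, j v⟫)) → R (f + h) = f
  le : ∀ v x, 2 * ⟪j v, x⟫ - ⟪R x, x⟫ ≤ B v v + ‖j v‖ ^ 2

/-- Completion of `D` in the form norm; `j` is a contraction for it and extends to `ι`. Injectivity
of `ι` (closability of the form) is neither claimed nor needed. -/
theorem exists_form_completion [CompleteSpace H] (j : D →ₗ[ℝ] H) (B : D →ₗ[ℝ] D →ₗ[ℝ] ℝ)
    (hs : ∀ u v, B u v = B v u) (hn : ∀ u, 0 ≤ B u u) :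
    ∃ (V : Type v) (_ : NormedAddCommGroup V) (_ : InnerProductSpace ℝ V) (_ : CompleteSpace V)
      (i : D →ₗ[ℝ] V) (ι : V →L[ℝ] H), DenseRange i ∧ (∀ u, ι (i u) = j u) ∧
      ∀ u v, ⟪i u, i v⟫ = B u v + ⟪j u, j v⟫ := by
  let core : PreInnerProductSpace.Core ℝ D :=
    { inner := fun u v => B u v + ⟪j u, j v⟫
      conj_inner_symm := fun u v => by
        simp only [conj_trivial]; rw [hs, real_inner_comm]
      re_inner_nonneg := fun u => by
        simpa using add_nonneg (hn u) real_inner_self_nonneg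
      add_left := fun u v w => by simp [inner_add_left]; ring
      smul_left := fun u v c => by simp [inner_smul_left]; ring }
  let _ : SeminormedAddCommGroup D := InnerProductSpace.Core.toSeminormedAddCommGroup (c := core)
  let _ : InnerProductSpace ℝ D := InnerProductSpace.ofCore core
  have hin : ∀ u v : D, inner ℝ u v = B u v + ⟪j u, j v⟫ := fun u v => rfl
  let i : D →L[ℝ] UniformSpace.Completion D := UniformSpace.Completion.toComplL
  have hb : ∀ u : D, ‖j u‖ ≤ 1 * ‖u‖ := fun u => by
    rw [one_mul]
    refine le_of_sq_le_sq ?_ (norm_nonneg u)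
    rw [← real_inner_self_eq_norm_sq u, hin, real_inner_self_eq_norm_sq]
    linarith [hn u]
  let jc : D →L[ℝ] H := j.mkContinuous 1 hb
  have hd : DenseRange i := UniformSpace.Completion.denseRange_coe
  refine ⟨UniformSpace.Completion D, inferInstance, inferInstance, inferInstance, i.toLinearMap,
    jc.extend i, hd, ?_, ?_⟩
  · intro u
    exact ContinuousLinearMap.extend_eq jc hd
      (UniformSpace.Completion.isUniformInducing_coe D) u
  · intro u v
    exact (UniformSpace.Completion.inner_coe u v).trans (hin u v)

/-- The resolvent is `ι ι*`, by Riesz representation in the form completion. `approx` approximates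
`ι* x` from the dense image of `D`, `le` expands `‖i v - ι* x‖² ≥ 0`, and `weak` holds because
bounded sequences converge weakly as soon as they do so against a dense set; no Cauchy condition in
the form norm is needed there. -/
theorem exists_isFormResolvent [CompleteSpace H] (j : D →ₗ[ℝ] H) (B : D →ₗ[ℝ] D →ₗ[ℝ] ℝ)
    (hs : ∀ u v, B u v = B v u) (hn : ∀ u, 0 ≤ B u u) : ∃ R, IsFormResolvent j B R := by
  obtain ⟨V, _, _, _, i, ι, hd, hι, hin⟩ := exists_form_completion j B hs hn
  have had : ∀ (x : H) (F : V), ⟪ι.adjoint x, F⟫ = ⟪x, ι F⟫ := fun x F =>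
    ContinuousLinearMap.adjoint_inner_left ι F x
  have hR : ∀ x y, ⟪ι (ι.adjoint x), y⟫ = ⟪ι.adjoint x, ι.adjoint y⟫ := fun x y => by
    rw [real_inner_comm, ← had, real_inner_comm]
  have hB : ∀ u v, B u v = ⟪i u, i v⟫ - ⟪ι (i u), ι (i v)⟫ := fun u v => by
    rw [hin, hι, hι]; ring
  refine ⟨ι ∘L ι.adjoint, ?_, ?_, ?_, ?_⟩
  · intro x y
    change ⟪ι (ι.adjoint x), y⟫ = ⟪x, ι (ι.adjoint y)⟫
    rw [hR, had]
  · intro x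
    have hx : ι.adjoint x ∈ closure (range i) := hd _
    obtain ⟨s, hs1, hs2⟩ := mem_closure_iff_seq_limit.1 hx
    choose u hu using hs1
    have hlim : Tendsto (fun n => i (u n)) atTop (𝓝 (ι.adjoint x)) := by simpa [hu] using hs2
    have hlim' : Tendsto (fun n => ι (i (u n))) atTop (𝓝 (ι (ι.adjoint x))) :=
      (ι.continuous.tendsto _).comp hlim
    refine ⟨u, ?_, ?_, ?_, ?_⟩
    · simpa [hι] using hlim'
    · simp only [hB]
      have := (hlim.inner hlim (𝕜 := ℝ)).sub (hlim'.inner hlim' (𝕜 := ℝ))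
      rw [← hR, real_inner_self_eq_norm_sq] at this
      exact this
    · intro v
      simp only [hB, ← hι v]
      have := (hlim.inner (tendsto_const_nhds (x := i v)) (𝕜 := ℝ)).sub
        (hlim'.inner (tendsto_const_nhds (x := ι (i v))) (𝕜 := ℝ))
      rw [had] at this
      exact this
    · intro ε hε
      have hc := hlim.cauchySeq
      obtain ⟨N, hN⟩ := Metric.cauchySeq_iff.1 hc (Real.sqrt ε) (Real.sqrt_pos.2 hε)
      refine ⟨N, fun a ha b hb => ?_⟩
      have h1 := hN a ha b hb
      rw [dist_eq_norm, ← map_sub, Real.lt_sqrt (norm_nonneg _)] at h1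
      rw [hB, real_inner_self_eq_norm_sq, real_inner_self_eq_norm_sq]
      nlinarith [sq_nonneg ‖ι (i (u a - u b))‖]
  · intro u C f h hC hf hv
    change ι (ι.adjoint (f + h)) = f
    obtain ⟨M, hM⟩ : ∃ M, ∀ n, ‖i (u n)‖ ≤ M := by
      obtain ⟨M', hM'⟩ := (Metric.isBounded_range_of_tendsto _ hf).exists_norm_le
      refine ⟨Real.sqrt (C + M' ^ 2), fun n => Real.le_sqrt_of_sq_le ?_⟩
      have h1 := hM' _ (mem_range_self n)
      rw [← real_inner_self_eq_norm_sq, hin, real_inner_self_eq_norm_sq]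
      have := pow_le_pow_left₀ (norm_nonneg _) h1 2
      linarith [hC n]
    -- Weak convergence in the completion, first against `i v`, then against any `F` by density; `c`
    -- bounds `‖i (u n) - ι* (f + h)‖` uniformly in `n`.
    have key : ∀ F : V, Tendsto (fun n => ⟪i (u n), F⟫) atTop (𝓝 ⟪ι.adjoint (f + h), F⟫) := by
      intro F
      refine Metric.tendsto_atTop.2 fun ε hε => ?_
      have hM0 : 0 ≤ M := (norm_nonneg _).trans (hM 0)
      set c : ℝ := M + ‖ι.adjoint (f + h)‖ + 1 with hc
      have hcpos : 0 < c := by positivity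
      obtain ⟨v, hvF⟩ := hd.exists_dist_lt F (show 0 < ε / (2 * c) by positivity)
      have hvt : Tendsto (fun n => ⟪i (u n), i v⟫) atTop (𝓝 ⟪ι.adjoint (f + h), i v⟫) := by
        have := (hv v).add (hf.inner (tendsto_const_nhds (x := j v)) (𝕜 := ℝ))
        simp only [hin, had, hι, inner_add_left]
        rw [add_comm ⟪f, j v⟫]
        exact this
      obtain ⟨N, hN⟩ := Metric.tendsto_atTop.1 hvt (ε / 2) (by positivity)
      refine ⟨N, fun n hn' => ?_⟩
      have h1 := hN n hn'
      rw [Real.dist_eq, ← inner_sub_left] at h1 ⊢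
      have h2 : ⟪i (u n) - ι.adjoint (f + h), F⟫ =
          ⟪i (u n) - ι.adjoint (f + h), F - i v⟫ + ⟪i (u n) - ι.adjoint (f + h), i v⟫ := by
        rw [← inner_add_right]; simp
      rw [h2]
      refine (abs_add_le _ _).trans_lt ?_
      have h3 : |⟪i (u n) - ι.adjoint (f + h), F - i v⟫| ≤ c * (ε / (2 * c)) := by
        refine (abs_real_inner_le_norm _ _).trans ?_
        rw [dist_eq_norm] at hvF
        refine mul_le_mul ?_ hvF.le (norm_nonneg _) hcpos.le
        refine (norm_sub_le _ _).trans ?_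
        linarith [hM n]
      have h4 : c * (ε / (2 * c)) = ε / 2 := by field_simp
      linarith
    refine ext_inner_right ℝ fun y => ?_
    have h1 := key (ι.adjoint y)
    have h2 : Tendsto (fun n => ⟪i (u n), ι.adjoint y⟫) atTop (𝓝 ⟪f, y⟫) := by
      have := hf.inner (tendsto_const_nhds (x := y)) (𝕜 := ℝ)
      refine this.congr fun n => ?_
      rw [real_inner_comm (ι.adjoint y), had, hι, real_inner_comm]
    rw [hR]
    exact tendsto_nhds_unique h1 h2
  · intro v x
    change 2 * ⟪j v, x⟫ - ⟪ι (ι.adjoint x), x⟫ ≤ _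
    have h1 : (0 : ℝ) ≤ ⟪i v - ι.adjoint x, i v - ι.adjoint x⟫ := real_inner_self_nonneg
    rw [inner_sub_left, inner_sub_right, inner_sub_right, ← hR, hin, had, hι,
      real_inner_comm (ι.adjoint x), had, hι, real_inner_comm (j v) x,
      real_inner_self_eq_norm_sq] at h1
    linarith

namespace IsFormResolvent

variable {j : D →ₗ[ℝ] H} {B : D →ₗ[ℝ] D →ₗ[ℝ] ℝ} {R : H →L[ℝ] H}

theorem norm_sq_le (hR : IsFormResolvent j B R) (hn : ∀ u, 0 ≤ B u u) (x : H) :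
    ‖R x‖ ^ 2 ≤ ⟪R x, x⟫ := by
  obtain ⟨u, -, h, -⟩ := hR.approx x
  linarith [ge_of_tendsto' h fun n => hn (u n)]

/-- The graph of the operator `A` of the form `B` in terms of its resolvent. -/
theorem graph_iff (hR : IsFormResolvent j B R) (hs : ∀ u v, B u v = B v u) (hn : ∀ u, 0 ≤ B u u)
    (f h : H) :
    (∃ u : ℕ → D, Tendsto (fun n => j (u n)) atTop (𝓝 f) ∧
      (∀ ε : ℝ, 0 < ε → ∃ N : ℕ, ∀ i ≥ N, ∀ l ≥ N, B (u i - u l) (u i - u l) < ε) ∧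
      ∀ v, Tendsto (fun n => B (u n) v) atTop (𝓝 ⟪h, j v⟫)) ↔ R (f + h) = f := by
  constructor
  · rintro ⟨u, hf, hc, hv⟩
    obtain ⟨N, hN⟩ := hc 1 one_pos
    refine hR.weak (fun n => u (n + N)) (2 * B (u N) (u N) + 2) f h (fun n => ?_)
      ((tendsto_add_atTop_iff_nat N).2 hf) fun v => (tendsto_add_atTop_iff_nat N).2 (hv v)
    have h1 := hN (n + N) (by omega) N le_rfl
    -- For `a = u (n + N)` and `b = u N`, positivity of `B` at `a - 2b` is `B(a) ≤ 2 B(a - b) + 2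
    -- B(b)`, whence the constant `2 B(b) + 2`.
    have h2 := hn (u (n + N) - u N - u N)
    simp only [map_sub, LinearMap.sub_apply] at h1 h2
    rw [hs (u N) (u (n + N))] at h1 h2
    linarith
  · intro hf
    obtain ⟨u, h1, -, h3, h4⟩ := hR.approx (f + h)
    rw [hf] at h1
    refine ⟨u, h1, h4, fun v => ?_⟩
    have := h3 v
    rwa [hf, inner_add_left, add_sub_cancel_left] at this

end IsFormResolvent

end FormResolvent

/-! ### Spectral gaps in terms of the resolvent -/

section Gap

variable {H : Type*} [NormedAddCommGroup H] [InnerProductSpace ℝ H]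

/-- The equation rearranges to `f - (t + 1) R f = R h`, whose right side only ranges over the image
of `R`. Surjectivity onto all of `H` still follows, by correcting `y` with a solution for the right
side `R y`. -/
theorem resolvent_equation_iff_bijective (R : H →L[ℝ] H) (t : ℝ) :
    (∀ h : H, ∃! f : H, R (f + (h + t • f)) = f) ↔
      Function.Bijective fun f => f - (t + 1) • R f := by
  have key : ∀ f h : H, R (f + (h + t • f)) = f ↔ f - (t + 1) • R f = R h := fun f h => by
    rw [map_add, map_add, map_smul, sub_eq_iff_eq_add, eq_comm,
      show R f + (R h + t • R f) = R h + (t + 1) • R f by module]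
  constructor
  · intro hex
    constructor
    · have h0 : ∀ f, f - (t + 1) • R f = 0 → f = 0 := fun f hf =>
        (hex 0).unique ((key f 0).2 (by rw [hf, map_zero])) ((key 0 0).2 (by simp))
      intro f g hfg
      refine sub_eq_zero.1 (h0 _ ?_)
      dsimp only at hfg
      rw [map_sub, smul_sub, sub_sub_sub_comm, hfg, sub_self]
    · intro y
      obtain ⟨f, hf, -⟩ := hex y
      have hf' := (key f y).1 hf
      -- Resolvent identity: with `f - (t + 1) R f = R y`, the terms beyond `y` cancel.
      refine ⟨y + (t + 1) • f, ?_⟩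
      simp only [map_add, map_smul, ← hf']
      module
  · intro hb h
    obtain ⟨f, hf⟩ := hb.2 (R h)
    exact ⟨f, (key f h).2 hf, fun g hg => hb.1 (((key g h).1 hg).trans hf.symm)⟩

theorem inner_apply_sq_le {S : H →L[ℝ] H} (hs : ∀ x y, ⟪S x, y⟫ = ⟪x, S y⟫)
    (hn : ∀ x, 0 ≤ ⟪S x, x⟫) (x y : H) : ⟪S x, y⟫ ^ 2 ≤ ⟪S x, x⟫ * ⟪S y, y⟫ := by
  have h : ∀ t : ℝ, 0 ≤ ⟪S y, y⟫ * (t * t) + 2 * ⟪S x, y⟫ * t + ⟪S x, x⟫ := fun t => by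
    have h1 := hn (x + t • y)
    have h2 : ⟪S y, x⟫ = ⟪S x, y⟫ := by rw [hs, real_inner_comm]
    simp only [map_add, map_smul, inner_add_left, inner_add_right, inner_smul_left,
      inner_smul_right, h2, conj_trivial] at h1
    linarith
  have h1 := discrim_le_zero h
  rw [discrim] at h1
  linarith

/-- Cauchy–Schwarz for the semi-inner product of `S`, taken at `x` and `S x`. -/
theorem norm_apply_sq_le {S : H →L[ℝ] H} (hs : ∀ x y, ⟪S x, y⟫ = ⟪x, S y⟫)
    (hn : ∀ x, 0 ≤ ⟪S x, x⟫) (x : H) : ‖S x‖ ^ 2 ≤ ‖S‖ * ⟪S x, x⟫ := by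
  have h1 := inner_apply_sq_le hs hn x (S x)
  rw [real_inner_self_eq_norm_sq] at h1
  have h2 : ⟪S (S x), S x⟫ ≤ ‖S‖ * ‖S x‖ ^ 2 := by
    refine (real_inner_le_norm _ _).trans ?_
    rw [pow_two, ← mul_assoc]
    exact mul_le_mul_of_nonneg_right (S.le_opNorm _) (norm_nonneg _)
  rcases eq_or_lt_of_le (sq_nonneg ‖S x‖) with h0 | h0
  · rw [← h0]; exact mul_nonneg (norm_nonneg _) (hn x)
  · have h3 := h1.trans (mul_le_mul_of_nonneg_left h2 (hn x))
    refine le_of_mul_le_mul_right ?_ h0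
    nlinarith

/-- A symmetric operator whose spectrum misses `(b - d, b + d)` is bounded below away from `b`. -/
theorem norm_sub_smul_ge [CompleteSpace H] {R : H →L[ℝ] H} (hs : ∀ x y, ⟪R x, y⟫ = ⟪x, R y⟫)
    {b d : ℝ} (hd : 0 ≤ d)
    (hbij : ∀ μ ∈ Ioo (b - d) (b + d), Function.Bijective fun x => R x - μ • x) (x : H) :
    d ^ 2 * ‖x‖ ^ 2 ≤ ‖R x - b • x‖ ^ 2 := by
  -- Let `c₀` be the best constant and suppose `c₀ < d²`. Then `(R - b)² - c₀` is nonnegative, and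
  -- it factors as `(R - (b - s)) (R - (b + s))` with `s = √c₀ < d`, hence is bijective. A bijective
  -- nonnegative operator is strictly positive, which improves `c₀`.
  set C : Set ℝ := {c | ∀ x, c * ‖x‖ ^ 2 ≤ ‖R x - b • x‖ ^ 2} with hC
  suffices d ^ 2 ∈ C from this x
  by_contra hcon
  have hle : ∀ c ∈ C, c < d ^ 2 := fun c hc => by
    by_contra! h
    exact hcon fun x => (mul_le_mul_of_nonneg_right h (sq_nonneg _)).trans (hc x)
  have h0 : (0 : ℝ) ∈ C := fun x => by rw [zero_mul]; positivity
  have hbdd : BddAbove C := ⟨d ^ 2, fun c hc => (hle c hc).le⟩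
  set c₀ := sSup C with hc₀
  have hc₀0 : 0 ≤ c₀ := le_csSup hbdd h0
  have hc₀C : c₀ ∈ C := fun x => by
    rcases eq_or_lt_of_le (sq_nonneg ‖x‖) with hx | hx
    · rw [← hx, mul_zero]; positivity
    · rw [← le_div_iff₀ hx]
      exact csSup_le ⟨0, h0⟩ fun c hc => by rw [le_div_iff₀ hx]; exact hc x
  have hlt := hle _ hc₀C
  have hs0 : Real.sqrt c₀ < d := by
    rw [Real.sqrt_lt' (lt_of_le_of_ne hd fun h => by rw [← h] at hlt; simp at hlt; linarith)]
    exact hlt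
  have hsn := Real.sqrt_nonneg c₀
  have hsq := Real.sq_sqrt hc₀0
  set s := Real.sqrt c₀
  let G : ℝ → H →L[ℝ] H := fun μ => R - μ • ContinuousLinearMap.id ℝ H
  have hG : ∀ μ x, G μ x = R x - μ • x := fun μ x => rfl
  have hGs : ∀ μ x y, ⟪G μ x, y⟫ = ⟪x, G μ y⟫ := fun μ x y => by
    simp only [hG, inner_sub_left, inner_sub_right, hs, inner_smul_left, inner_smul_right,
      conj_trivial]
  let S : H →L[ℝ] H := G (b - s) ∘L G (b + s)
  have hSG : ∀ x, S x = G b (G b x) - c₀ • x := fun x => by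
    simp only [S, ContinuousLinearMap.comp_apply, hG, map_sub, map_smul, ← hsq]
    module
  have hSs : ∀ x y, ⟪S x, y⟫ = ⟪x, S y⟫ := fun x y => by
    simp only [hSG, inner_sub_left, inner_sub_right, hGs, inner_smul_left, inner_smul_right,
      conj_trivial]
  have hSx : ∀ x, ⟪S x, x⟫ = ‖R x - b • x‖ ^ 2 - c₀ * ‖x‖ ^ 2 := fun x => by
    rw [hSG, inner_sub_left, hGs, real_inner_self_eq_norm_sq, hG, inner_smul_left,
      real_inner_self_eq_norm_sq]; rfl
  have hSn : ∀ x, 0 ≤ ⟪S x, x⟫ := fun x => by rw [hSx]; linarith [hc₀C x]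
  have hSb : Function.Bijective S :=
    (hbij (b - s) ⟨by linarith, by linarith⟩).comp (hbij (b + s) ⟨by linarith, by linarith⟩)
  let e := ContinuousLinearEquiv.ofBijective S (LinearMap.ker_eq_bot.2 hSb.1)
    (LinearMap.range_eq_top.2 hSb.2)
  set κ : ℝ := ‖(e.symm : H →L[ℝ] H)‖ with hκ
  have hbd : ∀ x, ‖x‖ ≤ κ * ‖S x‖ := fun x => by
    have h1 : (e.symm : H →L[ℝ] H) (S x) = x := e.symm_apply_apply x
    calc ‖x‖ = ‖(e.symm : H →L[ℝ] H) (S x)‖ := by rw [h1]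
      _ ≤ _ := ContinuousLinearMap.le_opNorm _ _
  -- From `‖x‖ ≤ κ ‖S x‖` and `‖S x‖² ≤ ‖S‖ ⟪S x, x⟫`; the summand `1` keeps `M` positive.
  set M : ℝ := κ ^ 2 * ‖S‖ + 1 with hM
  have hMpos : 0 < M := by positivity
  have : c₀ + 1 / M ∈ C := fun x => by
    have h1 : ‖x‖ ^ 2 ≤ M * ⟪S x, x⟫ := by
      calc ‖x‖ ^ 2 ≤ (κ * ‖S x‖) ^ 2 := pow_le_pow_left₀ (norm_nonneg _) (hbd x) 2
        _ = κ ^ 2 * ‖S x‖ ^ 2 := by ring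
        _ ≤ κ ^ 2 * (‖S‖ * ⟪S x, x⟫) :=
          mul_le_mul_of_nonneg_left (norm_apply_sq_le hSs hSn x) (sq_nonneg _)
        _ ≤ M * ⟪S x, x⟫ := by rw [hM]; nlinarith [hSn x]
    rw [hSx] at h1
    have h2 : 1 / M * ‖x‖ ^ 2 ≤ ‖R x - b • x‖ ^ 2 - c₀ * ‖x‖ ^ 2 := by
      rw [one_div, inv_mul_le_iff₀ hMpos]; exact h1
    linarith
  have h1 := le_csSup hbdd this
  have : 0 < 1 / M := by positivity
  linarith

/-- The fixed vectors of `R`, that is, the kernel of `A` if `R = (1 + A)⁻¹`. -/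
noncomputable def fixedSpace (R : H →L[ℝ] H) : Submodule ℝ H :=
  LinearMap.ker (ContinuousLinearMap.id ℝ H - R : H →L[ℝ] H).toLinearMap

theorem mem_fixedSpace {R : H →L[ℝ] H} {x : H} : x ∈ fixedSpace R ↔ R x = x := by
  rw [fixedSpace, LinearMap.mem_ker]
  change x - R x = 0 ↔ _
  rw [sub_eq_zero, eq_comm]

instance [CompleteSpace H] (R : H →L[ℝ] H) : CompleteSpace (fixedSpace R) :=
  (ContinuousLinearMap.isClosed_ker (ContinuousLinearMap.id ℝ H - R)).completeSpace_coe

/-- Under `μ = 1 / (1 + t)` the hypothesis says that the spectrum of `R` misses `(a, 1)`, with `a =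
1 / (1 + lam)`. Then `(1 - R)(a - R) ≥ 0`. For `T = 1 - R` this gives `T ≥ 1 - a` on the range of
`T`, hence on its closure, the complement of the fixed vectors. -/
theorem inner_le_of_gap [CompleteSpace H] {R : H →L[ℝ] H} (hs : ∀ x y, ⟪R x, y⟫ = ⟪x, R y⟫)
    (hle : ∀ x, ‖R x‖ ^ 2 ≤ ⟪R x, x⟫) {lam : ℝ} (hlam : 0 < lam)
    (hbij : ∀ t ∈ Ioo 0 lam, Function.Bijective fun f => f - (t + 1) • R f)
    {x : H} (hx : x ∈ (fixedSpace R)ᗮ) : (1 + lam) * ⟪R x, x⟫ ≤ ‖x‖ ^ 2 := by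
  set a : ℝ := 1 / (1 + lam) with ha
  have ha0 : 0 < a := by positivity
  have ha1 : a < 1 := by rw [ha, div_lt_one (by positivity)]; linarith
  -- `‖(R - b) f‖² ≥ d² ‖f‖²` with `b` the midpoint and `d` half the length of `(a, 1)`; expanding
  -- gives the product form.
  have hgap : ∀ f, 0 ≤ ⟪f - R f, a • f - R f⟫ := by
    intro f
    have h1 := norm_sub_smul_ge (R := R) hs (b := (a + 1) / 2) (d := (1 - a) / 2) (by linarith)
      (fun μ hμ => by
        have hμ1 : a < μ := by linarith [hμ.1]
        have hμ2 : μ < 1 := by linarith [hμ.2]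
        have hμ0 : 0 < μ := ha0.trans hμ1
        have h2 := hbij (1 / μ - 1) ⟨by
          rw [sub_pos, lt_div_iff₀ hμ0]; linarith, by
          rw [sub_lt_iff_lt_add, div_lt_iff₀ hμ0]
          rw [ha, div_lt_iff₀ (by positivity)] at hμ1
          linarith⟩
        have h3 : (fun x => R x - μ • x) =
            (fun x => (-μ) • x) ∘ fun f => f - (1 / μ - 1 + 1) • R f := by
          funext x
          simp only [Function.comp_apply, smul_sub, smul_smul]
          rw [show -μ * (1 / μ - 1 + 1) = -1 by field_simp; ring]
          module
        rw [h3]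
        exact (MulAction.bijective₀ (neg_ne_zero.2 hμ0.ne')).comp h2) f
    rw [← real_inner_self_eq_norm_sq, ← real_inner_self_eq_norm_sq] at h1
    simp only [inner_sub_left, inner_sub_right, inner_smul_left, inner_smul_right,
      conj_trivial, real_inner_comm f (R f)] at h1 ⊢
    nlinarith
  have hBs : ∀ x y : H, ⟪(ContinuousLinearMap.id ℝ H - R) x, y⟫ =
      ⟪x, (ContinuousLinearMap.id ℝ H - R) y⟫ := fun x y => by
    simp [inner_sub_left, inner_sub_right, hs]
  have hRle : ∀ x, ⟪R x, x⟫ ≤ ‖x‖ ^ 2 := fun x => by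
    have h1 := hle x
    have h2 := real_inner_le_norm (R x) x
    nlinarith [norm_nonneg (R x), norm_nonneg x, sq_nonneg (‖R x‖ - ‖x‖)]
  have hBn : ∀ x : H, 0 ≤ ⟪(ContinuousLinearMap.id ℝ H - R) x, x⟫ := fun x => by
    simp only [sub_apply, ContinuousLinearMap.id_apply, inner_sub_left,
      real_inner_self_eq_norm_sq]
    linarith [hRle x]
  set T : H →L[ℝ] H := ContinuousLinearMap.id ℝ H - R with hT
  have hTgap : ∀ f, (1 - a) * ⟪T f, f⟫ ≤ ‖T f‖ ^ 2 := fun f => by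
    have h1 := hgap f
    rw [show a • f - R f = T f - (1 - a) • f by simp [hT]; module,
      show f - R f = T f from rfl, inner_sub_right, inner_smul_right,
      real_inner_self_eq_norm_sq] at h1
    linarith
  -- Cauchy–Schwarz for `T` reads `‖T w‖⁴ ≤ ⟪T w, w⟫ ⟪T (T w), T w⟫`; inserting `hTgap` allows
  -- division by `⟪T w, w⟫`.
  have hrange : ∀ w, (1 - a) * ‖T w‖ ^ 2 ≤ ⟪T (T w), T w⟫ := fun w => by
    have h1 := inner_apply_sq_le hBs hBn w (T w)
    rw [real_inner_self_eq_norm_sq] at h1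
    have h2 := hTgap w
    have h3 := hBn w
    have h4 := hBn (T w)
    rcases eq_or_lt_of_le h3 with h0 | h0
    · rw [← h0, zero_mul] at h1
      have : ‖T w‖ ^ 2 = 0 := by nlinarith [sq_nonneg (‖T w‖ ^ 2)]
      rw [this, mul_zero]; exact h4
    · refine le_of_mul_le_mul_left ?_ h0
      nlinarith [sq_nonneg ‖T w‖]
  have hcl : x ∈ closure (range T) := by
    have h1 : (fixedSpace R)ᗮ = (LinearMap.range T.toLinearMap).topologicalClosure := by
      rw [← Submodule.orthogonal_orthogonal_eq_closure]
      congr 1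
      ext y
      rw [Submodule.mem_orthogonal]
      constructor
      · rintro hy _ ⟨z, rfl⟩
        change ⟪T z, y⟫ = 0
        rw [hBs]
        have : T y = 0 := hy
        rw [this, inner_zero_right]
      · intro hy
        change T y = 0
        have h2 : ⟪T (T y), y⟫ = 0 := hy _ ⟨T y, rfl⟩
        rw [hBs] at h2
        exact inner_self_eq_zero.1 h2
    rw [h1] at hx
    exact hx
  have hx' : (1 - a) * ‖x‖ ^ 2 ≤ ⟪T x, x⟫ := by
    refine closure_minimal (t := {x | (1 - a) * ‖x‖ ^ 2 ≤ ⟪T x, x⟫}) ?_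
      (isClosed_le (by fun_prop) (by fun_prop)) hcl
    rintro _ ⟨w, rfl⟩
    exact hrange w
  rw [hT, sub_apply, ContinuousLinearMap.id_apply, inner_sub_left,
    real_inner_self_eq_norm_sq] at hx'
  have h5 : ⟪R x, x⟫ ≤ a * ‖x‖ ^ 2 := by linarith
  rw [ha, div_mul_eq_mul_div, one_mul, le_div_iff₀ (by positivity)] at h5
  linarith

/-- `T = 1 - (t + 1) R` is multiplication by `-t` on `W` and coercive on `Wᗮ`. Adding `(t + 1) P`,
with `P` the projection to `W`, makes it the identity on `W`, so Lax–Milgram applies to the sum;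
since `t ≠ 0`, bijectivity passes back to `T`. -/
theorem bijective_of_gap [CompleteSpace H] {R : H →L[ℝ] H} (hs : ∀ x y, ⟪R x, y⟫ = ⟪x, R y⟫)
    (hn : ∀ x, 0 ≤ ⟪R x, x⟫) {Lam : ℝ} (W : Submodule ℝ H) [CompleteSpace W]
    (hW : ∀ x ∈ W, R x = x) (hgap : ∀ x ∈ Wᗮ, (1 + Lam) * ⟪R x, x⟫ ≤ ‖x‖ ^ 2)
    {t : ℝ} (ht : t < Lam) (ht0 : t ≠ 0) (hLam : 0 < Lam) :
    Function.Bijective fun f => f - (t + 1) • R f := by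
  let P : H →L[ℝ] H := W.starProjection
  let T : H →L[ℝ] H := ContinuousLinearMap.id ℝ H - (t + 1) • R
  let S : H →L[ℝ] H := T + (t + 1) • P
  have hPW : ∀ x, P x ∈ W := fun x => Submodule.starProjection_apply_mem _ _
  have hQ : ∀ x, x - P x ∈ Wᗮ := fun x => Submodule.sub_starProjection_mem_orthogonal x
  have hRW : ∀ x ∈ Wᗮ, R x ∈ Wᗮ := fun x hx => by
    rw [Submodule.mem_orthogonal] at hx ⊢
    intro w hw
    rw [← hs, hW w hw]
    exact hx w hw
  have hTW : ∀ x ∈ W, T x = -(t • x) := fun x hx => by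
    simp [T, hW x hx]; module
  have hTW' : ∀ x ∈ Wᗮ, T x ∈ Wᗮ := fun x hx =>
    Submodule.sub_mem _ hx (Submodule.smul_mem _ _ (hRW x hx))
  have hP0 : ∀ x ∈ Wᗮ, P x = 0 := fun x hx =>
    (Submodule.starProjection_apply_eq_zero_iff W).2 hx
  have hP1 : ∀ x ∈ W, P x = x := fun x hx => Submodule.starProjection_eq_self_iff.2 hx
  have hSW : ∀ x ∈ W, S x = x := fun x hx => by
    simp [S, hTW x hx, hP1 x hx]; module
  have hSW' : ∀ x ∈ Wᗮ, S x = T x := fun x hx => by simp [S, hP0 x hx]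
  -- If `t + 1 ≤ 0`, positivity of `R` is enough. Otherwise the gap gives `c = 1 - (t + 1) / (1 +
  -- Lam)`. The bound `c ≤ 1` lets the same constant serve on `W`.
  obtain ⟨c, hc, hc1, hcT⟩ : ∃ c : ℝ, 0 < c ∧ c ≤ 1 ∧ ∀ x ∈ Wᗮ, c * ‖x‖ ^ 2 ≤ ⟪T x, x⟫ := by
    have hTx : ∀ x, ⟪T x, x⟫ = ‖x‖ ^ 2 - (t + 1) * ⟪R x, x⟫ := fun x => by
      simp [T, inner_sub_left, inner_smul_left]
    rcases le_total (t + 1) 0 with h | h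
    · refine ⟨1, one_pos, le_rfl, fun x hx => ?_⟩
      rw [hTx]
      nlinarith [hn x]
    · refine ⟨1 - (t + 1) / (1 + Lam), ?_, ?_, fun x hx => ?_⟩
      · rw [sub_pos, div_lt_one (by positivity)]; linarith
      · linarith [div_nonneg h (by positivity : 0 ≤ 1 + Lam)]
      · rw [hTx]
        have h1 : ⟪R x, x⟫ ≤ ‖x‖ ^ 2 / (1 + Lam) := by
          rw [le_div_iff₀ (by positivity)]; linarith [hgap x hx]
        have h2 := mul_le_mul_of_nonneg_left h1 h
        have h3 : (t + 1) / (1 + Lam) * ‖x‖ ^ 2 = (t + 1) * (‖x‖ ^ 2 / (1 + Lam)) := by ring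
        nlinarith
  have hcoer : IsCoercive ((innerSL ℝ : H →L[ℝ] H →L[ℝ] ℝ) ∘L S) := by
    refine ⟨c, hc, fun x => ?_⟩
    change c * ‖x‖ * ‖x‖ ≤ ⟪S x, x⟫
    have hx : x = P x + (x - P x) := by abel
    have hperp : ⟪P x, x - P x⟫ = 0 := hQ x _ (hPW x)
    have h1 : ⟪S x, x⟫ = ‖P x‖ ^ 2 + ⟪T (x - P x), x - P x⟫ := by
      have h2 : S x = P x + T (x - P x) := by
        conv_lhs => rw [hx, map_add, hSW _ (hPW x), hSW' _ (hQ x)]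
      have h3 : ⟪T (x - P x), P x⟫ = 0 := by
        rw [real_inner_comm]; exact hTW' _ (hQ x) _ (hPW x)
      have h4 : ⟪S x, x⟫ = ⟪P x + T (x - P x), P x + (x - P x)⟫ := by rw [← h2, ← hx]
      rw [h4, inner_add_left, inner_add_right, inner_add_right, hperp, h3,
        real_inner_self_eq_norm_sq]
      ring
    have h5 : ‖x‖ * ‖x‖ = ‖P x‖ ^ 2 + ‖x - P x‖ ^ 2 := by
      conv_lhs => rw [hx]
      rw [norm_add_sq_eq_norm_sq_add_norm_sq_of_inner_eq_zero _ _ hperp]; ring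
    rw [mul_assoc, h5, h1]
    have := hcT _ (hQ x)
    nlinarith [sq_nonneg ‖P x‖]
  have hSb : Function.Bijective S := by
    have h1 : ∀ x, hcoer.continuousLinearEquivOfBilin x = S x := fun x =>
      ext_inner_right ℝ fun y => by
        rw [IsCoercive.continuousLinearEquivOfBilin_apply]; rfl
    have h2 : ⇑(hcoer.continuousLinearEquivOfBilin) = S := funext h1
    rw [← h2]
    exact hcoer.continuousLinearEquivOfBilin.bijective
  change Function.Bijective T
  constructor
  · rw [injective_iff_map_eq_zero]
    intro f hf
    have h1 : T f = -(t • P f) + T (f - P f) := by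
      rw [← hTW _ (hPW f), ← map_add]; congr 1; abel
    have h2 : ⟪P f, T f⟫ = -(t * ‖P f‖ ^ 2) := by
      rw [h1, inner_add_right, hTW' _ (hQ f) _ (hPW f), inner_neg_right, inner_smul_right,
        real_inner_self_eq_norm_sq, add_zero]
    rw [hf, inner_zero_right] at h2
    have h3 : P f = 0 := by
      have : t * ‖P f‖ ^ 2 = 0 := by linarith
      simpa [ht0] using this
    have h4 : S f = 0 := by
      have := hQ f
      rw [h3, sub_zero] at this
      rw [hSW' f this, hf]
    exact hSb.1 (h4.trans (map_zero S).symm)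
  · intro y
    obtain ⟨g, hg⟩ := hSb.2 (y - P y)
    have hgW : g ∈ Wᗮ := by
      have h2 : S g = P g + T (g - P g) := by
        conv_lhs => rw [show g = P g + (g - P g) by abel, map_add, hSW _ (hPW g), hSW' _ (hQ g)]
      have h3 : ⟪P g, S g⟫ = ‖P g‖ ^ 2 := by
        rw [h2, inner_add_right, hTW' _ (hQ g) _ (hPW g), real_inner_self_eq_norm_sq, add_zero]
      rw [hg, hQ y _ (hPW g)] at h3
      have h4 : P g = 0 := by simpa using h3.symm
      have := hQ g
      rwa [h4, sub_zero] at this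
    refine ⟨-(t⁻¹ • P y) + g, ?_⟩
    rw [map_add, map_neg, map_smul, hTW _ (hPW y), ← hSW' g hgW, hg, smul_neg, smul_smul,
      inv_mul_cancel₀ ht0]
    module

/-- The form is bounded below by the spectral gap off the kernel. -/
theorem IsFormResolvent.form_ge_of_gap [CompleteSpace H] {D : Type*} [AddCommGroup D] [Module ℝ D]
    {j : D →ₗ[ℝ] H} {B : D →ₗ[ℝ] D →ₗ[ℝ] ℝ} {R : H →L[ℝ] H} (hR : IsFormResolvent j B R)
    (hn : ∀ u, 0 ≤ B u u) {lam : ℝ} (hlam : 0 < lam)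
    (hbij : ∀ t ∈ Ioo 0 lam, Function.Bijective fun f => f - (t + 1) • R f) (v : D) :
    lam * ‖j v - (fixedSpace R).starProjection (j v)‖ ^ 2 ≤ B v v := by
  set f := j v
  set p := (fixedSpace R).starProjection f
  have hp : R p = p := mem_fixedSpace.1 (Submodule.starProjection_apply_mem _ _)
  have hq : f - p ∈ (fixedSpace R)ᗮ := Submodule.sub_starProjection_mem_orthogonal f
  set q := f - p with hq'
  have hf : f = p + q := by rw [hq']; abel
  have hpq : ⟪p, q⟫ = 0 := hq _ (Submodule.starProjection_apply_mem _ _)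
  -- The dual bound is sharp at `x = (1 + A) f`; this choice is that vector when `q` is an
  -- eigenvector at `lam`.
  have h1 := hR.le v (p + (1 + lam) • q)
  have h2 := inner_le_of_gap hR.symm (hR.norm_sq_le hn) hlam hbij hq
  have h3 : ⟪R q, p⟫ = 0 := by rw [hR.symm, hp, real_inner_comm, hpq]
  change 2 * ⟪f, _⟫ - _ ≤ _ + ‖f‖ ^ 2 at h1
  have h4 : ‖f‖ ^ 2 = ‖p‖ ^ 2 + ‖q‖ ^ 2 := by
    rw [hf, pow_two, norm_add_sq_eq_norm_sq_add_norm_sq_of_inner_eq_zero _ _ hpq]; ring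
  rw [h4, hf] at h1
  simp only [map_add, map_smul, hp, inner_add_left, inner_add_right, inner_smul_left,
    inner_smul_right, h3, hpq, real_inner_comm p q, conj_trivial,
    real_inner_self_eq_norm_sq] at h1
  nlinarith

end Gap

/-! ### Calculus on the unit ball with the metric of the hemisphere and the weight `r ^ (m - 1)` -/

section BallCalculus

variable {k : ℕ}

/-- The measure `r ^ (m - 1) dy` on the unit ball. -/
noncomputable def ballVol (k m : ℕ) : Measure (Euc k) :=
  ((volume : Measure (Euc k)).restrict (Metric.ball 0 1)).withDensity
    fun y => ENNReal.ofReal (StratSpace.suspRadius y ^ m / StratSpace.suspRadius y)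

/-- The dual of the hemisphere metric `|dy|² + dr²`, `r² = 1 - |y|²`. -/
noncomputable def sphDual (y : Euc k) (α β : Euc k →L[ℝ] ℝ) : ℝ :=
  ∑ i, α (EuclideanSpace.single i 1) * β (EuclideanSpace.single i 1) - α y * β y

open StratSpace (suspRadius)

theorem suspRadius_nonneg (y : Euc k) : 0 ≤ suspRadius y := Real.sqrt_nonneg _

theorem suspRadius_le_one (y : Euc k) : suspRadius y ≤ 1 :=
  Real.sqrt_le_one.2 (by nlinarith [sq_nonneg ‖y‖])

theorem suspRadius_pos {y : Euc k} (hy : y ∈ Metric.ball (0 : Euc k) 1) : 0 < suspRadius y := by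
  rw [mem_ball_zero_iff] at hy
  exact Real.sqrt_pos.2 (by nlinarith [norm_nonneg y])

theorem suspRadius_sq {y : Euc k} (hy : y ∈ Metric.ball (0 : Euc k) 1) :
    suspRadius y ^ 2 = 1 - ‖y‖ ^ 2 := by
  rw [mem_ball_zero_iff] at hy
  exact Real.sq_sqrt (by nlinarith [norm_nonneg y])

theorem continuous_suspRadius : Continuous (suspRadius : Euc k → ℝ) := by
  unfold suspRadius; fun_prop

theorem suspRadius_pow_div {y : Euc k} (hy : y ∈ Metric.ball (0 : Euc k) 1) (m : ℕ) :
    suspRadius y ^ m / suspRadius y = suspRadius y ^ ((m : ℝ) - 1) := by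
  rw [Real.rpow_sub_one (suspRadius_pos hy).ne', Real.rpow_natCast]

theorem suspRadius_pow_div_le_one (y : Euc k) {m : ℕ} (hm : 1 ≤ m) :
    suspRadius y ^ m / suspRadius y ≤ 1 := by
  refine div_le_one_of_le₀ ?_ (suspRadius_nonneg y)
  simpa using pow_le_pow_of_le_one (suspRadius_nonneg y) (suspRadius_le_one y) hm

theorem hasFDerivAt_suspRadius_rpow {y : Euc k} (hy : y ∈ Metric.ball (0 : Euc k) 1) (s : ℝ) :
    HasFDerivAt (fun y : Euc k => suspRadius y ^ s)
      ((-s * suspRadius y ^ (s - 2)) • innerSL ℝ y) y := by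
  have hr := suspRadius_pos hy
  have h1 : HasFDerivAt (fun y : Euc k => 1 - ‖y‖ ^ 2) (-(2 • innerSL ℝ y)) y :=
    (hasStrictFDerivAt_norm_sq y).hasFDerivAt.const_sub 1
  have h2 := (h1.sqrt (by rw [← suspRadius_sq hy]; positivity)).rpow_const (p := s) (Or.inl hr.ne')
  refine h2.congr_fderiv ?_
  change (s * suspRadius y ^ (s - 1)) • (1 / (2 * suspRadius y)) • -(2 • innerSL ℝ y) = _
  rw [show s - 2 = s - 1 - 1 by ring, Real.rpow_sub_one hr.ne' (s - 1)]
  ext v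
  simp
  field_simp

theorem isFiniteMeasure_ballVol {m : ℕ} (hm : 1 ≤ m) : IsFiniteMeasure (ballVol k m) := by
  refine isFiniteMeasure_withDensity (ne_of_lt ?_)
  calc ∫⁻ y in Metric.ball (0 : Euc k) 1, ENNReal.ofReal (suspRadius y ^ m / suspRadius y)
      ≤ ∫⁻ _ in Metric.ball (0 : Euc k) 1, 1 := lintegral_mono fun y => by
        rw [← ENNReal.ofReal_one]
        exact ENNReal.ofReal_le_ofReal (suspRadius_pow_div_le_one y hm)
    _ < ⊤ := by simpa using measure_ball_lt_top

theorem ballVol_compl_ball (m : ℕ) : ballVol k m (Metric.ball 0 1)ᶜ = 0 := by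
  refine withDensity_absolutelyContinuous _ _ ?_
  rw [Measure.restrict_apply Metric.isOpen_ball.measurableSet.compl, compl_inter_self,
    measure_empty]

theorem ae_mem_ball_ballVol (m : ℕ) : ∀ᵐ y ∂(ballVol k m), y ∈ Metric.ball (0 : Euc k) 1 :=
  ballVol_compl_ball m

theorem integral_ballVol {F : Type*} [NormedAddCommGroup F] [NormedSpace ℝ F] (m : ℕ)
    (g : Euc k → F) :
    ∫ y, g y ∂(ballVol k m) =
      ∫ y in Metric.ball (0 : Euc k) 1, suspRadius y ^ ((m : ℝ) - 1) • g y := by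
  have hc := continuous_suspRadius (k := k)
  rw [ballVol, integral_withDensity_eq_integral_toReal_smul (by fun_prop)
    (ae_of_all _ fun _ => ENNReal.ofReal_lt_top)]
  refine setIntegral_congr_fun Metric.isOpen_ball.measurableSet fun y hy => ?_
  rw [ENNReal.toReal_ofReal (div_nonneg (pow_nonneg (suspRadius_nonneg y) _) (suspRadius_nonneg y)),
    suspRadius_pow_div hy]

theorem integral_ballVol_of_support {F : Type*} [NormedAddCommGroup F] [NormedSpace ℝ F] (m : ℕ)
    {g : Euc k → F} (hg : ∀ y, y ∉ Metric.ball (0 : Euc k) 1 → g y = 0) :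
    ∫ y, g y ∂(ballVol k m) = ∫ y, suspRadius y ^ ((m : ℝ) - 1) • g y := by
  rw [integral_ballVol]
  exact setIntegral_eq_integral_of_forall_compl_eq_zero fun y hy => by rw [hg y hy, smul_zero]

theorem integrable_ballVol {F : Type*} [NormedAddCommGroup F] {m : ℕ} (hm : 1 ≤ m)
    {g : Euc k → F} {K : Set (Euc k)} (hK : IsCompact K) (hK1 : K ⊆ Metric.ball 0 1)
    (hg : ContinuousOn g (Metric.ball 0 1)) (hs : ∀ y, y ∉ K → g y = 0) :
    Integrable g (ballVol k m) := by
  have := isFiniteMeasure_ballVol (k := k) hm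
  rw [← integrableOn_iff_integrable_of_support_subset (s := K)
    fun y hy => by_contra fun h => hy (hs y h)]
  exact (hg.mono hK1).integrableOn_compact hK

theorem HasLineDerivAt.eq_zero_of_notMem_tsupport {F : Type*} [NormedAddCommGroup F]
    [NormedSpace ℝ F] {ψ : Euc k → F} {y v : Euc k} {x : F} (hd : HasLineDerivAt ℝ ψ x y v)
    (hy : y ∉ tsupport ψ) : x = 0 := by
  have h1 : ψ =ᶠ[𝓝 y] fun _ => 0 := notMem_tsupport_iff_eventuallyEq.1 hy
  rw [← hd.lineDeriv, h1.lineDeriv_eq]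
  simp [lineDeriv]

/-- Integration by parts against a function with compact support in the unit ball. -/
theorem integral_lineDeriv_mul {ψ ψ' s s' : Euc k → ℝ} {v : Euc k}
    (hψ : Continuous ψ) (hψ' : Continuous ψ') (hc : HasCompactSupport ψ)
    (hsub : tsupport ψ ⊆ Metric.ball 0 1) (hd : ∀ y, HasLineDerivAt ℝ ψ (ψ' y) y v)
    (hs : ContinuousOn s (Metric.ball 0 1)) (hs' : ContinuousOn s' (Metric.ball 0 1))
    (hsd : ∀ y ∈ Metric.ball (0 : Euc k) 1, HasLineDerivAt ℝ s (s' y) y v) :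
    ∫ y, s y * ψ' y = -∫ y, s' y * ψ y := by
  have h0 : ∀ y, y ∉ tsupport ψ → ψ' y = 0 := fun y hy =>
    (hd y).eq_zero_of_notMem_tsupport hy
  have hint : ∀ {f g : Euc k → ℝ}, ContinuousOn f (Metric.ball 0 1) → Continuous g →
      (∀ y, y ∉ tsupport ψ → g y = 0) → Integrable (fun y => f y * g y) := fun hf hg hz => by
    rw [← integrableOn_iff_integrable_of_support_subset (s := tsupport ψ)
      fun y hy => by_contra fun h => hy (by simp [hz y h])]
    exact ((hf.mono hsub).mul hg.continuousOn).integrableOn_compact hc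
  exact integral_bilinear_hasLineDerivAt_right_eq_neg_left_of_integrable
    (B := ContinuousLinearMap.mul ℝ ℝ) (f := s) (f' := s') (g := ψ) (g' := ψ')
    (hint hs' hψ fun y hy => image_eq_zero_of_notMem_tsupport hy) (hint hs hψ' h0)
    (hint hs hψ fun y hy => image_eq_zero_of_notMem_tsupport hy)
    (fun y hy => hsd y (hsub hy)) (fun y _ => hd y)

theorem sum_apply_single_mul (α : Euc k →L[ℝ] ℝ) (y : Euc k) :
    ∑ i, y i * α (EuclideanSpace.single i 1) = α y := by
  conv_rhs => rw [← (EuclideanSpace.basisFun (Fin k) ℝ).sum_repr y]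
  simp [EuclideanSpace.basisFun_apply]

/-- The divergence of the vector field `s(y) y` is `k s + ds(y)`; integration by parts is done in
each coordinate and summed. -/
theorem integral_radial_mul {ψ : Euc k → ℝ} {ψ' : Fin k → Euc k → ℝ} {s : Euc k → ℝ}
    {s' : Euc k → Euc k →L[ℝ] ℝ}
    (hψ : Continuous ψ) (hψ' : ∀ i, Continuous (ψ' i)) (hc : HasCompactSupport ψ)
    (hsub : tsupport ψ ⊆ Metric.ball 0 1)
    (hd : ∀ i y, HasLineDerivAt ℝ ψ (ψ' i y) y (EuclideanSpace.single i 1))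
    (hs' : ContinuousOn s' (Metric.ball 0 1))
    (hsd : ∀ y ∈ Metric.ball (0 : Euc k) 1, HasFDerivAt s (s' y) y) :
    ∫ y, s y * ∑ i, y i * ψ' i y = -∫ y, (k * s y + s' y y) * ψ y := by
  have hs : ContinuousOn s (Metric.ball 0 1) := fun y hy =>
    (hsd y hy).continuousAt.continuousWithinAt
  have h0 : ∀ i y, y ∉ tsupport ψ → ψ' i y = 0 := fun i y hy =>
    (hd i y).eq_zero_of_notMem_tsupport hy
  have hint : ∀ {f g : Euc k → ℝ}, ContinuousOn f (Metric.ball 0 1) → Continuous g →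
      (∀ y, y ∉ tsupport ψ → g y = 0) → Integrable (fun y => f y * g y) := fun hf hg hz => by
    rw [← integrableOn_iff_integrable_of_support_subset (s := tsupport ψ)
      fun y hy => by_contra fun h => hy (by simp [hz y h])]
    exact ((hf.mono hsub).mul hg.continuousOn).integrableOn_compact hc
  have hci : ∀ i : Fin k, Continuous fun y : Euc k => y i := fun i => by fun_prop
  have hsi : ∀ i, ContinuousOn (fun y : Euc k => s' y (EuclideanSpace.single i 1))
      (Metric.ball 0 1) := fun i => hs'.clm_apply continuousOn_const
  have hcs : ∀ i : Fin k, ContinuousOn (fun y : Euc k => y i * s y) (Metric.ball 0 1) := fun i =>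
    (hci i).continuousOn.mul hs
  have hcs' : ∀ i : Fin k, ContinuousOn
      (fun y : Euc k => s y + y i * s' y (EuclideanSpace.single i 1)) (Metric.ball 0 1) := fun i =>
    hs.add ((hci i).continuousOn.mul (hsi i))
  have hpart : ∀ i : Fin k, ∫ y, (y i * s y) * ψ' i y =
      -∫ y, (s y + y i * s' y (EuclideanSpace.single i 1)) * ψ y := fun i => by
    refine integral_lineDeriv_mul hψ (hψ' i) hc hsub (hd i) (hcs i) (hcs' i) fun y hy => ?_
    have h1 : HasFDerivAt (fun y : Euc k => y i)
        (EuclideanSpace.proj i : Euc k →L[ℝ] ℝ) y :=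
      (EuclideanSpace.proj i : Euc k →L[ℝ] ℝ).hasFDerivAt
    have h2 := ((h1.mul (hsd y hy)).hasLineDerivAt (EuclideanSpace.single i 1))
    refine Eq.mp (congrArg (fun c => HasLineDerivAt ℝ _ c y _) ?_) h2
    simp [add_comm]
  calc ∫ y, s y * ∑ i, y i * ψ' i y = ∫ y, ∑ i, (y i * s y) * ψ' i y := by
        congr 1; funext y; rw [Finset.mul_sum]; exact Finset.sum_congr rfl fun i _ => by ring
    _ = ∑ i, ∫ y, (y i * s y) * ψ' i y :=
        integral_finsetSum _ fun i _ => hint (hcs i) (hψ' i) (h0 i)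
    _ = -∑ i, ∫ y, (s y + y i * s' y (EuclideanSpace.single i 1)) * ψ y := by
        simp_rw [hpart, Finset.sum_neg_distrib]
    _ = -∫ y, ∑ i, (s y + y i * s' y (EuclideanSpace.single i 1)) * ψ y := by
        rw [integral_finsetSum _ fun i _ => hint (hcs' i) hψ
          fun y hy => image_eq_zero_of_notMem_tsupport hy]
    _ = -∫ y, (k * s y + s' y y) * ψ y := by
        congr 2; funext y
        rw [← Finset.sum_mul, Finset.sum_add_distrib, sum_apply_single_mul]
        simp

theorem suspRadius_rpow_sub_two {y : Euc k} (hy : y ∈ Metric.ball (0 : Euc k) 1) (s : ℝ) :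
    suspRadius y ^ (s - 2) = suspRadius y ^ s * (suspRadius y ^ 2)⁻¹ := by
  rw [Real.rpow_sub (suspRadius_pos hy), div_eq_mul_inv, Real.rpow_ofNat]

theorem norm_sq_mul_inv {y : Euc k} (hy : y ∈ Metric.ball (0 : Euc k) 1) :
    ‖y‖ ^ 2 * (suspRadius y ^ 2)⁻¹ = (suspRadius y ^ 2)⁻¹ - 1 := by
  have h := suspRadius_pos hy
  have h2 := suspRadius_sq hy
  field_simp
  linarith

theorem continuousOn_suspRadius_rpow (s : ℝ) :
    ContinuousOn (fun y : Euc k => suspRadius y ^ s) (Metric.ball 0 1) := fun _ hy =>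
  (hasFDerivAt_suspRadius_rpow hy s).continuousAt.continuousWithinAt

theorem continuousOn_suspRadius_inv :
    ContinuousOn (fun y : Euc k => (suspRadius y ^ 2)⁻¹) (Metric.ball 0 1) :=
  ((continuous_suspRadius.pow 2).continuousOn).inv₀ fun _ hy => (pow_pos (suspRadius_pos hy) 2).ne'

theorem continuousOn_fderiv_suspRadius_rpow (s : ℝ) :
    ContinuousOn (fun y : Euc k => (-s * suspRadius y ^ (s - 2)) • innerSL ℝ y)
      (Metric.ball 0 1) :=
  (continuousOn_const.mul (continuousOn_suspRadius_rpow _)).smul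
    (innerSL ℝ : Euc k →L[ℝ] Euc k →L[ℝ] ℝ).continuous.continuousOn

/-- Radial integration by parts for the weight `r ^ s`. -/
theorem integral_rpow_mul_radial (s : ℝ) {ψ : Euc k → ℝ} {ψ' : Fin k → Euc k → ℝ}
    (hψ : Continuous ψ) (hψ' : ∀ i, Continuous (ψ' i)) (hc : HasCompactSupport ψ)
    (hsub : tsupport ψ ⊆ Metric.ball 0 1)
    (hd : ∀ i y, HasLineDerivAt ℝ ψ (ψ' i y) y (EuclideanSpace.single i 1)) :
    ∫ y, suspRadius y ^ s * ∑ i, y i * ψ' i y =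
      -∫ y, suspRadius y ^ s * ((k + s - s * (suspRadius y ^ 2)⁻¹) * ψ y) := by
  rw [integral_radial_mul hψ hψ' hc hsub hd (continuousOn_fderiv_suspRadius_rpow s)
    fun y hy => hasFDerivAt_suspRadius_rpow hy s]
  congr 2; funext y
  by_cases hy : y ∈ Metric.ball (0 : Euc k) 1
  · have h1 := norm_sq_mul_inv hy
    simp only [smul_apply, innerSL_apply_apply, real_inner_self_eq_norm_sq, smul_eq_mul,
      suspRadius_rpow_sub_two hy]
    linear_combination (-s * suspRadius y ^ s * ψ y) * h1
  · rw [image_eq_zero_of_notMem_tsupport fun h => hy (hsub h)]; simp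

/-! ### The weighted Hardy inequality on the hemisphere, for functions with values in a Hilbert
space. -/

section GroundState

variable {F : Type*} [NormedAddCommGroup F] [InnerProductSpace ℝ F]

/-- Cauchy–Schwarz together with `|y| ≤ 1`. It says that the dual hemisphere metric `1 - y ⊗ y` is
nonnegative on Hilbert-space-valued covectors. -/
theorem sphForm_nonneg {y : Euc k} (hy : ‖y‖ ≤ 1) (ξ : Fin k → F) :
    ‖∑ i, y i • ξ i‖ ^ 2 ≤ ∑ i, ‖ξ i‖ ^ 2 := by
  have h1 : ‖∑ i, y i • ξ i‖ ≤ ∑ i, |y i| * ‖ξ i‖ := by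
    refine (norm_sum_le _ _).trans (Finset.sum_le_sum fun i _ => ?_)
    rw [norm_smul, Real.norm_eq_abs]
  have h2 : (∑ i, |y i| * ‖ξ i‖) ^ 2 ≤ (∑ i, |y i| ^ 2) * ∑ i, ‖ξ i‖ ^ 2 :=
    Finset.sum_mul_sq_le_sq_mul_sq _ _ _
  have h3 : ∑ i, |y i| ^ 2 = ‖y‖ ^ 2 := by
    rw [EuclideanSpace.norm_sq_eq]; simp
  have h4 : 0 ≤ ∑ i, ‖ξ i‖ ^ 2 := Finset.sum_nonneg fun i _ => sq_nonneg _
  have h5 := pow_le_pow_left₀ (norm_nonneg _) h1 2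
  rw [h3] at h2
  have h6 : ‖y‖ ^ 2 ≤ 1 := pow_le_one₀ (norm_nonneg y) hy
  nlinarith

/-- This is nonnegativity of the dual metric on `r ^ γ d(r ^ (-γ) Φ) = dΦ + γ r⁻² y Φ`, with `dΦ =
ξ` and `Φ = x`. The factor `1 - |y|² = r²` from the dual metric cancels the `r⁻²` in the cross term.
-/
theorem groundState_pointwise {y : Euc k} (hy : y ∈ Metric.ball (0 : Euc k) 1) (γ : ℝ)
    (ξ : Fin k → F) (x : F) :
    0 ≤ (∑ i, ‖ξ i‖ ^ 2 - ‖∑ i, y i • ξ i‖ ^ 2) + γ * ∑ i, y i * (2 * ⟪ξ i, x⟫)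
      + γ ^ 2 * ((suspRadius y ^ 2)⁻¹ - 1) * ‖x‖ ^ 2 := by
  set c := γ * (suspRadius y ^ 2)⁻¹ with hc
  have h1 := sphForm_nonneg (mem_ball_zero_iff.1 hy).le fun i => ξ i + (c * y i) • x
  set S := ∑ i, y i • ξ i with hS
  have hyy : ∑ i, y i * y i = ‖y‖ ^ 2 := by
    rw [EuclideanSpace.norm_sq_eq]; simp [pow_two]
  have hSx : ∑ i, y i * (2 * ⟪ξ i, x⟫) = 2 * ⟪S, x⟫ := by
    rw [hS, sum_inner, Finset.mul_sum]
    exact Finset.sum_congr rfl fun i _ => by rw [inner_smul_left, conj_trivial]; ring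
  have h2 : ∑ i, y i • (ξ i + (c * y i) • x) = S + (c * ‖y‖ ^ 2) • x := by
    simp only [smul_add, Finset.sum_add_distrib, smul_smul, ← hyy, Finset.mul_sum, Finset.sum_smul]
    congr 1
    exact Finset.sum_congr rfl fun i _ => by congr 1; ring
  have h3 : ∑ i, ‖ξ i + (c * y i) • x‖ ^ 2 =
      ∑ i, ‖ξ i‖ ^ 2 + 2 * c * ⟪S, x⟫ + c ^ 2 * ‖y‖ ^ 2 * ‖x‖ ^ 2 := by
    have : ∀ i, ‖ξ i + (c * y i) • x‖ ^ 2 =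
        ‖ξ i‖ ^ 2 + c * (y i * (2 * ⟪ξ i, x⟫)) + c ^ 2 * ‖x‖ ^ 2 * (y i * y i) := fun i => by
      rw [norm_add_sq_real, inner_smul_right, norm_smul, mul_pow, Real.norm_eq_abs, sq_abs]
      ring
    simp_rw [this, Finset.sum_add_distrib, ← Finset.mul_sum, hyy, hSx]
    ring
  rw [h2, h3, norm_add_sq_real, inner_smul_right, norm_smul, mul_pow, Real.norm_eq_abs,
    sq_abs] at h1
  have hr := suspRadius_pos hy
  have hr2 := suspRadius_sq hy
  have h4 : c * (1 - ‖y‖ ^ 2) = γ := by rw [hc, ← hr2]; field_simp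
  have h5 := norm_sq_mul_inv hy
  have h6 : c ^ 2 * ‖y‖ ^ 2 * (1 - ‖y‖ ^ 2) = γ ^ 2 * ((suspRadius y ^ 2)⁻¹ - 1) := by
    rw [← h5, hc, ← hr2]; field_simp
  rw [hSx]
  have h7 : γ * (2 * ⟪S, x⟫) = 2 * (c * (1 - ‖y‖ ^ 2)) * ⟪S, x⟫ := by rw [h4]; ring
  rw [h7, ← h6]
  nlinarith

/-- The sharp weighted Hardy type inequality on the hemisphere: `r ^ γ` is a ground state. -/
theorem groundState_le {m : ℕ} (hm : 1 ≤ m) (γ : ℝ) {Φ : Euc k → F}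
    {Φ' : Fin k → Euc k → F}
    (hΦ : Continuous Φ) (hΦ' : ∀ i, Continuous (Φ' i)) (hc : HasCompactSupport Φ)
    (hsub : tsupport Φ ⊆ Metric.ball 0 1)
    (hd : ∀ i y, HasLineDerivAt ℝ Φ (Φ' i y) y (EuclideanSpace.single i 1)) :
    γ * (k + m - 1 + γ) * ∫ y, ‖Φ y‖ ^ 2 ∂(ballVol k m) ≤
      ∫ y, ((∑ i, ‖Φ' i y‖ ^ 2 - ‖∑ i, y i • Φ' i y‖ ^ 2) +
        γ * (γ + m - 1) * ((suspRadius y ^ 2)⁻¹ * ‖Φ y‖ ^ 2)) ∂(ballVol k m) := by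
  have h0 : ∀ i y, y ∉ tsupport Φ → Φ' i y = 0 := fun i y hy =>
    (hd i y).eq_zero_of_notMem_tsupport hy
  have h00 : ∀ y, y ∉ tsupport Φ → Φ y = 0 := fun y hy => image_eq_zero_of_notMem_tsupport hy
  have hci : ∀ i : Fin k, Continuous fun y : Euc k => y i := fun i => by fun_prop
  have hψc : HasCompactSupport fun y => ‖Φ y‖ ^ 2 :=
    hc.comp_left (g := fun x : F => ‖x‖ ^ 2) (by simp)
  have hψs : tsupport (fun y => ‖Φ y‖ ^ 2) ⊆ Metric.ball 0 1 :=
    (tsupport_comp_subset (g := fun x : F => ‖x‖ ^ 2) (by simp) Φ).trans hsub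
  -- The cross term of the square is `γ` times the radial derivative of `‖Φ‖²`; with the weight `r ^
  -- (m - 1)` it integrates by parts to terms of order zero.
  have hibp := integral_rpow_mul_radial ((m : ℝ) - 1) (ψ := fun y => ‖Φ y‖ ^ 2)
    (ψ' := fun i y => 2 * ⟪Φ' i y, Φ y⟫) (by fun_prop)
    (fun i => continuous_const.mul ((hΦ' i).inner hΦ)) hψc hψs (fun i y => by
      have h1 := HasDerivAt.norm_sq (hd i y)
      simp only [zero_smul, add_zero] at h1
      rw [real_inner_comm] at h1
      exact h1)
  have hcon : ∀ {g : Euc k → ℝ}, (∀ y, y ∉ tsupport Φ → g y = 0) →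
      ∫ y, g y ∂(ballVol k m) = ∫ y, suspRadius y ^ ((m : ℝ) - 1) * g y := fun {g} hg =>
    integral_ballVol_of_support m fun y hy => hg y fun h => hy (hsub h)
  have hint : ∀ {g : Euc k → ℝ}, ContinuousOn g (Metric.ball 0 1) →
      (∀ y, y ∉ tsupport Φ → g y = 0) → Integrable g (ballVol k m) := fun hg hz =>
    integrable_ballVol hm hc hsub hg hz
  have hrc := continuousOn_suspRadius_inv (k := k)
  set Q : Euc k → ℝ := fun y => ∑ i, ‖Φ' i y‖ ^ 2 - ‖∑ i, y i • Φ' i y‖ ^ 2 with hQ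
  set S : Euc k → ℝ := fun y => ∑ i, y i * (2 * ⟪Φ' i y, Φ y⟫) with hS
  have hQc : Continuous Q := by
    refine (continuous_finsetSum _ fun i _ => (hΦ' i).norm.pow 2).sub
      ((continuous_finsetSum _ fun i _ => (hci i).smul (hΦ' i)).norm.pow 2)
  have hSc : Continuous S := continuous_finsetSum _ fun i _ =>
    (hci i).mul (continuous_const.mul ((hΦ' i).inner hΦ))
  have hQ0 : ∀ y, y ∉ tsupport Φ → Q y = 0 := fun y hy => by simp [hQ, h0 _ y hy]
  have hS0 : ∀ y, y ∉ tsupport Φ → S y = 0 := fun y hy => by simp [hS, h0 _ y hy]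
  have hNc : Continuous fun y => ‖Φ y‖ ^ 2 := by fun_prop
  have iQ := hint hQc.continuousOn hQ0
  have iS := hint hSc.continuousOn hS0
  have iN := hint hNc.continuousOn fun y hy => by simp [h00 y hy]
  have iR := hint (g := fun y => (suspRadius y ^ 2)⁻¹ * ‖Φ y‖ ^ 2) (hrc.mul hNc.continuousOn)
    fun y hy => by simp [h00 y hy]
  have hSibp : ∫ y, S y ∂(ballVol k m) = -((k + ((m : ℝ) - 1)) * ∫ y, ‖Φ y‖ ^ 2 ∂(ballVol k m) -
      ((m : ℝ) - 1) * ∫ y, (suspRadius y ^ 2)⁻¹ * ‖Φ y‖ ^ 2 ∂(ballVol k m)) := by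
    rw [hcon hS0, hibp, ← hcon (g := fun y => (k + ((m : ℝ) - 1) - ((m : ℝ) - 1) *
      (suspRadius y ^ 2)⁻¹) * ‖Φ y‖ ^ 2) (fun y hy => by simp [h00 y hy]),
      ← integral_const_mul, ← integral_const_mul, ← integral_sub (iN.const_mul _) (iR.const_mul _)]
    congr 2; funext y; ring
  have hpos : 0 ≤ ∫ y, (Q y + γ * S y + (γ ^ 2 * ((suspRadius y ^ 2)⁻¹ * ‖Φ y‖ ^ 2) -
      γ ^ 2 * ‖Φ y‖ ^ 2)) ∂(ballVol k m) := by
    refine integral_nonneg_of_ae ?_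
    filter_upwards [ae_mem_ball_ballVol m] with y hy
    have := groundState_pointwise hy γ (fun i => Φ' i y) (Φ y)
    simp only [Pi.zero_apply, hQ, hS]
    linarith
  have iQS : Integrable (fun y => Q y + γ * S y) (ballVol k m) := iQ.add (iS.const_mul γ)
  have iRN : Integrable (fun y => γ ^ 2 * ((suspRadius y ^ 2)⁻¹ * ‖Φ y‖ ^ 2) - γ ^ 2 * ‖Φ y‖ ^ 2)
      (ballVol k m) := (iR.const_mul _).sub (iN.const_mul _)
  rw [integral_add iQS iRN, integral_add iQ (iS.const_mul γ),
    integral_sub (iR.const_mul _) (iN.const_mul _),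
    integral_const_mul, integral_const_mul, integral_const_mul, hSibp] at hpos
  rw [integral_add iQ (iR.const_mul _), integral_const_mul]
  linarith

end GroundState

end BallCalculus

/-! ### Separated eigenfunctions on the hemisphere -/

section BallEquation

open StratSpace (suspRadius)

variable {k : ℕ}

/-- `φ` solves `-Δ φ + μ r⁻² φ = ζ` on the hemisphere with the weight `r ^ m`, in the weak sense. -/
structure IsSphSolution (k m : ℕ) (μ : ℝ) (φ ζ : Euc k → ℝ) : Prop where
  continuous : Continuous φ
  continuous_rhs : Continuous ζ
  contDiffOn : ContDiffOn ℝ 1 φ (Metric.ball 0 1)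
  eq : ∀ ψ : Euc k → ℝ, ContDiff ℝ 1 ψ → HasCompactSupport ψ → tsupport ψ ⊆ Metric.ball 0 1 →
    ∫ y, sphDual y (fderiv ℝ φ y) (fderiv ℝ ψ y) ∂(ballVol k m) =
      ∫ y, (ζ y - μ * (suspRadius y ^ 2)⁻¹ * φ y) * ψ y ∂(ballVol k m)

theorem fderiv_eq_zero_of_notMem_tsupport {ψ : Euc k → ℝ} {y : Euc k} (hy : y ∉ tsupport ψ) :
    fderiv ℝ ψ y = 0 := by
  rw [(notMem_tsupport_iff_eventuallyEq.1 hy).fderiv_eq]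
  exact fderiv_const_apply 0

theorem sphDual_zero_right (y : Euc k) (α : Euc k →L[ℝ] ℝ) : sphDual y α 0 = 0 := by
  simp [sphDual]

theorem sphDual_smul_innerSL (y a : Euc k) (c : ℝ) (β : Euc k →L[ℝ] ℝ) :
    sphDual y (c • innerSL ℝ a) β = c * (β a - ⟪a, y⟫ * β y) := by
  rw [sphDual, ← sum_apply_single_mul β a, mul_sub, Finset.mul_sum]
  simp [mul_assoc, EuclideanSpace.inner_single_right]

/-- Since `d(r ^ γ) = -γ r ^ (γ - 2) ⟨y, ·⟩`, its dual pairing with `dψ` is `-γ r ^ γ dψ(y)`. Radial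
integration by parts with the total weight `r ^ (γ + m - 1)` finishes. -/
theorem isSphSolution_rpow (m : ℕ) {γ : ℝ} (hγ : 0 < γ) :
    IsSphSolution k m (γ * (γ + m - 1)) (fun y => suspRadius y ^ γ)
      fun y => γ * (k + m - 1 + γ) * suspRadius y ^ γ := by
  have hcont : Continuous fun y : Euc k => suspRadius y ^ γ :=
    continuous_suspRadius.rpow_const fun _ => Or.inr hγ.le
  have hdiff : ContDiffOn ℝ 1 (fun y : Euc k => suspRadius y ^ γ) (Metric.ball 0 1) := by
    intro y hy
    have h1 : ContDiffAt ℝ 1 (fun y : Euc k => 1 - ‖y‖ ^ 2) y :=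
      contDiffAt_const.sub (contDiff_norm_sq ℝ).contDiffAt
    have h2 := suspRadius_pos hy
    exact ((h1.sqrt (by rw [← suspRadius_sq hy]; positivity)).rpow_const_of_ne
      h2.ne').contDiffWithinAt
  refine ⟨hcont, continuous_const.mul hcont, hdiff, fun ψ hψ hc hsub => ?_⟩
  have hψ' : Continuous (fderiv ℝ ψ) := hψ.continuous_fderiv one_ne_zero
  have hd : ∀ y, HasFDerivAt ψ (fderiv ℝ ψ y) y := fun y =>
    (hψ.differentiable one_ne_zero y).hasFDerivAt
  have hibp := integral_rpow_mul_radial (γ + m - 1) (ψ := ψ)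
    (ψ' := fun i y => fderiv ℝ ψ y (EuclideanSpace.single i 1)) hψ.continuous
    (fun i => by fun_prop) hc hsub fun i y => (hd y).hasLineDerivAt _
  simp only [sum_apply_single_mul] at hibp
  have hz : ∀ y, y ∉ Metric.ball (0 : Euc k) 1 → y ∉ tsupport ψ := fun y hy h => hy (hsub h)
  rw [integral_ballVol_of_support _ fun y hy => by
      rw [fderiv_eq_zero_of_notMem_tsupport (hz y hy), sphDual_zero_right],
    integral_ballVol_of_support _ fun y hy => by
      rw [image_eq_zero_of_notMem_tsupport (hz y hy), mul_zero]]
  have hsplit : ∀ y ∈ Metric.ball (0 : Euc k) 1, suspRadius y ^ (γ + m - 1) =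
      suspRadius y ^ ((m : ℝ) - 1) * suspRadius y ^ γ := fun y hy => by
    rw [← Real.rpow_add (suspRadius_pos hy)]; ring_nf
  have hL : ∀ y, suspRadius y ^ ((m : ℝ) - 1) •
      sphDual y (fderiv ℝ (fun y : Euc k => suspRadius y ^ γ) y) (fderiv ℝ ψ y) =
      (-γ) * (suspRadius y ^ (γ + m - 1) * fderiv ℝ ψ y y) := fun y => by
    by_cases hy : y ∈ Metric.ball (0 : Euc k) 1
    · rw [(hasFDerivAt_suspRadius_rpow hy γ).fderiv, sphDual_smul_innerSL,
        suspRadius_rpow_sub_two hy, real_inner_self_eq_norm_sq, hsplit y hy, smul_eq_mul]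
      have h2 := suspRadius_sq hy
      have h3 := suspRadius_pos hy
      have h4 : (suspRadius y ^ 2)⁻¹ * (1 - ‖y‖ ^ 2) = 1 := by rw [← h2]; field_simp
      linear_combination (-γ * suspRadius y ^ ((m : ℝ) - 1) * suspRadius y ^ γ *
        fderiv ℝ ψ y y) * h4
    · rw [fderiv_eq_zero_of_notMem_tsupport (hz y hy), sphDual_zero_right]; simp
  simp_rw [hL]
  rw [integral_const_mul, hibp, neg_mul_neg, ← integral_const_mul]
  refine integral_congr_ae (ae_of_all _ fun y => ?_)
  by_cases hy : y ∈ Metric.ball (0 : Euc k) 1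
  · simp only [hsplit y hy, smul_eq_mul]; ring
  · simp [image_eq_zero_of_notMem_tsupport (hz y hy)]

/-- `⟨a, y⟩ ^ d` is homogeneous of degree `d` on `C(S)` and has Laplacian `d (d - 1) |a|² ⟨a, y⟩ ^
(d - 2)` there; restriction to the unit sphere gives the right side. Here `μ = 0`, as the factor on
`Z` will be taken in the kernel. The truncated exponents `d - 1`, `d - 2` are harmless: wherever
truncation occurs the coefficient is zero. -/
theorem isSphSolution_ridge (m d : ℕ) (a : Euc k) :
    IsSphSolution k m 0 (fun y => ⟪a, y⟫ ^ d)
      fun y => d * (d + k + m - 1) * ⟪a, y⟫ ^ d -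
        d * ((d - 1 : ℕ) : ℝ) * ‖a‖ ^ 2 * ⟪a, y⟫ ^ (d - 2) := by
  have hpow : ∀ (d : ℕ) (y : Euc k), HasFDerivAt (fun y : Euc k => ⟪a, y⟫ ^ d)
      ((d * ⟪a, y⟫ ^ (d - 1)) • innerSL ℝ a) y := fun d y => by
    have h1 := ((innerSL ℝ a).hasFDerivAt (x := y)).pow d
    simpa using h1
  refine ⟨by fun_prop, by fun_prop, (((innerSL ℝ a).contDiff).pow d).contDiffOn,
    fun ψ hψ hc hsub => ?_⟩
  have hψ' : Continuous (fderiv ℝ ψ) := hψ.continuous_fderiv one_ne_zero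
  have hd : ∀ y, HasFDerivAt ψ (fderiv ℝ ψ y) y := fun y =>
    (hψ.differentiable one_ne_zero y).hasFDerivAt
  have hz : ∀ y, y ∉ Metric.ball (0 : Euc k) 1 → y ∉ tsupport ψ := fun y hy h => hy (hsub h)
  rw [integral_ballVol_of_support _ fun y hy => by
      rw [fderiv_eq_zero_of_notMem_tsupport (hz y hy), sphDual_zero_right],
    integral_ballVol_of_support _ fun y hy => by
      rw [image_eq_zero_of_notMem_tsupport (hz y hy), mul_zero]]
  set s : ℝ := (m : ℝ) - 1 with hs
  have hw := fun (y : Euc k) hy => hasFDerivAt_suspRadius_rpow (y := y) hy s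
  have hw' := continuousOn_fderiv_suspRadius_rpow (k := k) s
  have hwc := continuousOn_suspRadius_rpow (k := k) s
  have hprod : ∀ (e : ℕ) (y : Euc k), y ∈ Metric.ball (0 : Euc k) 1 →
      HasFDerivAt (fun y : Euc k => suspRadius y ^ s * ⟪a, y⟫ ^ e)
        (suspRadius y ^ s • ((e * ⟪a, y⟫ ^ (e - 1)) • innerSL ℝ a) +
          ⟪a, y⟫ ^ e • ((-s * suspRadius y ^ (s - 2)) • innerSL ℝ y)) y := fun e y hy =>
    (hw y hy).mul (hpow e y)
  have hpc : ∀ e : ℕ, ContinuousOn (fun y : Euc k =>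
      suspRadius y ^ s • ((e * ⟪a, y⟫ ^ (e - 1)) • innerSL ℝ a) +
          ⟪a, y⟫ ^ e • ((-s * suspRadius y ^ (s - 2)) • innerSL ℝ y)) (Metric.ball 0 1) := fun e =>
    (hwc.smul (Continuous.continuousOn
      (by fun_prop : Continuous fun y : Euc k => (e * ⟪a, y⟫ ^ (e - 1)) • innerSL ℝ a))).add
      ((Continuous.continuousOn (by fun_prop : Continuous fun y : Euc k => ⟪a, y⟫ ^ e)).smul hw')
  -- The dual pairing of `d⟨a, y⟩ ^ d` with `dψ` is `d ⟨a, y⟩ ^ (d - 1) dψ(a) - d ⟨a, y⟩ ^ d dψ(y)`: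
  -- one integration by parts in the fixed direction `a`, one radial.
  have h1 := integral_lineDeriv_mul (v := a) hψ.continuous
    (ψ' := fun y => fderiv ℝ ψ y a) (by fun_prop) hc hsub (fun y => (hd y).hasLineDerivAt a)
    (s := fun y => suspRadius y ^ s * ⟪a, y⟫ ^ (d - 1))
    (fun y hy => (hprod (d - 1) y hy).continuousAt.continuousWithinAt)
    ((hpc (d - 1)).clm_apply continuousOn_const) fun y hy => (hprod (d - 1) y hy).hasLineDerivAt a
  have h2 := integral_radial_mul hψ.continuous
    (ψ' := fun i y => fderiv ℝ ψ y (EuclideanSpace.single i 1))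
    (fun i => by fun_prop) hc hsub (fun i y => (hd y).hasLineDerivAt _) (hpc d) (hprod d)
  simp only [sum_apply_single_mul] at h2
  have hint : ∀ {f g : Euc k → ℝ}, ContinuousOn f (Metric.ball 0 1) → Continuous g →
      (∀ y, y ∉ tsupport ψ → g y = 0) → Integrable (fun y => f y * g y) := fun hf hg hz => by
    rw [← integrableOn_iff_integrable_of_support_subset (s := tsupport ψ)
      fun y hy => by_contra fun h => hy (by simp [hz y h])]
    exact ((hf.mono hsub).mul hg.continuousOn).integrableOn_compact hc
  have i1 : Integrable fun y => (suspRadius y ^ s * ⟪a, y⟫ ^ (d - 1)) * fderiv ℝ ψ y a :=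
    hint (hwc.mul (Continuous.continuousOn (by fun_prop))) (by fun_prop)
      fun y hy => by rw [fderiv_eq_zero_of_notMem_tsupport hy]; rfl
  have i2 : Integrable fun y => (suspRadius y ^ s * ⟪a, y⟫ ^ d) * fderiv ℝ ψ y y :=
    hint (hwc.mul (Continuous.continuousOn (by fun_prop))) (by fun_prop)
      fun y hy => by rw [fderiv_eq_zero_of_notMem_tsupport hy]; rfl
  have i3 := hint ((hpc (d - 1)).clm_apply (continuousOn_const (c := a))) hψ.continuous
      fun y hy => image_eq_zero_of_notMem_tsupport hy
  have i4 : Integrable fun y => (k * (suspRadius y ^ s * ⟪a, y⟫ ^ d) +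
      (suspRadius y ^ s • ((d * ⟪a, y⟫ ^ (d - 1)) • innerSL ℝ a) +
          ⟪a, y⟫ ^ d • ((-s * suspRadius y ^ (s - 2)) • innerSL ℝ y)) y) * ψ y :=
    hint ((continuousOn_const (c := (k : ℝ))).mul
      (hwc.mul (Continuous.continuousOn (by fun_prop : Continuous fun y : Euc k => ⟪a, y⟫ ^ d))) |>.add
        ((hpc d).clm_apply continuousOn_id)) hψ.continuous
      fun y hy => image_eq_zero_of_notMem_tsupport hy
  have hL : ∀ y, suspRadius y ^ s • sphDual y (fderiv ℝ (fun y : Euc k => ⟪a, y⟫ ^ d) y)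
      (fderiv ℝ ψ y) = d * ((suspRadius y ^ s * ⟪a, y⟫ ^ (d - 1)) * fderiv ℝ ψ y a) -
        d * ((suspRadius y ^ s * ⟪a, y⟫ ^ d) * fderiv ℝ ψ y y) := fun y => by
    rw [(hpow d y).fderiv, sphDual_smul_innerSL, smul_eq_mul]
    rcases Nat.eq_zero_or_pos d with rfl | hd0
    · simp
    · obtain ⟨e, rfl⟩ : ∃ e, d = e + 1 := ⟨d - 1, by omega⟩
      simp only [Nat.add_sub_cancel]; ring
  simp_rw [hL]
  rw [integral_sub (i1.const_mul _) (i2.const_mul _), integral_const_mul, integral_const_mul, h1, h2,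
    mul_neg, mul_neg, sub_neg_eq_add, ← integral_const_mul, ← integral_const_mul, neg_add_eq_sub,
    ← integral_sub (i4.const_mul _) (i3.const_mul _)]
  refine integral_congr_ae (ae_of_all _ fun y => ?_)
  by_cases hy : y ∈ Metric.ball (0 : Euc k) 1
  · have h3 := norm_sq_mul_inv hy
    have hm' : (m : ℝ) = s + 1 := by rw [hs]; ring
    simp only [hm', add_apply, smul_apply, innerSL_apply_apply,
      real_inner_self_eq_norm_sq, smul_eq_mul, suspRadius_rpow_sub_two hy, real_inner_comm a y]
    rcases Nat.eq_zero_or_pos d with rfl | hd0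
    · simp
    · obtain ⟨e, rfl⟩ : ∃ e, d = e + 1 := ⟨d - 1, by omega⟩
      rcases Nat.eq_zero_or_pos e with rfl | he0
      · simp only [zero_add, Nat.sub_self, pow_zero, pow_one, Nat.cast_one, Nat.cast_zero]
        linear_combination (-s * suspRadius y ^ s * ψ y * ⟪a, y⟫) * h3
      · obtain ⟨e, rfl⟩ : ∃ e', e = e' + 1 := ⟨e - 1, by omega⟩
        simp only [Nat.add_sub_cancel, show e + 1 + 1 - 2 = e by omega]
        push_cast
        linear_combination (-s * (e + 1 + 1) * suspRadius y ^ s * ψ y * ⟪a, y⟫ ^ (e + 2)) * h3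
  · simp [image_eq_zero_of_notMem_tsupport (hz y hy)]

end BallEquation

/-! ### Cutoff functions near the boundary of the hemisphere -/

section BallCutoff

open StratSpace (suspRadius)

variable {k : ℕ}

/-- A smooth cutoff which vanishes where `r² ≤ δ` and is `1` where `r² ≥ 2 δ`. -/
noncomputable def ballCutoff (δ : ℝ) (y : Euc k) : ℝ :=
  Real.smoothTransition ((1 - ‖y‖ ^ 2) / δ - 1)

theorem contDiff_ballCutoff (δ : ℝ) : ContDiff ℝ 1 (ballCutoff δ : Euc k → ℝ) := by
  unfold ballCutoff
  have h := contDiff_norm_sq ℝ (E := Euc k) (n := 1)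
  exact Real.smoothTransition.contDiff.comp
    (((contDiff_const.sub h).div_const δ).sub contDiff_const)

theorem ballCutoff_nonneg (δ : ℝ) (y : Euc k) : 0 ≤ ballCutoff δ y :=
  Real.smoothTransition.nonneg _

theorem ballCutoff_le_one (δ : ℝ) (y : Euc k) : ballCutoff δ y ≤ 1 :=
  Real.smoothTransition.le_one _

theorem ballCutoff_eq_one {δ : ℝ} (hδ : 0 < δ) {y : Euc k} (hy : ‖y‖ ^ 2 ≤ 1 - 2 * δ) :
    ballCutoff δ y = 1 := by
  refine Real.smoothTransition.one_of_one_le ?_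
  rw [le_sub_iff_add_le, le_div_iff₀ hδ]; linarith

theorem ballCutoff_eq_zero {δ : ℝ} (hδ : 0 < δ) {y : Euc k} (hy : 1 - δ ≤ ‖y‖ ^ 2) :
    ballCutoff δ y = 0 := by
  refine Real.smoothTransition.zero_of_nonpos ?_
  rw [sub_nonpos, div_le_one hδ]; linarith

theorem tsupport_ballCutoff_subset {δ : ℝ} (hδ : 0 < δ) :
    tsupport (ballCutoff δ : Euc k → ℝ) ⊆ {y | ‖y‖ ^ 2 ≤ 1 - δ} := by
  refine closure_minimal (fun y hy => ?_) (isClosed_le (by fun_prop) continuous_const)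
  by_contra h
  exact hy (ballCutoff_eq_zero hδ (not_le.1 h).le)

theorem tsupport_ballCutoff_subset_ball {δ : ℝ} (hδ : 0 < δ) :
    tsupport (ballCutoff δ : Euc k → ℝ) ⊆ Metric.ball 0 1 := fun y hy => by
  have h : ‖y‖ ^ 2 ≤ 1 - δ := tsupport_ballCutoff_subset hδ hy
  rw [mem_ball_zero_iff]
  nlinarith [norm_nonneg y]

theorem hasCompactSupport_ballCutoff {δ : ℝ} (hδ : 0 < δ) :
    HasCompactSupport (ballCutoff δ : Euc k → ℝ) :=
  (isCompact_closedBall (0 : Euc k) 1).of_isClosed_subset (isClosed_tsupport _)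
    ((tsupport_ballCutoff_subset_ball hδ).trans Metric.ball_subset_closedBall)

theorem sphDual_smul_smul (y : Euc k) (a b : ℝ) (α β : Euc k →L[ℝ] ℝ) :
    sphDual y (a • α) (b • β) = a * b * sphDual y α β := by
  simp only [sphDual, smul_apply, smul_eq_mul, mul_sub, Finset.mul_sum]
  congr 1
  · exact Finset.sum_congr rfl fun i _ => by ring
  · ring

theorem sphDual_add_left (y : Euc k) (α α' β : Euc k →L[ℝ] ℝ) :
    sphDual y (α + α') β = sphDual y α β + sphDual y α' β := by
  simp only [sphDual, add_apply, add_mul, Finset.sum_add_distrib]; ring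

theorem sphDual_comm (y : Euc k) (α β : Euc k →L[ℝ] ℝ) : sphDual y α β = sphDual y β α := by
  simp only [sphDual, mul_comm]

theorem sphDual_add_right (y : Euc k) (α β β' : Euc k →L[ℝ] ℝ) :
    sphDual y α (β + β') = sphDual y α β + sphDual y α β' := by
  rw [sphDual_comm, sphDual_add_left, sphDual_comm y β, sphDual_comm y β']

theorem sphDual_smul_left (y : Euc k) (a : ℝ) (α β : Euc k →L[ℝ] ℝ) :
    sphDual y (a • α) β = a * sphDual y α β := by
  simpa using sphDual_smul_smul y a 1 α β

theorem sphDual_smul_right (y : Euc k) (a : ℝ) (α β : Euc k →L[ℝ] ℝ) :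
    sphDual y α (a • β) = a * sphDual y α β := by
  simpa using sphDual_smul_smul y 1 a α β

theorem sphDual_self_nonneg {y : Euc k} (hy : ‖y‖ ≤ 1) (α : Euc k →L[ℝ] ℝ) :
    0 ≤ sphDual y α α := by
  have h := sphForm_nonneg hy fun i => α (EuclideanSpace.single i 1)
  simp only [smul_eq_mul, sum_apply_single_mul, Real.norm_eq_abs, sq_abs] at h
  simp only [sphDual, ← pow_two]
  linarith

/-- Inside the unit ball, `|y|² ≥ 1 - 2δ` forces `|y| ≥ 1 - 2δ`. The inner ball has relative volume
`(1 - 2δ) ^ k ≥ 1 - 2kδ` by Bernoulli. -/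
theorem measure_layer_le {δ : ℝ} (hδ : 0 < δ) (hδ2 : 2 * δ < 1) :
    (volume : Measure (Euc k)).real (Metric.ball 0 1 ∩ {y | 1 - 2 * δ ≤ ‖y‖ ^ 2}) ≤
      2 * k * δ * (volume : Measure (Euc k)).real (Metric.ball 0 1) := by
  have hsub : Metric.ball (0 : Euc k) 1 ∩ {y | 1 - 2 * δ ≤ ‖y‖ ^ 2} ⊆
      Metric.ball 0 1 \ Metric.ball 0 (1 - 2 * δ) := by
    rintro y ⟨hy, hy2⟩
    refine ⟨hy, fun h => ?_⟩
    rw [mem_ball_zero_iff] at hy h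
    have : 1 - 2 * δ ≤ ‖y‖ ^ 2 := hy2
    nlinarith [norm_nonneg y]
  refine (measureReal_mono hsub (ne_top_of_le_ne_top measure_ball_lt_top.ne
    (measure_mono sdiff_subset))).trans ?_
  rw [measureReal_sdiff (Metric.ball_subset_ball (by linarith)) Metric.isOpen_ball.measurableSet,
    measureReal_def (s := Metric.ball (0 : Euc k) (1 - 2 * δ)),
    Measure.addHaar_ball_of_pos _ _ (by linarith : 0 < 1 - 2 * δ), finrank_euclideanSpace,
    Fintype.card_fin, ENNReal.toReal_mul, ENNReal.toReal_ofReal (pow_nonneg (by linarith) _),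
    ← measureReal_def]
  have hb := one_add_mul_le_pow (a := -(2 * δ)) (by linarith) k
  rw [← sub_eq_add_neg] at hb
  have hv : 0 ≤ (volume : Measure (Euc k)).real (Metric.ball 0 1) := measureReal_nonneg
  nlinarith

/-- The radial dual metric contributes `|y|² (1 - |y|²) ≤ 2δ` on the layer, so the naive bound
`O(δ⁻²)` improves to `O(δ⁻¹)`. This matches the `O(δ)` volume of the layer and makes the energy of
the cutoffs bounded. -/
theorem exists_sphDual_ballCutoff_le :
    ∃ C : ℝ, ∀ δ : ℝ, 0 < δ → 2 * δ < 1 → ∀ y : Euc k, ‖y‖ ≤ 1 →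
      sphDual y (fderiv ℝ (ballCutoff δ) y) (fderiv ℝ (ballCutoff δ) y) ≤
        {y : Euc k | 1 - 2 * δ ≤ ‖y‖ ^ 2}.indicator (fun _ => C / δ) y := by
  have hT : ContDiff ℝ 1 Real.smoothTransition := Real.smoothTransition.contDiff
  obtain ⟨M, hM⟩ := (isCompact_Icc (a := (0 : ℝ)) (b := 1)).exists_bound_of_continuousOn
    (hT.continuous_deriv le_rfl).continuousOn
  have hM' : ∀ t, 0 ≤ t → |deriv Real.smoothTransition t| ≤ |M| := fun t ht => by
    rcases le_or_gt t 1 with h | h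
    · exact (hM t ⟨ht, h⟩).trans (le_abs_self M)
    · have : Real.smoothTransition =ᶠ[𝓝 t] fun _ => 1 :=
        (eventually_gt_nhds h).mono fun s hs => Real.smoothTransition.one_of_one_le hs.le
      rw [this.deriv_eq]; simp
  refine ⟨8 * M ^ 2, fun δ hδ hδ2 y hy => ?_⟩
  have hd : HasFDerivAt (ballCutoff δ : Euc k → ℝ)
      ((deriv Real.smoothTransition ((1 - ‖y‖ ^ 2) / δ - 1) * (-2 / δ)) • innerSL ℝ y) y := by
    have h1 : HasFDerivAt (fun y : Euc k => (1 - ‖y‖ ^ 2) / δ - 1)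
        ((-2 / δ) • innerSL ℝ y) y := by
      have h2 := (((hasStrictFDerivAt_norm_sq y).hasFDerivAt.const_sub 1).mul_const δ⁻¹).sub_const 1
      simp only [← div_eq_mul_inv] at h2
      refine h2.congr_fderiv ?_
      ext v; simp; ring
    have h3 := (hT.differentiable one_ne_zero ((1 - ‖y‖ ^ 2) / δ - 1)).hasDerivAt
    have h4 := h3.comp_hasFDerivAt y h1
    rw [smul_smul] at h4
    exact h4
  by_cases hy2 : y ∈ {y : Euc k | 1 - 2 * δ ≤ ‖y‖ ^ 2}
  · rw [indicator_of_mem hy2, hd.fderiv, sphDual_smul_innerSL, smul_apply, innerSL_apply_apply,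
      real_inner_self_eq_norm_sq, smul_eq_mul]
    set t := (1 - ‖y‖ ^ 2) / δ - 1 with ht
    have hy3 : 1 - 2 * δ ≤ ‖y‖ ^ 2 := hy2
    have hyn : ‖y‖ ^ 2 ≤ 1 := pow_le_one₀ (norm_nonneg _) hy
    rw [show ∀ c : ℝ, c * (c * ‖y‖ ^ 2 - ‖y‖ ^ 2 * (c * ‖y‖ ^ 2)) =
      c ^ 2 * (‖y‖ ^ 2 * (1 - ‖y‖ ^ 2)) from fun c => by ring]
    have h5 : (deriv Real.smoothTransition t) ^ 2 ≤ M ^ 2 := by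
      rcases le_or_gt 0 t with h | h
      · exact sq_le_sq.2 (hM' t h)
      · have : Real.smoothTransition =ᶠ[𝓝 t] fun _ => 0 :=
          (eventually_lt_nhds h).mono fun s hs => Real.smoothTransition.zero_of_nonpos hs.le
        rw [this.deriv_eq]; simp; positivity
    have h6 : ‖y‖ ^ 2 * (1 - ‖y‖ ^ 2) ≤ 2 * δ := by nlinarith [sq_nonneg ‖y‖]
    have h7 : 0 ≤ ‖y‖ ^ 2 * (1 - ‖y‖ ^ 2) := mul_nonneg (sq_nonneg _) (by linarith)
    calc (deriv Real.smoothTransition t * (-2 / δ)) ^ 2 * (‖y‖ ^ 2 * (1 - ‖y‖ ^ 2))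
        = (deriv Real.smoothTransition t) ^ 2 * (4 / δ ^ 2) * (‖y‖ ^ 2 * (1 - ‖y‖ ^ 2)) := by
          rw [mul_pow, div_pow]; norm_num
      _ ≤ M ^ 2 * (4 / δ ^ 2) * (2 * δ) := by gcongr
      _ = 8 * M ^ 2 / δ := by field_simp; ring
  · rw [indicator_of_notMem hy2]
    have h1 : (ballCutoff δ : Euc k → ℝ) =ᶠ[𝓝 y] fun _ => 1 := by
      have h2 : ‖y‖ ^ 2 < 1 - 2 * δ := not_le.1 hy2
      have h3 : ∀ᶠ x in 𝓝 y, ‖x‖ ^ 2 < 1 - 2 * δ :=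
        (by fun_prop : Continuous fun x : Euc k => ‖x‖ ^ 2).continuousAt.eventually_lt
          continuousAt_const h2
      exact h3.mono fun x hx => ballCutoff_eq_one hδ hx.le
    rw [h1.fderiv_eq, fderiv_const_apply, sphDual_zero_right]

theorem continuous_sphDual_fderiv {φ ψ : Euc k → ℝ} (hφ : ContDiff ℝ 1 φ) (hψ : ContDiff ℝ 1 ψ) :
    Continuous fun y => sphDual y (fderiv ℝ φ y) (fderiv ℝ ψ y) := by
  have h1 := hφ.continuous_fderiv one_ne_zero
  have h2 := hψ.continuous_fderiv one_ne_zero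
  unfold sphDual
  fun_prop

/-- The cutoffs have uniformly bounded energy. -/
theorem exists_integral_sphDual_ballCutoff_le {m : ℕ} (hm : 1 ≤ m) :
    ∃ C : ℝ, ∀ δ : ℝ, 0 < δ → 2 * δ < 1 →
      ∫ y, sphDual y (fderiv ℝ (ballCutoff δ) y) (fderiv ℝ (ballCutoff δ) y) ∂(ballVol k m) ≤ C := by
  obtain ⟨C, hC⟩ := exists_sphDual_ballCutoff_le (k := k)
  have := isFiniteMeasure_ballVol (k := k) hm
  refine ⟨|C| * (2 * k) * (volume : Measure (Euc k)).real (Metric.ball 0 1), fun δ hδ hδ2 => ?_⟩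
  set A : Set (Euc k) := {y | 1 - 2 * δ ≤ ‖y‖ ^ 2} with hA
  have hAm : MeasurableSet A := (isClosed_le continuous_const (by fun_prop)).measurableSet
  have h1 : ∫ y, sphDual y (fderiv ℝ (ballCutoff δ) y) (fderiv ℝ (ballCutoff δ) y) ∂(ballVol k m) ≤
      ∫ y, A.indicator (fun _ => |C| / δ) y ∂(ballVol k m) := by
    refine integral_mono_ae ?_ ((integrable_const _).indicator hAm) ?_
    · exact integrable_ballVol hm (hasCompactSupport_ballCutoff hδ)
        (tsupport_ballCutoff_subset_ball hδ)
        (continuous_sphDual_fderiv (contDiff_ballCutoff δ) (contDiff_ballCutoff δ)).continuousOn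
        fun y hy => by rw [fderiv_eq_zero_of_notMem_tsupport hy, sphDual_zero_right]
    · filter_upwards [ae_mem_ball_ballVol m] with y hy
      refine (hC δ hδ hδ2 y (mem_ball_zero_iff.1 hy).le).trans (indicator_le_indicator ?_)
      gcongr
      exact le_abs_self C
  refine h1.trans ?_
  rw [integral_indicator_const _ hAm, smul_eq_mul]
  have h2 : (ballVol k m).real A ≤
      (volume : Measure (Euc k)).real (Metric.ball 0 1 ∩ {y | 1 - 2 * δ ≤ ‖y‖ ^ 2}) := by
    refine ENNReal.toReal_mono (measure_inter_lt_top_of_left_ne_top measure_ball_lt_top.ne).ne ?_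
    rw [ballVol, withDensity_apply _ hAm, Measure.restrict_restrict hAm]
    calc ∫⁻ y in A ∩ Metric.ball (0 : Euc k) 1, ENNReal.ofReal (suspRadius y ^ m / suspRadius y)
        ≤ ∫⁻ _ in A ∩ Metric.ball (0 : Euc k) 1, 1 := lintegral_mono fun y => by
          rw [← ENNReal.ofReal_one]
          exact ENNReal.ofReal_le_ofReal (suspRadius_pow_div_le_one y hm)
      _ = _ := by rw [setLIntegral_one, inter_comm]
  calc (ballVol k m).real A * (|C| / δ)
      ≤ (2 * k * δ * (volume : Measure (Euc k)).real (Metric.ball 0 1)) * (|C| / δ) :=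
        mul_le_mul_of_nonneg_right (h2.trans (measure_layer_le hδ hδ2)) (by positivity)
    _ = _ := by field_simp

theorem contDiff_ballCutoff_mul {φ : Euc k → ℝ} (hφ : ContDiffOn ℝ 1 φ (Metric.ball 0 1)) {δ : ℝ}
    (hδ : 0 < δ) : ContDiff ℝ 1 fun y => ballCutoff δ y * φ y := by
  rw [contDiff_iff_contDiffAt]
  intro y
  by_cases hy : y ∈ Metric.ball (0 : Euc k) 1
  · exact (contDiff_ballCutoff δ).contDiffAt.mul (hφ.contDiffAt (Metric.isOpen_ball.mem_nhds hy))
  · have h1 : (ballCutoff δ : Euc k → ℝ) =ᶠ[𝓝 y] 0 :=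
      notMem_tsupport_iff_eventuallyEq.1 fun h => hy (tsupport_ballCutoff_subset_ball hδ h)
    have h2 : (fun y => ballCutoff δ y * φ y) =ᶠ[𝓝 y] fun _ => 0 :=
      h1.mono fun x hx => by simp [hx]
    exact contDiffAt_const.congr_of_eventuallyEq h2

/-- The energy of a solution which is cut off near the boundary. -/
theorem IsSphSolution.energy_cutoff {m : ℕ} (hm : 1 ≤ m) {μ : ℝ} {φ ζ : Euc k → ℝ}
    (h : IsSphSolution k m μ φ ζ) {δ : ℝ} (hδ : 0 < δ) :
    ∫ y, sphDual y (fderiv ℝ (fun y => ballCutoff δ y * φ y) y)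
        (fderiv ℝ (fun y => ballCutoff δ y * φ y) y) ∂(ballVol k m) +
      μ * ∫ y, (suspRadius y ^ 2)⁻¹ * (ballCutoff δ y * φ y) ^ 2 ∂(ballVol k m) =
    ∫ y, φ y ^ 2 * sphDual y (fderiv ℝ (ballCutoff δ) y) (fderiv ℝ (ballCutoff δ) y) ∂(ballVol k m)
      + ∫ y, ζ y * φ y * ballCutoff δ y ^ 2 ∂(ballVol k m) := by
  set χ : Euc k → ℝ := ballCutoff δ with hχ
  have hχc := contDiff_ballCutoff (k := k) δ
  have hχs := hasCompactSupport_ballCutoff (k := k) hδ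
  have hχb := tsupport_ballCutoff_subset_ball (k := k) hδ
  have hχφ := contDiff_ballCutoff_mul h.contDiffOn hδ
  have hcon := h.continuous
  have hcon2 := h.continuous_rhs
  have hχ0 : ∀ y, y ∉ tsupport χ → χ y = 0 := fun y hy => image_eq_zero_of_notMem_tsupport hy
  -- Testing with `χ² φ` isolates the energy of `χ φ`, because `|d(χφ)|² = φ² |dχ|² + ⟨dφ, d(χ²φ)⟩`.
  set ψ : Euc k → ℝ := fun y => χ y * (χ y * φ y) with hψ
  have hψc : ContDiff ℝ 1 ψ := hχc.mul hχφ
  have hψs : tsupport ψ ⊆ tsupport χ := tsupport_mul_subset_left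
  have heq := h.eq ψ hψc (hχs.mono' (subset_tsupport _ |>.trans hψs)) (hψs.trans hχb)
  have hpt : ∀ y ∈ Metric.ball (0 : Euc k) 1,
      sphDual y (fderiv ℝ (fun y => χ y * φ y) y) (fderiv ℝ (fun y => χ y * φ y) y) =
        φ y ^ 2 * sphDual y (fderiv ℝ χ y) (fderiv ℝ χ y) +
          sphDual y (fderiv ℝ φ y) (fderiv ℝ ψ y) := fun y hy => by
    have d1 := (hχc.differentiable one_ne_zero y)
    have d2 : DifferentiableAt ℝ φ y :=
      (h.contDiffOn.contDiffAt (Metric.isOpen_ball.mem_nhds hy)).differentiableAt one_ne_zero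
    rw [hψ, fderiv_fun_mul d1 (d1.fun_mul d2), fderiv_fun_mul d1 d2]
    simp only [sphDual_add_left, sphDual_add_right, sphDual_smul_left, sphDual_smul_right]
    rw [sphDual_comm y (fderiv ℝ χ y) (fderiv ℝ φ y)]
    ring
  have hint : ∀ {g : Euc k → ℝ}, ContinuousOn g (Metric.ball 0 1) →
      (∀ y, y ∉ tsupport χ → g y = 0) → Integrable g (ballVol k m) := fun hg hz =>
    integrable_ballVol hm hχs hχb hg hz
  have hrc := continuousOn_suspRadius_inv (k := k)
  have i1 : Integrable (fun y => φ y ^ 2 * sphDual y (fderiv ℝ χ y) (fderiv ℝ χ y))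
      (ballVol k m) := hint ((hcon.pow 2).mul (continuous_sphDual_fderiv hχc hχc)).continuousOn
    fun y hy => by rw [fderiv_eq_zero_of_notMem_tsupport hy, sphDual_zero_right, mul_zero]
  have i2 : Integrable (fun y => sphDual y (fderiv ℝ φ y) (fderiv ℝ ψ y)) (ballVol k m) := by
    refine hint ?_ fun y hy => by
      rw [fderiv_eq_zero_of_notMem_tsupport fun h => hy (hψs h), sphDual_zero_right]
    have h1 := h.contDiffOn.continuousOn_fderiv_of_isOpen Metric.isOpen_ball le_rfl
    have h2 := (hψc.continuous_fderiv one_ne_zero).continuousOn (s := Metric.ball (0 : Euc k) 1)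
    unfold sphDual
    refine (continuousOn_finsetSum _ fun i _ => (h1.clm_apply continuousOn_const).mul
      (h2.clm_apply continuousOn_const)).sub ((h1.clm_apply continuousOn_id).mul
      (h2.clm_apply continuousOn_id))
  have i3 : Integrable (fun y => ζ y * φ y * χ y ^ 2) (ballVol k m) :=
    hint ((hcon2.mul hcon).mul (hχc.continuous.pow 2)).continuousOn
      fun y hy => by simp [hχ0 y hy]
  have i4 : Integrable (fun y => (suspRadius y ^ 2)⁻¹ * (χ y * φ y) ^ 2) (ballVol k m) :=
    hint (hrc.mul ((hχc.continuous.mul hcon).pow 2).continuousOn)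
      fun y hy => by simp [hχ0 y hy]
  have e1 : ∫ y, sphDual y (fderiv ℝ (fun y => χ y * φ y) y)
      (fderiv ℝ (fun y => χ y * φ y) y) ∂(ballVol k m) =
      ∫ y, (φ y ^ 2 * sphDual y (fderiv ℝ χ y) (fderiv ℝ χ y) +
          sphDual y (fderiv ℝ φ y) (fderiv ℝ ψ y)) ∂(ballVol k m) :=
    integral_congr_ae ((ae_mem_ball_ballVol m).mono hpt)
  have e2 : ∫ y, (ζ y - μ * (suspRadius y ^ 2)⁻¹ * φ y) * ψ y ∂(ballVol k m) =
      ∫ y, ζ y * φ y * χ y ^ 2 ∂(ballVol k m) -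
        μ * ∫ y, (suspRadius y ^ 2)⁻¹ * (χ y * φ y) ^ 2 ∂(ballVol k m) := by
    rw [← integral_const_mul, ← integral_sub i3 (i4.const_mul _)]
    congr 1; funext y; simp only [hψ]; ring
  rw [e1, integral_add i1 i2, heq, e2]
  ring

/-- `φ` and `ζ` are bounded on the closed ball, so `energy_cutoff` leaves only the energy of the
cutoffs themselves. The estimate concerns the sum; the two terms on the left are not bounded
separately. -/
theorem IsSphSolution.exists_energy_cutoff_le {m : ℕ} (hm : 1 ≤ m) {μ : ℝ} {φ ζ : Euc k → ℝ}
    (h : IsSphSolution k m μ φ ζ) : ∃ C : ℝ, ∀ δ : ℝ, 0 < δ → 2 * δ < 1 →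
    ∫ y, sphDual y (fderiv ℝ (fun y => ballCutoff δ y * φ y) y)
        (fderiv ℝ (fun y => ballCutoff δ y * φ y) y) ∂(ballVol k m) +
      μ * ∫ y, (suspRadius y ^ 2)⁻¹ * (ballCutoff δ y * φ y) ^ 2 ∂(ballVol k m) ≤ C := by
  have := isFiniteMeasure_ballVol (k := k) hm
  obtain ⟨C₀, hC₀⟩ := exists_integral_sphDual_ballCutoff_le (k := k) hm
  obtain ⟨A, hA⟩ := (isCompact_closedBall (0 : Euc k) 1).exists_bound_of_continuousOn
    h.continuous.continuousOn
  obtain ⟨A', hA'⟩ := (isCompact_closedBall (0 : Euc k) 1).exists_bound_of_continuousOn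
    h.continuous_rhs.continuousOn
  refine ⟨A ^ 2 * C₀ + A' * A * (ballVol k m).real univ, fun δ hδ hδ2 => ?_⟩
  rw [h.energy_cutoff hm hδ]
  have hχc := contDiff_ballCutoff (k := k) δ
  have i0 : Integrable (fun y : Euc k => sphDual y (fderiv ℝ (ballCutoff δ) y)
      (fderiv ℝ (ballCutoff δ) y)) (ballVol k m) :=
    integrable_ballVol hm (hasCompactSupport_ballCutoff hδ)
      (tsupport_ballCutoff_subset_ball hδ) (continuous_sphDual_fderiv hχc hχc).continuousOn
      fun y hy => by rw [fderiv_eq_zero_of_notMem_tsupport hy, sphDual_zero_right]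
  refine add_le_add ?_ ?_
  · calc ∫ y, φ y ^ 2 * sphDual y (fderiv ℝ (ballCutoff δ) y) (fderiv ℝ (ballCutoff δ) y)
          ∂(ballVol k m)
        ≤ ∫ y, A ^ 2 * sphDual y (fderiv ℝ (ballCutoff δ) y) (fderiv ℝ (ballCutoff δ) y)
          ∂(ballVol k m) := by
          refine integral_mono_ae ?_ (i0.const_mul _) ?_
          · exact integrable_ballVol hm (hasCompactSupport_ballCutoff hδ)
              (tsupport_ballCutoff_subset_ball hδ)
              ((h.continuous.pow 2).mul (continuous_sphDual_fderiv hχc hχc)).continuousOn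
              fun y hy => by
                rw [fderiv_eq_zero_of_notMem_tsupport hy, sphDual_zero_right, mul_zero]
          · filter_upwards [ae_mem_ball_ballVol m] with y hy
            have h1 := hA y (Metric.ball_subset_closedBall hy)
            refine mul_le_mul_of_nonneg_right ?_
              (sphDual_self_nonneg (mem_ball_zero_iff.1 hy).le _)
            rw [← sq_abs]
            exact pow_le_pow_left₀ (abs_nonneg _) h1 2
      _ ≤ A ^ 2 * C₀ := by
          rw [integral_const_mul]
          exact mul_le_mul_of_nonneg_left (hC₀ δ hδ hδ2) (sq_nonneg _)
  · calc ∫ y, ζ y * φ y * ballCutoff δ y ^ 2 ∂(ballVol k m)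
        ≤ ∫ _, A' * A ∂(ballVol k m) := by
          refine integral_mono_ae ?_ (integrable_const _) ?_
          · exact integrable_ballVol hm (hasCompactSupport_ballCutoff hδ)
              (tsupport_ballCutoff_subset_ball hδ)
              ((h.continuous_rhs.mul h.continuous).mul (hχc.continuous.pow 2)).continuousOn
              fun y hy => by rw [image_eq_zero_of_notMem_tsupport hy]; simp
          · filter_upwards [ae_mem_ball_ballVol m] with y hy
            have h1 := hA y (Metric.ball_subset_closedBall hy)
            have h2 := hA' y (Metric.ball_subset_closedBall hy)
            have h3 := ballCutoff_nonneg δ y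
            have h4 := ballCutoff_le_one δ y
            rw [Real.norm_eq_abs] at h1 h2
            have h5 : |ζ y * φ y| ≤ A' * A := by
              rw [abs_mul]
              exact mul_le_mul h2 h1 (abs_nonneg _) ((abs_nonneg _).trans h2)
            have h6 : ballCutoff δ y ^ 2 ≤ 1 := pow_le_one₀ h3 h4
            have h7 := le_abs_self (ζ y * φ y)
            have h8 := abs_nonneg (ζ y * φ y)
            nlinarith [sq_nonneg (ballCutoff δ y)]
      _ = A' * A * (ballVol k m).real univ := by
          rw [integral_const, smul_eq_mul, mul_comm]

/-! ### Density of powers of linear forms -/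

/-- The span of the powers of linear forms. -/
noncomputable def ridgeSpan (k : ℕ) : Submodule ℝ (Euc k → ℝ) :=
  Submodule.span ℝ {p | ∃ (d : ℕ) (a : Euc k), p = fun y => ⟪a, y⟫ ^ d}

/-- The exponentials `exp ⟨a, y⟩` are closed under products and separate points (take `a = x - y`),
so Stone–Weierstrass applies to their span; the exponential series approximates each of them
uniformly by powers of linear forms. -/
theorem exists_ridge_approx {g : Euc k → ℝ} (hg : Continuous g) {ε : ℝ} (hε : 0 < ε) :
    ∃ p ∈ ridgeSpan k, ∀ y ∈ Metric.closedBall (0 : Euc k) 1, |g y - p y| < ε := by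
  let X := Metric.closedBall (0 : Euc k) 1
  have hX : CompactSpace X := isCompact_iff_compactSpace.1 (isCompact_closedBall _ _)
  let E : Euc k → C(X, ℝ) := fun a => ⟨fun y => Real.exp ⟪a, (y : Euc k)⟫, by fun_prop⟩
  let mon : Submonoid C(X, ℝ) :=
    { carrier := range E
      mul_mem' := by
        rintro _ _ ⟨a, rfl⟩ ⟨b, rfl⟩
        exact ⟨a + b, by ext y; simp [E, inner_add_left, Real.exp_add]⟩
      one_mem' := ⟨0, by ext y; simp [E]⟩ }
  let A : Subalgebra ℝ C(X, ℝ) := (Submodule.span ℝ (mon : Set C(X, ℝ))).toSubalgebra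
    (Submodule.subset_span mon.one_mem) fun x y hx hy => by
      have := Submodule.mul_mem_mul hx hy
      rw [Submodule.span_mul_span] at this
      refine Submodule.span_mono ?_ this
      rintro _ ⟨a, ha, b, hb, rfl⟩
      exact mon.mul_mem ha hb
  have hsep : A.SeparatesPoints := by
    intro x y hxy
    have hne : (x : Euc k) - y ≠ 0 := sub_ne_zero.2 fun h => hxy (Subtype.ext h)
    refine ⟨E ((x : Euc k) - y), ⟨E ((x : Euc k) - y), Submodule.subset_span ⟨_, rfl⟩, rfl⟩, ?_⟩
    intro h
    have h1 : ⟪(x : Euc k) - y, (x : Euc k)⟫ = ⟪(x : Euc k) - y, (y : Euc k)⟫ :=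
      Real.exp_injective h
    rw [← sub_eq_zero, ← inner_sub_right] at h1
    exact hne (inner_self_eq_zero.1 h1)
  let res : (Euc k → ℝ) →ₗ[ℝ] (X → ℝ) := LinearMap.funLeft ℝ ℝ Subtype.val
  let P : Submodule ℝ C(X, ℝ) :=
    ((ridgeSpan k).map res).comap (ContinuousMap.coeFnLinearMap ℝ)
  have hE : ∀ a, E a ∈ P.topologicalClosure := by
    intro a
    have hpart : ∀ N, (⟨fun y : X => ∑ n ∈ Finset.range N, ⟪a, (y : Euc k)⟫ ^ n / n.factorial,
        by fun_prop⟩ : C(X, ℝ)) ∈ P := by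
      intro N
      refine ⟨∑ n ∈ Finset.range N, ((n.factorial : ℝ)⁻¹) • fun y : Euc k => ⟪a, y⟫ ^ n, ?_, ?_⟩
      · exact Submodule.sum_mem _ fun n _ => Submodule.smul_mem _ _
          (Submodule.subset_span ⟨n, a, rfl⟩)
      · funext y
        simp [res, div_eq_inv_mul]
    refine mem_closure_of_tendsto (b := atTop) (f := fun N : ℕ => (⟨fun y : X =>
      ∑ n ∈ Finset.range N, ⟪a, (y : Euc k)⟫ ^ n / n.factorial, by fun_prop⟩ : C(X, ℝ))) ?_
      (Eventually.of_forall hpart)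
    rw [ContinuousMap.tendsto_iff_tendstoUniformly]
    have hu : TendstoUniformlyOn (fun (N : ℕ) (t : ℝ) =>
        ∑ n ∈ Finset.range N, t ^ n / n.factorial) Real.exp atTop (Metric.closedBall 0 ‖a‖) := by
      have := tendstoUniformlyOn_tsum_nat (f := fun n (t : ℝ) => t ^ n / n.factorial)
        (u := fun n => ‖a‖ ^ n / n.factorial) (Real.summable_pow_div_factorial ‖a‖)
        (s := Metric.closedBall 0 ‖a‖) (fun n t ht => by
          rw [norm_div, norm_pow, Real.norm_natCast]
          gcongr
          simpa using ht)
      refine this.congr_right fun t _ => ?_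
      rw [Real.exp_eq_exp_ℝ, NormedSpace.exp_eq_tsum_div]
    rw [Metric.tendstoUniformlyOn_iff] at hu
    rw [Metric.tendstoUniformly_iff]
    intro ε hε
    filter_upwards [hu ε hε] with N hN y
    refine hN ⟪a, (y : Euc k)⟫ ?_
    rw [mem_closedBall_zero_iff]
    refine (abs_real_inner_le_norm _ _).trans ?_
    have := mem_closedBall_zero_iff.1 y.2
    nlinarith [norm_nonneg a]
  have hAP : A.toSubmodule ≤ P.topologicalClosure := by
    refine Submodule.span_le.2 ?_
    rintro _ ⟨a, rfl⟩
    exact hE a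
  have htop : (A : Set C(X, ℝ)) ⊆ closure (P : Set C(X, ℝ)) := hAP
  let G : C(X, ℝ) := ⟨fun y => g y, by fun_prop⟩
  have hG : G ∈ closure (P : Set C(X, ℝ)) := by
    have h1 := ContinuousMap.continuousMap_mem_subalgebra_closure_of_separatesPoints A hsep G
    have h2 : G ∈ closure (A : Set C(X, ℝ)) := h1
    exact closure_minimal htop isClosed_closure h2
  obtain ⟨q, ⟨p, hp, hpq⟩, hq⟩ := Metric.mem_closure_iff.1 hG ε hε
  refine ⟨p, hp, fun y hy => ?_⟩
  have h1 := (ContinuousMap.dist_lt_iff hε).1 hq ⟨y, hy⟩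
  have h2 : q ⟨y, hy⟩ = p y := (congrFun hpq ⟨y, hy⟩).symm
  rw [h2, Real.dist_eq] at h1
  exact h1

end BallCutoff

/-! ### Dual vectors -/

section DualVector

variable {V : Type*} [AddCommGroup V] [Module ℝ V]

/-- `g` is a positive definite symmetric bilinear form. -/
structure IsInnerForm (g : V → V → ℝ) : Prop where
  add_left : ∀ u v w, g (u + v) w = g u w + g v w
  smul_left : ∀ (c : ℝ) u v, g (c • u) v = c * g u v
  symm : ∀ u v, g u v = g v u
  pos : ∀ v, v ≠ 0 → 0 < g v v

namespace IsInnerForm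

variable {g : V → V → ℝ} (hg : IsInnerForm g)
include hg

theorem add_right (u v w : V) : g u (v + w) = g u v + g u w := by
  rw [hg.symm, hg.add_left, hg.symm v, hg.symm w]

theorem smul_right (c : ℝ) (u v : V) : g u (c • v) = c * g u v := by
  rw [hg.symm, hg.smul_left, hg.symm v]

/-- The associated bilinear form. -/
def toBilin : V →ₗ[ℝ] V →ₗ[ℝ] ℝ :=
  LinearMap.mk₂ ℝ g hg.add_left hg.smul_left hg.add_right fun c u v => hg.smul_right c u v

theorem toBilin_apply (u v : V) : hg.toBilin u v = g u v := rfl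

theorem nonneg (v : V) : 0 ≤ g v v := by
  rcases eq_or_ne v 0 with rfl | h
  · rw [← hg.toBilin_apply]; simp
  · exact (hg.pos v h).le

theorem eq_of_forall {w w' : V} (h : ∀ v, g w v = g w' v) : w = w' := by
  by_contra hne
  have h1 := hg.pos (w - w') (sub_ne_zero.2 hne)
  have h2 := h (w - w')
  simp only [← hg.toBilin_apply, map_sub, LinearMap.sub_apply] at h1 h2
  linarith

variable [FiniteDimensional ℝ V]

theorem exists_dual (β : V →ₗ[ℝ] ℝ) : ∃ w, ∀ v, g w v = β v := by
  have hinj : Function.Injective hg.toBilin := fun w w' h =>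
    hg.eq_of_forall fun v => LinearMap.congr_fun h v
  have hsurj : Function.Surjective hg.toBilin :=
    (LinearMap.injective_iff_surjective_of_finrank_eq_finrank
      (Subspace.dual_finrank_eq (K := ℝ) (V := V)).symm).1 hinj
  obtain ⟨w, hw⟩ := hsurj β
  exact ⟨w, fun v => LinearMap.congr_fun hw v⟩

theorem dualVector_spec (β : V →ₗ[ℝ] ℝ) (v : V) : g (dualVector g fun w => β w) v = β v :=
  Classical.epsilon_spec (hg.exists_dual β) v

theorem dualVector_eq {β : V →ₗ[ℝ] ℝ} {w : V} (hw : ∀ v, g w v = β v) :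
    dualVector g (fun w => β w) = w :=
  hg.eq_of_forall fun v => by rw [hg.dualVector_spec, hw]

theorem apply_dualVector_comm (α β : V →ₗ[ℝ] ℝ) :
    α (dualVector g fun w => β w) = β (dualVector g fun w => α w) := by
  rw [← hg.dualVector_spec α, ← hg.dualVector_spec β, hg.symm]

theorem apply_dualVector_self_nonneg (α : V →ₗ[ℝ] ℝ) : 0 ≤ α (dualVector g fun w => α w) := by
  rw [← hg.dualVector_spec α]; exact hg.nonneg _

/-- A bound for a covector gives a bound for its dual norm. -/
theorem apply_dualVector_self_le {α : V →ₗ[ℝ] ℝ} {M : ℝ} (hM0 : 0 ≤ M) (hM : ∀ v, α v ^ 2 ≤ M * g v v) :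
    α (dualVector g fun w => α w) ≤ M := by
  have h1 := hM (dualVector g fun w => α w)
  rw [hg.dualVector_spec] at h1
  have h2 := hg.apply_dualVector_self_nonneg α
  rcases eq_or_lt_of_le h2 with h0 | h0
  · rwa [← h0]
  · exact le_of_mul_le_mul_right (by rwa [← pow_two]) h0

/-- The dual form in a frame. -/
theorem apply_dualVector_frame {m : ℕ} (D : (Fin m → ℝ) →ₗ[ℝ] V) (hD : Function.Bijective D)
    (α β : V →ₗ[ℝ] ℝ) :
    let G : Matrix (Fin m) (Fin m) ℝ :=
      Matrix.of fun i j => g (D (Pi.single i 1)) (D (Pi.single j 1))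
    0 < G.det ∧ α (dualVector g fun w => β w) =
      (fun i => α (D (Pi.single i 1))) ⬝ᵥ G⁻¹.mulVec fun i => β (D (Pi.single i 1)) := by
  intro G
  have hsum : ∀ c : Fin m → ℝ, D c = ∑ i, c i • D (Pi.single i 1) := fun c => by
    conv_lhs => rw [pi_eq_sum_univ' c]
    simp [map_sum, Pi.single]
  have hG : ∀ c e : Fin m → ℝ, c ⬝ᵥ G.mulVec e = g (D c) (D e) := fun c e => by
    rw [hsum c, hsum e, ← hg.toBilin_apply]
    simp only [map_sum, map_smul, LinearMap.sum_apply, LinearMap.smul_apply, smul_eq_mul,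
      dotProduct, Matrix.mulVec, Finset.mul_sum, hg.toBilin_apply, G, Matrix.of_apply]
    rw [Finset.sum_comm]
    exact Finset.sum_congr rfl fun i _ => Finset.sum_congr rfl fun j _ => by ring
  have hpd : G.PosDef := by
    refine Matrix.PosDef.of_dotProduct_mulVec_pos ?_ fun c hc => ?_
    · ext i j; simp [G, hg.symm]
    · rw [star_trivial, hG]
      exact hg.pos _ fun h => hc (hD.1 (h.trans (map_zero D).symm))
  refine ⟨hpd.det_pos, ?_⟩
  obtain ⟨c, hc⟩ := hD.2 (dualVector g fun w => β w)
  have h1 : G.mulVec c = fun i => β (D (Pi.single i 1)) := by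
    funext i
    have h2 := hG (Pi.single i 1) c
    rw [single_one_dotProduct, hc, hg.symm, hg.dualVector_spec] at h2
    exact h2
  rw [← h1, Matrix.mulVec_mulVec, Matrix.nonsing_inv_mul _ (isUnit_iff_ne_zero.2 hpd.det_pos.ne'),
    Matrix.one_mulVec, ← hc, hsum c, map_sum]
  simp [dotProduct, mul_comm]

end IsInnerForm

end DualVector

/-! ### The form of the Friedrichs operator -/

section FriedrichsForm

variable {E H M : Type*} [NormedAddCommGroup E] [NormedSpace ℝ E] [FiniteDimensional ℝ E]
  [TopologicalSpace H]
  {I : ModelWithCorners ℝ E H} [TopologicalSpace M] [ChartedSpace H M]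

instance (x : M) : FiniteDimensional ℝ (TangentSpace I x) :=
  inferInstanceAs (FiniteDimensional ℝ E)

theorem mfderiv_eq_zero_of_notMem_tsupport {u : M → ℝ} {x : M} (hx : x ∉ tsupport u) :
    mfderiv I 𝓘(ℝ, ℝ) u x = 0 := by
  have h1 : u =ᶠ[𝓝 x] fun _ => 0 := notMem_tsupport_iff_eventuallyEq.1 hx
  rw [h1.mfderiv_eq]
  exact mfderiv_const

variable {U : Set M} {g : ∀ x : M, TangentSpace I x → TangentSpace I x → ℝ}

theorem diffInner_eq_zero_of_notMem_left {u : M → ℝ} {x : M} (hx : x ∉ tsupport u) (v : M → ℝ) :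
    diffInner I g u v x = 0 := by
  rw [diffInner, mfderiv_eq_zero_of_notMem_tsupport hx]; rfl

theorem diffInner_comm {x : M} (hg : IsInnerForm (g x)) (u v : M → ℝ) :
    diffInner I g u v x = diffInner I g v u x :=
  hg.apply_dualVector_comm (mfderiv I 𝓘(ℝ, ℝ) u x).toLinearMap (mfderiv I 𝓘(ℝ, ℝ) v x).toLinearMap

theorem diffInner_self_nonneg {x : M} (hg : IsInnerForm (g x)) (u : M → ℝ) :
    0 ≤ diffInner I g u u x :=
  hg.apply_dualVector_self_nonneg (mfderiv I 𝓘(ℝ, ℝ) u x).toLinearMap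

theorem diffInner_add_left {u u' : M → ℝ} {x : M} (hu : MDifferentiableAt I 𝓘(ℝ, ℝ) u x)
    (hu' : MDifferentiableAt I 𝓘(ℝ, ℝ) u' x) (v : M → ℝ) :
    diffInner I g (u + u') v x = diffInner I g u v x + diffInner I g u' v x := by
  unfold diffInner
  rw [mfderiv_add hu hu']; rfl

theorem diffInner_smul_left {u : M → ℝ} {x : M} (hu : MDifferentiableAt I 𝓘(ℝ, ℝ) u x) (c : ℝ)
    (v : M → ℝ) : diffInner I g (c • u) v x = c * diffInner I g u v x := by
  unfold diffInner
  rw [const_smul_mfderiv hu]; rfl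

theorem IsTestFunction.mdifferentiableAt {u : M → ℝ} (hu : IsTestFunction I U u) (x : M) :
    MDifferentiableAt I 𝓘(ℝ, ℝ) u x :=
  (hu.contMDiff x).mdifferentiableAt one_ne_zero

variable (I U) in
/-- The space of test functions. -/
def testSubmodule : Submodule ℝ (M → ℝ) where
  carrier := {u | IsTestFunction I U u}
  add_mem' {u v} hu hv :=
    { contMDiff := hu.contMDiff.add hv.contMDiff
      hasCompactSupport := hu.hasCompactSupport.add hv.hasCompactSupport
      tsupport_subset := (tsupport_add u v).trans
        (union_subset hu.tsupport_subset hv.tsupport_subset) }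
  zero_mem' :=
    { contMDiff := contMDiff_const
      hasCompactSupport := HasCompactSupport.zero
      tsupport_subset := by rw [tsupport_zero]; exact empty_subset _ }
  smul_mem' c u hu :=
    { contMDiff := (contDiff_const_smul c).contMDiff.comp hu.contMDiff
      hasCompactSupport := hu.hasCompactSupport.smul_left (f := fun _ => c)
      tsupport_subset := (tsupport_smul_subset_right (fun _ => c) u).trans hu.tsupport_subset }

variable [MeasurableSpace M] {μ : Measure M}

variable (I U g μ) in
/-- The Dirichlet form and the `L²` norm are finite on test functions. -/
structure IsDirichletSpace : Prop where
  isInnerForm : ∀ x ∈ U, IsInnerForm (g x)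
  memLp : ∀ u : M → ℝ, IsTestFunction I U u → MemLp u 2 μ
  integrable : ∀ u v : M → ℝ, IsTestFunction I U u → IsTestFunction I U v →
    Integrable (diffInner I g u v) μ

namespace IsDirichletSpace

variable (hD : IsDirichletSpace I U g μ)
include hD

theorem diffInner_comm {u v : M → ℝ} (hu : IsTestFunction I U u) (hv : IsTestFunction I U v) :
    diffInner I g u v = diffInner I g v u := by
  funext x
  by_cases hx : x ∈ U
  · exact _root_.diffInner_comm (hD.isInnerForm x hx) u v
  · rw [diffInner_eq_zero_of_notMem_left fun h => hx (hu.tsupport_subset h),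
      diffInner_eq_zero_of_notMem_left fun h => hx (hv.tsupport_subset h)]

theorem diffInner_self_nonneg {u : M → ℝ} (hu : IsTestFunction I U u) (x : M) :
    0 ≤ diffInner I g u u x := by
  by_cases hx : x ∈ U
  · exact _root_.diffInner_self_nonneg (hD.isInnerForm x hx) u
  · rw [diffInner_eq_zero_of_notMem_left fun h => hx (hu.tsupport_subset h)]

/-- The class in `L²` of a test function. -/
noncomputable def toLp : testSubmodule I U →ₗ[ℝ] Lp ℝ 2 μ where
  toFun u := (hD.memLp u.1 u.2).toLp u.1
  map_add' _ _ := rfl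
  map_smul' _ _ := rfl

/-- The Dirichlet form as a bilinear form. -/
noncomputable def form : testSubmodule I U →ₗ[ℝ] testSubmodule I U →ₗ[ℝ] ℝ :=
  have hadd : ∀ u u' v : testSubmodule I U, dirichletForm I g μ (u + u') v.1 =
      dirichletForm I g μ u v.1 + dirichletForm I g μ u' v.1 := fun u u' v => by
    unfold dirichletForm
    rw [← integral_add (hD.integrable _ _ u.2 v.2) (hD.integrable _ _ u'.2 v.2)]
    refine integral_congr_ae (ae_of_all _ fun x => ?_)
    exact diffInner_add_left (u.2.mdifferentiableAt x) (u'.2.mdifferentiableAt x) _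
  have hsmul : ∀ (c : ℝ) (u v : testSubmodule I U), dirichletForm I g μ (c • u.1) v.1 =
      c * dirichletForm I g μ u v.1 := fun c u v => by
    unfold dirichletForm
    rw [← integral_const_mul]
    refine integral_congr_ae (ae_of_all _ fun x => ?_)
    exact diffInner_smul_left (u.2.mdifferentiableAt x) c _
  have hcomm : ∀ u v : testSubmodule I U, dirichletForm I g μ u.1 v.1 =
      dirichletForm I g μ v.1 u.1 := fun u v => by
    unfold dirichletForm
    rw [hD.diffInner_comm u.2 v.2]
  LinearMap.mk₂ ℝ (fun u v => dirichletForm I g μ u.1 v.1) hadd hsmul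
    (fun u v v' => by
      rw [hcomm u, hcomm u, hcomm u]; exact hadd v v' u)
    (fun c u v => by
      rw [hcomm u, hcomm u]; exact hsmul c v u)

theorem form_apply (u v : testSubmodule I U) : hD.form u v = dirichletForm I g μ u.1 v.1 := rfl

theorem form_comm (u v : testSubmodule I U) : hD.form u v = hD.form v u := by
  rw [form_apply, form_apply, dirichletForm, hD.diffInner_comm u.2 v.2]; rfl

theorem form_nonneg (u : testSubmodule I U) : 0 ≤ hD.form u u :=
  integral_nonneg fun x => hD.diffInner_self_nonneg u.2 x

/-- The resolvent `(1 - Δ)⁻¹` of the Friedrichs operator. -/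
noncomputable def resolvent : Lp ℝ 2 μ →L[ℝ] Lp ℝ 2 μ :=
  (exists_isFormResolvent hD.toLp hD.form hD.form_comm hD.form_nonneg).choose

theorem isFormResolvent : IsFormResolvent hD.toLp hD.form hD.resolvent :=
  (exists_isFormResolvent hD.toLp hD.form hD.form_comm hD.form_nonneg).choose_spec

theorem inner_toLp (h : Lp ℝ 2 μ) (v : testSubmodule I U) :
    ⟪h, hD.toLp v⟫ = ∫ x, h x * v.1 x ∂μ := by
  rw [L2.inner_def]
  refine integral_congr_ae ?_
  filter_upwards [(hD.memLp v.1 v.2).coeFn_toLp] with x hx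
  change inner ℝ (h x) ((hD.memLp v.1 v.2).toLp v.1 x) = _
  rw [hx]; simp [mul_comm]

/-- Translation into form language: the clauses of `FriedrichsGraph` are those of
`IsFormResolvent.graph_iff`, with `L²` seminorm convergence read as convergence in `Lp`. -/
theorem friedrichsGraph_iff (f h : Lp ℝ 2 μ) :
    FriedrichsGraph I U g μ f h ↔ hD.resolvent (f + h) = f := by
  rw [← hD.isFormResolvent.graph_iff hD.form_comm hD.form_nonneg]
  have hconv : ∀ u : ℕ → testSubmodule I U,
      Tendsto (fun n => hD.toLp (u n)) atTop (𝓝 f) ↔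
        Tendsto (fun n => eLpNorm (fun x => (u n).1 x - f x) 2 μ) atTop (𝓝 0) := fun u => by
    have h1 := Lp.tendsto_Lp_iff_tendsto_eLpNorm'' (fi := atTop) (p := 2) (μ := μ)
      (fun n => (u n).1) (fun n => hD.memLp _ (u n).2) f (Lp.memLp f)
    rw [Lp.toLp_coeFn] at h1
    exact h1
  constructor
  · rintro ⟨u, hu, h1, h2, h3⟩
    refine ⟨fun n => ⟨u n, hu n⟩, (hconv _).2 h1, h2, fun v => ?_⟩
    rw [inner_toLp]
    exact h3 v.1 v.2
  · rintro ⟨u, h1, h2, h3⟩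
    refine ⟨fun n => (u n).1, fun n => (u n).2, (hconv u).1 h1, h2, fun v hv => ?_⟩
    have := h3 ⟨v, hv⟩
    rw [inner_toLp] at this
    exact this

theorem mem_friedrichsSpectrum_iff (t : ℝ) : t ∈ friedrichsSpectrum I U g μ ↔
    ¬ Function.Bijective fun f => f - (t + 1) • hD.resolvent f := by
  rw [← resolvent_equation_iff_bijective, friedrichsSpectrum, mem_ofPred_eq]
  simp only [hD.friedrichsGraph_iff]

theorem isFriedrichsEigenvalue_iff (t : ℝ) : IsFriedrichsEigenvalue I U g μ t ↔
    ∃ f : Lp ℝ 2 μ, f ≠ 0 ∧ (1 + t) • hD.resolvent f = f := by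
  simp only [IsFriedrichsEigenvalue, hD.friedrichsGraph_iff, map_add, map_smul, add_smul, one_smul]

theorem norm_resolvent_sq_le (x : Lp ℝ 2 μ) :
    ‖hD.resolvent x‖ ^ 2 ≤ ⟪hD.resolvent x, x⟫ :=
  hD.isFormResolvent.norm_sq_le hD.form_nonneg x

/-- A first nonzero eigenvalue is positive and gives a spectral gap. -/
theorem gap_of_isFirstNonzeroEigenvalue {lam : ℝ} (h : IsFirstNonzeroEigenvalue I U g μ lam) :
    0 < lam ∧ (∃ f : Lp ℝ 2 μ, f ≠ 0 ∧ (1 + lam) • hD.resolvent f = f) ∧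
    ∀ v : testSubmodule I U, lam * ‖hD.toLp v -
      (fixedSpace hD.resolvent).starProjection (hD.toLp v)‖ ^ 2 ≤ dirichletForm I g μ v.1 v.1 := by
  obtain ⟨h1, h2⟩ := h
  obtain ⟨f, hf0, hf⟩ := (hD.isFriedrichsEigenvalue_iff lam).1 h1
  -- Zero is excluded by the definition. `lam ≥ 0` because `‖R f‖² ≤ ⟪R f, f⟫` forces `0 ≤ R ≤ 1`,
  -- while `(1 + lam) R f = f` with `f ≠ 0`.
  have hlam : 0 < lam := by
    refine lt_of_le_of_ne ?_ fun h => h2.1.2 h.symm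
    have h3 := hD.norm_resolvent_sq_le f
    have h4 := real_inner_le_norm (hD.resolvent f) f
    have h5 : 0 < ‖f‖ := norm_pos_iff.2 hf0
    have h6 : ‖f‖ = |1 + lam| * ‖hD.resolvent f‖ := by
      conv_lhs => rw [← hf]
      rw [norm_smul, Real.norm_eq_abs]
    have h7 : 0 < ‖hD.resolvent f‖ := by
      by_contra! h
      have : ‖hD.resolvent f‖ = 0 := le_antisymm h (norm_nonneg _)
      rw [this, mul_zero] at h6; exact h5.ne' h6
    have h8 : ‖f‖ ^ 2 = (1 + lam) * ⟪hD.resolvent f, f⟫ := by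
      rw [← real_inner_self_eq_norm_sq]
      conv_lhs => rw [← hf, inner_smul_left, hf]
      simp
    have h9 : 0 < ⟪hD.resolvent f, f⟫ := lt_of_lt_of_le (by positivity) h3
    have h10 : ‖hD.resolvent f‖ ≤ ‖f‖ := by nlinarith
    have h11 : ⟪hD.resolvent f, f⟫ ≤ ‖f‖ ^ 2 := by nlinarith
    nlinarith
  refine ⟨hlam, ⟨f, hf0, hf⟩, fun v => ?_⟩
  refine hD.isFormResolvent.form_ge_of_gap hD.form_nonneg hlam (fun t ht => ?_) v
  by_contra hb
  have h3 := h2.2 ⟨(hD.mem_friedrichsSpectrum_iff t).2 hb, ht.1.ne'⟩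
  exact absurd h3 (not_le.2 ht.2)

/-- A criterion for the first nonzero eigenvalue. -/
theorem isFirstNonzeroEigenvalue_of {Lam : ℝ} (hLam : 0 < Lam) (W : Submodule ℝ (Lp ℝ 2 μ))
    [CompleteSpace W] (hW : ∀ x ∈ W, hD.resolvent x = x)
    (hgap : ∀ x ∈ Wᗮ, (1 + Lam) * ⟪hD.resolvent x, x⟫ ≤ ‖x‖ ^ 2)
    {f : Lp ℝ 2 μ} (hf0 : f ≠ 0) (hf : (1 + Lam) • hD.resolvent f = f) :
    IsFirstNonzeroEigenvalue I U g μ Lam := by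
  refine ⟨(hD.isFriedrichsEigenvalue_iff Lam).2 ⟨f, hf0, hf⟩, ⟨?_, hLam.ne'⟩, fun t ht => ?_⟩
  · rw [hD.mem_friedrichsSpectrum_iff]
    intro hb
    refine hf0 (hb.1 ?_)
    simp only [map_zero, smul_zero, sub_zero]
    rw [add_comm Lam, hf, sub_self]
  · by_contra! hlt
    refine (hD.mem_friedrichsSpectrum_iff t).1 ht.1 ?_
    exact bijective_of_gap hD.isFormResolvent.symm
      (fun x => (sq_nonneg _).trans (hD.norm_resolvent_sq_le x)) W hW hgap hlt ht.2 hLam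

end IsDirichletSpace

end FriedrichsForm

/-! ### The regular set of a stratified space -/

namespace StratSpace

variable {n : ℕ} (X : StratSpace.{u} n)

theorem isOpenEmbedding_val : Topology.IsOpenEmbedding (fun z : X.Reg => z.1) :=
  X.isOpen_reg.isOpenEmbedding_subtypeVal

instance : T2Space X.Reg := inferInstanceAs (T2Space {x : X.carrier // X.sdim x = n})

instance : SecondCountableTopology X.Reg :=
  TopologicalSpace.Subtype.secondCountableTopology {x | X.sdim x = n}

instance : LocallyCompactSpace X.Reg := ChartedSpace.locallyCompactSpace (Euc n) X.Reg

theorem isInnerForm_g (z : X.Reg) : IsInnerForm (X.g z) where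
  add_left u v w := ContinuousLinearMap.map_add₂
    (X.metric.inner (show {x : X.carrier // X.sdim x = n} from z)) u v w
  smul_left c u v := ContinuousLinearMap.map_smul₂
    (X.metric.inner (show {x : X.carrier // X.sdim x = n} from z)) c u v
  symm u v := X.metric.symm _ u v
  pos v hv := X.metric.pos _ v hv

/-- The matrix of the metric in a chart. -/
noncomputable def gram (e : OpenPartialHomeomorph X.Reg (Euc n)) (p : Euc n) :
    Matrix (Fin n) (Fin n) ℝ :=
  Matrix.of fun i j => X.g (e.symm p)
    (mfderiv 𝓘(ℝ, Euc n) 𝓘(ℝ, Euc n) e.symm p (EuclideanSpace.single i 1))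
    (mfderiv 𝓘(ℝ, Euc n) 𝓘(ℝ, Euc n) e.symm p (EuclideanSpace.single j 1))

theorem regVol_chart {e : OpenPartialHomeomorph X.Reg (Euc n)}
    (he : e ∈ IsManifold.maximalAtlas 𝓘(ℝ, Euc n) ∞ X.Reg) {A : Set X.Reg} (hA : MeasurableSet A)
    (hAe : A ⊆ e.source) :
    X.regVol A = ∫⁻ p in e '' A, ENNReal.ofReal (Real.sqrt (X.gram e p).det) :=
  X.vol_chart e he A hA hAe

variable {X}

theorem mdifferentiable_of_mem_maximalAtlas {e : OpenPartialHomeomorph X.Reg (Euc n)}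
    (he : e ∈ IsManifold.maximalAtlas 𝓘(ℝ, Euc n) ∞ X.Reg) :
    e.MDifferentiable 𝓘(ℝ, Euc n) 𝓘(ℝ, Euc n) :=
  ⟨(contMDiffOn_of_mem_maximalAtlas he).mdifferentiableOn (by simp),
    (contMDiffOn_symm_of_mem_maximalAtlas he).mdifferentiableOn (by simp)⟩

/-- The coordinate frame of a chart. -/
noncomputable def frame (e : OpenPartialHomeomorph X.Reg (Euc n)) (p : Euc n) :
    (Fin n → ℝ) →ₗ[ℝ] TangentSpace 𝓘(ℝ, Euc n) (e.symm p) :=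
  (mfderiv 𝓘(ℝ, Euc n) 𝓘(ℝ, Euc n) e.symm p).toLinearMap ∘ₗ
    (WithLp.linearEquiv 2 ℝ (Fin n → ℝ)).symm.toLinearMap

theorem frame_bijective {e : OpenPartialHomeomorph X.Reg (Euc n)}
    (he : e ∈ IsManifold.maximalAtlas 𝓘(ℝ, Euc n) ∞ X.Reg) {p : Euc n} (hp : p ∈ e.target) :
    Function.Bijective (frame e p) :=
  ((mdifferentiable_of_mem_maximalAtlas he).symm.mfderiv_bijective hp).comp
    (WithLp.linearEquiv 2 ℝ (Fin n → ℝ)).symm.bijective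

/-- The coordinate vector fields are read as sections of the tangent bundle through the tangent map
of the inverse chart; this is the form in which continuity of the bundle metric can be applied. -/
theorem continuousOn_frame {e : OpenPartialHomeomorph X.Reg (Euc n)}
    (he : e ∈ IsManifold.maximalAtlas 𝓘(ℝ, Euc n) ∞ X.Reg) (v : Euc n) :
    ContinuousOn (fun p => Bundle.TotalSpace.mk' (Euc n)
      (E := fun x : X.Reg => TangentSpace 𝓘(ℝ, Euc n) x) (e.symm p)
      (mfderiv 𝓘(ℝ, Euc n) 𝓘(ℝ, Euc n) e.symm p v)) e.target := by
  have h1 := (contMDiffOn_symm_of_mem_maximalAtlas he).continuousOn_tangentMapWithin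
    (by simp) e.open_target.uniqueMDiffOn
  have h2 : Continuous fun p : Euc n =>
      (tangentBundleModelSpaceHomeomorph 𝓘(ℝ, Euc n)).symm (p, v) :=
    (Homeomorph.continuous _).comp (Continuous.prodMk continuous_id continuous_const)
  refine (h1.comp h2.continuousOn fun p hp => hp).congr fun p hp => ?_
  have h3 : mfderivWithin 𝓘(ℝ, Euc n) 𝓘(ℝ, Euc n) e.symm e.target p =
    mfderiv 𝓘(ℝ, Euc n) 𝓘(ℝ, Euc n) e.symm p := mfderivWithin_of_mem_nhds (e.open_target.mem_nhds hp)
  change _ = (⟨e.symm p, mfderivWithin 𝓘(ℝ, Euc n) 𝓘(ℝ, Euc n) e.symm e.target p v⟩ :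
    Bundle.TotalSpace (Euc n) fun x : X.Reg => TangentSpace 𝓘(ℝ, Euc n) x)
  rw [h3]

theorem continuousOn_gram {e : OpenPartialHomeomorph X.Reg (Euc n)}
    (he : e ∈ IsManifold.maximalAtlas 𝓘(ℝ, Euc n) ∞ X.Reg) : ContinuousOn (X.gram e) e.target := by
  refine continuousOn_pi.2 fun i => continuousOn_pi.2 fun j => ?_
  have hm : Continuous fun b : X.Reg => Bundle.TotalSpace.mk' (Euc n →L[ℝ] Euc n →L[ℝ] ℝ)
      (E := fun x : X.Reg => (TangentSpace 𝓘(ℝ, Euc n) x →L[ℝ] TangentSpace 𝓘(ℝ, Euc n) x →L[ℝ]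
        Bundle.Trivial X.Reg ℝ x)) b (X.metric.inner b) := X.metric.continuous
  have h1 := (hm.comp_continuousOn e.symm.continuousOn).clm_bundle_apply₂ (F₁ := Euc n)
    (F₂ := Euc n) (F₃ := ℝ)
    (continuousOn_frame he (EuclideanSpace.single i 1))
    (continuousOn_frame he (EuclideanSpace.single j 1))
  have h2 := (Bundle.Trivial.homeomorphProd X.Reg ℝ).continuous.comp_continuousOn h1
  exact continuous_snd.comp_continuousOn h2

theorem gram_det_pos {e : OpenPartialHomeomorph X.Reg (Euc n)}
    (he : e ∈ IsManifold.maximalAtlas 𝓘(ℝ, Euc n) ∞ X.Reg) {p : Euc n} (hp : p ∈ e.target) :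
    0 < (X.gram e p).det :=
  ((X.isInnerForm_g (e.symm p)).apply_dualVector_frame (frame e p) (frame_bijective he hp) 0 0).1

/-- The coordinate formula `∂u · G⁻¹ ∂v`. It replaces the choice hidden in `dualVector` by an
expression whose continuity is visible. -/
theorem diffInner_symm_chart {e : OpenPartialHomeomorph X.Reg (Euc n)}
    (he : e ∈ IsManifold.maximalAtlas 𝓘(ℝ, Euc n) ∞ X.Reg) {p : Euc n} (hp : p ∈ e.target)
    {u v : X.Reg → ℝ} (hu : MDifferentiableAt 𝓘(ℝ, Euc n) 𝓘(ℝ, ℝ) u (e.symm p))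
    (hv : MDifferentiableAt 𝓘(ℝ, Euc n) 𝓘(ℝ, ℝ) v (e.symm p)) :
    diffInner 𝓘(ℝ, Euc n) X.g u v (e.symm p) =
      (fun i => fderiv ℝ (u ∘ e.symm) p (EuclideanSpace.single i 1)) ⬝ᵥ (X.gram e p)⁻¹.mulVec
        fun i => fderiv ℝ (v ∘ e.symm) p (EuclideanSpace.single i 1) := by
  have hd := (mdifferentiable_of_mem_maximalAtlas he).mdifferentiableAt_symm hp
  have h1 : ∀ {w : X.Reg → ℝ}, MDifferentiableAt 𝓘(ℝ, Euc n) 𝓘(ℝ, ℝ) w (e.symm p) →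
      ∀ a : Euc n, fderiv ℝ (w ∘ e.symm) p a = mfderiv 𝓘(ℝ, Euc n) 𝓘(ℝ, ℝ) w (e.symm p)
        (mfderiv 𝓘(ℝ, Euc n) 𝓘(ℝ, Euc n) e.symm p a) := fun hw a => by
    rw [← mfderiv_eq_fderiv, mfderiv_comp p hw hd]; rfl
  simp only [h1 hu, h1 hv]
  exact ((X.isInnerForm_g (e.symm p)).apply_dualVector_frame (frame e p) (frame_bijective he hp)
    (mfderiv 𝓘(ℝ, Euc n) 𝓘(ℝ, ℝ) u (e.symm p)).toLinearMap
    (mfderiv 𝓘(ℝ, Euc n) 𝓘(ℝ, ℝ) v (e.symm p)).toLinearMap).2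

/-! ### Continuity of the differentials of slices of functions on `ℝᵏ × X^reg`. -/

section Slices

variable {k : ℕ}

theorem contDiffOn_comp_symm_chart {e : OpenPartialHomeomorph X.Reg (Euc n)}
    (he : e ∈ IsManifold.maximalAtlas 𝓘(ℝ, Euc n) ∞ X.Reg) {u : Euc k × X.Reg → ℝ}
    (hu : ContMDiff (𝓘(ℝ, Euc k).prod 𝓘(ℝ, Euc n)) 𝓘(ℝ, ℝ) 1 u) :
    ContDiffOn ℝ 1 (fun q : Euc k × Euc n => u (q.1, e.symm q.2)) (univ ×ˢ e.target) := by
  rw [← contMDiffOn_iff_contDiffOn]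
  have hI : 𝓘(ℝ, Euc k × Euc n) = 𝓘(ℝ, Euc k).prod 𝓘(ℝ, Euc n) := modelWithCornersSelf_prod
  suffices h : ContMDiffOn (𝓘(ℝ, Euc k).prod 𝓘(ℝ, Euc n)) 𝓘(ℝ, ℝ) 1
      (fun q : Euc k × Euc n => u (q.1, e.symm q.2)) (univ ×ˢ e.target) by
    convert! h using 1
    exact chartedSpaceSelf_prod.symm
  refine hu.comp_contMDiffOn (ContMDiffOn.prodMk contMDiffOn_fst ?_)
  exact ((contMDiffOn_symm_of_mem_maximalAtlas he).of_le (by simp)).comp contMDiffOn_snd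
    fun q hq => hq.2

theorem fderiv_slice_left {P : Euc k × Euc n → ℝ} {q : Euc k × Euc n}
    (hP : DifferentiableAt ℝ P q) (a : Euc k) :
    fderiv ℝ (fun y => P (y, q.2)) q.1 a = fderiv ℝ P q (a, 0) := by
  have h1 : HasFDerivAt (fun y : Euc k => (y, q.2)) (ContinuousLinearMap.inl ℝ (Euc k) (Euc n))
    q.1 := hasFDerivAt_prodMk_left _ _
  exact congrArg (fun L => L a) (HasFDerivAt.comp (g := P) q.1 hP.hasFDerivAt h1).fderiv

theorem fderiv_slice_right {P : Euc k × Euc n → ℝ} {q : Euc k × Euc n}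
    (hP : DifferentiableAt ℝ P q) (a : Euc n) :
    fderiv ℝ (fun y => P (q.1, y)) q.2 a = fderiv ℝ P q (0, a) := by
  have h1 : HasFDerivAt (fun y : Euc n => (q.1, y)) (ContinuousLinearMap.inr ℝ (Euc k) (Euc n))
    q.2 := hasFDerivAt_prodMk_right _ _
  exact congrArg (fun L => L a) (HasFDerivAt.comp (g := P) q.2 hP.hasFDerivAt h1).fderiv

theorem contMDiff_slice_left {u : Euc k × X.Reg → ℝ}
    (hu : ContMDiff (𝓘(ℝ, Euc k).prod 𝓘(ℝ, Euc n)) 𝓘(ℝ, ℝ) 1 u) (z : X.Reg) :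
    ContDiff ℝ 1 fun y => u (y, z) := by
  rw [← contMDiff_iff_contDiff]
  exact hu.comp (contMDiff_id.prodMk contMDiff_const)

theorem contMDiff_slice_right {u : Euc k × X.Reg → ℝ}
    (hu : ContMDiff (𝓘(ℝ, Euc k).prod 𝓘(ℝ, Euc n)) 𝓘(ℝ, ℝ) 1 u) (y : Euc k) :
    ContMDiff 𝓘(ℝ, Euc n) 𝓘(ℝ, ℝ) 1 fun z => u (y, z) :=
  hu.comp (contMDiff_const.prodMk contMDiff_id)

theorem continuous_fderiv_slice {u : Euc k × X.Reg → ℝ}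
    (hu : ContMDiff (𝓘(ℝ, Euc k).prod 𝓘(ℝ, Euc n)) 𝓘(ℝ, ℝ) 1 u) (a : Euc k) :
    Continuous fun q : Euc k × X.Reg => fderiv ℝ (fun y => u (y, q.2)) q.1 a := by
  refine continuous_iff_continuousAt.2 fun q₀ => ?_
  set e := chartAt (Euc n) q₀.2
  have he : e ∈ IsManifold.maximalAtlas 𝓘(ℝ, Euc n) ∞ X.Reg := IsManifold.chart_mem_maximalAtlas q₀.2
  have hP := contDiffOn_comp_symm_chart he hu
  have ho : IsOpen ((univ : Set (Euc k)) ×ˢ e.target) := isOpen_univ.prod e.open_target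
  have hq₀ : q₀.2 ∈ e.source := mem_chart_source _ _
  have h1 : ContinuousOn (fun q : Euc k × Euc n =>
      fderiv ℝ (fun q : Euc k × Euc n => u (q.1, e.symm q.2)) q (a, 0)) (univ ×ˢ e.target) :=
    (hP.continuousOn_fderiv_of_isOpen ho le_rfl).clm_apply continuousOn_const
  have h2 : ContinuousAt (fun q : Euc k × X.Reg => (q.1, e q.2)) q₀ :=
    continuousAt_fst.prodMk ((e.continuousAt hq₀).comp continuousAt_snd)
  have h3 := ContinuousAt.comp (f := fun q : Euc k × X.Reg => (q.1, e q.2))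
    (h1.continuousAt (ho.mem_nhds ⟨trivial, e.map_source hq₀⟩)) h2
  refine h3.congr ?_
  filter_upwards [continuousAt_snd.preimage_mem_nhds (e.open_source.mem_nhds hq₀)] with q hq
  have h4 := fderiv_slice_left (q := (q.1, e q.2))
    ((hP.differentiableOn one_ne_zero).differentiableAt
    (ho.mem_nhds ⟨trivial, e.map_source hq⟩)) a
  simp only [Function.comp]
  rw [← h4]
  simp only [e.left_inv hq]

theorem continuous_diffInner_slice {u v : Euc k × X.Reg → ℝ}
    (hu : ContMDiff (𝓘(ℝ, Euc k).prod 𝓘(ℝ, Euc n)) 𝓘(ℝ, ℝ) 1 u)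
    (hv : ContMDiff (𝓘(ℝ, Euc k).prod 𝓘(ℝ, Euc n)) 𝓘(ℝ, ℝ) 1 v) :
    Continuous fun q : Euc k × X.Reg =>
      diffInner 𝓘(ℝ, Euc n) X.g (fun z => u (q.1, z)) (fun z => v (q.1, z)) q.2 := by
  refine continuous_iff_continuousAt.2 fun q₀ => ?_
  set e := chartAt (Euc n) q₀.2
  have he : e ∈ IsManifold.maximalAtlas 𝓘(ℝ, Euc n) ∞ X.Reg := IsManifold.chart_mem_maximalAtlas q₀.2
  have ho : IsOpen ((univ : Set (Euc k)) ×ˢ e.target) := isOpen_univ.prod e.open_target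
  have hq₀ : q₀.2 ∈ e.source := mem_chart_source _ _
  have h1 : ∀ {w : Euc k × X.Reg → ℝ}, ContMDiff (𝓘(ℝ, Euc k).prod 𝓘(ℝ, Euc n)) 𝓘(ℝ, ℝ) 1 w →
      ContinuousOn (fun q : Euc k × Euc n => fun i : Fin n =>
      fderiv ℝ (fun q : Euc k × Euc n => w (q.1, e.symm q.2)) q (0, EuclideanSpace.single i 1))
      (univ ×ˢ e.target) := fun hw => continuousOn_pi.2 fun i =>
    ((contDiffOn_comp_symm_chart he hw).continuousOn_fderiv_of_isOpen ho le_rfl).clm_apply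
      continuousOn_const
  have hG : ContinuousOn (fun q : Euc k × Euc n => (X.gram e q.2)⁻¹) (univ ×ˢ e.target) := by
    have h2 : ContinuousOn (fun q : Euc k × Euc n => X.gram e q.2) (univ ×ˢ e.target) :=
      (continuousOn_gram he).comp continuousOn_snd fun q hq => hq.2
    simp only [Matrix.inv_def, Ring.inverse_eq_inv']
    refine ContinuousOn.smul (ContinuousOn.inv₀ ?_ fun q hq => (gram_det_pos he hq.2).ne') ?_
    · exact (continuous_id.matrix_det).comp_continuousOn h2
    · exact (continuous_id.matrix_adjugate).comp_continuousOn h2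
  have h2 : ContinuousAt (fun q : Euc k × X.Reg => (q.1, e q.2)) q₀ :=
    continuousAt_fst.prodMk ((e.continuousAt hq₀).comp continuousAt_snd)
  have h5 : ContinuousOn (fun q : Euc k × Euc n => (fun i : Fin n =>
      fderiv ℝ (fun q : Euc k × Euc n => u (q.1, e.symm q.2)) q (0, EuclideanSpace.single i 1))
      ⬝ᵥ (X.gram e q.2)⁻¹.mulVec (fun i : Fin n =>
      fderiv ℝ (fun q : Euc k × Euc n => v (q.1, e.symm q.2)) q (0, EuclideanSpace.single i 1)))
      (univ ×ˢ e.target) := by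
    simp only [dotProduct, Matrix.mulVec]
    refine continuousOn_finsetSum _ fun i _ => (continuousOn_pi.1 (h1 hu) i).mul ?_
    refine continuousOn_finsetSum _ fun j _ => ContinuousOn.mul ?_ (continuousOn_pi.1 (h1 hv) j)
    exact (continuous_apply_apply i j).comp_continuousOn hG
  have h3 := ContinuousAt.comp (f := fun q : Euc k × X.Reg => (q.1, e q.2))
    (h5.continuousAt (ho.mem_nhds ⟨trivial, e.map_source hq₀⟩)) h2
  refine h3.congr ?_
  filter_upwards [continuousAt_snd.preimage_mem_nhds (e.open_source.mem_nhds hq₀)] with q hq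
  have h4 : ∀ {w : Euc k × X.Reg → ℝ}, ContMDiff (𝓘(ℝ, Euc k).prod 𝓘(ℝ, Euc n)) 𝓘(ℝ, ℝ) 1 w →
    ∀ a, fderiv ℝ ((fun z => w (q.1, z)) ∘ e.symm) (e q.2) a =
      fderiv ℝ (fun q : Euc k × Euc n => w (q.1, e.symm q.2)) (q.1, e q.2) (0, a) := fun hw a =>
    fderiv_slice_right (q := (q.1, e q.2))
      (((contDiffOn_comp_symm_chart he hw).differentiableOn one_ne_zero).differentiableAt
      (ho.mem_nhds ⟨trivial, e.map_source hq⟩)) a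
  have h6 := diffInner_symm_chart he (e.map_source hq)
    (((contMDiff_slice_right hu q.1) _).mdifferentiableAt one_ne_zero)
    (((contMDiff_slice_right hv q.1) _).mdifferentiableAt one_ne_zero)
  simp only [h4 hu, h4 hv, e.left_inv hq] at h6
  exact h6.symm

end Slices

theorem continuous_diffInner {u v : X.Reg → ℝ} (hu : ContMDiff 𝓘(ℝ, Euc n) 𝓘(ℝ, ℝ) 1 u)
    (hv : ContMDiff 𝓘(ℝ, Euc n) 𝓘(ℝ, ℝ) 1 v) :
    Continuous (diffInner 𝓘(ℝ, Euc n) X.g u v) :=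
  (continuous_diffInner_slice (k := 0) (u := fun q => u q.2) (v := fun q => v q.2)
    (hu.comp contMDiff_snd) (hv.comp contMDiff_snd)).comp
    (Continuous.prodMk (continuous_const (y := (0 : Euc 0))) continuous_id)

/-- In a chart the density `√(det G)` is continuous, hence bounded on compact subsets of the target.
-/
instance : IsLocallyFiniteMeasure X.regVol := by
  refine ⟨fun z => ?_⟩
  set e := chartAt (Euc n) z
  have he : e ∈ IsManifold.maximalAtlas 𝓘(ℝ, Euc n) ∞ X.Reg := IsManifold.chart_mem_maximalAtlas z
  have hz : z ∈ e.source := mem_chart_source _ _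
  obtain ⟨K, hK, hzK, hKt⟩ := exists_compact_subset e.open_target (e.map_source hz)
  have hd : ContinuousOn (fun p => Real.sqrt (X.gram e p).det) K :=
    Real.continuous_sqrt.comp_continuousOn
      ((continuous_id.matrix_det).comp_continuousOn ((continuousOn_gram he).mono hKt))
  obtain ⟨B, hB⟩ := hK.bddAbove_image hd
  set A := e.source ∩ e ⁻¹' (interior K)
  have hA : IsOpen A := e.isOpen_inter_preimage isOpen_interior
  refine ⟨A, hA.mem_nhds ⟨hz, hzK⟩, ?_⟩
  rw [X.regVol_chart he hA.measurableSet inter_subset_left]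
  have hsub : e '' A ⊆ K := by
    rintro _ ⟨x, hx, rfl⟩; exact interior_subset hx.2
  calc ∫⁻ p in e '' A, ENNReal.ofReal (Real.sqrt (X.gram e p).det)
      ≤ ∫⁻ p in K, ENNReal.ofReal (Real.sqrt (X.gram e p).det) := lintegral_mono_set hsub
    _ ≤ ∫⁻ p in K, ENNReal.ofReal B := setLIntegral_mono' hK.measurableSet fun p hp =>
        ENNReal.ofReal_le_ofReal (hB ⟨p, hp, rfl⟩)
    _ = ENNReal.ofReal B * volume K := setLIntegral_const _ _
    _ < ⊤ := ENNReal.mul_lt_top ENNReal.ofReal_lt_top hK.measure_lt_top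

variable (X) in
theorem isDirichletSpace : IsDirichletSpace 𝓘(ℝ, Euc n) univ X.g X.regVol where
  isInnerForm z _ := X.isInnerForm_g z
  memLp u hu := hu.contMDiff.continuous.memLp_of_hasCompactSupport hu.hasCompactSupport
  integrable u v hu hv :=
    (continuous_diffInner hu.contMDiff hv.contMDiff).integrable_of_hasCompactSupport
      (hu.hasCompactSupport.mono' fun z hz => by
        by_contra h
        exact hz (diffInner_eq_zero_of_notMem_left h v))

end StratSpace

/-! ### The suspension as a Dirichlet space -/

namespace StratSpace

variable {k m : ℕ} {Z : StratSpace.{u} m}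

instance : SFinite (ballVol k m) := by unfold ballVol; infer_instance

theorem suspVol_eq : suspVol k Z = (ballVol k m).prod Z.regVol := rfl

/-! ### The dual of the suspension metric. -/

section SuspForm

variable {V : Type*} [AddCommGroup V] [Module ℝ V]

/-- The inner product `|dy|² + dr² + r² g` on `ℝᵏ × V`, where `dr = - ⟨y, dy⟩ / r`. -/
noncomputable def suspForm (y : Euc k) (g : V → V → ℝ) (v w : Euc k × V) : ℝ :=
  inner ℝ v.1 w.1 + (-(inner ℝ y v.1) / suspRadius y) * (-(inner ℝ y w.1) / suspRadius y)
    + suspRadius y ^ 2 * g v.2 w.2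

theorem isInnerForm_suspForm {y : Euc k} (hy : y ∈ Metric.ball (0 : Euc k) 1) {g : V → V → ℝ}
    (hg : IsInnerForm g) : IsInnerForm (suspForm y g) where
  add_left u v w := by
    simp only [suspForm, Prod.fst_add, Prod.snd_add, hg.add_left, inner_add_left, inner_add_right]
    ring
  smul_left c u w := by
    simp only [suspForm, Prod.smul_fst, Prod.smul_snd, hg.smul_left, real_inner_smul_left,
      real_inner_smul_right]
    ring
  symm u w := by
    unfold suspForm
    rw [hg.symm u.2, real_inner_comm, mul_comm (-_ / _)]
  pos v hv := by
    have hr : 0 < suspRadius y := suspRadius_pos hy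
    have h1 := hg.nonneg v.2
    have h2 : 0 ≤ inner ℝ v.1 v.1 := real_inner_self_nonneg
    unfold suspForm
    rw [← pow_two]
    by_cases h : v.1 = 0
    · have h3 : v.2 ≠ 0 := fun h3 => hv (Prod.ext h h3)
      have h4 := hg.pos v.2 h3
      have : 0 < suspRadius y ^ 2 * g v.2 v.2 := by positivity
      positivity
    · have h3 : 0 < inner ℝ v.1 v.1 := real_inner_self_pos.2 h
      positivity

theorem sphDual_eq_apply_toDual (y : Euc k) (α β : Euc k →L[ℝ] ℝ) :
    sphDual y α β = α ((InnerProductSpace.toDual ℝ (Euc k)).symm β) - α y * β y := by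
  rw [sphDual, ← sum_apply_single_mul α ((InnerProductSpace.toDual ℝ (Euc k)).symm β)]
  congr 1
  refine Finset.sum_congr rfl fun i _ => ?_
  have h : ⟪(InnerProductSpace.toDual ℝ (Euc k)).symm β, EuclideanSpace.single i 1⟫ =
    β (EuclideanSpace.single i 1) := InnerProductSpace.toDual_symm_apply
  rw [← h, mul_comm, EuclideanSpace.inner_single_right]
  simp

/-- The dual vector is explicit: `(b♯ - b(y) y, r⁻² β♯)`. Indeed `1 + y ⊗ y / r²` has inverse `1 - y
⊗ y` because `r² + |y|² = 1`; this is where `sphDual` comes from. -/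
theorem apply_dualVector_suspForm [FiniteDimensional ℝ V] {y : Euc k}
    (hy : y ∈ Metric.ball (0 : Euc k) 1) {g : V → V → ℝ}
    (hg : IsInnerForm g) {A B : Euc k × V →ₗ[ℝ] ℝ} {a b : Euc k →L[ℝ] ℝ} {α β : V →ₗ[ℝ] ℝ}
    (hA : ∀ w, A w = a w.1 + α w.2) (hB : ∀ w, B w = b w.1 + β w.2) :
    A (dualVector (suspForm y g) fun w => B w) =
      sphDual y a b + (suspRadius y ^ 2)⁻¹ * α (dualVector g fun w => β w) := by
  set bs : Euc k := (InnerProductSpace.toDual ℝ (Euc k)).symm b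
  have hbs : ∀ c : Euc k, inner ℝ bs c = b c := fun c => InnerProductSpace.toDual_symm_apply
  have hr : 0 < suspRadius y := suspRadius_pos hy
  have hr2 : suspRadius y ^ 2 = 1 - ‖y‖ ^ 2 := suspRadius_sq hy
  have key : dualVector (suspForm y g) (fun w => B w) =
      (bs - b y • y, (suspRadius y ^ 2)⁻¹ • dualVector g fun w => β w) := by
    refine (isInnerForm_suspForm hy hg).dualVector_eq fun w => ?_
    have h3 : inner ℝ (bs - b y • y) w.1 = b w.1 - b y * inner ℝ y w.1 := by
      rw [inner_sub_left, hbs, real_inner_smul_left]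
    have h4 : inner ℝ y (bs - b y • y) = b y * suspRadius y ^ 2 := by
      rw [inner_sub_right, real_inner_comm, hbs, real_inner_smul_right, real_inner_self_eq_norm_sq,
        hr2]
      ring
    rw [suspForm, h3, h4, hg.smul_left, hg.dualVector_spec, hB]
    field_simp
    ring
  rw [key, hA, sphDual_eq_apply_toDual, map_sub, map_smul, map_smul, smul_eq_mul, smul_eq_mul,
    mul_comm (b y)]

end SuspForm

theorem isInnerForm_suspMetric {p : Euc k × Z.Reg} (hp : p ∈ suspSet k Z) :
    IsInnerForm (suspMetric k Z p) :=
  isInnerForm_suspForm (V := TangentSpace 𝓘(ℝ, Euc m) p.2) hp.1 (Z.isInnerForm_g p.2)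

theorem diffInner_susp {p : Euc k × Z.Reg} (hp : p ∈ suspSet k Z) {u v : Euc k × Z.Reg → ℝ}
    (hu : MDifferentiableAt (𝓘(ℝ, Euc k).prod 𝓘(ℝ, Euc m)) 𝓘(ℝ, ℝ) u p)
    (hv : MDifferentiableAt (𝓘(ℝ, Euc k).prod 𝓘(ℝ, Euc m)) 𝓘(ℝ, ℝ) v p) :
    diffInner (𝓘(ℝ, Euc k).prod 𝓘(ℝ, Euc m)) (suspMetric k Z) u v p =
      sphDual p.1 (fderiv ℝ (fun y => u (y, p.2)) p.1) (fderiv ℝ (fun y => v (y, p.2)) p.1) +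
      (suspRadius p.1 ^ 2)⁻¹ *
        diffInner 𝓘(ℝ, Euc m) Z.g (fun z => u (p.1, z)) (fun z => v (p.1, z)) p.2 :=
  have h1 : ∀ {w : Euc k × Z.Reg → ℝ},
      MDifferentiableAt (𝓘(ℝ, Euc k).prod 𝓘(ℝ, Euc m)) 𝓘(ℝ, ℝ) w p →
      ∀ a : TangentSpace (𝓘(ℝ, Euc k).prod 𝓘(ℝ, Euc m)) p,
        mfderiv (𝓘(ℝ, Euc k).prod 𝓘(ℝ, Euc m)) 𝓘(ℝ, ℝ) w p a =
        fderiv ℝ (fun y => w (y, p.2)) p.1 a.1 +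
          (show ℝ from mfderiv 𝓘(ℝ, Euc m) 𝓘(ℝ, ℝ) (fun z => w (p.1, z)) p.2 a.2) := fun hw a => by
    rw [mfderiv_prod_eq_add_apply hw, mfderiv_eq_fderiv]; rfl
  apply_dualVector_suspForm (V := TangentSpace 𝓘(ℝ, Euc m) p.2) hp.1 (Z.isInnerForm_g p.2)
    (A := (mfderiv (𝓘(ℝ, Euc k).prod 𝓘(ℝ, Euc m)) 𝓘(ℝ, ℝ) u p).toLinearMap)
    (B := (mfderiv (𝓘(ℝ, Euc k).prod 𝓘(ℝ, Euc m)) 𝓘(ℝ, ℝ) v p).toLinearMap)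
    (α := (mfderiv 𝓘(ℝ, Euc m) 𝓘(ℝ, ℝ) (fun z => u (p.1, z)) p.2).toLinearMap)
    (β := (mfderiv 𝓘(ℝ, Euc m) 𝓘(ℝ, ℝ) (fun z => v (p.1, z)) p.2).toLinearMap)
    (h1 hu) (h1 hv)

variable {u v : Euc k × Z.Reg → ℝ}

theorem continuousOn_diffInner_susp
    (hu : ContMDiff (𝓘(ℝ, Euc k).prod 𝓘(ℝ, Euc m)) 𝓘(ℝ, ℝ) 1 u)
    (hv : ContMDiff (𝓘(ℝ, Euc k).prod 𝓘(ℝ, Euc m)) 𝓘(ℝ, ℝ) 1 v) :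
    ContinuousOn (diffInner (𝓘(ℝ, Euc k).prod 𝓘(ℝ, Euc m)) (suspMetric k Z) u v)
      (suspSet k Z) := by
  have h0 : ∀ {w : Euc k × Z.Reg → ℝ},
      ContMDiff (𝓘(ℝ, Euc k).prod 𝓘(ℝ, Euc m)) 𝓘(ℝ, ℝ) 1 w →
      Continuous fun p : Euc k × Z.Reg => fderiv ℝ (fun y => w (y, p.2)) p.1 p.1 := fun hw => by
    refine Continuous.congr ?_ fun p => sum_apply_single_mul _ p.1
    refine continuous_finsetSum _ fun i _ => ?_
    exact Continuous.mul (by fun_prop) (continuous_fderiv_slice hw _)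
  have h1 : Continuous fun p : Euc k × Z.Reg => sphDual p.1 (fderiv ℝ (fun y => u (y, p.2)) p.1)
      (fderiv ℝ (fun y => v (y, p.2)) p.1) := by
    unfold sphDual
    refine Continuous.sub (continuous_finsetSum _ fun i _ => ?_) ((h0 hu).mul (h0 hv))
    exact (continuous_fderiv_slice hu _).mul (continuous_fderiv_slice hv _)
  have h2 : ContinuousOn (fun p : Euc k × Z.Reg => (suspRadius p.1 ^ 2)⁻¹) (suspSet k Z) :=
    continuousOn_suspRadius_inv.comp continuousOn_fst fun p hp => hp.1
  refine (h1.continuousOn.add (h2.mul (continuous_diffInner_slice hu hv).continuousOn)).congr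
    fun p hp => ?_
  exact diffInner_susp hp ((hu p).mdifferentiableAt one_ne_zero)
    ((hv p).mdifferentiableAt one_ne_zero)

theorem isLocallyFiniteMeasure_suspVol (hm : 1 ≤ m) : IsLocallyFiniteMeasure (suspVol k Z) := by
  haveI := isFiniteMeasure_ballVol (k := k) hm
  rw [suspVol_eq]; infer_instance

theorem integrable_of_continuousOn_suspSet (hm : 1 ≤ m) {K : Set (Euc k × Z.Reg)}
    (hK : IsCompact K) {F : Euc k × Z.Reg → ℝ} (hF : ContinuousOn F K) (h0 : ∀ p ∉ K, F p = 0) :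
    Integrable F (suspVol k Z) := by
  haveI := isLocallyFiniteMeasure_suspVol (k := k) (Z := Z) hm
  rw [← integrableOn_iff_integrable_of_support_subset
    (fun p hp => by by_contra h; exact hp (h0 p h))]
  exact hF.integrableOn_compact hK

theorem isDirichletSpace_susp (hm : 1 ≤ m) :
    IsDirichletSpace (𝓘(ℝ, Euc k).prod 𝓘(ℝ, Euc m)) (suspSet k Z) (suspMetric k Z)
      (suspVol k Z) where
  isInnerForm p hp := isInnerForm_suspMetric hp
  memLp u hu := by
    haveI := isLocallyFiniteMeasure_suspVol (k := k) (Z := Z) hm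
    exact hu.contMDiff.continuous.memLp_of_hasCompactSupport hu.hasCompactSupport
  integrable u v hu hv := integrable_of_continuousOn_suspSet hm hu.hasCompactSupport
    ((continuousOn_diffInner_susp hu.contMDiff hv.contMDiff).mono hu.tsupport_subset)
    fun p hp => diffInner_eq_zero_of_notMem_left hp v

end StratSpace

/-! ### Slices of functions on a product as `L²` valued functions -/

section Slices

variable {k : ℕ} {M : Type*} [TopologicalSpace M] [T2Space M] [MeasurableSpace M] [BorelSpace M]
  {ν : Measure M} [IsLocallyFiniteMeasure ν]

theorem hasCompactSupport_slice {Y : Type*} [TopologicalSpace Y] {F : Type*} [Zero F]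
    {w : Y × M → F} (hc : HasCompactSupport w) (y : Y) : HasCompactSupport fun z => w (y, z) :=
  HasCompactSupport.intro (hc.image continuous_snd) fun z hz => by
    by_contra h
    exact hz ⟨(y, z), subset_tsupport _ h, rfl⟩

variable (ν) in
/-- The slice `w (y, ·)` of a continuous function with compact support. -/
noncomputable def sliceLp {w : Euc k × M → ℝ} (hw : Continuous w) (hc : HasCompactSupport w)
    (y : Euc k) : Lp ℝ 2 ν :=
  ((hw.comp (Continuous.prodMk_right y)).memLp_of_hasCompactSupport
    (hasCompactSupport_slice hc y)).toLp fun z => w (y, z)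

theorem norm_toLp_le_of_support {f : M → ℝ} (hf : MemLp f 2 ν) {s : Set M} (hs : MeasurableSet s)
    (hν : ν s ≠ ⊤) {c : ℝ} (hc : 0 ≤ c) (h : ∀ z, |f z| ≤ c) (hfs : ∀ z ∉ s, f z = 0) :
    ‖hf.toLp f‖ ≤ c * ν.real s ^ (1 / 2 : ℝ) := by
  have h1 := eLpNorm_sub_le_of_dist_bdd ν (p := 2) (by simp) hs hc (f := f) (g := 0)
    (fun z => by simpa using h z) (fun z hz => by by_contra h'; exact hz (hfs z h')) (by simp)
  rw [sub_zero] at h1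
  rw [Lp.norm_toLp]
  refine (ENNReal.toReal_mono ?_ h1).trans_eq ?_
  · exact ENNReal.mul_ne_top ENNReal.ofReal_ne_top (ENNReal.rpow_ne_top_of_nonneg (by simp) hν)
  · rw [ENNReal.toReal_mul, ENNReal.toReal_ofReal hc, ← ENNReal.toReal_rpow, Measure.real]
    simp

theorem inner_toLp_toLp {f g : M → ℝ} (hf : MemLp f 2 ν) (hg : MemLp g 2 ν) :
    ⟪hf.toLp f, hg.toLp g⟫ = ∫ z, f z * g z ∂ν := by
  rw [L2.inner_def]
  refine integral_congr_ae ?_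
  filter_upwards [hf.coeFn_toLp, hg.coeFn_toLp] with z h1 h2
  rw [h1, h2]; simp [mul_comm]

theorem inner_sliceLp {w w' : Euc k × M → ℝ} (hw : Continuous w) (hc : HasCompactSupport w)
    (hw' : Continuous w') (hc' : HasCompactSupport w') (y : Euc k) :
    ⟪sliceLp ν hw hc y, sliceLp ν hw' hc' y⟫ = ∫ z, w (y, z) * w' (y, z) ∂ν :=
  inner_toLp_toLp _ _

theorem eventually_forall_slice {F : Type*} [NormedAddCommGroup F] {w : Euc k × M → F}
    (hw : Continuous w) {s : Set M} (hs : IsCompact s) (y : Euc k) {ε : ℝ} (hε : 0 < ε) :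
    ∀ᶠ y' in 𝓝 y, ∀ z ∈ s, ‖w (y', z) - w (y, z)‖ < ε := by
  refine hs.eventually_forall_of_forall_eventually (P := fun y' z => ‖w (y', z) - w (y, z)‖ < ε)
    fun z _ => ?_
  have h1 : Continuous fun q : Euc k × M => ‖w (q.1, q.2) - w (y, q.2)‖ :=
    ((hw.comp (by fun_prop)).sub (hw.comp (by fun_prop))).norm
  exact h1.continuousAt.eventually_lt continuousAt_const (by simpa using hε)

theorem continuous_sliceLp {w : Euc k × M → ℝ} (hw : Continuous w) (hc : HasCompactSupport w) :
    Continuous (sliceLp ν hw hc) := by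
  set s : Set M := Prod.snd '' tsupport w
  have hs : IsCompact s := hc.image continuous_snd
  have hws : ∀ y, ∀ z ∉ s, w (y, z) = 0 := fun y z hz => by
    by_contra h; exact hz ⟨(y, z), subset_tsupport _ h, rfl⟩
  refine continuous_iff_continuousAt.2 fun y => Metric.tendsto_nhds.2 fun ε hε => ?_
  set B := ν.real s ^ (1 / 2 : ℝ)
  have hB : 0 ≤ B := by positivity
  have hB1 : ε / (B + 1) * B < ε := by
    rw [div_mul_eq_mul_div, div_lt_iff₀ (by positivity)]
    nlinarith
  filter_upwards [eventually_forall_slice hw hs y (ε := ε / (B + 1)) (by positivity)] with y' hy'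
  rw [dist_eq_norm, sliceLp, sliceLp, ← MemLp.toLp_sub]
  refine (norm_toLp_le_of_support _ hs.measurableSet hs.measure_lt_top.ne
    (c := ε / (B + 1)) (by positivity) (fun z => ?_) fun z hz => ?_).trans_lt hB1
  · by_cases hz : z ∈ s
    · exact (hy' z hz).le
    · simp only [Pi.sub_apply, hws _ z hz, sub_zero, abs_zero]; positivity
  · simp [hws _ z hz]

/-- All slices live on one compact set `s` of finite measure, on which `D` is continuous in `y`
uniformly in `z`. The mean value inequality bounds the remainder pointwise by a multiple of `‖h‖`,
and the `L²` norm costs the factor `B = ν(s) ^ (1/2)`, which explains `ε / (B + 1)`. -/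
theorem hasFDerivAt_sliceLp {w : Euc k × M → ℝ} (hw : Continuous w) (hc : HasCompactSupport w)
    {D : Euc k × M → Euc k →L[ℝ] ℝ} (hD : Continuous D)
    (hd : ∀ y z, HasFDerivAt (fun y => w (y, z)) (D (y, z)) y)
    {D' : Fin k → Euc k × M → ℝ} (hD' : ∀ i, Continuous (D' i))
    (hcD' : ∀ i, HasCompactSupport (D' i)) (hDD' : ∀ i p, D p (EuclideanSpace.single i 1) = D' i p)
    (y : Euc k) :
    HasFDerivAt (sliceLp ν hw hc) (∑ i, (EuclideanSpace.proj i : Euc k →L[ℝ] ℝ).smulRight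
      (sliceLp ν (hD' i) (hcD' i) y)) y := by
  set s : Set M := Prod.snd '' tsupport w
  have hs : IsCompact s := hc.image continuous_snd
  have hws : ∀ y, ∀ z ∉ s, w (y, z) = 0 := fun y z hz => by
    by_contra h; exact hz ⟨(y, z), subset_tsupport _ h, rfl⟩
  have hDs : ∀ y, ∀ z ∉ s, D (y, z) = 0 := fun y z hz => by
    have h1 := hd y z
    have h2 : (fun y => w (y, z)) = fun _ => 0 := funext fun y => hws y z hz
    rw [h2] at h1
    exact h1.unique (hasFDerivAt_const _ _)
  rw [hasFDerivAt_iff_isLittleO_nhds_zero, Asymptotics.isLittleO_iff]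
  intro ε hε
  set B := ν.real s ^ (1 / 2 : ℝ)
  have hB : 0 ≤ B := by positivity
  have hB1 : ε / (B + 1) * B ≤ ε := by
    rw [div_mul_eq_mul_div, div_le_iff₀ (by positivity)]
    nlinarith
  obtain ⟨δ, hδ, hball⟩ := Metric.eventually_nhds_iff_ball.1
    (eventually_forall_slice hD hs y (ε := ε / (B + 1)) (by positivity))
  filter_upwards [Metric.ball_mem_nhds (0 : Euc k) hδ] with h hh
  have hmem : MemLp (fun z => D (y, z) h) 2 ν := by
    have : Continuous fun z => D (y, z) h :=
      (hD.comp (Continuous.prodMk_right y)).clm_apply continuous_const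
    refine this.memLp_of_hasCompactSupport (HasCompactSupport.intro hs fun z hz => ?_)
    rw [hDs y z hz]; rfl
  have hsum : (∑ i, (EuclideanSpace.proj i : Euc k →L[ℝ] ℝ).smulRight
      (sliceLp ν (hD' i) (hcD' i) y)) h = hmem.toLp fun z => D (y, z) h := by
    have h1 : (fun z => D (y, z) h) = ∑ i, h i • fun z => D' i (y, z) := by
      funext z
      rw [← sum_apply_single_mul (D (y, z)) h]
      simp [Finset.sum_apply, hDD']
    have hm : ∀ i, MemLp (fun z => D' i (y, z)) 2 ν := fun i =>
      ((hD' i).comp (Continuous.prodMk_right y)).memLp_of_hasCompactSupport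
        (hasCompactSupport_slice (hcD' i) y)
    -- Induction over finsets, as passing to classes in `Lp` is additive only for two summands at a
    -- time.
    have h2 : ∀ (S : Finset (Fin k)) (hS : MemLp (∑ i ∈ S, h i • fun z => D' i (y, z)) 2 ν),
        hS.toLp _ = ∑ i ∈ S, h i • (hm i).toLp _ := fun S => by
      induction S using Finset.induction_on with
      | empty => intro hS; simp only [Finset.sum_empty]; exact MemLp.toLp_zero _
      | insert i S hi ih =>
        intro hS
        have hS' : MemLp (∑ i ∈ S, h i • fun z => D' i (y, z)) 2 ν :=
          memLp_finsetSum' S fun i _ => (hm i).const_smul (h i)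
        rw [Finset.sum_insert hi (f := fun i => h i • (hm i).toLp fun z => D' i (y, z)), ← ih hS',
          ← MemLp.toLp_const_smul, ← MemLp.toLp_add]
        refine MemLp.toLp_congr _ _ (ae_of_all _ fun z => ?_)
        rw [Finset.sum_insert hi]
    simp only [h1]
    rw [h2]
    simp [sum_apply, sliceLp]
  rw [hsum, sliceLp, sliceLp, ← MemLp.toLp_sub, ← MemLp.toLp_sub]
  have hb : ∀ z, |w (y + h, z) - w (y, z) - D (y, z) h| ≤ ε / (B + 1) * ‖h‖ := fun z => by
    by_cases hz : z ∈ s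
    · have h3 := (convex_ball y δ).norm_image_sub_le_of_norm_hasFDerivWithin_le'
        (f := fun y => w (y, z)) (f' := fun y => D (y, z)) (φ := D (y, z)) (C := ε / (B + 1))
        (fun x _ => (hd x z).hasFDerivWithinAt) (fun x hx => (hball x hx z hz).le)
        (Metric.mem_ball_self hδ) (y := y + h) (by simpa using hh)
      simpa using h3
    · rw [hws _ z hz, hws _ z hz, hDs y z hz]
      simp only [sub_zero, zero_apply, abs_zero]; positivity
  refine (norm_toLp_le_of_support _ hs.measurableSet hs.measure_lt_top.ne
    (c := ε / (B + 1) * ‖h‖) (by positivity) hb fun z hz => ?_).trans ?_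
  · simp [hws _ z hz, hDs y z hz]
  · calc ε / (B + 1) * ‖h‖ * B = ε / (B + 1) * B * ‖h‖ := by ring
      _ ≤ ε * ‖h‖ := by gcongr

end Slices

/-- A test function as an element of the space of test functions. -/
def IsTestFunction.toTest {E H M : Type*} [NormedAddCommGroup E] [NormedSpace ℝ E]
    [TopologicalSpace H] {I : ModelWithCorners ℝ E H} [TopologicalSpace M] [ChartedSpace H M]
    {U : Set M} {u : M → ℝ} (hu : IsTestFunction I U u) : testSubmodule I U := ⟨u, hu⟩

/-! ### The Dirichlet form of the suspension through slices -/

namespace StratSpace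

variable {k m : ℕ} {Z : StratSpace.{u} m}

/-- The partial derivatives in the directions of `ℝᵏ`. -/
noncomputable def suspPartial (u : Euc k × Z.Reg → ℝ) (i : Fin k) (p : Euc k × Z.Reg) : ℝ :=
  fderiv ℝ (fun y => u (y, p.2)) p.1 (EuclideanSpace.single i 1)

theorem suspPartial_eq_zero {u : Euc k × Z.Reg → ℝ} {p : Euc k × Z.Reg} (hp : p ∉ tsupport u)
    (i : Fin k) : suspPartial u i p = 0 := by
  have h1 : u =ᶠ[𝓝 p] fun _ => 0 := notMem_tsupport_iff_eventuallyEq.1 hp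
  have h2 : (fun y => u (y, p.2)) =ᶠ[𝓝 p.1] fun _ => 0 :=
    Tendsto.eventually (f := fun y => (y, p.2)) (l₁ := 𝓝 p.1)
      (Continuous.prodMk_left p.2).continuousAt h1
  rw [suspPartial, h2.fderiv_eq]
  simp

/-- Test functions on the suspension. -/
abbrev SuspTest (k : ℕ) (Z : StratSpace.{u} m) (u : Euc k × Z.Reg → ℝ) : Prop :=
  IsTestFunction (𝓘(ℝ, Euc k).prod 𝓘(ℝ, Euc m)) (suspSet k Z) u

namespace SuspTest

variable {u v : Euc k × Z.Reg → ℝ} (hu : SuspTest k Z u) (hv : SuspTest k Z v)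

include hu in
theorem continuous_partial (i : Fin k) : Continuous (suspPartial u i) :=
  continuous_fderiv_slice hu.contMDiff _

include hu in
theorem hasCompactSupport_partial (i : Fin k) : HasCompactSupport (suspPartial u i) :=
  HasCompactSupport.intro hu.hasCompactSupport fun _ hp => suspPartial_eq_zero hp i

include hu in
theorem isTestFunction_slice (y : Euc k) :
    IsTestFunction 𝓘(ℝ, Euc m) univ fun z => u (y, z) where
  contMDiff := contMDiff_slice_right hu.contMDiff y
  hasCompactSupport := hasCompactSupport_slice hu.hasCompactSupport y
  tsupport_subset := subset_univ _

/-- The slices of a test function on the suspension. -/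
noncomputable def slice (y : Euc k) : Lp ℝ 2 Z.regVol :=
  sliceLp Z.regVol hu.contMDiff.continuous hu.hasCompactSupport y

/-- The slices of the partial derivatives of a test function on the suspension. -/
noncomputable def sliceDeriv (i : Fin k) (y : Euc k) : Lp ℝ 2 Z.regVol :=
  sliceLp Z.regVol (hu.continuous_partial i) (hu.hasCompactSupport_partial i) y

theorem slice_eq_toLp (y : Euc k) : hu.slice y =
    Z.isDirichletSpace.toLp (hu.isTestFunction_slice y).toTest := rfl

theorem continuous_slice : Continuous hu.slice :=
  continuous_sliceLp hu.contMDiff.continuous hu.hasCompactSupport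

theorem continuous_sliceDeriv (i : Fin k) : Continuous (hu.sliceDeriv i) :=
  continuous_sliceLp (hu.continuous_partial i) (hu.hasCompactSupport_partial i)

theorem hasFDerivAt_slice (y : Euc k) : HasFDerivAt hu.slice
    (∑ i, (EuclideanSpace.proj i : Euc k →L[ℝ] ℝ).smulRight (hu.sliceDeriv i y)) y := by
  have hd : ∀ p : Euc k × Z.Reg, HasFDerivAt (fun y => u (y, p.2))
      (fderiv ℝ (fun y => u (y, p.2)) p.1) p.1 := fun p =>
    ((contMDiff_slice_left hu.contMDiff p.2).differentiable one_ne_zero _).hasFDerivAt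
  have hsum : ∀ p : Euc k × Z.Reg, fderiv ℝ (fun y => u (y, p.2)) p.1 =
      ∑ i, suspPartial u i p • (EuclideanSpace.proj i : Euc k →L[ℝ] ℝ) := fun p => by
    ext h
    rw [← sum_apply_single_mul]
    simp [sum_apply, suspPartial, mul_comm]
  refine hasFDerivAt_sliceLp (D := fun p => fderiv ℝ (fun y => u (y, p.2)) p.1)
    hu.contMDiff.continuous hu.hasCompactSupport ?_ (fun y z => hd (y, z)) _ _
    (fun i p => rfl) y
  simp_rw [hsum]
  exact continuous_finsetSum _ fun i _ => (hu.continuous_partial i).smul continuous_const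

theorem hasLineDerivAt_slice (i : Fin k) (y : Euc k) :
    HasLineDerivAt ℝ hu.slice (hu.sliceDeriv i y) y (EuclideanSpace.single i 1) := by
  have h := (hu.hasFDerivAt_slice y).hasLineDerivAt (EuclideanSpace.single i 1)
  have h1 : (∑ j, (EuclideanSpace.proj j : Euc k →L[ℝ] ℝ).smulRight (hu.sliceDeriv j y))
      (EuclideanSpace.single i 1) = hu.sliceDeriv i y := by
    rw [sum_apply, Finset.sum_eq_single i]
    · simp
    · intro j _ hj; simp [hj]
    · simp
  rwa [h1] at h

include hu in
theorem exists_compact_ball : ∃ K : Set (Euc k), IsCompact K ∧ K ⊆ Metric.ball 0 1 ∧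
    ∀ y ∉ K, ∀ z, (y, z) ∉ tsupport u :=
  ⟨Prod.fst '' tsupport u, hu.hasCompactSupport.image continuous_fst, by
    rintro _ ⟨p, hp, rfl⟩; exact (hu.tsupport_subset hp).1, fun y hy z h => hy ⟨(y, z), h, rfl⟩⟩

theorem slice_eq_zero {y : Euc k} (hy : ∀ z, (y, z) ∉ tsupport u) : hu.slice y = 0 := by
  have : (fun z => u (y, z)) = 0 := funext fun z => image_eq_zero_of_notMem_tsupport (hy z)
  simp only [slice, sliceLp, this]
  exact MemLp.toLp_zero _

theorem sliceDeriv_eq_zero {y : Euc k} (hy : ∀ z, (y, z) ∉ tsupport u) (i : Fin k) :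
    hu.sliceDeriv i y = 0 := by
  have : (fun z => suspPartial u i (y, z)) = 0 := funext fun z => suspPartial_eq_zero (hy z) i
  simp only [sliceDeriv, sliceLp, this]
  exact MemLp.toLp_zero _

include hu in
theorem dirichletForm_slice_eq_zero {y : Euc k} (hy : ∀ z, (y, z) ∉ tsupport u) :
    dirichletForm 𝓘(ℝ, Euc m) Z.g Z.regVol (fun z => u (y, z)) (fun z => v (y, z)) = 0 := by
  have h1 : (fun z => u (y, z)) = fun _ => 0 :=
    funext fun z => image_eq_zero_of_notMem_tsupport (hy z)
  have h2 : ∀ z, diffInner 𝓘(ℝ, Euc m) Z.g (fun z => u (y, z)) (fun z => v (y, z)) z = 0 :=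
    fun z => diffInner_eq_zero_of_notMem_left (by rw [h1]; simp [tsupport_eq_empty_iff]) _
  simp [dirichletForm, h2]

include hu hv in
theorem continuous_dirichletForm_slice : Continuous fun y =>
    dirichletForm 𝓘(ℝ, Euc m) Z.g Z.regVol (fun z => u (y, z)) (fun z => v (y, z)) := by
  have hs : IsCompact (Prod.snd '' tsupport u) := hu.hasCompactSupport.image continuous_snd
  have h1 := continuous_parametric_integral_of_continuous (μ := Z.regVol)
    (f := fun (y : Euc k) z =>
      diffInner 𝓘(ℝ, Euc m) Z.g (fun z => u (y, z)) (fun z => v (y, z)) z)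
    (continuous_diffInner_slice hu.contMDiff hv.contMDiff) hs
  refine h1.congr fun y => ?_
  refine setIntegral_eq_integral_of_forall_compl_eq_zero fun z hz =>
    diffInner_eq_zero_of_notMem_left (fun h => hz ?_) _
  have h2 : tsupport (fun z => u (y, z)) ⊆ (fun z => (y, z)) ⁻¹' tsupport u :=
    closure_minimal (fun z hz => subset_tsupport _ hz)
      ((isClosed_tsupport u).preimage (Continuous.prodMk_right y))
  exact ⟨(y, z), h2 h, rfl⟩

theorem inner_sum_sliceDeriv (y : Euc k) :
    ∑ i, ⟪hu.sliceDeriv i y, hv.sliceDeriv i y⟫ -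
      ⟪∑ i, y i • hu.sliceDeriv i y, ∑ i, y i • hv.sliceDeriv i y⟫ =
    ∫ z, sphDual y (fderiv ℝ (fun y => u (y, z)) y) (fderiv ℝ (fun y => v (y, z)) y) ∂Z.regVol := by
  have hint : ∀ i j, Integrable (fun z => suspPartial u i (y, z) * suspPartial v j (y, z))
      Z.regVol := fun i j => by
    refine Continuous.integrable_of_hasCompactSupport ?_ ?_
    · exact ((hu.continuous_partial i).comp (Continuous.prodMk_right y)).mul
        ((hv.continuous_partial j).comp (Continuous.prodMk_right y))
    · exact (hasCompactSupport_slice (hu.hasCompactSupport_partial i) y).mul_right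
  have hin : ∀ i j, ⟪hu.sliceDeriv i y, hv.sliceDeriv j y⟫ =
      ∫ z, suspPartial u i (y, z) * suspPartial v j (y, z) ∂Z.regVol := fun i j =>
    inner_sliceLp _ _ _ _ y
  have h1 : ∀ z, sphDual y (fderiv ℝ (fun y => u (y, z)) y) (fderiv ℝ (fun y => v (y, z)) y) =
      ∑ i, suspPartial u i (y, z) * suspPartial v i (y, z) -
      ∑ i, ∑ j, y i * y j * (suspPartial u i (y, z) * suspPartial v j (y, z)) := fun z => by
    rw [sphDual, ← sum_apply_single_mul _ y, ← sum_apply_single_mul (fderiv ℝ (fun y => v (y, z)) y) y,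
      Finset.sum_mul_sum]
    congr 1
    exact Finset.sum_congr rfl fun i _ => Finset.sum_congr rfl fun j _ => by
      rw [suspPartial, suspPartial]; ring
  simp_rw [h1]
  rw [integral_sub (integrable_finsetSum _ fun i _ => hint i i)
    (integrable_finsetSum _ fun i _ => integrable_finsetSum _ fun j _ => (hint i j).const_mul _),
    integral_finsetSum _ fun i _ => hint i i, integral_finsetSum _ fun i _ =>
      integrable_finsetSum _ fun j _ => (hint i j).const_mul _]
  congr 1
  · exact Finset.sum_congr rfl fun i _ => hin i i
  · rw [sum_inner]
    refine Finset.sum_congr rfl fun i _ => ?_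
    rw [inner_sum, integral_finsetSum _ fun j _ => (hint i j).const_mul _]
    refine Finset.sum_congr rfl fun j _ => ?_
    rw [integral_const_mul, real_inner_smul_left, real_inner_smul_right, hin]
    ring

/-- Fubini for `suspVol = ballVol × vol_Z` applied to the pointwise splitting `diffInner_susp`. -/
theorem dirichletForm_susp (hm : 1 ≤ m) :
    dirichletForm (𝓘(ℝ, Euc k).prod 𝓘(ℝ, Euc m)) (suspMetric k Z) (suspVol k Z) u v =
      ∫ y, (∑ i, ⟪hu.sliceDeriv i y, hv.sliceDeriv i y⟫ -
        ⟪∑ i, y i • hu.sliceDeriv i y, ∑ i, y i • hv.sliceDeriv i y⟫ +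
        (suspRadius y ^ 2)⁻¹ * dirichletForm 𝓘(ℝ, Euc m) Z.g Z.regVol (fun z => u (y, z))
          fun z => v (y, z)) ∂(ballVol k m) := by
  refine (integral_prod _ ((isDirichletSpace_susp hm).integrable u v hu hv)).trans ?_
  refine integral_congr_ae ?_
  filter_upwards [ae_mem_ball_ballVol m] with y hy
  rw [hu.inner_sum_sliceDeriv hv, dirichletForm, ← integral_const_mul, ← integral_add]
  · refine integral_congr_ae (ae_of_all _ fun z => ?_)
    exact diffInner_susp (p := (y, z)) ⟨hy, trivial⟩ (hu.mdifferentiableAt _)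
      (hv.mdifferentiableAt _)
  · refine Continuous.integrable_of_hasCompactSupport ?_ (HasCompactSupport.intro
      (hu.hasCompactSupport.image continuous_snd) fun z hz => ?_)
    · have h0 : ∀ {w : Euc k × Z.Reg → ℝ}, SuspTest k Z w →
        Continuous fun z => fderiv ℝ (fun y => w (y, z)) y y := fun hw =>
          (continuous_fderiv_slice hw.contMDiff y).comp (Continuous.prodMk_right y)
      unfold sphDual
      refine Continuous.sub (continuous_finsetSum _ fun i _ => ?_) ((h0 hu).mul (h0 hv))
      exact ((hu.continuous_partial i).comp (Continuous.prodMk_right y)).mul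
        ((hv.continuous_partial i).comp (Continuous.prodMk_right y))
    · have : (fun y => u (y, z)) = fun _ => 0 := funext fun y => by
        by_contra h; exact hz ⟨(y, z), subset_tsupport _ h, rfl⟩
      rw [this]
      simp [sphDual]
  · exact (Z.isDirichletSpace.integrable _ _ (hu.isTestFunction_slice y)
      (hv.isTestFunction_slice y)).const_mul _

theorem norm_sq_toLp (hm : 1 ≤ m) :
    ‖(isDirichletSpace_susp hm).toLp hu.toTest‖ ^ 2 = ∫ y, ‖hu.slice y‖ ^ 2 ∂(ballVol k m) := by
  rw [← real_inner_self_eq_norm_sq]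
  have h1 := (isDirichletSpace_susp (k := k) (Z := Z) hm).memLp u hu
  haveI := isLocallyFiniteMeasure_suspVol (k := k) (Z := Z) hm
  refine (inner_toLp_toLp h1 h1).trans ?_
  rw [suspVol_eq, integral_prod]
  · refine integral_congr_ae (ae_of_all _ fun y => ?_)
    simp only [← real_inner_self_eq_norm_sq]
    exact (inner_sliceLp _ _ _ _ y).symm
  · exact h1.integrable_mul h1

/-- The spectral gap of `Z` gives a lower bound for the Dirichlet form of the suspension. -/
theorem le_dirichletForm_susp (hm : 1 ≤ m) {lam γ : ℝ} (hγ : γ * (γ + m - 1) ≤ lam)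
    (K : Submodule ℝ (Lp ℝ 2 Z.regVol)) [CompleteSpace K]
    (hgap : ∀ v : testSubmodule 𝓘(ℝ, Euc m) univ, lam * ‖Z.isDirichletSpace.toLp v -
      K.starProjection (Z.isDirichletSpace.toLp v)‖ ^ 2 ≤
        dirichletForm 𝓘(ℝ, Euc m) Z.g Z.regVol v.1 v.1) :
    γ * (k + m - 1 + γ) * ∫ y, ‖hu.slice y - K.starProjection (hu.slice y)‖ ^ 2 ∂(ballVol k m) ≤
      dirichletForm (𝓘(ℝ, Euc k).prod 𝓘(ℝ, Euc m)) (suspMetric k Z) (suspVol k Z) u u := by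
  -- `Q` acts on `L²(Z)` only and so commutes with derivatives in `y`: the slices `Q u(y)` have
  -- partial derivatives `Q ∂ᵢu(y)`, and `groundState_le` applies to them.
  set Q : Lp ℝ 2 Z.regVol →L[ℝ] Lp ℝ 2 Z.regVol := ContinuousLinearMap.id ℝ _ - K.starProjection
  have hQ : ∀ x, Q x = x - K.starProjection x := fun x => rfl
  have hpyth : ∀ x, ‖x‖ ^ 2 = ‖K.starProjection x‖ ^ 2 + ‖Q x‖ ^ 2 := fun x => by
    rw [K.norm_sq_eq_add_norm_sq_starProjection x, hQ]
    congr 3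
    exact K.starProjection_orthogonal_val x
  obtain ⟨C, hC, hCb, hC0⟩ := hu.exists_compact_ball
  have hsupp : ∀ y ∉ C, Q (hu.slice y) = 0 := fun y hy => by
    rw [hu.slice_eq_zero (hC0 y hy), map_zero]
  have hcomp : HasCompactSupport fun y => Q (hu.slice y) := HasCompactSupport.intro hC hsupp
  have hts : tsupport (fun y => Q (hu.slice y)) ⊆ Metric.ball 0 1 :=
    (closure_minimal (fun y hy => by by_contra h; exact hy (hsupp y h)) hC.isClosed).trans hCb
  have h1 := groundState_le hm γ (Φ := fun y => Q (hu.slice y))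
    (Φ' := fun i y => Q (hu.sliceDeriv i y)) (Q.continuous.comp hu.continuous_slice)
    (fun i => Q.continuous.comp (hu.continuous_sliceDeriv i)) hcomp hts
    (fun i y => Q.hasFDerivAt.comp_hasDerivAt _ (hu.hasLineDerivAt_slice i y))
  refine h1.trans ?_
  rw [hu.dirichletForm_susp hu hm]
  have hcont : ∀ F : Lp ℝ 2 Z.regVol →L[ℝ] Lp ℝ 2 Z.regVol, Continuous fun y =>
      ∑ i, ‖F (hu.sliceDeriv i y)‖ ^ 2 - ‖∑ i, y i • F (hu.sliceDeriv i y)‖ ^ 2 := fun F => by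
    have := hu.continuous_sliceDeriv
    fun_prop
  refine integral_mono_ae (integrable_ballVol hm hC hCb ?_ fun y hy => ?_)
    (integrable_ballVol hm hC hCb ?_ fun y hy => ?_) ?_
  · refine ((hcont Q).continuousOn).add (continuousOn_const.mul (continuousOn_suspRadius_inv.mul ?_))
    have := hu.continuous_slice
    exact Continuous.continuousOn (by fun_prop)
  · simp [hsupp y hy, hu.sliceDeriv_eq_zero (hC0 y hy)]
  · refine ContinuousOn.add ?_ (continuousOn_suspRadius_inv.mul
      (hu.continuous_dirichletForm_slice hu).continuousOn)
    have h2 := hu.continuous_sliceDeriv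
    exact Continuous.continuousOn (by fun_prop)
  · simp [hu.sliceDeriv_eq_zero (hC0 y hy), hu.dirichletForm_slice_eq_zero (hC0 y hy)]
  · filter_upwards [ae_mem_ball_ballVol m] with y hy
    have hy1 : ‖y‖ ≤ 1 := (mem_ball_zero_iff.1 hy).le
    simp only [real_inner_self_eq_norm_sq]
    refine add_le_add ?_ ?_
    -- By Pythagoras the hemisphere energy splits into its parts along `K` and along `Q`; the former
    -- is nonnegative and is dropped.
    · have h2 := sphForm_nonneg hy1 fun i => K.starProjection (hu.sliceDeriv i y)
      have h3 := hpyth (∑ i, y i • hu.sliceDeriv i y)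
      simp only [map_sum, map_smul] at h3
      have h4 : ∑ i, ‖hu.sliceDeriv i y‖ ^ 2 = ∑ i, ‖K.starProjection (hu.sliceDeriv i y)‖ ^ 2 +
          ∑ i, ‖Q (hu.sliceDeriv i y)‖ ^ 2 := by
        rw [← Finset.sum_add_distrib]; exact Finset.sum_congr rfl fun i _ => hpyth _
      linarith
    · rw [mul_left_comm]
      refine mul_le_mul_of_nonneg_left ?_ (by positivity)
      refine le_trans (mul_le_mul_of_nonneg_right hγ (by positivity)) ?_
      exact hgap (hu.isTestFunction_slice y).toTest

end SuspTest

end StratSpace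

/-! ### Tensor products of `L²` functions -/

section LpTensor

variable {α β : Type*} [MeasurableSpace α] [MeasurableSpace β] {μ : Measure α} {ν : Measure β}
  [SFinite μ] [SFinite ν]

theorem memLp_tensor {f : α → ℝ} {g : β → ℝ} (hf : MemLp f 2 μ) (hg : MemLp g 2 ν) :
    MemLp (fun p : α × β => f p.1 * g p.2) 2 (μ.prod ν) := by
  refine (memLp_two_iff_integrable_sq (hf.1.comp_fst.mul hg.1.comp_snd)).2 ?_
  refine (hf.integrable_sq.mul_prod hg.integrable_sq).congr (ae_of_all _ fun p => ?_)
  exact (mul_pow _ _ 2).symm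

theorem toLp_tensor_congr {f f' : α → ℝ} {g g' : β → ℝ} (hf : MemLp f 2 μ) (hg : MemLp g 2 ν)
    (hf' : MemLp f' 2 μ) (hg' : MemLp g' 2 ν) (h : f =ᵐ[μ] f') (h' : g =ᵐ[ν] g') :
    (memLp_tensor hf hg).toLp _ = (memLp_tensor hf' hg').toLp _ := by
  refine MemLp.toLp_congr _ _ ?_
  filter_upwards [Measure.quasiMeasurePreserving_fst.ae h,
    Measure.quasiMeasurePreserving_snd.ae h'] with p h1 h2
  rw [h1, h2]

/-- The tensor product `(y, z) ↦ φ y * f z`. -/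
noncomputable def lpTensor :
    Lp ℝ 2 μ →ₗ[ℝ] Lp ℝ 2 ν →ₗ[ℝ] Lp ℝ 2 (μ.prod ν) :=
  LinearMap.mk₂ ℝ (fun φ f => (memLp_tensor (Lp.memLp φ) (Lp.memLp f)).toLp _)
    (fun φ φ' f => by
      rw [← MemLp.toLp_add]
      refine MemLp.toLp_congr _ _ ?_
      filter_upwards [Measure.quasiMeasurePreserving_fst.ae (Lp.coeFn_add φ φ')] with p hp
      rw [hp, Pi.add_apply, Pi.add_apply, add_mul])
    (fun c φ f => by
      rw [← MemLp.toLp_const_smul]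
      refine MemLp.toLp_congr _ _ ?_
      filter_upwards [Measure.quasiMeasurePreserving_fst.ae (Lp.coeFn_smul c φ)] with p hp
      rw [hp, Pi.smul_apply, Pi.smul_apply, smul_mul_assoc])
    (fun φ f f' => by
      rw [← MemLp.toLp_add]
      refine MemLp.toLp_congr _ _ ?_
      filter_upwards [Measure.quasiMeasurePreserving_snd.ae (Lp.coeFn_add f f')] with p hp
      rw [hp, Pi.add_apply, Pi.add_apply, mul_add])
    (fun c φ f => by
      rw [← MemLp.toLp_const_smul]
      refine MemLp.toLp_congr _ _ ?_
      filter_upwards [Measure.quasiMeasurePreserving_snd.ae (Lp.coeFn_smul c f)] with p hp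
      rw [hp, Pi.smul_apply, Pi.smul_apply, mul_smul_comm])

theorem lpTensor_toLp {f : α → ℝ} {g : β → ℝ} (hf : MemLp f 2 μ) (hg : MemLp g 2 ν) :
    lpTensor (hf.toLp f) (hg.toLp g) = (memLp_tensor hf hg).toLp _ :=
  toLp_tensor_congr (Lp.memLp _) (Lp.memLp _) hf hg hf.coeFn_toLp hg.coeFn_toLp

theorem coeFn_lpTensor (φ : Lp ℝ 2 μ) (f : Lp ℝ 2 ν) :
    lpTensor φ f =ᵐ[μ.prod ν] fun p => φ p.1 * f p.2 :=
  (memLp_tensor (Lp.memLp φ) (Lp.memLp f)).coeFn_toLp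

theorem inner_lpTensor (φ ψ : Lp ℝ 2 μ) (f g : Lp ℝ 2 ν) :
    ⟪lpTensor φ f, lpTensor ψ g⟫ = ⟪φ, ψ⟫ * ⟪f, g⟫ := by
  rw [L2.inner_def, L2.inner_def, L2.inner_def, ← integral_prod_mul]
  refine integral_congr_ae ?_
  filter_upwards [coeFn_lpTensor φ f, coeFn_lpTensor ψ g] with p h1 h2
  rw [h1, h2]
  simp only [RCLike.inner_apply, conj_trivial]
  ring

theorem norm_lpTensor (φ : Lp ℝ 2 μ) (f : Lp ℝ 2 ν) : ‖lpTensor φ f‖ = ‖φ‖ * ‖f‖ := by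
  have h := inner_lpTensor φ φ f f
  simp only [real_inner_self_eq_norm_sq, ← mul_pow] at h
  exact (sq_eq_sq₀ (by positivity) (by positivity)).1 h

theorem tendsto_lpTensor {φ : ℕ → Lp ℝ 2 μ} {f : ℕ → Lp ℝ 2 ν} {φ₀ : Lp ℝ 2 μ} {f₀ : Lp ℝ 2 ν}
    (hφ : Tendsto φ atTop (𝓝 φ₀)) (hf : Tendsto f atTop (𝓝 f₀)) :
    Tendsto (fun n => lpTensor (φ n) (f n)) atTop (𝓝 (lpTensor φ₀ f₀)) := by
  rw [tendsto_iff_norm_sub_tendsto_zero]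
  have h1 : Tendsto (fun n => ‖φ n - φ₀‖ * ‖f n‖ + ‖φ₀‖ * ‖f n - f₀‖) atTop (𝓝 0) := by
    have := ((tendsto_iff_norm_sub_tendsto_zero.1 hφ).mul hf.norm).add
      ((tendsto_iff_norm_sub_tendsto_zero.1 hf).const_mul ‖φ₀‖)
    simpa using this
  refine squeeze_zero (fun n => norm_nonneg _) (fun n => ?_) h1
  have : lpTensor (φ n) (f n) - lpTensor φ₀ f₀ =
      lpTensor (φ n - φ₀) (f n) + lpTensor φ₀ (f n - f₀) := by
    simp only [map_sub, LinearMap.sub_apply]; abel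
  rw [this, ← norm_lpTensor, ← norm_lpTensor]
  exact norm_add_le _ _

end LpTensor

/-! ### Continuous functions on the ball -/

section BallLp

variable {k m : ℕ}

theorem memLp_ballVol (hm : 1 ≤ m) {φ : Euc k → ℝ} (hφ : Continuous φ) :
    MemLp φ 2 (ballVol k m) := by
  haveI := isFiniteMeasure_ballVol (k := k) hm
  obtain ⟨C, hC⟩ := (isCompact_closedBall (0 : Euc k) 1).exists_bound_of_continuousOn
    hφ.continuousOn
  refine MemLp.of_bound hφ.aestronglyMeasurable C ?_
  filter_upwards [ae_mem_ball_ballVol m] with y hy using hC y (Metric.ball_subset_closedBall hy)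

/-- The class of a continuous function on the unit ball. -/
noncomputable def ballLp (hm : 1 ≤ m) {φ : Euc k → ℝ} (hφ : Continuous φ) :
    Lp ℝ 2 (ballVol k m) :=
  (memLp_ballVol hm hφ).toLp φ

theorem inner_ballLp (hm : 1 ≤ m) {φ ψ : Euc k → ℝ} (hφ : Continuous φ) (hψ : Continuous ψ) :
    ⟪ballLp hm hφ, ballLp hm hψ⟫ = ∫ y, φ y * ψ y ∂(ballVol k m) := by
  haveI := isFiniteMeasure_ballVol (k := k) hm
  exact inner_toLp_toLp _ _

theorem norm_ballLp_le (hm : 1 ≤ m) {φ : Euc k → ℝ} (hφ : Continuous φ) {c : ℝ}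
    (hc : ∀ y ∈ Metric.closedBall (0 : Euc k) 1, |φ y| ≤ c) :
    ‖ballLp hm hφ‖ ^ 2 ≤ c ^ 2 * (ballVol k m).real univ := by
  haveI := isFiniteMeasure_ballVol (k := k) hm
  rw [← real_inner_self_eq_norm_sq, inner_ballLp, mul_comm, ← smul_eq_mul, ← integral_const]
  refine integral_mono_ae ((memLp_ballVol hm hφ).integrable_mul (memLp_ballVol hm hφ))
    (integrable_const _) ?_
  filter_upwards [ae_mem_ball_ballVol m] with y hy
  have := hc y (Metric.ball_subset_closedBall hy)
  rw [← pow_two, ← sq_abs]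
  gcongr

theorem tendsto_ballLp_cutoff (hm : 1 ≤ m) {φ : Euc k → ℝ} (hφ : Continuous φ) {δ : ℕ → ℝ}
    (hδ : ∀ n, 0 < δ n) (hδ0 : Tendsto δ atTop (𝓝 0)) :
    Tendsto (fun n => ballLp hm ((contDiff_ballCutoff (k := k) (δ n)).continuous.mul hφ)) atTop
      (𝓝 (ballLp hm hφ)) := by
  haveI := isFiniteMeasure_ballVol (k := k) hm
  have hc : ∀ n, Continuous fun y : Euc k => ballCutoff (δ n) y * φ y - φ y := fun n =>
    ((contDiff_ballCutoff (k := k) (δ n)).continuous.mul hφ).sub hφ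
  have h0 : ∀ n, ballLp hm ((contDiff_ballCutoff (k := k) (δ n)).continuous.mul hφ) - ballLp hm hφ
      = ballLp hm (hc n) := fun n => (MemLp.toLp_sub _ _).symm
  rw [tendsto_iff_norm_sub_tendsto_zero]
  suffices h : Tendsto (fun n => ‖ballLp hm (hc n)‖ ^ 2) atTop (𝓝 0) by
    have h1 := h.sqrt
    simp only [Real.sqrt_sq (norm_nonneg _), Real.sqrt_zero] at h1
    simpa only [h0] using h1
  obtain ⟨C, hC⟩ := (isCompact_closedBall (0 : Euc k) 1).exists_bound_of_continuousOn
    hφ.continuousOn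
  have h2 := tendsto_integral_of_dominated_convergence (μ := ballVol k m)
    (F := fun n y => (ballCutoff (δ n) y * φ y - φ y) * (ballCutoff (δ n) y * φ y - φ y))
    (f := fun _ => 0) (fun _ => C ^ 2) (fun n => ((hc n).mul (hc n)).aestronglyMeasurable)
    (integrable_const _) (fun n => ?_) ?_
  · simp only [← real_inner_self_eq_norm_sq, inner_ballLp]
    simpa using h2
  · filter_upwards [ae_mem_ball_ballVol m] with y hy
    have h3 := hC y (Metric.ball_subset_closedBall hy)
    have h4 : |ballCutoff (δ n) y * φ y - φ y| ≤ |φ y| := by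
      have h5 : ballCutoff (δ n) y * φ y - φ y = -((1 - ballCutoff (δ n) y) * φ y) := by ring
      rw [h5, abs_neg, abs_mul, abs_of_nonneg (sub_nonneg.2 (ballCutoff_le_one _ _))]
      exact mul_le_of_le_one_left (abs_nonneg _) (by linarith [ballCutoff_nonneg (δ n) y])
    rw [← pow_two, Real.norm_eq_abs, abs_pow]
    rw [Real.norm_eq_abs] at h3
    have := h4.trans h3
    gcongr
  · filter_upwards [ae_mem_ball_ballVol m] with y hy
    refine tendsto_const_nhds.congr' ?_
    have hy1 : 0 < (1 - ‖y‖ ^ 2) / 2 := by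
      have := mem_ball_zero_iff.1 hy
      have := norm_nonneg y
      nlinarith
    filter_upwards [hδ0.eventually_lt_const hy1] with n hn
    rw [ballCutoff_eq_one (hδ n) (by linarith)]
    ring

end BallLp

/-! ### Separated solutions on the suspension -/

namespace StratSpace

variable {k m : ℕ} {Z : StratSpace.{u} m}

/-- The tensor product `φ ⊗ f` on the suspension. -/
noncomputable def suspTensor : Lp ℝ 2 (ballVol k m) →ₗ[ℝ] Lp ℝ 2 Z.regVol →ₗ[ℝ]
    Lp ℝ 2 (suspVol k Z) := lpTensor

theorem inner_suspTensor (φ ψ : Lp ℝ 2 (ballVol k m)) (f g : Lp ℝ 2 Z.regVol) :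
    ⟪suspTensor φ f, suspTensor ψ g⟫ = ⟪φ, ψ⟫ * ⟪f, g⟫ := inner_lpTensor φ ψ f g

theorem norm_suspTensor (φ : Lp ℝ 2 (ballVol k m)) (f : Lp ℝ 2 Z.regVol) :
    ‖suspTensor φ f‖ = ‖φ‖ * ‖f‖ := norm_lpTensor φ f

theorem coeFn_suspTensor (φ : Lp ℝ 2 (ballVol k m)) (f : Lp ℝ 2 Z.regVol) :
    suspTensor φ f =ᵐ[suspVol k Z] fun p => φ p.1 * f p.2 := coeFn_lpTensor φ f

namespace SuspTest

variable {w : Euc k × Z.Reg → ℝ} (hw : SuspTest k Z w)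

theorem contDiff_inner_slice (x : Lp ℝ 2 Z.regVol) : ContDiff ℝ 1 fun y => ⟪x, hw.slice y⟫ := by
  have h1 : ContDiff ℝ 1 hw.slice := by
    rw [contDiff_one_iff_fderiv]
    refine ⟨fun y => (hw.hasFDerivAt_slice y).differentiableAt, ?_⟩
    have : fderiv ℝ hw.slice = fun y => ∑ i, (EuclideanSpace.proj i : Euc k →L[ℝ] ℝ).smulRight
        (hw.sliceDeriv i y) := funext fun y => (hw.hasFDerivAt_slice y).fderiv
    rw [this]
    refine continuous_finsetSum _ fun i _ => ?_
    exact (ContinuousLinearMap.smulRightL ℝ (Euc k) (Lp ℝ 2 Z.regVol)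
      (EuclideanSpace.proj i)).continuous.comp (hw.continuous_sliceDeriv i)
  exact contDiff_const.inner ℝ h1

theorem fderiv_inner_slice (x : Lp ℝ 2 Z.regVol) (y : Euc k) (i : Fin k) :
    fderiv ℝ (fun y => ⟪x, hw.slice y⟫) y (EuclideanSpace.single i 1) =
      ⟪x, hw.sliceDeriv i y⟫ := by
  have h1 : HasFDerivAt (fun y => ⟪x, hw.slice y⟫) _ y :=
    (innerSL ℝ x).hasFDerivAt.comp y (hw.hasFDerivAt_slice y)
  rw [h1.fderiv]
  simp only [ContinuousLinearMap.comp_apply, sum_apply]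
  rw [Finset.sum_eq_single i]
  · simp
  · intro j _ hj; simp [hj]
  · simp

include hw in
theorem inner_suspTensor_toLp (hm : 1 ≤ m) {φ : Euc k → ℝ} (hφ : Continuous φ)
    (f : Lp ℝ 2 Z.regVol) :
    ⟪suspTensor (ballLp hm hφ) f, (isDirichletSpace_susp hm).toLp hw.toTest⟫ =
      ∫ y, φ y * ⟪f, hw.slice y⟫ ∂(ballVol k m) := by
  have h1 := (isDirichletSpace_susp (k := k) (Z := Z) hm).memLp w hw
  have h2 : suspTensor (ballLp hm hφ) f =ᵐ[suspVol k Z]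
      fun p => φ p.1 * f p.2 := by
    refine (coeFn_suspTensor (ballLp hm hφ) f).trans ?_
    filter_upwards [Measure.quasiMeasurePreserving_fst.ae (memLp_ballVol hm hφ).coeFn_toLp]
      with p hp
    rw [ballLp, hp]
  rw [IsDirichletSpace.inner_toLp]
  have h3 : Integrable (fun p : Euc k × Z.Reg => φ p.1 * f p.2 * w p)
      ((ballVol k m).prod Z.regVol) :=
    (memLp_tensor (memLp_ballVol hm hφ) (Lp.memLp f)).integrable_mul h1
  calc _ = ∫ p : Euc k × Z.Reg, φ p.1 * f p.2 * w p ∂((ballVol k m).prod Z.regVol) := by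
        refine integral_congr_ae ?_
        filter_upwards [h2] with p hp
        rw [hp]; rfl
    _ = _ := by
        rw [integral_prod _ h3]
        refine integral_congr_ae (ae_of_all _ fun y => ?_)
        simp only [mul_assoc]
        rw [integral_const_mul, hw.slice_eq_toLp, IsDirichletSpace.inner_toLp]
        rfl

end SuspTest

/-! ### Dirichlet forms of products `φ(y) v(z)`. -/

section Tensor

variable {φ : Euc k → ℝ} {v : Z.Reg → ℝ}

theorem suspTest_tensor (hφ : ContDiff ℝ 1 φ) (hc : HasCompactSupport φ)
    (hb : tsupport φ ⊆ Metric.ball 0 1) (hv : IsTestFunction 𝓘(ℝ, Euc m) univ v) :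
    SuspTest k Z fun p => φ p.1 * v p.2 := by
  have hK : IsCompact (tsupport φ ×ˢ tsupport v) := IsCompact.prod hc hv.hasCompactSupport
  have h0 : ∀ p ∉ tsupport φ ×ˢ tsupport v, φ p.1 * v p.2 = 0 := fun p hp => by
    by_cases h : p.1 ∈ tsupport φ
    · rw [image_eq_zero_of_notMem_tsupport fun h' => hp ⟨h, h'⟩, mul_zero]
    · rw [image_eq_zero_of_notMem_tsupport h, zero_mul]
  refine ⟨?_, HasCompactSupport.intro hK h0, ?_⟩
  · exact (hφ.contMDiff.comp contMDiff_fst).mul (hv.contMDiff.comp contMDiff_snd)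
  · refine (closure_minimal (fun p hp => ?_) hK.isClosed).trans
      (prod_mono hb (subset_univ _))
    by_contra h
    exact hp (h0 p h)

variable (hφ : ContDiff ℝ 1 φ) (hc : HasCompactSupport φ)
  (hb : tsupport φ ⊆ Metric.ball 0 1) (hv : IsTestFunction 𝓘(ℝ, Euc m) univ v)

theorem slice_tensor (y : Euc k) : (suspTest_tensor hφ hc hb hv).slice y =
    φ y • Z.isDirichletSpace.toLp hv.toTest := rfl

theorem sliceDeriv_tensor (i : Fin k) (y : Euc k) :
    (suspTest_tensor hφ hc hb hv).sliceDeriv i y =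
      fderiv ℝ φ y (EuclideanSpace.single i 1) • Z.isDirichletSpace.toLp hv.toTest := by
  have h : ∀ z, suspPartial (fun p : Euc k × Z.Reg => φ p.1 * v p.2) i (y, z) =
      fderiv ℝ φ y (EuclideanSpace.single i 1) * v z := fun z => by
    change fderiv ℝ (fun y => φ y * v z) y (EuclideanSpace.single i 1) = _
    rw [fderiv_mul_const (hφ.differentiable one_ne_zero y)]
    simp [mul_comm]
  have h2 : (fun z => suspPartial (fun p : Euc k × Z.Reg => φ p.1 * v p.2) i (y, z)) =
      fderiv ℝ φ y (EuclideanSpace.single i 1) • v := funext h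
  simp only [SuspTest.sliceDeriv, sliceLp, h2]
  rfl

theorem toLp_tensor (hm : 1 ≤ m) :
    (isDirichletSpace_susp hm).toLp (suspTest_tensor hφ hc hb hv).toTest =
      suspTensor (ballLp hm hφ.continuous) (Z.isDirichletSpace.toLp hv.toTest) :=
  (lpTensor_toLp (memLp_ballVol hm hφ.continuous) (Z.isDirichletSpace.memLp v hv)).symm

include hφ hc hb in
theorem dirichletForm_tensor (hm : 1 ≤ m) {w : Euc k × Z.Reg → ℝ} (hw : SuspTest k Z w) :
    dirichletForm (𝓘(ℝ, Euc k).prod 𝓘(ℝ, Euc m)) (suspMetric k Z) (suspVol k Z)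
      (fun p => φ p.1 * v p.2) w =
      ∫ y, (sphDual y (fderiv ℝ φ y)
          (fderiv ℝ (fun y => ⟪Z.isDirichletSpace.toLp hv.toTest, hw.slice y⟫) y) +
        (suspRadius y ^ 2)⁻¹ * (φ y * dirichletForm 𝓘(ℝ, Euc m) Z.g Z.regVol v
          fun z => w (y, z))) ∂(ballVol k m) := by
  rw [(suspTest_tensor hφ hc hb hv).dirichletForm_susp hw hm]
  refine integral_congr_ae (ae_of_all _ fun y => ?_)
  have h1 : dirichletForm 𝓘(ℝ, Euc m) Z.g Z.regVol (fun z => φ y * v z) (fun z => w (y, z)) =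
      φ y * dirichletForm 𝓘(ℝ, Euc m) Z.g Z.regVol v (fun z => w (y, z)) :=
    (Z.isDirichletSpace.form).map_smul₂ (φ y) hv.toTest (hw.isTestFunction_slice y).toTest
  have h2 : ∑ i, ⟪(suspTest_tensor hφ hc hb hv).sliceDeriv i y, hw.sliceDeriv i y⟫ -
      ⟪∑ i, y i • (suspTest_tensor hφ hc hb hv).sliceDeriv i y, ∑ i, y i • hw.sliceDeriv i y⟫ =
      sphDual y (fderiv ℝ φ y)
        (fderiv ℝ (fun y => ⟪Z.isDirichletSpace.toLp hv.toTest, hw.slice y⟫) y) := by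
    rw [sphDual, ← sum_apply_single_mul (fderiv ℝ φ y) y,
      ← sum_apply_single_mul (fderiv ℝ (fun y => ⟪_, hw.slice y⟫) y) y]
    simp only [sliceDeriv_tensor hφ hc hb hv, hw.fderiv_inner_slice, real_inner_smul_left,
      sum_inner, inner_sum, real_inner_smul_right, Finset.sum_mul_sum]
    congr 1
    rw [Finset.sum_comm]
    exact Finset.sum_congr rfl fun i _ => Finset.sum_congr rfl fun j _ => by ring
  simp only [h1, h2]

include hφ hc hb in
theorem dirichletForm_tensor_self (hm : 1 ≤ m) :
    dirichletForm (𝓘(ℝ, Euc k).prod 𝓘(ℝ, Euc m)) (suspMetric k Z) (suspVol k Z)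
      (fun p => φ p.1 * v p.2) (fun p => φ p.1 * v p.2) =
      (∫ y, sphDual y (fderiv ℝ φ y) (fderiv ℝ φ y) ∂(ballVol k m)) *
        ‖Z.isDirichletSpace.toLp hv.toTest‖ ^ 2 +
      (∫ y, (suspRadius y ^ 2)⁻¹ * φ y ^ 2 ∂(ballVol k m)) *
        dirichletForm 𝓘(ℝ, Euc m) Z.g Z.regVol v v := by
  rw [dirichletForm_tensor hφ hc hb hv hm (suspTest_tensor hφ hc hb hv), ← integral_mul_const,
    ← integral_mul_const, ← integral_add]
  · refine integral_congr_ae (ae_of_all _ fun y => ?_)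
    have h0 : (fun y => ⟪Z.isDirichletSpace.toLp hv.toTest,
        (suspTest_tensor hφ hc hb hv).slice y⟫) =
        fun y => φ y * ‖Z.isDirichletSpace.toLp hv.toTest‖ ^ 2 := funext fun y => by
      rw [slice_tensor hφ hc hb hv, real_inner_smul_right, real_inner_self_eq_norm_sq]
    simp only [h0]
    have h1 : dirichletForm 𝓘(ℝ, Euc m) Z.g Z.regVol v (fun z => φ y * v z) =
        φ y * dirichletForm 𝓘(ℝ, Euc m) Z.g Z.regVol v v :=
      (Z.isDirichletSpace.form hv.toTest).map_smul (φ y) hv.toTest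
    rw [h1, fderiv_mul_const (hφ.differentiable one_ne_zero y), sphDual_smul_right]
    ring
  · refine (integrable_ballVol hm hc hb (continuous_sphDual_fderiv hφ hφ).continuousOn
      fun y hy => ?_).mul_const _
    rw [fderiv_eq_zero_of_notMem_tsupport hy, sphDual_zero_right]
  · refine (integrable_ballVol hm hc hb (continuousOn_suspRadius_inv.mul
      (hφ.continuous.pow 2).continuousOn) fun y hy => ?_).mul_const _
    simp [image_eq_zero_of_notMem_tsupport hy]

end Tensor

end StratSpace

/-! ### Passage to the limit in truncated separated solutions. -/

namespace StratSpace

variable {k m : ℕ} {Z : StratSpace.{u} m} {w : Euc k × Z.Reg → ℝ} (hw : SuspTest k Z w)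

include hw in
-- The margin `ρ` ensures that every cutoff with parameter `δ ≤ ρ` equals one on the projected
-- support of `w`.
theorem SuspTest.exists_compact_ball_lt : ∃ (C : Set (Euc k)) (ρ : ℝ), IsCompact C ∧
    C ⊆ Metric.ball 0 1 ∧ (∀ y ∉ C, ∀ z, (y, z) ∉ tsupport w) ∧ 0 < ρ ∧
    ∀ y ∈ C, ‖y‖ ^ 2 < 1 - 2 * ρ := by
  obtain ⟨C, hC, hCb, hC0⟩ := hw.exists_compact_ball
  rcases C.eq_empty_or_nonempty with rfl | hne
  · exact ⟨∅, 1, hC, hCb, hC0, one_pos, by simp⟩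
  · obtain ⟨y₀, hy₀, hmax⟩ := hC.exists_isMaxOn hne
      (f := fun y : Euc k => ‖y‖ ^ 2) (by fun_prop)
    have h1 := mem_ball_zero_iff.1 (hCb hy₀)
    have h2 : ‖y₀‖ ^ 2 < 1 := by nlinarith [norm_nonneg y₀]
    refine ⟨C, (1 - ‖y₀‖ ^ 2) / 4, hC, hCb, hC0, by linarith, fun y hy => ?_⟩
    have h3 : ‖y‖ ^ 2 ≤ ‖y₀‖ ^ 2 := hmax hy
    linarith

include hw in
-- A function of `z` alone is no test function on the suspension. Multiplying it by a cutoff in `y`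
-- that is one wherever `w` lives makes it one, without changing the pairing.
theorem SuspTest.continuous_dirichletForm_left {v : Z.Reg → ℝ}
    (hv : IsTestFunction 𝓘(ℝ, Euc m) univ v) : Continuous fun y =>
      dirichletForm 𝓘(ℝ, Euc m) Z.g Z.regVol v (fun z => w (y, z)) := by
  obtain ⟨C, δ, hC, hCb, hC0, hδ, hCδ⟩ := hw.exists_compact_ball_lt
  have h0 := suspTest_tensor (Z := Z) (contDiff_ballCutoff (k := k) δ)
    (hasCompactSupport_ballCutoff hδ) (tsupport_ballCutoff_subset_ball hδ) hv
  refine (h0.continuous_dirichletForm_slice hw).congr fun y => ?_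
  have h1 : dirichletForm 𝓘(ℝ, Euc m) Z.g Z.regVol (fun z => ballCutoff δ y * v z)
      (fun z => w (y, z)) = ballCutoff δ y *
      dirichletForm 𝓘(ℝ, Euc m) Z.g Z.regVol v (fun z => w (y, z)) :=
    (Z.isDirichletSpace.form).map_smul₂ (ballCutoff δ y) hv.toTest
      (hw.isTestFunction_slice y).toTest
  refine h1.trans ?_
  by_cases hy : y ∈ C
  · rw [ballCutoff_eq_one hδ (hCδ y hy).le, one_mul]
  · have h2 : (fun z => w (y, z)) = fun _ => 0 :=
      funext fun z => image_eq_zero_of_notMem_tsupport (hC0 y hy z)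
    have h3 : dirichletForm 𝓘(ℝ, Euc m) Z.g Z.regVol v (fun _ => 0) = 0 :=
      (Z.isDirichletSpace.form hv.toTest).map_zero
    rw [h2, h3, mul_zero]

/-- The Dirichlet form of a truncated separated solution against a test function. -/
theorem dirichletForm_cutoff_tensor (hm : 1 ≤ m) {μ : ℝ} {φ ζ : Euc k → ℝ}
    (h : IsSphSolution k m μ φ ζ) {C : Set (Euc k)}
    (hC : IsCompact C) (hCb : C ⊆ Metric.ball 0 1) (hC0 : ∀ y ∉ C, ∀ z, (y, z) ∉ tsupport w)
    {δ : ℝ} (hδ : 0 < δ) (hCδ : ∀ y ∈ C, ‖y‖ ^ 2 < 1 - 2 * δ) {v : Z.Reg → ℝ}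
    (hv : IsTestFunction 𝓘(ℝ, Euc m) univ v) :
    dirichletForm (𝓘(ℝ, Euc k).prod 𝓘(ℝ, Euc m)) (suspMetric k Z) (suspVol k Z)
      (fun p => ballCutoff δ p.1 * φ p.1 * v p.2) w =
      ∫ y, (ζ y * ⟪Z.isDirichletSpace.toLp hv.toTest, hw.slice y⟫ +
        (suspRadius y ^ 2)⁻¹ * φ y * (dirichletForm 𝓘(ℝ, Euc m) Z.g Z.regVol v (fun z => w (y, z)) -
          μ * ⟪Z.isDirichletSpace.toLp hv.toTest, hw.slice y⟫)) ∂(ballVol k m) := by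
  set ψ : Euc k → ℝ := fun y => ⟪Z.isDirichletSpace.toLp hv.toTest, hw.slice y⟫ with hψdef
  set e : Euc k → ℝ := fun y => dirichletForm 𝓘(ℝ, Euc m) Z.g Z.regVol v (fun z => w (y, z))
  have hψ : ContDiff ℝ 1 ψ := hw.contDiff_inner_slice _
  have hψ0 : ∀ y ∉ C, ψ y = 0 := fun y hy => by
    simp only [ψ, hw.slice_eq_zero (hC0 y hy), inner_zero_right]
  have hψc : HasCompactSupport ψ := HasCompactSupport.intro hC hψ0
  have hψt : tsupport ψ ⊆ C :=
    closure_minimal (fun y hy => by by_contra h; exact hy (hψ0 y h)) hC.isClosed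
  have he0 : ∀ y ∉ C, e y = 0 := fun y hy => by
    have h1 : (fun z => w (y, z)) = fun _ => 0 :=
      funext fun z => image_eq_zero_of_notMem_tsupport (hC0 y hy z)
    simp only [e, h1]
    exact (Z.isDirichletSpace.form hv.toTest).map_zero
  have hχ : tsupport (fun y : Euc k => ballCutoff δ y * φ y) ⊆ tsupport (ballCutoff δ) :=
    tsupport_mul_subset_left
  have hχ1 : ContDiff ℝ 1 fun y : Euc k => ballCutoff δ y * φ y :=
    contDiff_ballCutoff_mul h.contDiffOn hδ
  have hχc : HasCompactSupport fun y : Euc k => ballCutoff δ y * φ y :=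
    (hasCompactSupport_ballCutoff hδ).mul_right
  have he : Continuous e := hw.continuous_dirichletForm_left hv
  rw [dirichletForm_tensor hχ1 hχc (hχ.trans (tsupport_ballCutoff_subset_ball hδ)) hv hm hw]
  change ∫ y, (sphDual y (fderiv ℝ (fun y : Euc k => ballCutoff δ y * φ y) y) (fderiv ℝ ψ y) +
    (suspRadius y ^ 2)⁻¹ * (ballCutoff δ y * φ y * e y)) ∂(ballVol k m) = _
  have h1 : ∀ y, sphDual y (fderiv ℝ (fun y : Euc k => ballCutoff δ y * φ y) y) (fderiv ℝ ψ y) +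
      (suspRadius y ^ 2)⁻¹ * (ballCutoff δ y * φ y * e y) =
      sphDual y (fderiv ℝ φ y) (fderiv ℝ ψ y) + (suspRadius y ^ 2)⁻¹ * φ y * e y := fun y => by
    by_cases hy : y ∈ C
    · have h2 : (fun y : Euc k => ballCutoff δ y * φ y) =ᶠ[𝓝 y] φ := by
        have : Continuous fun y : Euc k => ‖y‖ ^ 2 := by fun_prop
        filter_upwards [this.continuousAt.eventually_lt continuousAt_const (hCδ y hy)] with x hx
        rw [ballCutoff_eq_one hδ hx.le, one_mul]
      rw [h2.fderiv_eq, ballCutoff_eq_one hδ (hCδ y hy).le]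
      ring
    · rw [fderiv_eq_zero_of_notMem_tsupport fun h => hy (hψt h), sphDual_zero_right,
        sphDual_zero_right, he0 y hy]
      ring
  simp only [h1]
  have hcφ := h.continuous
  have hcζ := h.continuous_rhs
  have hcψ := hψ.continuous
  have hdφ : ContinuousOn (fun y => sphDual y (fderiv ℝ φ y) (fderiv ℝ ψ y)) (Metric.ball 0 1) := by
    have h2 := h.contDiffOn.continuousOn_fderiv_of_isOpen Metric.isOpen_ball le_rfl
    have h3 := hψ.continuous_fderiv one_ne_zero
    unfold sphDual
    refine ContinuousOn.sub (continuousOn_finsetSum _ fun i _ => ?_) ?_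
    · exact (h2.clm_apply continuousOn_const).mul (h3.clm_apply continuous_const).continuousOn
    · exact (h2.clm_apply continuousOn_id).mul (h3.clm_apply continuous_id).continuousOn
  have hr := continuousOn_suspRadius_inv (k := k)
  have i1 : Integrable (fun y => sphDual y (fderiv ℝ φ y) (fderiv ℝ ψ y)) (ballVol k m) :=
    integrable_ballVol hm hC hCb hdφ fun y hy => by
      rw [fderiv_eq_zero_of_notMem_tsupport fun h => hy (hψt h), sphDual_zero_right]
  have i2 : Integrable (fun y => (suspRadius y ^ 2)⁻¹ * φ y * e y) (ballVol k m) :=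
    integrable_ballVol hm hC hCb ((hr.mul hcφ.continuousOn).mul he.continuousOn) fun y hy => by
      rw [he0 y hy, mul_zero]
  have i3 : Integrable (fun y => (ζ y - μ * (suspRadius y ^ 2)⁻¹ * φ y) * ψ y) (ballVol k m) :=
    integrable_ballVol hm hC hCb ((hcζ.continuousOn.sub ((continuousOn_const.mul hr).mul
      hcφ.continuousOn)).mul hcψ.continuousOn) fun y hy => by rw [hψ0 y hy, mul_zero]
  rw [integral_add i1 i2, h.eq ψ hψ hψc (hψt.trans hCb), ← integral_add i3 i2]
  refine integral_congr_ae (ae_of_all _ fun y => ?_)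
  ring

theorem abs_dirichletForm_le {v w : Z.Reg → ℝ} (hv : IsTestFunction 𝓘(ℝ, Euc m) univ v)
    (hw : IsTestFunction 𝓘(ℝ, Euc m) univ w) :
    |dirichletForm 𝓘(ℝ, Euc m) Z.g Z.regVol v w| ≤
      √(dirichletForm 𝓘(ℝ, Euc m) Z.g Z.regVol v v) *
      √(dirichletForm 𝓘(ℝ, Euc m) Z.g Z.regVol w w) := by
  have hD := Z.isDirichletSpace
  have h1 := LinearMap.BilinForm.apply_mul_apply_le_of_forall_zero_le hD.form hD.form_nonneg
    hv.toTest hw.toTest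
  rw [hD.form_comm hw.toTest hv.toTest, ← pow_two] at h1
  exact (Real.abs_le_sqrt h1).trans_eq (Real.sqrt_mul (hD.form_nonneg hv.toTest) _)

/-- For large `j` the cutoff is invisible to `w`, and `dirichletForm_cutoff_tensor` applies. For
each fixed `y` the defect in the weak eigenvalue equation of `v j` against the slice of `w` tends to
zero; the energy bound `B` and Cauchy–Schwarz give domination. -/
theorem tendsto_dirichletForm_cutoff_tensor (hm : 1 ≤ m) {μ : ℝ} {φ ζ : Euc k → ℝ}
    (h : IsSphSolution k m μ φ ζ)
    {v : ℕ → Z.Reg → ℝ} (hv : ∀ j, IsTestFunction 𝓘(ℝ, Euc m) univ (v j))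
    {f : Lp ℝ 2 Z.regVol}
    (hvf : Tendsto (fun j => Z.isDirichletSpace.toLp (hv j).toTest) atTop (𝓝 f)) {B : ℝ}
    (hB : ∀ j, dirichletForm 𝓘(ℝ, Euc m) Z.g Z.regVol (v j) (v j) ≤ B)
    (hweak : ∀ x : testSubmodule 𝓘(ℝ, Euc m) univ, Tendsto (fun j =>
      dirichletForm 𝓘(ℝ, Euc m) Z.g Z.regVol (v j) x.1) atTop
        (𝓝 (μ * ⟪f, Z.isDirichletSpace.toLp x⟫)))
    {δ : ℕ → ℝ} (hδ : ∀ n, 0 < δ n) (hδ0 : Tendsto δ atTop (𝓝 0)) :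
    Tendsto (fun j => dirichletForm (𝓘(ℝ, Euc k).prod 𝓘(ℝ, Euc m)) (suspMetric k Z) (suspVol k Z)
      (fun p => ballCutoff (δ j) p.1 * φ p.1 * v j p.2) w) atTop
      (𝓝 ⟪suspTensor (ballLp hm h.continuous_rhs) f,
        (isDirichletSpace_susp hm).toLp hw.toTest⟫) := by
  obtain ⟨C, ρ, hC, hCb, hC0, hρ, hCρ⟩ := hw.exists_compact_ball_lt
  rw [hw.inner_suspTensor_toLp]
  obtain ⟨V, hV⟩ : ∃ V, ∀ j, ‖Z.isDirichletSpace.toLp (hv j).toTest‖ ≤ V := by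
    obtain ⟨V, hV⟩ := hvf.norm.bddAbove_range
    exact ⟨V, fun j => hV ⟨j, rfl⟩⟩
  have hV0 : 0 ≤ V := (norm_nonneg _).trans (hV 0)
  have hsl := hw.continuous_slice
  have hcφ := h.continuous
  have hcζ := h.continuous_rhs
  have hr := continuousOn_suspRadius_inv (k := k)
  have hEw := hw.continuous_dirichletForm_slice hw
  have key : Tendsto (fun j => ∫ y, (ζ y * ⟪Z.isDirichletSpace.toLp (hv j).toTest, hw.slice y⟫ +
      (suspRadius y ^ 2)⁻¹ * φ y *
        (dirichletForm 𝓘(ℝ, Euc m) Z.g Z.regVol (v j) (fun z => w (y, z)) -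
          μ * ⟪Z.isDirichletSpace.toLp (hv j).toTest, hw.slice y⟫)) ∂(ballVol k m)) atTop
      (𝓝 (∫ y, ζ y * ⟪f, hw.slice y⟫ ∂(ballVol k m))) := by
    refine tendsto_integral_of_dominated_convergence (fun y => |ζ y| * (V * ‖hw.slice y‖) +
      (suspRadius y ^ 2)⁻¹ * |φ y| * (√B * √(dirichletForm 𝓘(ℝ, Euc m) Z.g Z.regVol
        (fun z => w (y, z)) (fun z => w (y, z))) + |μ| * (V * ‖hw.slice y‖))) (fun j => ?_) ?_
      (fun j => ?_) ?_
    · have he := hw.continuous_dirichletForm_left (hv j)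
      have h2 : Continuous fun y => ⟪Z.isDirichletSpace.toLp (hv j).toTest, hw.slice y⟫ := by
        fun_prop
      refine AEStronglyMeasurable.add (hcζ.mul h2).aestronglyMeasurable ?_
      refine AEStronglyMeasurable.mul ?_ (he.sub (continuous_const.mul h2)).aestronglyMeasurable
      refine AEStronglyMeasurable.mul ?_ hcφ.aestronglyMeasurable
      exact ((continuous_suspRadius.pow 2).measurable.inv).aestronglyMeasurable
    · refine integrable_ballVol hm hC hCb ?_ fun y hy => ?_
      · refine ContinuousOn.add ?_ ((hr.mul hcφ.abs.continuousOn).mul ?_)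
        · exact Continuous.continuousOn (by fun_prop)
        · exact Continuous.continuousOn (by fun_prop)
      · simp [hw.slice_eq_zero (hC0 y hy), hw.dirichletForm_slice_eq_zero (hC0 y hy)]
    · refine ae_of_all _ fun y => ?_
      have h1 : |⟪Z.isDirichletSpace.toLp (hv j).toTest, hw.slice y⟫| ≤ V * ‖hw.slice y‖ :=
        (abs_real_inner_le_norm _ _).trans (mul_le_mul_of_nonneg_right (hV j) (norm_nonneg _))
      have h2 := (abs_dirichletForm_le (hv j) (hw.isTestFunction_slice y)).trans
        (mul_le_mul_of_nonneg_right (Real.sqrt_le_sqrt (hB j)) (Real.sqrt_nonneg _))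
      refine (norm_add_le _ _).trans (add_le_add ?_ ?_)
      · rw [Real.norm_eq_abs, abs_mul]
        gcongr
      · rw [Real.norm_eq_abs, abs_mul, abs_mul, abs_of_nonneg (a := (suspRadius y ^ 2)⁻¹)
          (by positivity)]
        refine mul_le_mul_of_nonneg_left ((abs_sub _ _).trans (add_le_add h2 ?_)) (by positivity)
        rw [abs_mul]
        gcongr
    · refine ae_of_all _ fun y => ?_
      have h1 : Tendsto (fun j => ⟪Z.isDirichletSpace.toLp (hv j).toTest, hw.slice y⟫) atTop
        (𝓝 ⟪f, hw.slice y⟫) := hvf.inner tendsto_const_nhds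
      have h2 := hweak (hw.isTestFunction_slice y).toTest
      rw [← hw.slice_eq_toLp] at h2
      have h3 := (h1.const_mul (ζ y)).add (((h2.sub (h1.const_mul μ))).const_mul
        ((suspRadius y ^ 2)⁻¹ * φ y))
      rw [sub_self, mul_zero, add_zero] at h3
      exact h3
  refine key.congr' ?_
  filter_upwards [hδ0.eventually_lt_const hρ] with j hj
  exact (dirichletForm_cutoff_tensor hw hm h hC hCb hC0 (hδ j)
    (fun y hy => (hCρ y hy).trans (by linarith)) (hv j)).symm

/-- Separation of variables: a solution on the ball and an eigenfunction on `Z` give a solution on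
the suspension. -/
theorem resolvent_suspTensor (hm : 1 ≤ m) {μ : ℝ} {φ ζ : Euc k → ℝ}
    (h : IsSphSolution k m μ φ ζ) {f : Lp ℝ 2 Z.regVol}
    (hf : (1 + μ) • Z.isDirichletSpace.resolvent f = f) :
    (isDirichletSpace_susp hm).resolvent (suspTensor (ballLp hm h.continuous) f +
      suspTensor (ballLp hm h.continuous_rhs) f) = suspTensor (ballLp hm h.continuous) f := by
  have hD := Z.isDirichletSpace
  -- Since `R ((1 + μ) f) = f`, this yields test functions tending to `f` in `L²` whose energies
  -- tend to exactly `μ ‖f‖²`.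
  obtain ⟨v, hv1, hv2, hv3, -⟩ := hD.isFormResolvent.approx ((1 + μ) • f)
  rw [map_smul, hf] at hv1 hv2 hv3
  have hv2' : Tendsto (fun n => dirichletForm 𝓘(ℝ, Euc m) Z.g Z.regVol (v n).1 (v n).1) atTop
      (𝓝 (μ * ‖f‖ ^ 2)) := by
    refine (congrArg (fun c => Tendsto _ _ (𝓝 c)) ?_).mp hv2
    rw [real_inner_smul_right, real_inner_self_eq_norm_sq]; ring
  have hv3' : ∀ x : testSubmodule 𝓘(ℝ, Euc m) univ, Tendsto (fun j =>
      dirichletForm 𝓘(ℝ, Euc m) Z.g Z.regVol (v j).1 x.1) atTop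
        (𝓝 (μ * ⟪f, Z.isDirichletSpace.toLp x⟫)) := fun x => by
    refine (congrArg (fun c => Tendsto _ _ (𝓝 c)) ?_).mp (hv3 x)
    rw [real_inner_smul_left]; ring
  -- The shift by `3` keeps `2 δ < 1` from the first index on, as the energy bound for the cutoffs
  -- requires.
  set δ : ℕ → ℝ := fun j => 1 / ((j : ℝ) + 3)
  have hδ : ∀ j, 0 < δ j := fun j => by positivity
  have hδ2 : ∀ j, 2 * δ j < 1 := fun j => by
    simp only [δ]; rw [mul_one_div, div_lt_one (by positivity)]
    have : (0 : ℝ) ≤ j := by positivity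
    linarith
  have hδ0 : Tendsto δ atTop (𝓝 0) := by
    have h1 : Tendsto (fun j : ℕ => (j : ℝ) + 3) atTop atTop :=
      tendsto_atTop_add_const_right _ _ tendsto_natCast_atTop_atTop
    simp only [δ, one_div]
    exact h1.inv_tendsto_atTop
  obtain ⟨C, hC⟩ := h.exists_energy_cutoff_le hm
  set b : ℕ → ℝ := fun j => ∫ y : Euc k, (suspRadius y ^ 2)⁻¹ * (ballCutoff (δ j) y * φ y) ^ 2
    ∂(ballVol k m)
  have hb : ∀ j, 0 ≤ b j := fun j => integral_nonneg fun y => by positivity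
  -- Diagonal choice. No bound on `b j` uniform in `j` is available. The energy of the product is
  -- `(a + μ b) ‖v‖² + b (E(v) - μ ‖v‖²)`, with `a` the hemisphere energy, `E` the energy on `Z` and
  -- `a + μ b` bounded; taking `v` so late that its defect is below `1 / (1 + b j)` bounds the rest
  -- by `1`.
  have hex : ∀ j, ∃ i, j ≤ i ∧ dirichletForm 𝓘(ℝ, Euc m) Z.g Z.regVol (v i).1 (v i).1 -
      μ * ‖hD.toLp (v i)‖ ^ 2 < 1 / (1 + b j) := fun j => by
    have h1 := hv2'.sub ((hv1.norm.pow 2).const_mul μ)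
    rw [sub_self] at h1
    have h2 : 0 < 1 / (1 + b j) := by have := hb j; positivity
    exact ((eventually_ge_atTop j).and (h1.eventually_lt_const h2)).exists
  choose i hij hi using hex
  have hit : Tendsto i atTop atTop := tendsto_atTop_mono hij tendsto_id
  have hχ : ∀ j, ContDiff ℝ 1 fun y : Euc k => ballCutoff (δ j) y * φ y := fun j =>
    contDiff_ballCutoff_mul h.contDiffOn (hδ j)
  have hχc : ∀ j, HasCompactSupport fun y : Euc k => ballCutoff (δ j) y * φ y := fun j =>
    (hasCompactSupport_ballCutoff (hδ j)).mul_right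
  have hχb : ∀ j, tsupport (fun y : Euc k => ballCutoff (δ j) y * φ y) ⊆ Metric.ball 0 1 := fun j =>
    tsupport_mul_subset_left.trans (tsupport_ballCutoff_subset_ball (hδ j))
  set u : ℕ → testSubmodule (𝓘(ℝ, Euc k).prod 𝓘(ℝ, Euc m)) (suspSet k Z) := fun j =>
    (suspTest_tensor (hχ j) (hχc j) (hχb j) (v (i j)).2).toTest
  obtain ⟨V, hV⟩ : ∃ V, ∀ j, ‖hD.toLp (v j)‖ ≤ V := by
    obtain ⟨V, hV⟩ := hv1.norm.bddAbove_range
    exact ⟨V, fun j => hV ⟨j, rfl⟩⟩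
  obtain ⟨B, hB⟩ : ∃ B, ∀ j, dirichletForm 𝓘(ℝ, Euc m) Z.g Z.regVol (v j).1 (v j).1 ≤ B := by
    obtain ⟨V, hV⟩ := hv2'.bddAbove_range
    exact ⟨V, fun j => hV ⟨j, rfl⟩⟩
  refine (isDirichletSpace_susp hm).isFormResolvent.weak u (|C| * V ^ 2 + 1) _ _ (fun j => ?_) ?_
    fun w => ?_
  · refine (dirichletForm_tensor_self (hχ j) (hχc j) (hχb j) (v (i j)).2 hm).trans_le ?_
    change _ * ‖hD.toLp (v (i j))‖ ^ 2 + b j * _ ≤ _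
    have h1 := hC (δ j) (hδ j) (hδ2 j)
    change _ + μ * b j ≤ C at h1
    have h2 := hi j
    rw [lt_div_iff₀ (by have := hb j; positivity)] at h2
    have h3 : ‖hD.toLp (v (i j))‖ ^ 2 ≤ V ^ 2 := by have := hV (i j); gcongr
    have h4 : 0 ≤ ‖hD.toLp (v (i j))‖ ^ 2 := by positivity
    have h5 := hb j
    have h6 := mul_le_mul_of_nonneg_right (h1.trans (le_abs_self C)) h4
    have h7 := mul_le_mul_of_nonneg_left h3 (abs_nonneg C)
    have h8 : (dirichletForm 𝓘(ℝ, Euc m) Z.g Z.regVol (v (i j)).1 (v (i j)).1 -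
      μ * ‖hD.toLp (v (i j))‖ ^ 2) * b j ≤ 1 := by
      rcases le_total 0 (dirichletForm 𝓘(ℝ, Euc m) Z.g Z.regVol (v (i j)).1 (v (i j)).1 -
        μ * ‖hD.toLp (v (i j))‖ ^ 2) with h | h <;> nlinarith
    linarith
  · have h1 : ∀ j, (isDirichletSpace_susp hm).toLp (u j) =
        suspTensor (ballLp hm ((contDiff_ballCutoff (k := k) (δ j)).continuous.mul h.continuous))
          (hD.toLp (v (i j))) := fun j =>
      toLp_tensor (hχ j) (hχc j) (hχb j) (v (i j)).2 hm
    simp only [h1]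
    exact tendsto_lpTensor (tendsto_ballLp_cutoff hm h.continuous hδ hδ0) (hv1.comp hit)
  · exact tendsto_dirichletForm_cutoff_tensor (w := w.1) w.2 hm h (v := fun j => (v (i j)).1)
      (fun j => (v (i j)).2) (hv1.comp hit) (fun j => hB _) (fun x => (hv3' x).comp hit) hδ hδ0

end StratSpace

/-! ### Spectral gaps from filtrations -/

section Filtration

variable {H : Type*} [NormedAddCommGroup H] [InnerProductSpace ℝ H] [CompleteSpace H]

/-- Let `x ∈ W (d + 1)` be orthogonal to `W d`. Then `(1 + λ) R x - x` lies in `W d` by `hW` and is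
orthogonal to it by symmetry and invariance, so it vanishes: `x` is an eigenvector. Such pieces add
up orthogonally, the closure of the union follows by continuity, and `hgap` covers the complement.
-/
theorem inner_map_le_of_filtration {R : H →L[ℝ] H} (hs : ∀ x y, ⟪R x, y⟫ = ⟪x, R y⟫)
    (hn : ∀ x, 0 ≤ ⟪R x, x⟫) (W : ℕ → Submodule ℝ H) (hmono : Monotone W)
    (hcl : ∀ d, IsClosed (W d : Set H)) (hinv : ∀ d, ∀ x ∈ W d, R x ∈ W d)
    {lam : ℕ → ℝ} {Lam : ℝ} (hlam : ∀ d, Lam ≤ lam (d + 1))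
    (hW : ∀ d, ∀ x ∈ W (d + 1), (1 + lam (d + 1)) • R x - x ∈ W d)
    (hgap : ∀ x ∈ (⨆ d, W d).topologicalClosureᗮ, (1 + Lam) * ⟪R x, x⟫ ≤ ‖x‖ ^ 2)
    {x : H} (hx : x ∈ (W 0)ᗮ) : (1 + Lam) * ⟪R x, x⟫ ≤ ‖x‖ ^ 2 := by
  haveI : ∀ d, CompleteSpace (W d) := fun d => (hcl d).completeSpace_coe
  -- For invariant `V` the mixed terms vanish, so the inequality adds over `V ⊕ Vᗮ`.
  have hsplit : ∀ {V : Submodule ℝ H}, (∀ y ∈ V, R y ∈ V) → ∀ {p q : H}, p ∈ V → q ∈ Vᗮ →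
      (1 + Lam) * ⟪R p, p⟫ ≤ ‖p‖ ^ 2 → (1 + Lam) * ⟪R q, q⟫ ≤ ‖q‖ ^ 2 →
      (1 + Lam) * ⟪R (p + q), p + q⟫ ≤ ‖p + q‖ ^ 2 := fun hV p q hp hq h1 h2 => by
    have h3 : ⟪R p, q⟫ = 0 := hq _ (hV p hp)
    have h4 : ⟪R q, p⟫ = 0 := by rw [hs, real_inner_comm]; exact h3
    have h5 : ⟪p, q⟫ = 0 := hq _ hp
    rw [map_add, inner_add_left, inner_add_right, inner_add_right, h3, h4, norm_add_sq_real, h5]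
    linarith
  have hA : ∀ d, ∀ x ∈ W d, x ∈ (W 0)ᗮ → (1 + Lam) * ⟪R x, x⟫ ≤ ‖x‖ ^ 2 := fun d => by
    induction d with
    | zero =>
      intro x hx hx0
      have : x = 0 := inner_self_eq_zero.1 (hx0 x hx)
      simp [this]
    | succ d ih =>
      intro x hx hx0
      set p := (W d).starProjection x
      have hp : p ∈ W d := Submodule.starProjection_apply_mem _ _
      have hq : x - p ∈ (W d)ᗮ := Submodule.sub_starProjection_mem_orthogonal x
      have hq1 : x - p ∈ W (d + 1) := sub_mem hx (hmono d.le_succ hp)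
      have hp0 : p ∈ (W 0)ᗮ := fun w hw => by
        have h1 := hq w (hmono d.zero_le hw)
        rw [inner_sub_right, hx0 w hw] at h1
        linarith
      have h1 := hW d _ hq1
      have h2 : (1 + lam (d + 1)) • R (x - p) - (x - p) ∈ (W d)ᗮ := by
        refine sub_mem (Submodule.smul_mem _ _ fun w hw => ?_) hq
        rw [← hs]; exact hq _ (hinv d w hw)
      have h3 : (1 + lam (d + 1)) • R (x - p) = x - p :=
        sub_eq_zero.1 (inner_self_eq_zero.1 (h2 _ h1))
      have h4 : (1 + lam (d + 1)) * ⟪R (x - p), x - p⟫ = ‖x - p‖ ^ 2 := by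
        rw [← real_inner_smul_left, h3, real_inner_self_eq_norm_sq]
      have h5 : (1 + Lam) * ⟪R (x - p), x - p⟫ ≤ ‖x - p‖ ^ 2 := by
        rw [← h4]
        exact mul_le_mul_of_nonneg_right (by linarith [hlam d]) (hn _)
      have h6 := hsplit (hinv d) hp hq (ih p hp hp0) h5
      rwa [add_sub_cancel] at h6
  set M := (⨆ d, W d).topologicalClosure
  haveI : CompleteSpace M := (Submodule.isClosed_topologicalClosure _).completeSpace_coe
  have hM0 : ∀ d, W d ≤ M := fun d => (le_iSup W d).trans (Submodule.le_topologicalClosure _)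
  have hMinv : ∀ y ∈ M, R y ∈ M := by
    have h1 : M ≤ M.comap R.toLinearMap := by
      refine Submodule.topologicalClosure_minimal _ (iSup_le fun d y hy => hM0 d (hinv d y hy)) ?_
      exact (Submodule.isClosed_topologicalClosure _).preimage R.continuous
    exact h1
  -- Subtracting the projection to `W 0` replaces the condition `y ∈ (W 0)ᗮ`, which approximants of
  -- `y` need not satisfy, by a closed condition on all of `M`.
  have hB : ∀ y ∈ M, (1 + Lam) * ⟪R (y - (W 0).starProjection y), y - (W 0).starProjection y⟫ ≤
      ‖y - (W 0).starProjection y‖ ^ 2 := by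
    have hc : IsClosed {y | (1 + Lam) * ⟪R (y - (W 0).starProjection y),
        y - (W 0).starProjection y⟫ ≤ ‖y - (W 0).starProjection y‖ ^ 2} :=
      isClosed_le (by fun_prop) (by fun_prop)
    refine fun y hy => closure_minimal (fun y hy => ?_) hc hy
    obtain ⟨d, hd⟩ := (Submodule.mem_iSup_of_directed W hmono.directed_le).1 hy
    exact hA d _ (sub_mem hd (hmono d.zero_le (Submodule.starProjection_apply_mem _ _)))
      (Submodule.sub_starProjection_mem_orthogonal y)
  set p := M.starProjection x
  have hp : p ∈ M := Submodule.starProjection_apply_mem _ _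
  have hq : x - p ∈ Mᗮ := Submodule.sub_starProjection_mem_orthogonal x
  have hp0 : (W 0).starProjection p = 0 := by
    refine (Submodule.starProjection_apply_eq_zero_iff _).2 fun w hw => ?_
    have h1 := hq w (hM0 0 hw)
    rw [inner_sub_right, hx w hw] at h1
    linarith
  have h1 := hB p hp
  rw [hp0, sub_zero] at h1
  have h2 := hsplit hMinv hp hq h1 (hgap _ hq)
  rwa [add_sub_cancel] at h2

theorem norm_sub_starProjection_sq_le (V : Submodule ℝ H) [CompleteSpace V] (x : H) {s : H}
    (hs : s ∈ V) : ‖x - V.starProjection x‖ ^ 2 ≤ ‖x - s‖ ^ 2 := by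
  have h1 : ⟪V.starProjection x - s, x - V.starProjection x⟫ = 0 :=
    Submodule.sub_starProjection_mem_orthogonal x _
      (sub_mem (Submodule.starProjection_apply_mem _ _) hs)
  have h2 : x - s = (V.starProjection x - s) + (x - V.starProjection x) := by abel
  rw [h2, norm_add_sq_real, h1]
  nlinarith [sq_nonneg ‖V.starProjection x - s‖]

/-- A compact family in `V` is approximated by orthonormal systems in `V`. -/
theorem exists_orthonormal_approx {Y : Type*} {U : Y → H} {S : Set Y} {V : Submodule ℝ H}
    [CompleteSpace V] (hS : IsCompact ((fun y => V.starProjection (U y)) '' S)) {ε : ℝ}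
    (hε : 0 < ε) :
    ∃ (N : ℕ) (b : Fin N → H), Orthonormal ℝ b ∧ (∀ i, b i ∈ V) ∧
      ∀ y ∈ S, ‖U y‖ ^ 2 - ∑ i, ⟪b i, U y⟫ ^ 2 ≤ ‖U y - V.starProjection (U y)‖ ^ 2 + ε ^ 2 := by
  -- Centres `t` of an `ε`-cover of the compact projected family span a finite-dimensional `F ≤ V`,
  -- whose orthonormal basis is taken. Projecting to `F` is at least as good as moving to the
  -- nearest centre, and Pythagoras splits that distance along `V`.
  obtain ⟨t, hts, htf, htc⟩ := hS.finite_cover_balls hε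
  haveI : FiniteDimensional ℝ (Submodule.span ℝ t) := FiniteDimensional.span_of_finite ℝ htf
  set F := Submodule.span ℝ t
  have hFV : F ≤ V := Submodule.span_le.2 fun x hx => by
    obtain ⟨y, -, rfl⟩ := hts hx; exact Submodule.starProjection_apply_mem _ _
  let b := stdOrthonormalBasis ℝ F
  refine ⟨_, fun i => (b i : H), b.orthonormal.comp_linearIsometry F.subtypeₗᵢ,
    fun i => hFV (b i).2, fun y hy => ?_⟩
  obtain ⟨c, hc, hyc⟩ := mem_iUnion₂.1 (htc ⟨y, hy, rfl⟩)
  have hcF : c ∈ F := Submodule.subset_span hc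
  have h1 : ∑ i, ⟪(b i : H), U y⟫ ^ 2 = ‖F.starProjection (U y)‖ ^ 2 := by
    have h2 : ∀ i, ⟪(b i : H), U y⟫ = ⟪b i, F.orthogonalProjectionOnto (U y)⟫ := fun i => by
      have h3 : ⟪(b i : H), U y - F.starProjection (U y)⟫ = 0 :=
        Submodule.sub_starProjection_mem_orthogonal (U y) _ (b i).2
      rw [inner_sub_right] at h3
      exact sub_eq_zero.1 h3
    simp only [h2]
    exact b.sum_sq_inner_right (F.orthogonalProjectionOnto (U y))
  have h2 : ‖U y‖ ^ 2 = ‖F.starProjection (U y)‖ ^ 2 + ‖U y - F.starProjection (U y)‖ ^ 2 := by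
    have h3 : ⟪F.starProjection (U y), U y - F.starProjection (U y)⟫ = 0 :=
      Submodule.sub_starProjection_mem_orthogonal (U y) _ (Submodule.starProjection_apply_mem _ _)
    conv_lhs => rw [← add_sub_cancel (F.starProjection (U y)) (U y)]
    rw [norm_add_sq_real, h3]; ring
  have h3 := norm_sub_starProjection_sq_le F (U y) hcF
  have h4 : ‖U y - c‖ ^ 2 = ‖U y - V.starProjection (U y)‖ ^ 2 + ‖V.starProjection (U y) - c‖ ^ 2 := by
    have h5 : ⟪V.starProjection (U y) - c, U y - V.starProjection (U y)⟫ = 0 :=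
      Submodule.sub_starProjection_mem_orthogonal (U y) _
        (sub_mem (Submodule.starProjection_apply_mem _ _) (hFV hcF))
    have h6 : U y - c = (U y - V.starProjection (U y)) + (V.starProjection (U y) - c) := by abel
    rw [h6, norm_add_sq_real, real_inner_comm, h5]; ring
  have h5 : ‖V.starProjection (U y) - c‖ ^ 2 ≤ ε ^ 2 := by
    have := (mem_ball_iff_norm.1 hyc).le
    gcongr
  rw [h1]
  linarith

end Filtration

/-! ### The spectral gap of the suspension -/

namespace StratSpace

variable {k m : ℕ} {Z : StratSpace.{u} m}

theorem continuous_ridge (a : Euc k) (d : ℕ) : Continuous fun y : Euc k => ⟪a, y⟫ ^ d := by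
  fun_prop

theorem map_topologicalClosure_span_le {H : Type*} [NormedAddCommGroup H] [NormedSpace ℝ H]
    (L : H →L[ℝ] H) {S : Set H} {V : Submodule ℝ H} (hV : IsClosed (V : Set H))
    (h : ∀ x ∈ S, L x ∈ V) : ∀ x ∈ (Submodule.span ℝ S).topologicalClosure, L x ∈ V := by
  have h1 : (Submodule.span ℝ S).topologicalClosure ≤ V.comap L.toLinearMap :=
    Submodule.topologicalClosure_minimal _ (Submodule.span_le.2 h) (hV.preimage L.continuous)
  exact h1

variable (Z) in
/-- The closed span of the products `⟨a, y⟩ʲ ⊗ b`, `j ≤ d`, with `b` in the kernel of `Δ_Z`. -/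
noncomputable def ridgeFiltration (k : ℕ) (hm : 1 ≤ m) (d : ℕ) :
    Submodule ℝ (Lp ℝ 2 (suspVol k Z)) :=
  (Submodule.span ℝ {x | ∃ j ≤ d, ∃ a : Euc k, ∃ b ∈ fixedSpace Z.isDirichletSpace.resolvent,
    x = suspTensor (ballLp hm (continuous_ridge a j)) b}).topologicalClosure

theorem isClosed_ridgeFiltration (hm : 1 ≤ m) (d : ℕ) :
    IsClosed (Z.ridgeFiltration k hm d : Set (Lp ℝ 2 (suspVol k Z))) :=
  Submodule.isClosed_topologicalClosure _

theorem ridgeFiltration_mono (hm : 1 ≤ m) : Monotone (Z.ridgeFiltration k hm) := fun d d' hd =>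
  Submodule.topologicalClosure_mono (Submodule.span_mono fun _ ⟨j, hj, h⟩ => ⟨j, hj.trans hd, h⟩)

theorem suspTensor_mem_ridgeFiltration (hm : 1 ≤ m) {j d : ℕ} (hj : j ≤ d) (a : Euc k)
    {b : Lp ℝ 2 Z.regVol} (hb : b ∈ fixedSpace Z.isDirichletSpace.resolvent) :
    suspTensor (ballLp hm (continuous_ridge a j)) b ∈ Z.ridgeFiltration k hm d :=
  Submodule.le_topologicalClosure _ (Submodule.subset_span ⟨j, hj, a, b, hb, rfl⟩)

/-- The eigenvalues of the unit sphere. -/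
def sphEigenvalue (k m d : ℕ) : ℝ := d * (d + k + m - 1)

/-- Separation of variables for `⟨a, y⟩ ^ d` and an element of the kernel of `Δ_Z`. The failure to
be an eigenfunction has degree `d - 2`, so the operator is triangular for the degree. -/
theorem resolvent_ridge (hm : 1 ≤ m) (d : ℕ) (a : Euc k) {b : Lp ℝ 2 Z.regVol}
    (hb : b ∈ fixedSpace Z.isDirichletSpace.resolvent) :
    (1 + sphEigenvalue k m d) • (isDirichletSpace_susp hm).resolvent
        (suspTensor (ballLp hm (continuous_ridge a d)) b) -
      suspTensor (ballLp hm (continuous_ridge a d)) b =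
      (d * ((d - 1 : ℕ) : ℝ) * ‖a‖ ^ 2) • (isDirichletSpace_susp hm).resolvent
        (suspTensor (ballLp hm (continuous_ridge a (d - 2))) b) := by
  have h := isSphSolution_ridge (k := k) m d a
  have h1 := resolvent_suspTensor (Z := Z) hm h (f := b)
    (by rw [add_zero, one_smul]; exact mem_fixedSpace.1 hb)
  have h2 : ballLp hm h.continuous_rhs = sphEigenvalue k m d • ballLp hm (continuous_ridge a d) -
      (d * ((d - 1 : ℕ) : ℝ) * ‖a‖ ^ 2) • ballLp hm (continuous_ridge a (d - 2)) := rfl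
  rw [h2] at h1
  simp only [map_add, map_sub, map_smul, LinearMap.sub_apply, LinearMap.smul_apply] at h1
  rw [sub_eq_iff_eq_add]
  have h3 : ballLp hm h.continuous = ballLp hm (continuous_ridge a d) := rfl
  rw [h3] at h1
  rw [add_smul, one_smul]
  nth_rewrite 3 [← h1]
  abel

/-- Strong induction on the degree: `resolvent_ridge` expresses `R` of a power through that power
and `R` of a lower one, after division by `1 + λ_j > 0`. -/
theorem resolvent_mem_ridgeFiltration (hm : 1 ≤ m) (d : ℕ) :
    ∀ x ∈ Z.ridgeFiltration k hm d,
      (isDirichletSpace_susp hm).resolvent x ∈ Z.ridgeFiltration k hm d := by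
  have key : ∀ (j : ℕ) (a : Euc k), ∀ b ∈ fixedSpace Z.isDirichletSpace.resolvent,
      (isDirichletSpace_susp hm).resolvent (suspTensor (ballLp hm (continuous_ridge a j)) b) ∈
        Z.ridgeFiltration k hm j := fun j => by
    induction j using Nat.strong_induction_on with
    | _ j ih =>
      intro a b hb
      have h1 := resolvent_ridge hm j a hb
      have h2 : (1 + sphEigenvalue k m j) ≠ 0 := by
        have : (1 : ℝ) ≤ m := by exact_mod_cast hm
        have h3 : 0 ≤ (j : ℝ) * (j + k + m - 1) :=
          mul_nonneg (by positivity) (by have : (0 : ℝ) ≤ j + k := by positivity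
                                         linarith)
        have : 0 < 1 + sphEigenvalue k m j := by unfold sphEigenvalue; linarith
        exact this.ne'
      rw [sub_eq_iff_eq_add] at h1
      rw [← Submodule.smul_mem_iff _ h2, h1]
      refine add_mem ?_ (suspTensor_mem_ridgeFiltration hm le_rfl a hb)
      rcases lt_or_ge j 2 with hj | hj
      · have : (j : ℝ) * ((j - 1 : ℕ) : ℝ) = 0 := by interval_cases j <;> simp
        rw [this, zero_mul, zero_smul]
        exact zero_mem _
      · exact Submodule.smul_mem _ _ (ridgeFiltration_mono hm (by lia) (ih (j - 2) (by lia) a b hb))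
  refine map_topologicalClosure_span_le _ (isClosed_ridgeFiltration hm d) ?_
  rintro _ ⟨j, hj, a, b, hb, rfl⟩
  exact ridgeFiltration_mono hm hj (key j a b hb)

theorem resolvent_sub_mem_ridgeFiltration (hm : 1 ≤ m) (d : ℕ) :
    ∀ x ∈ Z.ridgeFiltration k hm (d + 1), (1 + sphEigenvalue k m (d + 1)) •
      (isDirichletSpace_susp hm).resolvent x - x ∈ Z.ridgeFiltration k hm d := by
  refine map_topologicalClosure_span_le ((1 + sphEigenvalue k m (d + 1)) •
    (isDirichletSpace_susp hm).resolvent - ContinuousLinearMap.id ℝ _)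
    (isClosed_ridgeFiltration hm d) ?_
  rintro _ ⟨j, hj, a, b, hb, rfl⟩
  simp only [sub_apply, smul_apply, ContinuousLinearMap.id_apply]
  rcases Nat.lt_or_ge d j with h | h
  · obtain rfl : j = d + 1 := le_antisymm hj h
    rw [resolvent_ridge hm (d + 1) a hb]
    rcases d with - | d
    · simp
    · exact Submodule.smul_mem _ _ (resolvent_mem_ridgeFiltration hm _ _
        (suspTensor_mem_ridgeFiltration hm (by lia) a hb))
  · have h1 := suspTensor_mem_ridgeFiltration (Z := Z) hm h a hb
    exact sub_mem (Submodule.smul_mem _ _ (resolvent_mem_ridgeFiltration hm d _ h1)) h1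

theorem resolvent_eq_of_mem_ridgeFiltration_zero (hm : 1 ≤ m) :
    ∀ x ∈ Z.ridgeFiltration k hm 0, (isDirichletSpace_susp hm).resolvent x = x := by
  intro x hx
  have h := map_topologicalClosure_span_le ((isDirichletSpace_susp hm).resolvent -
    ContinuousLinearMap.id ℝ (Lp ℝ 2 (suspVol k Z))) (V := ⊥)
    (by simp) ?_ x hx
  · exact sub_eq_zero.1 ((Submodule.mem_bot ℝ).1 h)
  · rintro _ ⟨j, hj, a, b, hb, rfl⟩
    obtain rfl : j = 0 := Nat.le_zero.1 hj
    have h1 := resolvent_ridge hm 0 a hb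
    simp only [sphEigenvalue, Nat.cast_zero, zero_mul, add_zero, one_smul, zero_smul] at h1
    exact (Submodule.mem_bot ℝ).2 h1

/-- The closure of the union of the filtration. -/
theorem suspTensor_mem_closure (hm : 1 ≤ m) {φ : Euc k → ℝ} (hφ : Continuous φ)
    {b : Lp ℝ 2 Z.regVol} (hb : b ∈ fixedSpace Z.isDirichletSpace.resolvent) :
    suspTensor (ballLp hm hφ) b ∈ (⨆ d, Z.ridgeFiltration k hm d).topologicalClosure := by
  set M := (⨆ d, Z.ridgeFiltration k hm d).topologicalClosure
  have h1 : ∀ p ∈ ridgeSpan k, ∃ hp : Continuous p, suspTensor (ballLp hm hp) b ∈ M := by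
    intro p hp
    induction hp using Submodule.span_induction with
    | mem p hp =>
      obtain ⟨d, a, rfl⟩ := hp
      exact ⟨continuous_ridge a d, Submodule.le_topologicalClosure _ (le_iSup
        (Z.ridgeFiltration k hm) d (suspTensor_mem_ridgeFiltration hm le_rfl a hb))⟩
    | zero =>
      refine ⟨continuous_const, ?_⟩
      have : ballLp hm (continuous_const : Continuous (0 : Euc k → ℝ)) = 0 := rfl
      rw [this, map_zero]; exact zero_mem _
    | add p q _ _ hp hq =>
      obtain ⟨hp, hp'⟩ := hp
      obtain ⟨hq, hq'⟩ := hq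
      refine ⟨hp.add hq, ?_⟩
      have : ballLp hm (hp.add hq) = ballLp hm hp + ballLp hm hq := rfl
      rw [this, map_add]; exact add_mem hp' hq'
    | smul c p _ hp =>
      obtain ⟨hp, hp'⟩ := hp
      refine ⟨hp.const_smul c, ?_⟩
      have : ballLp hm (hp.const_smul c) = c • ballLp hm hp := rfl
      rw [this, map_smul]; exact Submodule.smul_mem _ _ hp'
  have hM : IsClosed (M : Set (Lp ℝ 2 (suspVol k Z))) := Submodule.isClosed_topologicalClosure _
  refine hM.closure_subset (Metric.mem_closure_iff.2 fun ε hε => ?_)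
  set B := (ballVol k m).real univ
  have hB : 0 ≤ B := measureReal_nonneg
  set c := ε / ((B + 1) * (‖b‖ + 1))
  have hc : 0 < c := by positivity
  obtain ⟨p, hp, hpφ⟩ := exists_ridge_approx hφ hc
  obtain ⟨hpc, hpM⟩ := h1 p hp
  refine ⟨_, hpM, ?_⟩
  have h2 : ballLp hm hφ - ballLp hm hpc = ballLp hm (hφ.sub hpc) := rfl
  rw [dist_eq_norm, ← LinearMap.sub_apply, ← map_sub, h2, norm_suspTensor]
  have h3 := norm_ballLp_le hm (hφ.sub hpc) (c := c) fun y hy => (hpφ y hy).le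
  have h4 : ‖ballLp hm (hφ.sub hpc)‖ ≤ c * (B + 1) := by
    refine (sq_le_sq₀ (norm_nonneg _) (by positivity)).1 ?_
    refine h3.trans ?_
    rw [mul_pow]
    refine mul_le_mul_of_nonneg_left ?_ (by positivity)
    change B ≤ _
    nlinarith
  calc _ ≤ c * (B + 1) * ‖b‖ := by gcongr
    _ < c * (B + 1) * (‖b‖ + 1) := by
        refine mul_lt_mul_of_pos_left (by linarith) (by positivity)
    _ = ε := by simp only [c]; field_simp

/-- The slices form a compact family, so one finite orthonormal system `bᵢ` in `K` nearly computes
all their projections to `K`. The finite sum of `⟨bᵢ, u(y)⟩ ⊗ bᵢ` lies in `M` and its distance to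
`u` bounds the distance to `M`, up to an arbitrary `ε`. -/
theorem SuspTest.norm_sub_starProjection_sq_le (hm : 1 ≤ m) {u : Euc k × Z.Reg → ℝ}
    (hu : SuspTest k Z u) (M : Submodule ℝ (Lp ℝ 2 (suspVol k Z))) [CompleteSpace M]
    {K : Submodule ℝ (Lp ℝ 2 Z.regVol)} [CompleteSpace K]
    (hM : ∀ (φ : Euc k → ℝ) (hφ : Continuous φ), ∀ b ∈ K, suspTensor (ballLp hm hφ) b ∈ M) :
    ‖(isDirichletSpace_susp hm).toLp hu.toTest -
      M.starProjection ((isDirichletSpace_susp hm).toLp hu.toTest)‖ ^ 2 ≤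
      ∫ y, ‖hu.slice y - K.starProjection (hu.slice y)‖ ^ 2 ∂(ballVol k m) := by
  haveI := isFiniteMeasure_ballVol (k := k) hm
  set B := (ballVol k m).real univ
  have hB : 0 ≤ B := measureReal_nonneg
  set x := (isDirichletSpace_susp hm).toLp hu.toTest
  have hsl := hu.continuous_slice
  have hint : ∀ {F : Euc k → ℝ}, Continuous F → Integrable F (ballVol k m) := fun {F} hF =>
    (memLp_ballVol hm hF).integrable (by norm_num)
  refine le_of_forall_pos_le_add fun ε hε => ?_
  -- Chosen so that the pointwise error `η²`, integrated over total mass `B`, is at most `ε`.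
  set η := √(ε / (B + 1))
  have hη : 0 < η := Real.sqrt_pos.2 (by positivity)
  obtain ⟨N, b, hb, hbK, hbU⟩ := exists_orthonormal_approx (U := hu.slice) (V := K)
    (S := Metric.closedBall (0 : Euc k) 1)
    ((isCompact_closedBall _ _).image (by fun_prop)) hη
  set c : Fin N → Euc k → ℝ := fun i y => ⟪b i, hu.slice y⟫
  have hc : ∀ i, Continuous (c i) := fun i => by fun_prop
  set s := ∑ i, suspTensor (ballLp hm (hc i)) (b i)
  have hs : s ∈ M := sum_mem fun i _ => hM _ (hc i) _ (hbK i)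
  refine (_root_.norm_sub_starProjection_sq_le M x hs).trans ?_
  have h1 : ⟪s, x⟫ = ∑ i, ∫ y, c i y ^ 2 ∂(ballVol k m) := by
    rw [sum_inner]
    refine Finset.sum_congr rfl fun i _ => ?_
    rw [hu.inner_suspTensor_toLp]
    simp only [pow_two, c]
  have h2 : ‖s‖ ^ 2 = ∑ i, ∫ y, c i y ^ 2 ∂(ballVol k m) := by
    rw [← real_inner_self_eq_norm_sq, sum_inner]
    refine Finset.sum_congr rfl fun i _ => ?_
    rw [inner_sum, Finset.sum_eq_single i]
    · rw [inner_suspTensor, inner_ballLp, real_inner_self_eq_norm_sq, hb.1 i]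
      simp only [pow_two, mul_one]
    · intro j _ hj
      rw [inner_suspTensor, hb.2 hj.symm, mul_zero]
    · simp
  rw [norm_sub_sq_real, real_inner_comm, h1, h2, hu.norm_sq_toLp hm,
    ← integral_finsetSum (f := fun i y => c i y ^ 2) _ fun i _ => hint ((hc i).pow 2)]
  have h3 : ∫ y, ‖hu.slice y‖ ^ 2 ∂(ballVol k m) - ∫ y, ∑ i, c i y ^ 2 ∂(ballVol k m) ≤
      ∫ y, ‖hu.slice y - K.starProjection (hu.slice y)‖ ^ 2 ∂(ballVol k m) + B * η ^ 2 := by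
    have h4 : B * η ^ 2 = ∫ _, η ^ 2 ∂(ballVol k m) := by rw [integral_const, smul_eq_mul]
    rw [h4, ← integral_sub (hint (by fun_prop)) (hint (by fun_prop)),
      ← integral_add (hint (by fun_prop)) (integrable_const _)]
    refine integral_mono_ae (hint (by fun_prop)) (hint (by fun_prop)) ?_
    filter_upwards [ae_mem_ball_ballVol m] with y hy
    exact hbU y (Metric.ball_subset_closedBall hy)
  have h5 : B * η ^ 2 ≤ ε := by
    rw [Real.sq_sqrt (by positivity), mul_div_assoc', div_le_iff₀ (by positivity)]
    nlinarith
  linarith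

/-- The first nonzero eigenvalue of the suspension, given an eigenfunction. -/
theorem isSuspLambdaOne_of_eigenfunction (hm : 1 ≤ m) {lam γ : ℝ} (hlam : Z.IsLambdaOne lam)
    (hγ0 : 0 < γ) (hγ1 : γ ≤ 1) (hγ : γ * (γ + m - 1) ≤ lam) {f : Lp ℝ 2 (suspVol k Z)}
    (hf0 : f ≠ 0)
    (hf : (1 + γ * (k + m - 1 + γ)) • (isDirichletSpace_susp hm).resolvent f = f) :
    Z.IsSuspLambdaOne k (γ * (k + m - 1 + γ)) := by
  obtain ⟨-, -, hgap⟩ := Z.isDirichletSpace.gap_of_isFirstNonzeroEigenvalue hlam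
  set Lam := γ * (k + m - 1 + γ)
  have hm1 : (1 : ℝ) ≤ m := by exact_mod_cast hm
  have hk0 : (0 : ℝ) ≤ k := by positivity
  have hLam : 0 < Lam := mul_pos hγ0 (by linarith)
  have hS := isDirichletSpace_susp (k := k) (Z := Z) hm
  haveI : CompleteSpace (Z.ridgeFiltration k hm 0) :=
    (isClosed_ridgeFiltration hm 0).completeSpace_coe
  refine hS.isFirstNonzeroEigenvalue_of hLam (Z.ridgeFiltration k hm 0)
    (resolvent_eq_of_mem_ridgeFiltration_zero hm) (fun x hx => ?_) hf0 hf
  refine inner_map_le_of_filtration hS.isFormResolvent.symm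
    (fun x => (sq_nonneg _).trans (hS.norm_resolvent_sq_le x)) (Z.ridgeFiltration k hm)
    (ridgeFiltration_mono hm) (isClosed_ridgeFiltration hm) (resolvent_mem_ridgeFiltration hm)
    (lam := sphEigenvalue k m) (fun d => ?_) (resolvent_sub_mem_ridgeFiltration hm)
    (fun y hy => ?_) hx
  -- As `γ ≤ 1`, `γ (k + m - 1 + γ) ≤ k + m ≤ (d + 1) (d + k + m)`, the eigenvalue of degree `d +
  -- 1`.
  · have hd : (0 : ℝ) ≤ d := by positivity
    simp only [sphEigenvalue, Lam]
    push_cast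
    nlinarith
  · set M := (⨆ d, Z.ridgeFiltration k hm d).topologicalClosure
    haveI : CompleteSpace M := (Submodule.isClosed_topologicalClosure _).completeSpace_coe
    have hRy : hS.resolvent y ∈ Mᗮ := fun w hw => by
      rw [← hS.isFormResolvent.symm]
      refine hy _ ?_
      have h1 : M ≤ M.comap hS.resolvent.toLinearMap :=
        Submodule.topologicalClosure_minimal _ (iSup_le fun d y hy =>
          Submodule.le_topologicalClosure _ (le_iSup (Z.ridgeFiltration k hm) d
            (resolvent_mem_ridgeFiltration hm d y hy)))
          ((Submodule.isClosed_topologicalClosure _).preimage hS.resolvent.continuous)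
      exact h1 hw
    obtain ⟨u, hu1, hu2, -, -⟩ := hS.isFormResolvent.approx y
    -- `M` contains every `φ ⊗ b` with `b` in the kernel of `Δ_Z`, so the distance to `M` is at most
    -- the fibrewise distance to that kernel, and the ground state bound applies. In the limit `R y`
    -- is itself orthogonal to `M`.
    have h2 : ∀ n, Lam * ‖hS.toLp (u n) - M.starProjection (hS.toLp (u n))‖ ^ 2 ≤
        hS.form (u n) (u n) := fun n => by
      have hun : SuspTest k Z (u n).1 := (u n).2
      have h3 := hun.norm_sub_starProjection_sq_le hm M
        (K := fixedSpace Z.isDirichletSpace.resolvent)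
        fun φ hφ b hb => suspTensor_mem_closure hm hφ hb
      exact (mul_le_mul_of_nonneg_left h3 hLam.le).trans
        (hun.le_dirichletForm_susp hm hγ (fixedSpace Z.isDirichletSpace.resolvent) hgap)
    have h4 : Tendsto (fun n => Lam * ‖hS.toLp (u n) - M.starProjection (hS.toLp (u n))‖ ^ 2) atTop
        (𝓝 (Lam * ‖hS.resolvent y‖ ^ 2)) := by
      have h5 := ((hu1.sub ((M.starProjection.continuous.tendsto _).comp hu1)).norm.pow 2).const_mul
        Lam
      rw [(Submodule.starProjection_apply_eq_zero_iff M).2 hRy, sub_zero] at h5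
      exact h5
    have h6 : Lam * ‖hS.resolvent y‖ ^ 2 ≤ ⟪hS.resolvent y, y⟫ - ‖hS.resolvent y‖ ^ 2 :=
      le_of_tendsto_of_tendsto' h4 hu2 h2
    have h7 := real_inner_le_norm (hS.resolvent y) y
    rcases eq_or_lt_of_le (norm_nonneg (hS.resolvent y)) with h8 | h8
    · have : hS.resolvent y = 0 := norm_eq_zero.1 h8.symm
      rw [this]; simp
    · have h9 : (1 + Lam) * ‖hS.resolvent y‖ ≤ ‖y‖ := by
        refine le_of_mul_le_mul_right ?_ h8
        nlinarith
      nlinarith [norm_nonneg y]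

end StratSpace

/-! ### Comparison of determinants -/

section Det

open Matrix

/-- Every eigenvalue is at least one: evaluate `M - 1 ≥ 0` on a unit eigenvector. -/
theorem Matrix.one_le_det_of_posSemidef_sub_one {ι : Type*} [Fintype ι] [DecidableEq ι]
    {M : Matrix ι ι ℝ} (h : (M - 1).PosSemidef) : 1 ≤ M.det := by
  have hM : M.IsHermitian := by
    have h1 := h.1.add (isHermitian_one (n := ι) (α := ℝ))
    simpa using h1
  rw [hM.det_eq_prod_eigenvalues]
  refine Finset.one_le_prod fun i => ?_
  have h1 := hM.mulVec_eigenvectorBasis i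
  have h2 := h.dotProduct_mulVec_nonneg (hM.eigenvectorBasis i).ofLp
  rw [sub_mulVec, one_mulVec, h1, dotProduct_sub, dotProduct_smul] at h2
  have h3 : star (hM.eigenvectorBasis i).ofLp ⬝ᵥ (hM.eigenvectorBasis i).ofLp = 1 := by
    have h4 := hM.eigenvectorBasis.orthonormal.1 i
    have h5 := EuclideanSpace.inner_eq_star_dotProduct (𝕜 := ℝ) (hM.eigenvectorBasis i)
      (hM.eigenvectorBasis i)
    rw [real_inner_self_eq_norm_sq, h4] at h5
    simpa [dotProduct_comm] using h5.symm
  rw [h3] at h2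
  simpa using h2

open scoped MatrixOrder in
-- Writing `A = Sᴴ S` and conjugating by `S⁻¹` reduces to `A = 1`.
theorem Matrix.PosDef.det_le_det {ι : Type*} [Fintype ι] [DecidableEq ι] {A B : Matrix ι ι ℝ}
    (hA : A.PosDef) (hAB : (B - A).PosSemidef) : A.det ≤ B.det := by
  obtain ⟨S, hS⟩ := CStarAlgebra.nonneg_iff_eq_star_mul_self.mp hA.posSemidef.nonneg
  rw [star_eq_conjTranspose] at hS
  have hd : A.det = S.det * S.det := by rw [hS, det_mul, det_conjTranspose]; simp
  have hu : IsUnit S.det := by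
    have := hA.det_pos
    rw [hd] at this
    exact isUnit_iff_ne_zero.2 fun h => by simp [h] at this
  have hM : ((S⁻¹)ᴴ * B * S⁻¹ - 1).PosSemidef := by
    have h1 := hAB.conjTranspose_mul_mul_same S⁻¹
    have h2 : (S⁻¹)ᴴ * (B - A) * S⁻¹ = (S⁻¹)ᴴ * B * S⁻¹ - 1 := by
      rw [Matrix.mul_sub, Matrix.sub_mul, hS]
      congr 1
      rw [← Matrix.mul_assoc, ← conjTranspose_mul, mul_nonsing_inv _ hu, conjTranspose_one,
        Matrix.one_mul, mul_nonsing_inv _ hu]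
    rwa [h2] at h1
  have h3 := one_le_det_of_posSemidef_sub_one hM
  rw [det_mul, det_mul, det_conjTranspose, det_nonsing_inv, Ring.inverse_eq_inv'] at h3
  rw [hd]
  have h4 : 0 < S.det * S.det := by
    exact mul_self_pos.2 hu.ne_zero
  have h5 : star (S.det)⁻¹ * B.det * (S.det)⁻¹ = B.det / (S.det * S.det) := by
    simp; field_simp
  rw [h5, le_div_iff₀ h4] at h3
  linarith

end Det

/-! ### Linear coordinates on `ℝʲ × ℝ × ℝˡ` and the determinant of the model metric. -/

section ConeCoord

variable {n j l : ℕ} (σ : Fin j ⊕ (Unit ⊕ Fin l) ≃ Fin n)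

/-- Linear coordinates on the product `ℝʲ × ℝ × ℝˡ`. -/
noncomputable def coneCoord : (Euc j × ℝ × Euc l) ≃L[ℝ] Euc n :=
  LinearEquiv.toContinuousLinearEquiv
    { toFun := fun q => WithLp.toLp 2 fun i =>
        Sum.elim q.1.ofLp (Sum.elim (fun _ => q.2.1) q.2.2.ofLp) (σ.symm i)
      invFun := fun p => (WithLp.toLp 2 fun a => p (σ (.inl a)), p (σ (.inr (.inl ()))),
        WithLp.toLp 2 fun b => p (σ (.inr (.inr b))))
      map_add' := fun p q => by
        ext i
        rcases h : σ.symm i with a | a | a <;> simp [h]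
      map_smul' := fun c q => by
        ext i
        rcases h : σ.symm i with a | a | a <;> simp [h]
      left_inv := fun q => by simp
      right_inv := fun p => by
        ext i
        obtain ⟨a, rfl⟩ := σ.surjective i
        rcases a with a | a | a <;> simp }

open Matrix in
-- The right side is the determinant of `c` times the block diagonal matrix with blocks `1`, `1`,
-- `r² Q`; monotonicity of determinants applies.
theorem det_le_of_coneCoord {G : Matrix (Fin n) (Fin n) ℝ} (hG : G.PosDef)
    {Q : Matrix (Fin l) (Fin l) ℝ} (hQ : Q.IsHermitian) {c r : ℝ}
    (h : ∀ q : Euc j × ℝ × Euc l, (coneCoord σ q).ofLp ⬝ᵥ G *ᵥ (coneCoord σ q).ofLp ≤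
      c * (‖q.1‖ ^ 2 + q.2.1 ^ 2 + r ^ 2 * (q.2.2.ofLp ⬝ᵥ Q *ᵥ q.2.2.ofLp))) :
    G.det ≤ c ^ n * ((r ^ l) ^ 2 * Q.det) := by
  set B₀ : Matrix (Fin j ⊕ (Unit ⊕ Fin l)) (Fin j ⊕ (Unit ⊕ Fin l)) ℝ :=
    fromBlocks 1 0 0 (fromBlocks 1 0 0 (r ^ 2 • Q)) with hB₀
  set B : Matrix (Fin n) (Fin n) ℝ := c • reindex σ σ B₀ with hB
  have hdet : B.det = c ^ n * ((r ^ l) ^ 2 * Q.det) := by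
    rw [hB, det_smul, det_reindex_self, hB₀, det_fromBlocks_zero₂₁, det_fromBlocks_zero₂₁,
      det_smul]
    simp [← pow_mul, mul_comm]
  have hB₀h : B₀.IsHermitian := by
    refine IsHermitian.fromBlocks isHermitian_one (by simp) ?_
    refine IsHermitian.fromBlocks isHermitian_one (by simp) ?_
    ext a b
    have := congrFun (congrFun hQ a) b
    simp at this
    simp [this]
  have hBh : B.IsHermitian := by
    have h1 := hB₀h.submatrix σ.symm
    ext a b
    have := congrFun (congrFun h1 a) b
    simp at this
    simp [hB, this]
  rw [← hdet]
  refine hG.det_le_det (PosSemidef.of_dotProduct_mulVec_nonneg (hBh.sub hG.1) fun x => ?_)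
  set q := (coneCoord σ).symm (WithLp.toLp 2 x) with hq
  have hx : (coneCoord σ q).ofLp = x := by simp [hq]
  have h1 := h q
  rw [hx] at h1
  rw [sub_mulVec, dotProduct_sub]
  have h2 : star x ⬝ᵥ B *ᵥ x = c * (‖q.1‖ ^ 2 + q.2.1 ^ 2 +
      r ^ 2 * (q.2.2.ofLp ⬝ᵥ Q *ᵥ q.2.2.ofLp)) := by
    have h3 : x = Sum.elim q.1.ofLp (Sum.elim (fun _ => q.2.1) q.2.2.ofLp) ∘ σ.symm := by
      rw [← hx]; rfl
    rw [hB, smul_mulVec, dotProduct_smul, reindex_apply, h3]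
    simp only [star_trivial]
    rw [submatrix_mulVec_equiv, dotProduct_comp_equiv_symm]
    have h4 : ∀ v : Fin j ⊕ (Unit ⊕ Fin l) → ℝ, (v ∘ ⇑σ.symm) ∘ ⇑σ.symm.symm = v := fun v => by
      ext; simp
    have h5 : ∀ v : Fin j ⊕ (Unit ⊕ Fin l) → ℝ, (v ∘ ⇑σ.symm) ∘ ⇑σ = v := fun v => by
      ext; simp
    rw [h4, h5, hB₀, fromBlocks_mulVec]
    simp only [Sum.elim_comp_inl, Sum.elim_comp_inr, sumElim_dotProduct_sumElim,
      fromBlocks_mulVec, one_mulVec, zero_mulVec, add_zero, zero_add, smul_mulVec,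
      dotProduct_smul, smul_eq_mul]
    congr 1
    rw [EuclideanSpace.real_norm_sq_eq]
    simp [dotProduct, pow_two, add_assoc]
  rw [h2]
  simp only [star_trivial]
  linarith

end ConeCoord

/-! ### Volumes in product charts -/

theorem OpenPartialHomeomorph.measurableSet_image {M N : Type*} [TopologicalSpace M]
    [MeasurableSpace M] [BorelSpace M] [TopologicalSpace N] [MeasurableSpace N] [BorelSpace N]
    (e : OpenPartialHomeomorph M N) {S : Set M} (hS : MeasurableSet S) (hSe : S ⊆ e.source) :
    MeasurableSet (e '' S) := by
  have h1 : e '' S = Subtype.val '' (e.target.domRestrict e.symm ⁻¹' S) := by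
    ext x
    constructor
    · rintro ⟨s, hs, rfl⟩
      exact ⟨⟨e s, e.map_source (hSe hs)⟩, by simpa [e.left_inv (hSe hs)] using hs, rfl⟩
    · rintro ⟨⟨x, hx⟩, hxs, rfl⟩
      exact ⟨e.symm x, hxs, e.right_inv hx⟩
  rw [h1]
  exact e.open_target.measurableSet.subtype_image
    ((continuousOn_iff_continuous_domRestrict.1 e.symm.continuousOn).measurable hS)

theorem IsInnerForm.dotProduct_gram_mulVec {V : Type*} [AddCommGroup V] [Module ℝ V]
    {g : V → V → ℝ} (hg : IsInnerForm g) {n : ℕ} (D : (Fin n → ℝ) →ₗ[ℝ] V) (x : Fin n → ℝ) :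
    x ⬝ᵥ (Matrix.of fun i j => g (D (Pi.single i 1)) (D (Pi.single j 1))).mulVec x =
      g (D x) (D x) := by
  have hx : D x = ∑ i, x i • D (Pi.single i 1) := by
    conv_lhs => rw [pi_eq_sum_univ' x]
    rw [map_sum]
    refine Finset.sum_congr rfl fun i _ => ?_
    rw [map_smul]
  rw [← hg.toBilin_apply, hx]
  simp only [map_sum, LinearMap.sum_apply, map_smul, LinearMap.smul_apply, dotProduct,
    Matrix.mulVec, Matrix.of_apply, smul_eq_mul, hg.toBilin_apply, Finset.mul_sum]
  rw [Finset.sum_comm]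
  refine Finset.sum_congr rfl fun i _ => Finset.sum_congr rfl fun k _ => ?_
  ring

namespace StratSpace

section Gram

variable {n : ℕ} {X : StratSpace.{u} n}

theorem dotProduct_gram_mulVec (e : OpenPartialHomeomorph X.Reg (Euc n)) (p v : Euc n) :
    v.ofLp ⬝ᵥ (X.gram e p).mulVec v.ofLp = X.g (e.symm p)
      (mfderiv 𝓘(ℝ, Euc n) 𝓘(ℝ, Euc n) e.symm p v) (mfderiv 𝓘(ℝ, Euc n) 𝓘(ℝ, Euc n) e.symm p v) :=
  (X.isInnerForm_g (e.symm p)).dotProduct_gram_mulVec (frame e p) v.ofLp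

theorem isHermitian_gram (e : OpenPartialHomeomorph X.Reg (Euc n)) (p : Euc n) :
    (X.gram e p).IsHermitian := by
  ext i j
  exact (X.isInnerForm_g (e.symm p)).symm _ _

theorem posDef_gram {e : OpenPartialHomeomorph X.Reg (Euc n)}
    (he : e ∈ IsManifold.maximalAtlas 𝓘(ℝ, Euc n) ∞ X.Reg) {p : Euc n} (hp : p ∈ e.target) :
    (X.gram e p).PosDef := by
  refine Matrix.PosDef.of_dotProduct_mulVec_pos (isHermitian_gram e p) fun x hx => ?_
  have h1 := dotProduct_gram_mulVec (X := X) e p (WithLp.toLp 2 x)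
  refine lt_of_lt_of_eq ?_ h1.symm
  refine (X.isInnerForm_g (e.symm p)).pos _ fun h0 => hx ?_
  exact (frame_bijective he hp).1 (h0.trans (map_zero (frame e p)).symm)

end Gram

/-! ### Volume estimates in cone charts. -/

section ProductChart

variable {n j l : ℕ} {X : StratSpace.{u} n} {L : StratSpace.{u} l}

variable (σ : Fin j ⊕ (Unit ⊕ Fin l) ≃ Fin n)
  (ψ : PartialDiffeomorph (𝓘(ℝ, Euc j).prod (𝓘(ℝ, ℝ).prod 𝓘(ℝ, Euc l))) 𝓘(ℝ, Euc n)
      (Euc j × ℝ × L.Reg) X.Reg ∞)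
  (e : OpenPartialHomeomorph L.Reg (Euc l))

/-- The product of a chart of the link with linear coordinates. -/
noncomputable def linkChart : OpenPartialHomeomorph (Euc j × ℝ × L.Reg) (Euc j × ℝ × Euc l) :=
  (OpenPartialHomeomorph.refl (Euc j)).prod ((OpenPartialHomeomorph.refl ℝ).prod e)

/-- The chart of `X` induced by a chart of the link. -/
noncomputable def productChart : OpenPartialHomeomorph X.Reg (Euc n) :=
  ψ.toOpenPartialHomeomorph.symm.trans ((linkChart e).trans
    (coneCoord σ).toHomeomorph.toOpenPartialHomeomorph)

theorem productChart_apply (x : X.Reg) : productChart σ ψ e x =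
    coneCoord σ ((ψ.symm x).1, (ψ.symm x).2.1, e (ψ.symm x).2.2) := rfl

theorem productChart_symm_apply (p : Euc n) : (productChart σ ψ e).symm p =
    ψ (((coneCoord σ).symm p).1, ((coneCoord σ).symm p).2.1,
      e.symm ((coneCoord σ).symm p).2.2) := rfl

theorem mem_productChart_source {x : X.Reg} : x ∈ (productChart σ ψ e).source ↔
    x ∈ ψ.target ∧ (ψ.symm x).2.2 ∈ e.source := by
  simp [productChart, linkChart]

theorem mem_productChart_target {p : Euc n} : p ∈ (productChart σ ψ e).target ↔
    ((coneCoord σ).symm p).2.2 ∈ e.target ∧ (((coneCoord σ).symm p).1,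
      ((coneCoord σ).symm p).2.1, e.symm ((coneCoord σ).symm p).2.2) ∈ ψ.source := by
  simp [productChart, linkChart]

theorem contMDiff_coneCoord :
    ContMDiff (𝓘(ℝ, Euc j).prod (𝓘(ℝ, ℝ).prod 𝓘(ℝ, Euc l))) 𝓘(ℝ, Euc n) ∞ (coneCoord σ) := by
  have h1 : (coneCoord σ : Euc j × ℝ × Euc l → Euc n) = fun q =>
      ((coneCoord σ).toContinuousLinearMap ∘L ContinuousLinearMap.inl ℝ (Euc j) (ℝ × Euc l)) q.1 +
      (((coneCoord σ).toContinuousLinearMap ∘L ContinuousLinearMap.inr ℝ (Euc j) (ℝ × Euc l) ∘L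
        ContinuousLinearMap.inl ℝ ℝ (Euc l)) q.2.1 +
      ((coneCoord σ).toContinuousLinearMap ∘L ContinuousLinearMap.inr ℝ (Euc j) (ℝ × Euc l) ∘L
        ContinuousLinearMap.inr ℝ ℝ (Euc l)) q.2.2) := by
    ext1 q
    simp [← map_add]
  rw [h1]
  refine ContMDiff.add ?_ (ContMDiff.add ?_ ?_)
  · exact (ContinuousLinearMap.contMDiff _).comp contMDiff_fst
  · exact (ContinuousLinearMap.contMDiff _).comp (contMDiff_fst.comp contMDiff_snd)
  · exact (ContinuousLinearMap.contMDiff _).comp (contMDiff_snd.comp contMDiff_snd)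

theorem contMDiff_coneCoord_symm :
    ContMDiff 𝓘(ℝ, Euc n) (𝓘(ℝ, Euc j).prod (𝓘(ℝ, ℝ).prod 𝓘(ℝ, Euc l))) ∞ (coneCoord σ).symm := by
  refine ContMDiff.prodMk
    (((ContinuousLinearMap.fst ℝ (Euc j) (ℝ × Euc l)) ∘L
      (coneCoord σ).symm.toContinuousLinearMap).contMDiff) (ContMDiff.prodMk
    (((ContinuousLinearMap.fst ℝ ℝ (Euc l)) ∘L (ContinuousLinearMap.snd ℝ (Euc j) (ℝ × Euc l)) ∘L
      (coneCoord σ).symm.toContinuousLinearMap).contMDiff)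
    (((ContinuousLinearMap.snd ℝ ℝ (Euc l)) ∘L (ContinuousLinearMap.snd ℝ (Euc j) (ℝ × Euc l)) ∘L
      (coneCoord σ).symm.toContinuousLinearMap).contMDiff))

variable {e}

/-- Membership in the maximal atlas makes the volume formula `regVol_chart` of `X` available in
coordinates adapted to the cone. -/
theorem productChart_mem_maximalAtlas (he : e ∈ IsManifold.maximalAtlas 𝓘(ℝ, Euc l) ∞ L.Reg) :
    productChart σ ψ e ∈ IsManifold.maximalAtlas 𝓘(ℝ, Euc n) ∞ X.Reg := by
  refine OpenPartialHomeomorph.mem_maximalAtlas_of_contMDiffOn _ ?_ ?_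
  · refine (contMDiff_coneCoord σ).comp_contMDiffOn (s := (productChart σ ψ e).source)
      (f := fun x => ((ψ.symm x).1, (ψ.symm x).2.1, e (ψ.symm x).2.2)) ?_
    have h0 : ContMDiffOn 𝓘(ℝ, Euc n) (𝓘(ℝ, Euc j).prod (𝓘(ℝ, ℝ).prod 𝓘(ℝ, Euc l))) ∞ ψ.symm
        (productChart σ ψ e).source :=
      ψ.symm.contMDiffOn.mono fun x hx => ((mem_productChart_source σ ψ e).1 hx).1
    have h1 := contMDiff_snd.comp_contMDiffOn (contMDiff_snd.comp_contMDiffOn h0)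
    refine (contMDiff_fst.comp_contMDiffOn h0).prodMk
      ((contMDiff_fst.comp_contMDiffOn (contMDiff_snd.comp_contMDiffOn h0)).prodMk ?_)
    exact (contMDiffOn_of_mem_maximalAtlas he).comp h1
      fun x hx => ((mem_productChart_source σ ψ e).1 hx).2
  · have h0 : ContMDiffOn 𝓘(ℝ, Euc n) (𝓘(ℝ, Euc j).prod (𝓘(ℝ, ℝ).prod 𝓘(ℝ, Euc l))) ∞
        (coneCoord σ).symm (productChart σ ψ e).target := (contMDiff_coneCoord_symm σ).contMDiffOn
    refine ψ.contMDiffOn.comp (t := ψ.source) (f := fun p => (((coneCoord σ).symm p).1,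
      ((coneCoord σ).symm p).2.1, e.symm ((coneCoord σ).symm p).2.2)) ?_
      fun p hp => ((mem_productChart_target σ ψ e).1 hp).2
    have h1 := contMDiff_snd.comp_contMDiffOn (contMDiff_snd.comp_contMDiffOn h0)
    refine (contMDiff_fst.comp_contMDiffOn h0).prodMk
      ((contMDiff_fst.comp_contMDiffOn (contMDiff_snd.comp_contMDiffOn h0)).prodMk ?_)
    exact (contMDiffOn_symm_of_mem_maximalAtlas he).comp h1
      fun x hx => ((mem_productChart_target σ ψ e).1 hx).1

theorem mfderiv_productChart_symm (he : e ∈ IsManifold.maximalAtlas 𝓘(ℝ, Euc l) ∞ L.Reg)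
    {p : Euc n} (hp : p ∈ (productChart σ ψ e).target) (v : Euc n) :
    mfderiv 𝓘(ℝ, Euc n) 𝓘(ℝ, Euc n) (productChart σ ψ e).symm p v =
    mfderiv (𝓘(ℝ, Euc j).prod (𝓘(ℝ, ℝ).prod 𝓘(ℝ, Euc l))) 𝓘(ℝ, Euc n) ψ
      (((coneCoord σ).symm p).1, ((coneCoord σ).symm p).2.1, e.symm ((coneCoord σ).symm p).2.2)
      (((coneCoord σ).symm v).1, ((coneCoord σ).symm v).2.1,
        mfderiv 𝓘(ℝ, Euc l) 𝓘(ℝ, Euc l) e.symm ((coneCoord σ).symm p).2.2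
          ((coneCoord σ).symm v).2.2) := by
  obtain ⟨hq, hs⟩ := (mem_productChart_target σ ψ e).1 hp
  set S : Euc n →L[ℝ] Euc j × ℝ × Euc l := (coneCoord σ).symm.toContinuousLinearMap with hS
  have h1 := ((ContinuousLinearMap.fst ℝ (Euc j) (ℝ × Euc l)) ∘L S).hasMFDerivAt (x := p)
  have h2 := ((ContinuousLinearMap.fst ℝ ℝ (Euc l)) ∘L
    (ContinuousLinearMap.snd ℝ (Euc j) (ℝ × Euc l)) ∘L S).hasMFDerivAt (x := p)
  have h3 := ((ContinuousLinearMap.snd ℝ ℝ (Euc l)) ∘L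
    (ContinuousLinearMap.snd ℝ (Euc j) (ℝ × Euc l)) ∘L S).hasMFDerivAt (x := p)
  have he1 := ((mdifferentiable_of_mem_maximalAtlas he).mdifferentiableAt_symm hq).hasMFDerivAt
  have h4 := HasMFDerivAt.comp p he1 h3
  have h5 := h1.prodMk (h2.prodMk h4)
  have hψ := (ψ.mdifferentiableAt (by simp) hs).hasMFDerivAt
  have h6 := HasMFDerivAt.comp p hψ h5
  exact congrArg (fun A : Euc n →L[ℝ] Euc n => A v) h6.mfderiv

theorem det_gram_productChart_le (he : e ∈ IsManifold.maximalAtlas 𝓘(ℝ, Euc l) ∞ L.Reg)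
    {y : Euc j} {r : ℝ} {q : Euc l} (hq : q ∈ e.target) (hs : (y, r, e.symm q) ∈ ψ.source) {c : ℝ}
    (hc : ∀ (a : Euc j) (b : ℝ) (w : TangentSpace 𝓘(ℝ, Euc l) (e.symm q)),
      let V := mfderiv (𝓘(ℝ, Euc j).prod (𝓘(ℝ, ℝ).prod 𝓘(ℝ, Euc l))) 𝓘(ℝ, Euc n) ψ
        (y, r, e.symm q) (a, b, w)
      X.g (ψ (y, r, e.symm q)) V V ≤ c * modelMetric L r (e.symm q) a b w) :
    (X.gram (productChart σ ψ e) (coneCoord σ (y, r, q))).det ≤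
      c ^ n * ((r ^ l) ^ 2 * (L.gram e q).det) := by
  have hp : coneCoord σ (y, r, q) ∈ (productChart σ ψ e).target := by
    rw [mem_productChart_target]
    simpa using ⟨hq, hs⟩
  refine det_le_of_coneCoord σ (posDef_gram (productChart_mem_maximalAtlas σ ψ he) hp)
    (isHermitian_gram e q) fun v => ?_
  rw [dotProduct_gram_mulVec, dotProduct_gram_mulVec, mfderiv_productChart_symm σ ψ he hp]
  have h1 := hc v.1 v.2.1 (mfderiv 𝓘(ℝ, Euc l) 𝓘(ℝ, Euc l) e.symm q v.2.2)
  have h2 : (coneCoord σ).symm (coneCoord σ (y, r, q)) = (y, r, q) :=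
    (coneCoord σ).symm_apply_apply _
  have h3 : (coneCoord σ).symm (coneCoord σ v) = v := (coneCoord σ).symm_apply_apply _
  rw [productChart_symm_apply, h3]
  generalize (coneCoord σ).symm (coneCoord σ (y, r, q)) = t at h2 ⊢
  subst h2
  exact h1

/-- Uniqueness of Haar measure. The value of the constant is irrelevant; only finiteness is used
later. -/
theorem exists_volume_eq_smul_map_coneCoord : ∃ κ : ℝ≥0∞, κ ≠ ⊤ ∧
    (volume : Measure (Euc n)) = κ • (volume : Measure (Euc j × ℝ × Euc l)).map (coneCoord σ) := by
  have i1 : (volume : Measure (ℝ × Euc l)).IsAddHaarMeasure :=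
    Measure.prod.instIsAddHaarMeasure _ _
  have i2 : (volume : Measure (Euc j × ℝ × Euc l)).IsAddHaarMeasure :=
    Measure.prod.instIsAddHaarMeasure _ _
  have : ((volume : Measure (Euc j × ℝ × Euc l)).map (coneCoord σ)).IsAddHaarMeasure :=
    (coneCoord σ).isAddHaarMeasure_map _
  exact ⟨_, ENNReal.coe_ne_top, Measure.isAddLeftInvariant_eq_smul _ _⟩

/-- Fubini reduces to fixed `(y, r)`, where the identity is the chart formula for the volume of `L`.
-/
theorem lintegral_image_linkChart (he : e ∈ IsManifold.maximalAtlas 𝓘(ℝ, Euc l) ∞ L.Reg)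
    {S : Set (Euc j × ℝ × L.Reg)} (hS : MeasurableSet S) (hSe : ∀ s ∈ S, s.2.2 ∈ e.source) :
    ∫⁻ q in linkChart e '' S, ENNReal.ofReal (q.2.1 ^ l) *
      ENNReal.ofReal (Real.sqrt (L.gram e q.2.2).det) =
    ∫⁻ s in S, ENNReal.ofReal (s.2.1 ^ l) ∂(volume.prod (volume.prod L.regVol)) := by
  have hSs : S ⊆ (linkChart (j := j) e).source := fun s hs => by
    simpa [linkChart] using hSe s hs
  have hS' : MeasurableSet (linkChart e '' S) := (linkChart e).measurableSet_image hS hSs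
  have hmem : ∀ y r q, (y, r, q) ∈ linkChart e '' S ↔ q ∈ e '' {z | (y, r, z) ∈ S} := by
    intro y r q
    constructor
    · rintro ⟨⟨y', r', z⟩, hs, h⟩
      obtain ⟨rfl, rfl, rfl⟩ : y' = y ∧ r' = r ∧ e z = q := by
        simpa [linkChart] using h
      exact ⟨z, hs, rfl⟩
    · rintro ⟨z, hz, rfl⟩
      exact ⟨(y, r, z), hz, rfl⟩
  have hcont : ContinuousOn (fun q : Euc j × ℝ × Euc l => ENNReal.ofReal (q.2.1 ^ l) *
      ENNReal.ofReal (Real.sqrt (L.gram e q.2.2).det)) (linkChart e '' S) := by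
    have h1 : ContinuousOn (fun q : Euc j × ℝ × Euc l => Real.sqrt (L.gram e q.2.2).det)
        (linkChart e '' S) := by
      refine Real.continuous_sqrt.comp_continuousOn ((continuous_id.matrix_det).comp_continuousOn
        ((continuousOn_gram he).comp (by fun_prop) ?_))
      rintro _ ⟨s, hs, rfl⟩
      exact e.map_source (hSe s hs)
    have h2 : (fun q : Euc j × ℝ × Euc l => ENNReal.ofReal (q.2.1 ^ l) *
        ENNReal.ofReal (Real.sqrt (L.gram e q.2.2).det)) = fun q => ENNReal.ofReal
          (Real.sqrt (L.gram e q.2.2).det * q.2.1 ^ l) := by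
      ext q
      rw [mul_comm, ← ENNReal.ofReal_mul (Real.sqrt_nonneg _)]
    rw [h2]
    exact ENNReal.continuous_ofReal.comp_continuousOn (h1.mul (by fun_prop))
  classical
  have hae := hcont.measurable_piecewise (g := 0) continuousOn_const hS'
  rw [piecewise_eq_indicator] at hae
  have hae' : Measurable (S.indicator fun s : Euc j × ℝ × L.Reg => ENNReal.ofReal (s.2.1 ^ l)) :=
    Measurable.indicator (by fun_prop) hS
  rw [← lintegral_indicator hS', ← lintegral_indicator hS]
  rw [Measure.volume_eq_prod, lintegral_prod _ hae.aemeasurable,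
    lintegral_prod _ hae'.aemeasurable]
  refine lintegral_congr fun y => ?_
  have hy : Measurable fun t : ℝ × Euc l => (linkChart e '' S).indicator
    (fun q : Euc j × ℝ × Euc l => ENNReal.ofReal (q.2.1 ^ l) *
      ENNReal.ofReal (Real.sqrt (L.gram e q.2.2).det)) (y, t) := hae.comp measurable_prodMk_left
  have hy' : Measurable fun t : ℝ × L.Reg => S.indicator (fun s : Euc j × ℝ × L.Reg =>
    ENNReal.ofReal (s.2.1 ^ l)) (y, t) := hae'.comp measurable_prodMk_left
  rw [Measure.volume_eq_prod, lintegral_prod _ hy.aemeasurable, lintegral_prod _ hy'.aemeasurable]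
  refine lintegral_congr fun r => ?_
  have hA : MeasurableSet {z | (y, r, z) ∈ S} :=
    (measurable_prodMk_left.comp measurable_prodMk_left) hS
  have hAe : {z | (y, r, z) ∈ S} ⊆ e.source := fun z hz => hSe _ hz
  have hA' := e.measurableSet_image hA hAe
  calc ∫⁻ q, (linkChart e '' S).indicator (fun q : Euc j × ℝ × Euc l =>
        ENNReal.ofReal (q.2.1 ^ l) * ENNReal.ofReal (Real.sqrt (L.gram e q.2.2).det)) (y, r, q)
      = ∫⁻ q, (e '' {z | (y, r, z) ∈ S}).indicator (fun q => ENNReal.ofReal (r ^ l) *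
          ENNReal.ofReal (Real.sqrt (L.gram e q).det)) q := by
        refine lintegral_congr fun q => ?_
        by_cases h : q ∈ e '' {z | (y, r, z) ∈ S}
        · rw [indicator_of_mem h, indicator_of_mem ((hmem y r q).2 h)]
        · rw [indicator_of_notMem h, indicator_of_notMem fun h' => h ((hmem y r q).1 h')]
    _ = ENNReal.ofReal (r ^ l) * L.regVol {z | (y, r, z) ∈ S} := by
        rw [lintegral_indicator hA', lintegral_const_mul' _ _ ENNReal.ofReal_ne_top,
          L.regVol_chart he hA hAe]
    _ = ∫⁻ z, S.indicator (fun s : Euc j × ℝ × L.Reg => ENNReal.ofReal (s.2.1 ^ l)) (y, r, z)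
          ∂L.regVol := by
        rw [← setLIntegral_const, ← lintegral_indicator hA]
        rfl

/-- An upper bound `g ≤ c g₀` on quadratic forms bounds the density by `√(c ^ n)` times the model
density `r ^ l √(det k_L)`; the rest is change of coordinates. -/
theorem regVol_image_le_of_mem_chart {κ : ℝ≥0∞}
    (hκ : (volume : Measure (Euc n)) = κ • (volume : Measure (Euc j × ℝ × Euc l)).map (coneCoord σ))
    (he : e ∈ IsManifold.maximalAtlas 𝓘(ℝ, Euc l) ∞ L.Reg) {c : ℝ} (hc0 : 0 ≤ c)
    {S : Set (Euc j × ℝ × L.Reg)} (hS : MeasurableSet S) (hSe : ∀ s ∈ S, s.2.2 ∈ e.source)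
    (hSψ : S ⊆ ψ.source) (hr : ∀ s ∈ S, 0 ≤ s.2.1)
    (hc : ∀ s ∈ S, ∀ (a : Euc j) (b : ℝ) (w : TangentSpace 𝓘(ℝ, Euc l) s.2.2),
      let V := mfderiv (𝓘(ℝ, Euc j).prod (𝓘(ℝ, ℝ).prod 𝓘(ℝ, Euc l))) 𝓘(ℝ, Euc n) ψ s (a, b, w)
      X.g (ψ s) V V ≤ c * modelMetric L s.2.1 s.2.2 a b w) :
    X.regVol (ψ '' S) ≤ κ * ENNReal.ofReal (Real.sqrt (c ^ n)) *
      ∫⁻ s in S, ENNReal.ofReal (s.2.1 ^ l) ∂(volume.prod (volume.prod L.regVol)) := by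
  have hSs : S ⊆ (linkChart (j := j) e).source := fun s hs => by
    simpa [linkChart] using hSe s hs
  have hS' : MeasurableSet (linkChart e '' S) := (linkChart e).measurableSet_image hS hSs
  have hψS : MeasurableSet (ψ '' S) := ψ.toOpenPartialHomeomorph.measurableSet_image hS hSψ
  have hinv : ∀ s ∈ S, ψ.symm (ψ s) = s := fun s hs => ψ.left_inv' (hSψ hs)
  have hsub : ψ '' S ⊆ (productChart σ ψ e).source := by
    rintro _ ⟨s, hs, rfl⟩
    rw [mem_productChart_source, hinv s hs]
    exact ⟨ψ.map_source' (hSψ hs), hSe s hs⟩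
  have himg : productChart σ ψ e '' (ψ '' S) = coneCoord σ '' (linkChart e '' S) := by
    rw [image_image, image_image]
    refine image_congr fun s hs => ?_
    rw [productChart_apply, hinv s hs]
    rfl
  set T := (coneCoord σ).toHomeomorph.toMeasurableEquiv with hT
  rw [X.regVol_chart (productChart_mem_maximalAtlas σ ψ he) hψS hsub, himg, hκ,
    Measure.restrict_smul, lintegral_smul_measure, smul_eq_mul, mul_assoc]
  gcongr
  have h1 : (volume.map (coneCoord σ)).restrict (coneCoord σ '' (linkChart e '' S)) =
      ((volume : Measure (Euc j × ℝ × Euc l)).restrict (linkChart e '' S)).map (coneCoord σ) := by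
    have := T.restrict_map (volume : Measure (Euc j × ℝ × Euc l))
      (coneCoord σ '' (linkChart e '' S))
    have h0 : T ⁻¹' (coneCoord σ '' (linkChart e '' S)) = linkChart e '' S :=
      preimage_image_eq _ (coneCoord σ).injective
    rw [h0] at this
    exact this
  rw [h1]
  have h2 := lintegral_map_equiv (μ := (volume : Measure (Euc j × ℝ × Euc l)).restrict
    (linkChart e '' S)) (fun p => ENNReal.ofReal √(X.gram (productChart σ ψ e) p).det) T
  refine h2.trans_le ?_
  rw [← lintegral_image_linkChart he hS hSe, ← lintegral_const_mul' _ _ ENNReal.ofReal_ne_top]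
  refine setLIntegral_mono' hS' ?_
  rintro _ ⟨⟨y, r, z⟩, hs, rfl⟩
  have hz : z ∈ e.source := hSe _ hs
  have hzz : e.symm (e z) = z := e.left_inv hz
  have h3 : (X.gram (productChart σ ψ e) (coneCoord σ (y, r, e z))).det ≤
      c ^ n * ((r ^ l) ^ 2 * (L.gram e (e z)).det) := by
    refine det_gram_productChart_le σ ψ he (e.map_source hz) (by rw [hzz]; exact hSψ hs) ?_
    rw [hzz]
    exact hc _ hs
  have hr0 : 0 ≤ r := hr _ hs
  change ENNReal.ofReal √(X.gram (productChart σ ψ e) (coneCoord σ (y, r, e z))).det ≤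
    ENNReal.ofReal √(c ^ n) * (ENNReal.ofReal (r ^ l) * ENNReal.ofReal √(L.gram e (e z)).det)
  rw [← ENNReal.ofReal_mul (by positivity), ← ENNReal.ofReal_mul (by positivity)]
  refine ENNReal.ofReal_le_ofReal ((Real.sqrt_le_sqrt h3).trans_eq ?_)
  rw [Real.sqrt_mul (by positivity), Real.sqrt_mul (by positivity), Real.sqrt_sq (by positivity)]

include σ in
-- The link is covered by countably many charts and `S` is cut into disjoint pieces, each over one
-- chart. The constant of the local estimate does not depend on the chart, so the pieces sum up.
theorem exists_regVol_image_le {c : ℝ} (hc0 : 0 ≤ c) : ∃ K : ℝ≥0∞, K ≠ ⊤ ∧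
    ∀ {S : Set (Euc j × ℝ × L.Reg)}, MeasurableSet S → S ⊆ ψ.source → (∀ s ∈ S, 0 ≤ s.2.1) →
    (∀ s ∈ S, ∀ (a : Euc j) (b : ℝ) (w : TangentSpace 𝓘(ℝ, Euc l) s.2.2),
      let V := mfderiv (𝓘(ℝ, Euc j).prod (𝓘(ℝ, ℝ).prod 𝓘(ℝ, Euc l))) 𝓘(ℝ, Euc n) ψ s (a, b, w)
      X.g (ψ s) V V ≤ c * modelMetric L s.2.1 s.2.2 a b w) →
    X.regVol (ψ '' S) ≤ K *
      ∫⁻ s in S, ENNReal.ofReal (s.2.1 ^ l) ∂(volume.prod (volume.prod L.regVol)) := by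
  obtain ⟨κ, hκ0, hκ⟩ := exists_volume_eq_smul_map_coneCoord σ
  refine ⟨κ * ENNReal.ofReal (Real.sqrt (c ^ n)), ENNReal.mul_ne_top hκ0 ENNReal.ofReal_ne_top,
    fun {S} hS hSψ hr hc => ?_⟩
  obtain ⟨D, hDc, hD⟩ := TopologicalSpace.countable_cover_nhds
    (fun z : L.Reg => (chartAt (Euc l) z).open_source.mem_nhds (mem_chart_source (Euc l) z))
  rcases D.eq_empty_or_nonempty with rfl | hDn
  · have : S = ∅ := by
      refine eq_empty_of_forall_notMem fun s _ => ?_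
      have := hD.symm ▸ mem_univ s.2.2
      simp at this
    simp [this]
  obtain ⟨f, rfl⟩ := hDc.exists_eq_range hDn
  set A : ℕ → Set (Euc j × ℝ × L.Reg) := disjointed fun i =>
    {s | s.2.2 ∈ (chartAt (Euc l) (f i)).source} with hA
  have hm : ∀ i, MeasurableSet {s : Euc j × ℝ × L.Reg | s.2.2 ∈ (chartAt (Euc l) (f i)).source} :=
    fun i => (measurable_snd.comp measurable_snd) (chartAt (Euc l) (f i)).open_source.measurableSet
  have hAm : ∀ i, MeasurableSet (A i) := fun i => MeasurableSet.disjointed hm i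
  have hAS : S = ⋃ i, S ∩ A i := by
    rw [← inter_iUnion, hA, iUnion_disjointed]
    refine (inter_eq_left.2 fun s _ => ?_).symm
    have := hD.symm ▸ mem_univ s.2.2
    simpa using this
  have h1 : ∀ i, X.regVol (ψ '' (S ∩ A i)) ≤ κ * ENNReal.ofReal (Real.sqrt (c ^ n)) *
      ∫⁻ s in S ∩ A i, ENNReal.ofReal (s.2.1 ^ l) ∂(volume.prod (volume.prod L.regVol)) :=
    fun i => regVol_image_le_of_mem_chart σ ψ hκ
      (IsManifold.chart_mem_maximalAtlas (f i)) hc0 (hS.inter (hAm i))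
      (fun s hs => disjointed_subset _ i hs.2) (inter_subset_left.trans hSψ)
      (fun s hs => hr s hs.1) (fun s hs => hc s hs.1)
  calc X.regVol (ψ '' S) = X.regVol (⋃ i, ψ '' (S ∩ A i)) := by
        conv_lhs => rw [hAS]
        rw [image_iUnion]
    _ ≤ ∑' i, X.regVol (ψ '' (S ∩ A i)) := measure_iUnion_le _
    _ ≤ ∑' i, κ * ENNReal.ofReal (Real.sqrt (c ^ n)) * ∫⁻ s in S ∩ A i,
          ENNReal.ofReal (s.2.1 ^ l) ∂(volume.prod (volume.prod L.regVol)) :=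
        ENNReal.tsum_le_tsum h1
    _ = _ := by
        rw [ENNReal.tsum_mul_left, ← lintegral_iUnion (fun i => hS.inter (hAm i)), ← hAS]
        intro a b hab
        exact (disjoint_disjointed _ hab).mono inter_subset_right inter_subset_right

end ProductChart

end StratSpace

namespace StratSpace

/-! ### Functions with bounded differential -/

section Lipschitz

variable {n : ℕ} (X : StratSpace.{u} n)

/-- The differential of a function on the regular set. -/
noncomputable def regDeriv (u : X.Reg → ℝ) (x : X.Reg) : Euc n →L[ℝ] ℝ :=
  mfderiv 𝓘(ℝ, Euc n) 𝓘(ℝ, ℝ) u x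

/-- Continuous functions that are `C¹` with bounded differential on the regular set. -/
structure IsEdgeFunction (F : X.carrier → ℝ) : Prop where
  continuous : Continuous F
  contMDiff : ContMDiff 𝓘(ℝ, Euc n) 𝓘(ℝ, ℝ) 1 fun x : X.Reg => F x.1
  bound : ∃ C, 0 ≤ C ∧ ∀ x v, X.regDeriv (fun x => F x.1) x v ^ 2 ≤ C * X.g x v v

variable {X}

theorem regDeriv_add {u v : X.Reg → ℝ} (hu : ContMDiff 𝓘(ℝ, Euc n) 𝓘(ℝ, ℝ) 1 u)
    (hv : ContMDiff 𝓘(ℝ, Euc n) 𝓘(ℝ, ℝ) 1 v) (x : X.Reg) :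
    X.regDeriv (u + v) x = X.regDeriv u x + X.regDeriv v x :=
  mfderiv_add ((hu x).mdifferentiableAt one_ne_zero) ((hv x).mdifferentiableAt one_ne_zero)

theorem regDeriv_mul {u v : X.Reg → ℝ} (hu : ContMDiff 𝓘(ℝ, Euc n) 𝓘(ℝ, ℝ) 1 u)
    (hv : ContMDiff 𝓘(ℝ, Euc n) 𝓘(ℝ, ℝ) 1 v) (x : X.Reg) :
    X.regDeriv (u * v) x = u x • X.regDeriv v x + v x • X.regDeriv u x :=
  (HasMFDerivAt.mul ((hu x).mdifferentiableAt one_ne_zero).hasMFDerivAt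
    ((hv x).mdifferentiableAt one_ne_zero).hasMFDerivAt).mfderiv

theorem regDeriv_comp {u : X.Reg → ℝ} (hu : ContMDiff 𝓘(ℝ, Euc n) 𝓘(ℝ, ℝ) 1 u) {s : ℝ → ℝ}
    (hs : Differentiable ℝ s) (x : X.Reg) :
    X.regDeriv (s ∘ u) x = deriv s (u x) • X.regDeriv u x := by
  have h1 := HasMFDerivAt.comp x (hs (u x)).hasFDerivAt.hasMFDerivAt
    ((hu x).mdifferentiableAt one_ne_zero).hasMFDerivAt
  refine h1.mfderiv.trans ?_
  ext v
  change fderiv ℝ s (u x) (X.regDeriv u x v) = deriv s (u x) * X.regDeriv u x v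
  exact (fderiv_eq_smul_deriv (f := s) (x := u x) _).trans (mul_comm _ _)

theorem IsEdgeFunction.exists_abs_le {F : X.carrier → ℝ} (hF : X.IsEdgeFunction F) :
    ∃ B, 0 ≤ B ∧ ∀ x, |F x| ≤ B := by
  obtain ⟨B, hB⟩ := (isCompact_range hF.continuous.abs).bddAbove
  have h : ∀ x, |F x| ≤ B := fun x => hB ⟨x, rfl⟩
  exact ⟨B, (abs_nonneg _).trans (h (Classical.arbitrary _)), h⟩

theorem isEdgeFunction_const (c : ℝ) : X.IsEdgeFunction fun _ => c where
  continuous := continuous_const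
  contMDiff := contMDiff_const
  bound := by
    refine ⟨0, le_rfl, fun x v => ?_⟩
    have h : X.regDeriv (fun _ => c) x = 0 := mfderiv_const
    rw [h]
    simp

theorem IsEdgeFunction.add {F G : X.carrier → ℝ} (hF : X.IsEdgeFunction F)
    (hG : X.IsEdgeFunction G) : X.IsEdgeFunction fun x => F x + G x where
  continuous := hF.continuous.add hG.continuous
  contMDiff := hF.contMDiff.add hG.contMDiff
  bound := by
    obtain ⟨C, hC0, hC⟩ := hF.bound
    obtain ⟨D, hD0, hD⟩ := hG.bound
    refine ⟨2 * C + 2 * D, by positivity, fun x v => ?_⟩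
    have h := congrArg (fun A => A v) (regDeriv_add hF.contMDiff hG.contMDiff x)
    refine (congrArg (· ^ 2) h).trans_le ?_
    have h1 := hC x v
    have h2 := hD x v
    change (X.regDeriv (fun x => F x.1) x v + X.regDeriv (fun x => G x.1) x v) ^ 2 ≤ _
    nlinarith [sq_nonneg (X.regDeriv (fun x => F x.1) x v - X.regDeriv (fun x => G x.1) x v)]

theorem IsEdgeFunction.mul {F G : X.carrier → ℝ} (hF : X.IsEdgeFunction F)
    (hG : X.IsEdgeFunction G) : X.IsEdgeFunction fun x => F x * G x where
  continuous := hF.continuous.mul hG.continuous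
  contMDiff := hF.contMDiff.mul hG.contMDiff
  bound := by
    obtain ⟨C, hC0, hC⟩ := hF.bound
    obtain ⟨D, hD0, hD⟩ := hG.bound
    obtain ⟨A, hA0, hA⟩ := hF.exists_abs_le
    obtain ⟨B, hB0, hB⟩ := hG.exists_abs_le
    refine ⟨2 * (A ^ 2 * D) + 2 * (B ^ 2 * C), by positivity, fun x v => ?_⟩
    have h := congrArg (fun A => A v) (regDeriv_mul hF.contMDiff hG.contMDiff x)
    refine (congrArg (· ^ 2) h).trans_le ?_
    change (F x.1 * X.regDeriv (fun x => G x.1) x v + G x.1 * X.regDeriv (fun x => F x.1) x v) ^ 2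
      ≤ _
    have h0 := (X.isInnerForm_g x).nonneg v
    have h1 : F x.1 ^ 2 * X.regDeriv (fun x => G x.1) x v ^ 2 ≤ A ^ 2 * (D * X.g x v v) :=
      mul_le_mul (sq_le_sq' (abs_le.1 (hA _)).1 (abs_le.1 (hA _)).2) (hD x v) (sq_nonneg _)
        (sq_nonneg _)
    have h2 : G x.1 ^ 2 * X.regDeriv (fun x => F x.1) x v ^ 2 ≤ B ^ 2 * (C * X.g x v v) :=
      mul_le_mul (sq_le_sq' (abs_le.1 (hB _)).1 (abs_le.1 (hB _)).2) (hC x v) (sq_nonneg _)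
        (sq_nonneg _)
    nlinarith [sq_nonneg (F x.1 * X.regDeriv (fun x => G x.1) x v -
      G x.1 * X.regDeriv (fun x => F x.1) x v)]

theorem isEdgeFunction_sum {ι : Type*} (s : Finset ι) {F : ι → X.carrier → ℝ}
    (hF : ∀ i ∈ s, X.IsEdgeFunction (F i)) : X.IsEdgeFunction fun x => ∑ i ∈ s, F i x := by
  classical
  induction s using Finset.induction_on with
  | empty => simpa using isEdgeFunction_const 0
  | insert a s ha ih =>
    simp only [Finset.sum_insert ha]
    exact (hF a (by simp)).add (ih fun i hi => hF i (by simp [hi]))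

theorem isEdgeFunction_prod {ι : Type*} (s : Finset ι) {F : ι → X.carrier → ℝ}
    (hF : ∀ i ∈ s, X.IsEdgeFunction (F i)) : X.IsEdgeFunction fun x => ∏ i ∈ s, F i x := by
  classical
  induction s using Finset.induction_on with
  | empty => simpa using isEdgeFunction_const 1
  | insert a s ha ih =>
    simp only [Finset.prod_insert ha]
    exact (hF a (by simp)).mul (ih fun i hi => hF i (by simp [hi]))

end Lipschitz

end StratSpace

/-! ### Truncated cones -/

namespace TruncCone

variable {δ : ℝ} {L : Type u} [TopologicalSpace L]

/-- The function `r G(z)` on the cone. -/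
def radMul (G : L → ℝ) : TruncCone δ L → ℝ :=
  Quotient.lift (fun p : Ico (0 : ℝ) δ × L => (p.1 : ℝ) * G p.2) (by
    rintro p q (rfl | h)
    · rfl
    · rw [h.1, h.2, zero_mul, zero_mul])

/-- The radius function on the cone. -/
def rad : TruncCone δ L → ℝ := radMul fun _ => 1

omit [TopologicalSpace L] in
theorem radMul_mk (G : L → ℝ) (r : Ico (0 : ℝ) δ) (z : L) : radMul G (mk r z) = r * G z := rfl

omit [TopologicalSpace L] in
theorem rad_mk (r : Ico (0 : ℝ) δ) (z : L) : rad (mk r z) = r := mul_one _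

omit [TopologicalSpace L] in
theorem exists_rep (c : TruncCone δ L) : ∃ r z, mk r z = c := by
  induction c using Quotient.inductionOn with
  | h p => exact ⟨p.1, p.2, rfl⟩

theorem continuous_radMul {G : L → ℝ} (hG : Continuous G) :
    Continuous (radMul G : TruncCone δ L → ℝ) :=
  continuous_quot_lift _ (by fun_prop)

theorem continuous_rad : Continuous (rad : TruncCone δ L → ℝ) := continuous_radMul continuous_const

theorem continuous_mk : Continuous fun p : Ico (0 : ℝ) δ × L => mk p.1 p.2 := continuous_quot_mk

theorem isCompact_rad_le [CompactSpace L] {a : ℝ} (ha : a < δ) :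
    IsCompact {c : TruncCone δ L | rad c ≤ a} := by
  have h1 : IsCompact {r : Ico (0 : ℝ) δ | (r : ℝ) ≤ a} := by
    rw [Subtype.isCompact_iff]
    have : Subtype.val '' {r : Ico (0 : ℝ) δ | (r : ℝ) ≤ a} = Icc 0 a := by
      ext r
      constructor
      · rintro ⟨r, hr, rfl⟩
        exact ⟨r.2.1, hr⟩
      · exact fun hr => ⟨⟨r, hr.1, hr.2.trans_lt ha⟩, hr.2, rfl⟩
    rw [this]
    exact isCompact_Icc
  convert (h1.prod (isCompact_univ (X := L))).image continuous_mk using 1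
  ext c
  obtain ⟨r, z, rfl⟩ := exists_rep c
  constructor
  · intro h
    exact ⟨(r, z), ⟨by simpa [rad_mk] using h, trivial⟩, rfl⟩
  · rintro ⟨p, hp, h⟩
    rw [← h]
    simpa [rad_mk] using hp.1

end TruncCone

namespace StratSpace

/-! ### Functions on cone charts -/

variable {n j l : ℕ}

/-- The data of a cone chart, in which the metric is comparable to the model metric. -/
structure ConeChart (X : StratSpace.{u} n) (x : X.carrier) (j : ℕ) {l : ℕ} (L : StratSpace.{u} l)
    where
  dim_eq : j + 1 + l = n
  δ : ℝ
  φ : Metric.ball (0 : Euc j) δ × TruncCone δ L.carrier → X.carrier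
  isOpenEmbedding : Topology.IsOpenEmbedding φ
  φ_tip : ∀ (y : Metric.ball (0 : Euc j) δ) (r : Ico (0 : ℝ) δ) (z : L.carrier),
    (y : Euc j) = 0 → (r : ℝ) = 0 → φ (y, TruncCone.mk r z) = x
  sdim_tip : ∀ (y : Metric.ball (0 : Euc j) δ) (r : Ico (0 : ℝ) δ) (z : L.carrier),
    (r : ℝ) = 0 → X.sdim (φ (y, TruncCone.mk r z)) = j
  sdim_pos : ∀ (y : Metric.ball (0 : Euc j) δ) (r : Ico (0 : ℝ) δ) (z : L.carrier),
    0 < (r : ℝ) → X.sdim (φ (y, TruncCone.mk r z)) = j + 1 + L.sdim z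
  ψ : PartialDiffeomorph (𝓘(ℝ, Euc j).prod (𝓘(ℝ, ℝ).prod 𝓘(ℝ, Euc l))) 𝓘(ℝ, Euc n)
      (Euc j × ℝ × L.Reg) X.Reg ∞
  source_eq : ψ.source = Metric.ball 0 δ ×ˢ Ioo 0 δ ×ˢ univ
  ψ_eq : ∀ (y : Metric.ball (0 : Euc j) δ) (r : Ico (0 : ℝ) δ) (z : L.Reg), 0 < (r : ℝ) →
      (ψ ((y : Euc j), (r : ℝ), z)).1 = φ (y, TruncCone.mk r z.1)
  /-- The size of the region where the metrics are comparable. -/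
  a : ℝ
  a_pos : 0 < a
  a_lt : a < δ
  a_le_one : a ≤ 1
  abs_sub_le : ∀ y ∈ Metric.ball (0 : Euc j) a, ∀ r ∈ Ioo 0 a, ∀ z : L.Reg,
    ∀ (α : Euc j) (b : ℝ) (w : TangentSpace 𝓘(ℝ, Euc l) z),
      let V := mfderiv (𝓘(ℝ, Euc j).prod (𝓘(ℝ, ℝ).prod 𝓘(ℝ, Euc l))) 𝓘(ℝ, Euc n) ψ (y, r, z)
        (α, b, w)
      |X.g (ψ (y, r, z)) V V - modelMetric L r z α b w| ≤ 1 / 2 * modelMetric L r z α b w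

theorem modelMetric_nonneg (L : StratSpace.{u} l) (r : ℝ) (z : L.Reg) (a : Euc j) (b : ℝ)
    (w : TangentSpace 𝓘(ℝ, Euc l) z) : 0 ≤ modelMetric L r z a b w := by
  have := (L.isInnerForm_g z).nonneg w
  unfold modelMetric
  positivity

/-- Of the decay `C ρ ^ γ` only this much is used: it drops below `1/2` at some radius `a`, which
makes the two metrics comparable. -/
theorem HasConeChart.nonempty {X : StratSpace.{u} n} {x : X.carrier} {L : StratSpace.{u} l}
    (h : X.HasConeChart x j L) (hn : j + 1 + l = n) : Nonempty (ConeChart X x j L) := by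
  obtain ⟨δ, hδ, φ, h1, h2, h3, h4, ψ, h5, h6, C, γ, hγ, h7⟩ := h
  have hlim : Tendsto (fun ρ : ℝ => C * ρ ^ γ) (𝓝[>] 0) (𝓝 0) := by
    have : Tendsto (fun ρ : ℝ => C * ρ ^ γ) (𝓝 0) (𝓝 (C * 0 ^ γ)) :=
      ((Real.continuousAt_rpow_const 0 γ (Or.inr hγ.le)).tendsto).const_mul C
    rw [Real.zero_rpow hγ.ne', mul_zero] at this
    exact this.mono_left nhdsWithin_le_nhds
  obtain ⟨a, ⟨ha1, ha0, ha2⟩⟩ := ((hlim.eventually (gt_mem_nhds (by norm_num : (0 : ℝ) < 1 / 2))).and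
    (Ioo_mem_nhdsGT (lt_min hδ one_pos))).exists
  exact ⟨{
    dim_eq := hn
    δ := δ
    φ := φ
    isOpenEmbedding := h1
    φ_tip := h2
    sdim_tip := h3
    sdim_pos := h4
    ψ := ψ
    source_eq := h5
    ψ_eq := h6
    a := a
    a_pos := ha0
    a_lt := ha2.trans_le (min_le_left _ _)
    a_le_one := ha2.le.trans (min_le_right _ _)
    abs_sub_le := fun y hy r hr z α b w =>
      (h7 a (ha2.trans_le (min_le_left _ _)) y hy r hr z α b w).trans
        (mul_le_mul_of_nonneg_right ha1.le (modelMetric_nonneg _ _ _ _ _ _)) }⟩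

namespace ConeChart

variable {X : StratSpace.{u} n} {x : X.carrier} {L : StratSpace.{u} l} (c : ConeChart X x j L)

theorem mem_source {y : Euc j} {r : ℝ} {z : L.Reg} : (y, r, z) ∈ c.ψ.source ↔
    ‖y‖ < c.δ ∧ r ∈ Ioo 0 c.δ := by
  rw [c.source_eq]
  simp

theorem δ_pos : 0 < c.δ := c.a_pos.trans c.a_lt

theorem ψ_val {y : Euc j} {r : ℝ} {z : L.Reg} (hy : ‖y‖ < c.δ) (hr : r ∈ Ioo 0 c.δ) :
    (c.ψ (y, r, z)).1 = c.φ (⟨y, by simpa using hy⟩, TruncCone.mk ⟨r, hr.1.le, hr.2⟩ z.1) :=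
  c.ψ_eq ⟨y, by simpa using hy⟩ ⟨r, hr.1.le, hr.2⟩ z hr.1

theorem sdim_eq_iff (y : Metric.ball (0 : Euc j) c.δ) (r : Ico (0 : ℝ) c.δ) (z : L.carrier) :
    X.sdim (c.φ (y, TruncCone.mk r z)) = n ↔ 0 < (r : ℝ) ∧ L.sdim z = l := by
  have hn := c.dim_eq
  rcases r.2.1.eq_or_lt with h | h
  · rw [c.sdim_tip y r z h.symm]
    refine ⟨fun h' => by omega, fun h' => absurd h'.1 (by rw [← h]; exact lt_irrefl _)⟩
  · rw [c.sdim_pos y r z h]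
    exact ⟨fun h' => ⟨h, by omega⟩, fun h' => by omega⟩

/-- The compact part of the chart over the ball of radius `ρ`. -/
def piece (ρ : ℝ) : Set X.carrier :=
  c.φ '' {p | ‖(p.1 : Euc j)‖ ≤ ρ ∧ p.2.rad ≤ ρ}

theorem isCompact_piece {ρ : ℝ} (hρ : ρ < c.δ) : IsCompact (c.piece ρ) := by
  have h1 : IsCompact {y : Metric.ball (0 : Euc j) c.δ | ‖(y : Euc j)‖ ≤ ρ} := by
    rw [Subtype.isCompact_iff]
    have : Subtype.val '' {y : Metric.ball (0 : Euc j) c.δ | ‖(y : Euc j)‖ ≤ ρ} =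
        Metric.closedBall 0 ρ := by
      ext y
      constructor
      · rintro ⟨y, hy, rfl⟩
        simpa using hy
      · intro hy
        have hy' : ‖y‖ ≤ ρ := by simpa using hy
        exact ⟨⟨y, by simpa using hy'.trans_lt hρ⟩, hy', rfl⟩
    rw [this]
    exact isCompact_closedBall _ _
  exact ((h1.prod (TruncCone.isCompact_rad_le hρ))).image c.isOpenEmbedding.continuous

/-- The function `τ(y, r) (c₁ + c₂ r G(z))` in a cone chart, extended by zero. -/
noncomputable def transplant (τ : Euc j × ℝ → ℝ) (c₁ c₂ : ℝ) (G : L.carrier → ℝ) : X.carrier → ℝ :=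
  Function.extend c.φ (fun p => τ (p.1, p.2.rad) * (c₁ + c₂ * p.2.radMul G)) 0

variable {τ : Euc j × ℝ → ℝ} {c₁ c₂ : ℝ} {G : L.carrier → ℝ}

theorem transplant_φ (y : Metric.ball (0 : Euc j) c.δ) (r : Ico (0 : ℝ) c.δ) (z : L.carrier) :
    c.transplant τ c₁ c₂ G (c.φ (y, TruncCone.mk r z)) = τ (y, r) * (c₁ + c₂ * (r * G z)) := by
  rw [transplant, c.isOpenEmbedding.injective.extend_apply, TruncCone.rad_mk, TruncCone.radMul_mk]

theorem transplant_ψ {y : Euc j} {r : ℝ} {z : L.Reg} (hy : ‖y‖ < c.δ) (hr : r ∈ Ioo 0 c.δ) :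
    c.transplant τ c₁ c₂ G (c.ψ (y, r, z)).1 = τ (y, r) * (c₁ + c₂ * (r * G z.1)) := by
  rw [c.ψ_val hy hr, transplant_φ]

theorem transplant_eq_zero {ρ : ℝ} (hτ : ∀ q, τ q ≠ 0 → ‖q‖ ≤ ρ) {p : X.carrier}
    (hp : p ∉ c.piece ρ) : c.transplant τ c₁ c₂ G p = 0 := by
  by_cases h : p ∈ range c.φ
  · obtain ⟨⟨y, t⟩, rfl⟩ := h
    obtain ⟨r, z, rfl⟩ := TruncCone.exists_rep t
    rw [transplant_φ]
    by_contra h0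
    have h1 := hτ _ (left_ne_zero_of_mul h0)
    rw [Prod.norm_def, max_le_iff] at h1
    refine hp (mem_image_of_mem c.φ ?_)
    refine ⟨h1.1, ?_⟩
    rw [TruncCone.rad_mk]
    exact (Real.le_norm_self _).trans h1.2
  · rw [transplant, Function.extend_apply' _ _ _ h]
    rfl

theorem transplant_eventuallyEq_zero {ρ : ℝ} (hρ : ρ < c.δ) (hτ : ∀ q, τ q ≠ 0 → ‖q‖ ≤ ρ)
    {p : X.carrier} (hp : p ∉ c.piece ρ) : c.transplant τ c₁ c₂ G =ᶠ[𝓝 p] 0 := by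
  filter_upwards [(c.isCompact_piece hρ).isClosed.isOpen_compl.mem_nhds hp] with q hq
  exact c.transplant_eq_zero hτ hq

theorem continuous_transplant {ρ : ℝ} (hρ : ρ < c.δ) (hτ : ∀ q, τ q ≠ 0 → ‖q‖ ≤ ρ)
    (hτc : Continuous τ) (hG : Continuous G) : Continuous (c.transplant τ c₁ c₂ G) := by
  refine continuous_iff_continuousAt.2 fun p => ?_
  by_cases hp : p ∈ c.piece ρ
  · obtain ⟨q, -, rfl⟩ := hp
    rw [← c.isOpenEmbedding.continuousAt_iff]
    have h1 : c.transplant τ c₁ c₂ G ∘ c.φ =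
        fun p => τ (p.1, p.2.rad) * (c₁ + c₂ * p.2.radMul G) :=
      funext fun q => c.isOpenEmbedding.injective.extend_apply
        (fun p => τ (p.1, p.2.rad) * (c₁ + c₂ * p.2.radMul G)) 0 q
    rw [h1]
    have h2 := TruncCone.continuous_rad (δ := c.δ) (L := L.carrier)
    have h3 := TruncCone.continuous_radMul (δ := c.δ) hG
    refine Continuous.continuousAt ?_
    fun_prop
  · exact continuousAt_const.congr (c.transplant_eventuallyEq_zero hρ hτ hp).symm

/-- The transplanted function in the coordinates of the chart. -/
def modelFun (τ : Euc j × ℝ → ℝ) (c₁ c₂ : ℝ) (G : L.carrier → ℝ) (s : Euc j × ℝ × L.Reg) : ℝ :=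
  τ (s.1, s.2.1) * (c₁ + c₂ * (s.2.1 * G s.2.2.1))

theorem contMDiff_modelFun (hτ : ContDiff ℝ 1 τ) (hG : L.IsEdgeFunction G) :
    ContMDiff (𝓘(ℝ, Euc j).prod (𝓘(ℝ, ℝ).prod 𝓘(ℝ, Euc l))) 𝓘(ℝ, ℝ) 1
      (modelFun τ c₁ c₂ G : Euc j × ℝ × L.Reg → ℝ) := by
  have h1 : ContMDiff (𝓘(ℝ, Euc j).prod (𝓘(ℝ, ℝ).prod 𝓘(ℝ, Euc l))) 𝓘(ℝ, Euc j × ℝ) 1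
      fun s : Euc j × ℝ × L.Reg => (s.1, s.2.1) :=
    contMDiff_fst.prodMk_space (contMDiff_fst.comp contMDiff_snd)
  have h2 : ContMDiff (𝓘(ℝ, Euc j).prod (𝓘(ℝ, ℝ).prod 𝓘(ℝ, Euc l))) 𝓘(ℝ, ℝ) 1
      fun s : Euc j × ℝ × L.Reg => s.2.1 := contMDiff_fst.comp contMDiff_snd
  have h3 : ContMDiff (𝓘(ℝ, Euc j).prod (𝓘(ℝ, ℝ).prod 𝓘(ℝ, Euc l))) 𝓘(ℝ, ℝ) 1
      fun s : Euc j × ℝ × L.Reg => G s.2.2.1 :=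
    hG.contMDiff.comp (contMDiff_snd.comp contMDiff_snd)
  exact (hτ.contMDiff.comp h1).mul (contMDiff_const.add (contMDiff_const.mul (h2.mul h3)))

theorem mfderiv_modelFun (hτ : ContDiff ℝ 1 τ) (hG : L.IsEdgeFunction G) (y : Euc j) (r : ℝ)
    (z : L.Reg) (a : Euc j) (b : ℝ) (w : Euc l) :
    mfderiv (𝓘(ℝ, Euc j).prod (𝓘(ℝ, ℝ).prod 𝓘(ℝ, Euc l))) 𝓘(ℝ, ℝ) (modelFun τ c₁ c₂ G) (y, r, z)
      (a, b, w) = (c₁ + c₂ * (r * G z.1)) * fderiv ℝ τ (y, r) (a, b) +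
        τ (y, r) * (c₂ * (b * G z.1 + r * L.regDeriv (fun z => G z.1) z w)) := by
  have f1 := hasMFDerivAt_fst (I := 𝓘(ℝ, Euc j)) (I' := 𝓘(ℝ, ℝ).prod 𝓘(ℝ, Euc l))
    (x := (y, r, z))
  have f2 := hasMFDerivAt_snd (I := 𝓘(ℝ, Euc j)) (I' := 𝓘(ℝ, ℝ).prod 𝓘(ℝ, Euc l))
    (x := (y, r, z))
  have f21 := HasMFDerivAt.comp (y, r, z)
    (hasMFDerivAt_fst (I := 𝓘(ℝ, ℝ)) (I' := 𝓘(ℝ, Euc l)) (x := (r, z))) f2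
  have f22 := HasMFDerivAt.comp (y, r, z)
    (hasMFDerivAt_snd (I := 𝓘(ℝ, ℝ)) (I' := 𝓘(ℝ, Euc l)) (x := (r, z))) f2
  have fq : HasMFDerivAt (𝓘(ℝ, Euc j).prod (𝓘(ℝ, ℝ).prod 𝓘(ℝ, Euc l))) 𝓘(ℝ, Euc j × ℝ)
      (fun s : Euc j × ℝ × L.Reg => (s.1, s.2.1)) (y, r, z) (ContinuousLinearMap.prod _ _) :=
    ⟨f1.1.prodMk f21.1, f1.2.prodMk f21.2⟩
  have hτ1 := HasMFDerivAt.comp (y, r, z)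
    (hτ.differentiable one_ne_zero (y, r)).hasFDerivAt.hasMFDerivAt fq
  have hG1 := HasMFDerivAt.comp (y, r, z)
    ((hG.contMDiff z).mdifferentiableAt one_ne_zero).hasMFDerivAt f22
  have h1 := ((f21.mul hG1).const_smul c₂)
  have h2 := (hasMFDerivAt_const (I := (𝓘(ℝ, Euc j).prod (𝓘(ℝ, ℝ).prod 𝓘(ℝ, Euc l))))
    (I' := 𝓘(ℝ, ℝ)) c₁ (y, r, z)).add h1
  have h3 := hτ1.mul h2
  have h4 := congrArg (fun A : (Euc j × ℝ × Euc l) →L[ℝ] ℝ => A (a, b, w)) h3.mfderiv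
  refine h4.trans ?_
  change τ (y, r) * (0 + c₂ * (r * L.regDeriv (fun z => G z.1) z w + G z.1 * b)) +
    (c₁ + c₂ * (r * G z.1)) * fderiv ℝ τ (y, r) (a, b) = _
  ring

end ConeChart

end StratSpace

/-! ### Functions transplanted from a cone chart have bounded differential. -/

namespace StratSpace

variable {n j l : ℕ}

namespace ConeChart

variable {X : StratSpace.{u} n} {x : X.carrier} {L : StratSpace.{u} l} (c : ConeChart X x j L)
  {τ : Euc j × ℝ → ℝ} {c₁ c₂ : ℝ} {G : L.carrier → ℝ}

theorem exists_of_mem_piece {ρ : ℝ} {p : X.Reg} (hp : p.1 ∈ c.piece ρ) :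
    ∃ y r z, ‖y‖ ≤ ρ ∧ ‖y‖ < c.δ ∧ r ∈ Ioo 0 c.δ ∧ r ≤ ρ ∧ c.ψ (y, r, z) = p := by
  obtain ⟨⟨y, t⟩, hyt, h⟩ := hp
  obtain ⟨r, z, rfl⟩ := TruncCone.exists_rep t
  have h1 : X.sdim (c.φ (y, TruncCone.mk r z)) = n := by rw [h]; exact p.2
  obtain ⟨hr, hz⟩ := (c.sdim_eq_iff y r z).1 h1
  have hy : ‖(y : Euc j)‖ < c.δ := mem_ball_zero_iff.1 y.2
  refine ⟨y, r, ⟨z, hz⟩, hyt.1, hy, ⟨hr, r.2.2⟩, ?_, Subtype.ext ((c.ψ_eq y r ⟨z, hz⟩ hr).trans h)⟩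
  have := hyt.2
  rwa [TruncCone.rad_mk] at this

theorem transplant_eventuallyEq_zero_reg {ρ : ℝ} (hρ : ρ < c.δ) (hτ : ∀ q, τ q ≠ 0 → ‖q‖ ≤ ρ)
    {p : X.Reg} (hp : p.1 ∉ c.piece ρ) :
    (fun q : X.Reg => c.transplant τ c₁ c₂ G q.1) =ᶠ[𝓝 p] fun _ => 0 :=
  (X.isOpenEmbedding_val.continuous.tendsto p).eventually
    (c.transplant_eventuallyEq_zero hρ hτ hp)

theorem contMDiff_transplant {ρ : ℝ} (hρ : ρ < c.δ) (hτ : ∀ q, τ q ≠ 0 → ‖q‖ ≤ ρ)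
    (hτc : ContDiff ℝ 1 τ) (hG : L.IsEdgeFunction G) :
    ContMDiff 𝓘(ℝ, Euc n) 𝓘(ℝ, ℝ) 1 fun q : X.Reg => c.transplant τ c₁ c₂ G q.1 := by
  intro p
  by_cases hp : p.1 ∈ c.piece ρ
  · obtain ⟨y, r, z, -, hy, hr, -, rfl⟩ := c.exists_of_mem_piece hp
    have hs : (y, r, z) ∈ c.ψ.source := c.mem_source.2 ⟨hy, hr⟩
    have ht : c.ψ (y, r, z) ∈ c.ψ.target := c.ψ.map_source' hs
    have h1 : ContMDiffAt 𝓘(ℝ, Euc n) (𝓘(ℝ, Euc j).prod (𝓘(ℝ, ℝ).prod 𝓘(ℝ, Euc l))) 1 c.ψ.symm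
        (c.ψ (y, r, z)) :=
      ((c.ψ.symm.contMDiffOn _ ht).contMDiffAt (c.ψ.open_target.mem_nhds ht)).of_le (by simp)
    have h2 := ((contMDiff_modelFun (c₁ := c₁) (c₂ := c₂) hτc hG).contMDiffAt
      (x := c.ψ.symm (c.ψ (y, r, z)))).comp _ h1
    refine h2.congr_of_eventuallyEq ?_
    filter_upwards [c.ψ.open_target.mem_nhds ht] with q hq
    have hq1 : c.ψ (c.ψ.symm q) = q := c.ψ.right_inv' hq
    have hq2 : c.ψ.symm q ∈ c.ψ.source := c.ψ.map_target' hq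
    obtain ⟨hy', hr'⟩ := c.mem_source.1 hq2
    conv_lhs => rw [← hq1]
    exact c.transplant_ψ hy' hr'
  · exact contMDiffAt_const.congr_of_eventuallyEq (c.transplant_eventuallyEq_zero_reg hρ hτ hp)

theorem regDeriv_transplant {y : Euc j} {r : ℝ} {z : L.Reg}
    (hf : MDifferentiableAt 𝓘(ℝ, Euc n) 𝓘(ℝ, ℝ)
      (fun q : X.Reg => c.transplant τ c₁ c₂ G q.1) (c.ψ (y, r, z)))
    (hy : ‖y‖ < c.δ) (hr : r ∈ Ioo 0 c.δ) (v : Euc j × ℝ × Euc l) :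
    X.regDeriv (fun q : X.Reg => c.transplant τ c₁ c₂ G q.1) (c.ψ (y, r, z))
      (mfderiv (𝓘(ℝ, Euc j).prod (𝓘(ℝ, ℝ).prod 𝓘(ℝ, Euc l))) 𝓘(ℝ, Euc n) c.ψ (y, r, z) v) =
    mfderiv (𝓘(ℝ, Euc j).prod (𝓘(ℝ, ℝ).prod 𝓘(ℝ, Euc l))) 𝓘(ℝ, ℝ) (modelFun τ c₁ c₂ G) (y, r, z)
      v := by
  have hs : (y, r, z) ∈ c.ψ.source := c.mem_source.2 ⟨hy, hr⟩
  have h1 := HasMFDerivAt.comp (y, r, z) hf.hasMFDerivAt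
    (c.ψ.mdifferentiableAt (by simp) hs).hasMFDerivAt
  have h2 : (fun q : X.Reg => c.transplant τ c₁ c₂ G q.1) ∘ c.ψ =ᶠ[𝓝 (y, r, z)]
      modelFun τ c₁ c₂ G := by
    filter_upwards [c.ψ.open_source.mem_nhds hs] with q hq
    obtain ⟨hy', hr'⟩ := c.mem_source.1 hq
    exact c.transplant_ψ hy' hr'
  have h3 := h1.mfderiv.symm.trans h2.mfderiv_eq
  exact congrArg (fun A : (Euc j × ℝ × Euc l) →L[ℝ] ℝ => A v) h3

theorem mfderiv_ψ_surjective {s : Euc j × ℝ × L.Reg} (hs : s ∈ c.ψ.source) : Function.Surjective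
    (mfderiv (𝓘(ℝ, Euc j).prod (𝓘(ℝ, ℝ).prod 𝓘(ℝ, Euc l))) 𝓘(ℝ, Euc n) c.ψ s) := by
  have h1 : c.ψ.toOpenPartialHomeomorph.MDifferentiable
      (𝓘(ℝ, Euc j).prod (𝓘(ℝ, ℝ).prod 𝓘(ℝ, Euc l))) 𝓘(ℝ, Euc n) :=
    ⟨c.ψ.mdifferentiableOn (by simp), c.ψ.symm.mdifferentiableOn (by simp)⟩
  exact h1.mfderiv_surjective hs

/-- The differential of `r G` along the link is `r dG`, and `(r dG(w))² ≤ D r² k_L(w, w)` is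
controlled by the cone metric with no loss as `r → 0`. The remaining terms are bounded for `r ≤ 1`,
with `E` bounding `c₁ + c₂ r G`; the factor `3` comes from squaring a sum of three terms. -/
theorem exists_sq_mfderiv_modelFun_le (hτc : ContDiff ℝ 1 τ) (hτs : HasCompactSupport τ)
    (hG : L.IsEdgeFunction G) : ∃ K, 0 ≤ K ∧ ∀ (y : Euc j) (r : ℝ) (z : L.Reg), 0 ≤ r → r ≤ 1 →
      ∀ (a : Euc j) (b : ℝ) (w : Euc l),
      ((c₁ + c₂ * (r * G z.1)) * fderiv ℝ τ (y, r) (a, b) +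
        τ (y, r) * (c₂ * (b * G z.1 + r * L.regDeriv (fun z => G z.1) z w))) ^ 2 ≤
      K * modelMetric L r z a b w := by
  obtain ⟨B, hB0, hB⟩ := hG.exists_abs_le
  obtain ⟨D, hD0, hD⟩ := hG.bound
  obtain ⟨T, hT⟩ := hτc.continuous.bounded_above_of_compact_support hτs
  obtain ⟨M, hM⟩ := (hτc.continuous_fderiv one_ne_zero).bounded_above_of_compact_support
    (hτs.fderiv ℝ)
  set E := |c₁| + |c₂| * B with hE
  refine ⟨3 * (E ^ 2 * M ^ 2 + T ^ 2 * c₂ ^ 2 * B ^ 2 + T ^ 2 * c₂ ^ 2 * D), by positivity,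
    fun y r z hr0 hr1 a b w => ?_⟩
  have hg := (L.isInnerForm_g z).nonneg w
  have hGz := hB z.1
  have hG2 : G z.1 ^ 2 ≤ B ^ 2 := sq_le_sq' (abs_le.1 hGz).1 (abs_le.1 hGz).2
  have hτ2 : τ (y, r) ^ 2 ≤ T ^ 2 := sq_le_sq' (abs_le.1 (hT _)).1 (abs_le.1 (hT _)).2
  have he : |c₁ + c₂ * (r * G z.1)| ≤ E := by
    refine (abs_add_le _ _).trans (add_le_add le_rfl ?_)
    rw [abs_mul, abs_mul, abs_of_nonneg hr0]
    have : r * |G z.1| ≤ 1 * B := mul_le_mul hr1 hGz (abs_nonneg _) zero_le_one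
    rw [one_mul] at this
    gcongr
  have he2 : (c₁ + c₂ * (r * G z.1)) ^ 2 ≤ E ^ 2 := sq_le_sq' (abs_le.1 he).1 (abs_le.1 he).2
  have hf : (fderiv ℝ τ (y, r) (a, b)) ^ 2 ≤ M ^ 2 * (‖a‖ ^ 2 + b ^ 2) := by
    have h1 : |fderiv ℝ τ (y, r) (a, b)| ≤ M * ‖(a, b)‖ :=
      ((fderiv ℝ τ (y, r)).le_opNorm _).trans
        (mul_le_mul_of_nonneg_right (hM _) (norm_nonneg _))
    have h2 : ‖(a, b)‖ ^ 2 ≤ ‖a‖ ^ 2 + b ^ 2 := by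
      rw [Prod.norm_def]
      rcases max_cases ‖a‖ ‖b‖ with h | h <;> rw [h.1]
      · nlinarith [sq_nonneg b]
      · rw [Real.norm_eq_abs, sq_abs]
        nlinarith [sq_nonneg ‖a‖]
    calc _ ≤ (M * ‖(a, b)‖) ^ 2 := sq_le_sq' (abs_le.1 h1).1 (abs_le.1 h1).2
      _ = M ^ 2 * ‖(a, b)‖ ^ 2 := by ring
      _ ≤ _ := by gcongr
  have h1 : (c₁ + c₂ * (r * G z.1)) ^ 2 * (fderiv ℝ τ (y, r) (a, b)) ^ 2 ≤
      E ^ 2 * (M ^ 2 * (‖a‖ ^ 2 + b ^ 2)) := mul_le_mul he2 hf (sq_nonneg _) (sq_nonneg _)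
  have h2 : τ (y, r) ^ 2 * (c₂ ^ 2 * (b ^ 2 * G z.1 ^ 2)) ≤ T ^ 2 * (c₂ ^ 2 * (b ^ 2 * B ^ 2)) := by
    gcongr
  have h3 : τ (y, r) ^ 2 * (c₂ ^ 2 * (r ^ 2 * (L.regDeriv (fun z => G z.1) z w) ^ 2)) ≤
      T ^ 2 * (c₂ ^ 2 * (r ^ 2 * (D * L.g z w w))) := by
    gcongr
    exact hD z w
  unfold modelMetric
  generalize hp : (c₁ + c₂ * (r * G z.1)) = e at *
  generalize hq : fderiv ℝ τ (y, r) (a, b) = f at *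
  generalize hrd : L.regDeriv (fun z => G z.1) z w = d at *
  generalize L.g z w w = γ at *
  have h4 : (e * f + τ (y, r) * (c₂ * (b * G z.1 + r * d))) ^ 2 ≤ 3 * (e ^ 2 * f ^ 2 +
      τ (y, r) ^ 2 * (c₂ ^ 2 * (b ^ 2 * G z.1 ^ 2)) + τ (y, r) ^ 2 * (c₂ ^ 2 * (r ^ 2 * d ^ 2))) := by
    nlinarith [sq_nonneg (e * f - τ (y, r) * (c₂ * (b * G z.1))),
      sq_nonneg (e * f - τ (y, r) * (c₂ * (r * d))),
      sq_nonneg (τ (y, r) * (c₂ * (b * G z.1)) - τ (y, r) * (c₂ * (r * d)))]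
  have h5 : 0 ≤ T ^ 2 * c₂ ^ 2 * B ^ 2 * (‖a‖ ^ 2 + r ^ 2 * γ) := by positivity
  have h6 : 0 ≤ T ^ 2 * c₂ ^ 2 * D * (‖a‖ ^ 2 + b ^ 2) := by positivity
  have h7 : 0 ≤ E ^ 2 * M ^ 2 * (r ^ 2 * γ) := by positivity
  nlinarith [h1, h2, h3, h4, h5, h6, h7]

theorem isEdgeFunction_transplant {ρ : ℝ} (hρ : ρ < c.a) (hτ : ∀ q, τ q ≠ 0 → ‖q‖ ≤ ρ)
    (hτc : ContDiff ℝ 1 τ) (hτs : HasCompactSupport τ) (hG : L.IsEdgeFunction G) :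
    X.IsEdgeFunction (c.transplant τ c₁ c₂ G) where
  continuous := c.continuous_transplant (hρ.trans c.a_lt) hτ hτc.continuous hG.continuous
  contMDiff := c.contMDiff_transplant (hρ.trans c.a_lt) hτ hτc hG
  bound := by
    obtain ⟨K, hK0, hK⟩ := exists_sq_mfderiv_modelFun_le (c₁ := c₁) (c₂ := c₂) hτc hτs hG
    -- In the region `a` of the chart `g₀ ≤ 2 g`, because `|g - g₀| ≤ g₀ / 2`.
    refine ⟨2 * K, by positivity, fun p v => ?_⟩
    by_cases hp : p.1 ∈ c.piece ρ
    · obtain ⟨y, r, z, hy1, hy, hr, hr1, rfl⟩ := c.exists_of_mem_piece hp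
      obtain ⟨⟨a, b, w⟩, rfl⟩ := c.mfderiv_ψ_surjective (s := (y, r, z)) (c.mem_source.2 ⟨hy, hr⟩) v
      have h1 := c.regDeriv_transplant (z := z) (((c.contMDiff_transplant (c₁ := c₁) (c₂ := c₂)
        (hρ.trans c.a_lt) hτ hτc hG) _).mdifferentiableAt one_ne_zero) hy hr (a, b, w)
      have h2 := h1.trans (mfderiv_modelFun hτc hG y r z a b w)
      refine (congrArg (· ^ 2) h2).trans_le ?_
      refine (hK y r z hr.1.le (hr1.trans (hρ.le.trans c.a_le_one)) a b w).trans ?_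
      have h3 := abs_le.1 (c.abs_sub_le y (mem_ball_zero_iff.2 (hy1.trans_lt hρ)) r
        ⟨hr.1, hr1.trans_lt hρ⟩ z a b w)
      rw [mul_comm 2 K, mul_assoc]
      refine mul_le_mul_of_nonneg_left ?_ hK0
      linarith [h3.1]
    · have h1 : X.regDeriv (fun q : X.Reg => c.transplant τ c₁ c₂ G q.1) p = 0 :=
        ((c.transplant_eventuallyEq_zero_reg (c₁ := c₁) (c₂ := c₂) (G := G) (hρ.trans c.a_lt) hτ
          hp).mfderiv_eq).trans mfderiv_const
      rw [h1]
      have := (X.isInnerForm_g p).nonneg v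
      simp only [zero_apply]
      nlinarith [mul_nonneg hK0 this]

end ConeChart

end StratSpace

namespace StratSpace

variable {n j l : ℕ}

/-! ### Tubes around the singular set -/

/-- A function with bounded differential, comparable to the distance from the singular set in that
it vanishes exactly there and its sublevel sets have the volume of tubes of codimension two. -/
structure IsTubeFunction (X : StratSpace.{u} n) (F : X.carrier → ℝ) : Prop extends
    X.IsEdgeFunction F where
  nonneg : ∀ x, 0 ≤ F x
  eq_zero_iff : ∀ x, F x = 0 ↔ X.sdim x ≠ n
  regVol_univ : X.regVol univ ≠ ⊤
  regVol_lt_le : ∃ C, 0 ≤ C ∧ ∀ ε, 0 < ε → X.regVol {x | F x.1 < ε} ≤ ENNReal.ofReal (C * ε ^ 2)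

/-- Volume of `{r G < ε}` in the model cone. For `l ≥ 2` the slice at radius `r` contributes at most
`r ^ l C (ε / r)² ≤ C ε²`. For `l = 1` that would not be integrable with this power, but then the
link has no singular points, `G` has a positive minimum `c₀`, and only `r < ε / c₀` contributes. -/
theorem IsTubeFunction.exists_lintegral_le {L : StratSpace.{u} l} {G : L.carrier → ℝ}
    (hG : L.IsTubeFunction G) (hl : 1 ≤ l) : ∃ C, 0 ≤ C ∧ ∀ ε, 0 < ε →
      ∫⁻ r in Ioo (0 : ℝ) 1, ENNReal.ofReal (r ^ l) * L.regVol {z | r * G z.1 < ε} ≤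
        ENNReal.ofReal (C * ε ^ 2) := by
  obtain ⟨C, hC0, hC⟩ := hG.regVol_lt_le
  rcases hl.eq_or_lt with rfl | hl
  · have hpos : ∀ z, 0 < G z := fun z => by
      refine (hG.nonneg z).lt_of_ne fun h => (hG.eq_zero_iff z).1 h.symm ?_
      have h1 := L.sdim_le z
      have h2 := L.sdim_codim z
      omega
    obtain ⟨z₀, -, hz₀⟩ := isCompact_univ.exists_isMinOn univ_nonempty hG.continuous.continuousOn
    set c₀ := G z₀
    have hc₀ : 0 < c₀ := hpos z₀
    set V := (L.regVol univ).toReal with hV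
    have hVe : L.regVol univ = ENNReal.ofReal V := (ENNReal.ofReal_toReal hG.regVol_univ).symm
    refine ⟨V / c₀ ^ 2, by positivity, fun ε hε => ?_⟩
    calc ∫⁻ r in Ioo (0 : ℝ) 1, ENNReal.ofReal (r ^ 1) * L.regVol {z | r * G z.1 < ε}
        ≤ ∫⁻ r in Ioo (0 : ℝ) 1, (Ioo (0 : ℝ) (ε / c₀)).indicator
          (fun _ => ENNReal.ofReal (ε / c₀) * ENNReal.ofReal V) r := by
          refine setLIntegral_mono' measurableSet_Ioo fun r hr => ?_
          by_cases h : r < ε / c₀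
          · rw [indicator_of_mem (show r ∈ Ioo 0 (ε / c₀) from ⟨hr.1, h⟩), pow_one, ← hVe]
            gcongr
            exact subset_univ _
          · have : {z : L.Reg | r * G z.1 < ε} = ∅ := by
              refine eq_empty_of_forall_notMem fun z hz => ?_
              have h1 : ε ≤ r * c₀ := (div_le_iff₀ hc₀).1 (not_lt.1 h)
              have h2 : c₀ ≤ G z.1 := hz₀ (mem_univ z.1)
              have h3 : r * c₀ ≤ r * G z.1 := mul_le_mul_of_nonneg_left h2 hr.1.le
              have h4 : r * G z.1 < ε := hz
              linarith
            rw [this]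
            simp
      _ ≤ ∫⁻ r, (Ioo (0 : ℝ) (ε / c₀)).indicator
          (fun _ => ENNReal.ofReal (ε / c₀) * ENNReal.ofReal V) r := setLIntegral_le_lintegral _ _
      _ = ENNReal.ofReal (V / c₀ ^ 2 * ε ^ 2) := by
          rw [lintegral_indicator measurableSet_Ioo, setLIntegral_const, Real.volume_Ioo, sub_zero,
            ← ENNReal.ofReal_mul (by positivity), ← ENNReal.ofReal_mul (by positivity)]
          congr 1
          field_simp
  · refine ⟨C, hC0, fun ε hε => ?_⟩
    calc ∫⁻ r in Ioo (0 : ℝ) 1, ENNReal.ofReal (r ^ l) * L.regVol {z | r * G z.1 < ε}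
        ≤ ∫⁻ _ in Ioo (0 : ℝ) 1, ENNReal.ofReal (C * ε ^ 2) := by
          refine setLIntegral_mono' measurableSet_Ioo fun r hr => ?_
          have h0 : 0 < r := hr.1
          have h1 : {z : L.Reg | r * G z.1 < ε} = {z | G z.1 < ε / r} := by
            ext z
            exact (lt_div_iff₀' h0).symm
          rw [h1]
          refine (mul_le_mul_right (hC (ε / r) (by positivity)) _).trans ?_
          rw [← ENNReal.ofReal_mul (by positivity)]
          refine ENNReal.ofReal_le_ofReal ?_
          obtain ⟨i, rfl⟩ : ∃ i, l = i + 2 := ⟨l - 2, by omega⟩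
          have h2 : r ^ (i + 2) * (C * (ε / r) ^ 2) = C * ε ^ 2 * r ^ i := by
            field_simp
            ring
          rw [h2]
          exact mul_le_of_le_one_right (by positivity) (pow_le_one₀ h0.le hr.2.le)
      _ = ENNReal.ofReal (C * ε ^ 2) := by simp

namespace ConeChart

variable {X : StratSpace.{u} n} {x : X.carrier} {L : StratSpace.{u} l} (c : ConeChart X x j L)
  {G : L.carrier → ℝ}

theorem exists_regVol_tube_le (hG : L.IsTubeFunction G) (hl : 1 ≤ l) : ∃ K, 0 ≤ K ∧ ∀ ε, 0 < ε →
    X.regVol (c.ψ '' {s | ‖s.1‖ < c.a ∧ s.2.1 ∈ Ioo 0 c.a ∧ s.2.1 * G s.2.2.1 < ε}) ≤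
      ENNReal.ofReal (K * ε ^ 2) := by
  obtain ⟨C, hC0, hC⟩ := hG.exists_lintegral_le hl
  have σ : Fin j ⊕ (Unit ⊕ Fin l) ≃ Fin n :=
    Fintype.equivOfCardEq (by have := c.dim_eq; simp; omega)
  -- `3/2` is the upper comparison constant from `|g - g₀| ≤ g₀ / 2`.
  obtain ⟨κ, hκ, hvol⟩ := exists_regVol_image_le σ c.ψ (c := 3 / 2) (by norm_num)
  set W := volume (Metric.ball (0 : Euc j) c.a) with hW
  have hWt : W ≠ ⊤ := Metric.isBounded_ball.measure_lt_top.ne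
  refine ⟨(κ * W).toReal * C, by positivity, fun ε hε => ?_⟩
  set S₂ : Set (ℝ × L.Reg) := {t | t.1 ∈ Ioo 0 c.a ∧ t.1 * G t.2.1 < ε} with hS₂
  have hS₂m : MeasurableSet S₂ := by
    have h1 : Continuous fun t : ℝ × L.Reg => t.1 * G t.2.1 :=
      continuous_fst.mul (hG.continuous.comp (X := ℝ × L.Reg)
        (L.isOpenEmbedding_val.continuous.comp continuous_snd))
    exact (measurable_fst measurableSet_Ioo).inter (isOpen_lt h1 continuous_const).measurableSet
  have hS : {s : Euc j × ℝ × L.Reg | ‖s.1‖ < c.a ∧ s.2.1 ∈ Ioo 0 c.a ∧ s.2.1 * G s.2.2.1 < ε} =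
      Metric.ball 0 c.a ×ˢ S₂ := by
    ext s
    simp [hS₂]
  rw [hS]
  refine (hvol (Metric.isOpen_ball.measurableSet.prod hS₂m) ?_ ?_ ?_).trans ?_
  · rintro ⟨y, r, z⟩ ⟨hy, hr, -⟩
    exact c.mem_source.2 ⟨(mem_ball_zero_iff.1 hy).trans c.a_lt, hr.1, hr.2.trans c.a_lt⟩
  · exact fun s hs => hs.2.1.1.le
  · rintro ⟨y, r, z⟩ ⟨hy, hr, -⟩ α b w
    have h3 := abs_le.1 (c.abs_sub_le y hy r hr z α b w)
    linarith [h3.2]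
  · rw [← Measure.prod_restrict]
    have h1 : ∫⁻ s, ENNReal.ofReal (s.2.1 ^ l) ∂((volume : Measure (Euc j)).restrict
        (Metric.ball 0 c.a)).prod ((volume.prod L.regVol).restrict S₂) =
        W * ∫⁻ t in S₂, ENNReal.ofReal (t.1 ^ l) ∂(volume.prod L.regVol) := by
      rw [lintegral_prod _ (by fun_prop)]
      dsimp only
      rw [lintegral_const, mul_comm, Measure.restrict_apply_univ]
    have h2 : ∫⁻ t in S₂, ENNReal.ofReal (t.1 ^ l) ∂(volume.prod L.regVol) ≤
        ENNReal.ofReal (C * ε ^ 2) := by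
      have hm : Measurable (S₂.indicator fun t : ℝ × L.Reg => ENNReal.ofReal (t.1 ^ l)) :=
        Measurable.indicator (by fun_prop) hS₂m
      rw [← lintegral_indicator hS₂m, lintegral_prod _ hm.aemeasurable]
      refine le_trans ?_ (hC ε hε)
      rw [← lintegral_indicator measurableSet_Ioo]
      refine lintegral_mono fun r => ?_
      by_cases hr : r ∈ Ioo 0 c.a
      · rw [indicator_of_mem (show r ∈ Ioo (0 : ℝ) 1 from ⟨hr.1, hr.2.trans_le c.a_le_one⟩)]
        have hA : MeasurableSet {z : L.Reg | (r, z) ∈ S₂} := measurable_prodMk_left hS₂m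
        have h3 : ∫⁻ z, S₂.indicator (fun t : ℝ × L.Reg => ENNReal.ofReal (t.1 ^ l)) (r, z)
            ∂L.regVol = ENNReal.ofReal (r ^ l) * L.regVol {z | (r, z) ∈ S₂} := by
          rw [← setLIntegral_const, ← lintegral_indicator hA]
          rfl
        exact h3.trans_le (mul_le_mul_right (measure_mono fun z hz => hz.2) _)
      · have : ∀ z : L.Reg, S₂.indicator (fun t : ℝ × L.Reg => ENNReal.ofReal (t.1 ^ l)) (r, z) = 0 :=
          fun z => indicator_of_notMem (fun h => hr h.1) _
        simp [this]
    rw [h1, ← mul_assoc]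
    refine (mul_le_mul_right h2 _).trans_eq ?_
    rw [mul_assoc (_ : ℝ), ENNReal.ofReal_mul ENNReal.toReal_nonneg,
      ENNReal.ofReal_toReal (ENNReal.mul_ne_top hκ hWt)]

include c in
-- With a bump function `b` in `(y, r)`, take `τ = b` and `F = b r G`. In the chart `r G` vanishes
-- exactly on the singular set, since a point is regular when `r > 0` and its link coordinate is
-- regular.
theorem exists_cutoff_and_tube (hG : L.IsTubeFunction G) (hl : 1 ≤ l) :
    ∃ τ F : X.carrier → ℝ, X.IsEdgeFunction τ ∧ X.IsEdgeFunction F ∧ (∀ p, τ p ≤ 1) ∧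
      (∃ O, IsOpen O ∧ x ∈ O ∧ ∀ p ∈ O, τ p = 1) ∧ (∀ p, 0 ≤ F p) ∧
      (∀ p, X.sdim p ≠ n → F p = 0) ∧ (∀ p, X.sdim p = n → 0 < τ p → 0 < F p) ∧
      ∃ K, 0 ≤ K ∧ ∀ ε, 0 < ε → X.regVol {p | 1 / 2 < τ p.1 ∧ F p.1 < ε} ≤
        ENNReal.ofReal (K * ε ^ 2) := by
  have ha := c.a_pos
  let b : ContDiffBump (0 : Euc j × ℝ) :=
    { rIn := c.a / 3
      rOut := c.a / 2
      rIn_pos := by positivity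
      rIn_lt_rOut := by linarith }
  have hρ : c.a / 2 < c.a := by linarith
  have hb : ∀ q, b q ≠ 0 → ‖q‖ ≤ c.a / 2 := fun q hq => by
    have h1 : q ∈ Function.support b := hq
    rw [b.support_eq] at h1
    exact (mem_ball_zero_iff.1 h1).le
  obtain ⟨K, hK0, hK⟩ := c.exists_regVol_tube_le hG hl
  have hF0 : ∀ p, 0 ≤ c.transplant b 0 1 G p := fun p => by
    by_cases hp : p ∈ c.piece (c.a / 2)
    · obtain ⟨⟨y, t⟩, -, rfl⟩ := hp
      obtain ⟨r, z, rfl⟩ := TruncCone.exists_rep t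
      rw [transplant_φ, zero_add, one_mul]
      exact mul_nonneg b.nonneg (mul_nonneg r.2.1 (hG.nonneg z))
    · exact (c.transplant_eq_zero hb hp).ge
  refine ⟨c.transplant b 1 0 G, c.transplant b 0 1 G,
    c.isEdgeFunction_transplant hρ hb b.contDiff b.hasCompactSupport hG.toIsEdgeFunction,
    c.isEdgeFunction_transplant hρ hb b.contDiff b.hasCompactSupport hG.toIsEdgeFunction,
    fun p => ?_, ?_, hF0, fun p hp => ?_, fun p hp hτ => ?_, K * 4, by positivity, fun ε hε => ?_⟩
  · by_cases hp : p ∈ c.piece (c.a / 2)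
    · obtain ⟨⟨y, t⟩, -, rfl⟩ := hp
      obtain ⟨r, z, rfl⟩ := TruncCone.exists_rep t
      rw [transplant_φ, zero_mul, add_zero, mul_one]
      exact b.le_one
    · rw [c.transplant_eq_zero hb hp]
      exact zero_le_one
  · refine ⟨c.φ '' {p | ‖(p.1 : Euc j)‖ < c.a / 3 ∧ p.2.rad < c.a / 3},
      c.isOpenEmbedding.isOpenMap _ ?_, ?_, ?_⟩
    · have h2 := TruncCone.continuous_rad (δ := c.δ) (L := L.carrier)
      have h3 : Continuous fun p : Metric.ball (0 : Euc j) c.δ × TruncCone c.δ L.carrier =>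
        ‖(p.1 : Euc j)‖ := by fun_prop
      have h4 : Continuous fun p : Metric.ball (0 : Euc j) c.δ × TruncCone c.δ L.carrier =>
        p.2.rad := h2.comp continuous_snd
      exact (isOpen_lt h3 continuous_const).inter (isOpen_lt h4 continuous_const)
    · have z : L.carrier := Classical.arbitrary _
      refine ⟨(⟨0, Metric.mem_ball_self c.δ_pos⟩, TruncCone.mk ⟨0, le_rfl, c.δ_pos⟩ z), ⟨?_, ?_⟩,
        c.φ_tip _ _ _ rfl rfl⟩
      · simpa using ha
      · rw [TruncCone.rad_mk]
        positivity
    · rintro _ ⟨⟨y, t⟩, ⟨hy, ht⟩, rfl⟩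
      obtain ⟨r, z, rfl⟩ := TruncCone.exists_rep t
      rw [TruncCone.rad_mk] at ht
      rw [transplant_φ, zero_mul, add_zero, mul_one]
      refine b.one_of_mem_closedBall ?_
      rw [mem_closedBall_zero_iff, Prod.norm_def]
      refine max_le hy.le ?_
      rw [Real.norm_of_nonneg r.2.1]
      exact ht.le
  · by_cases hp' : p ∈ c.piece (c.a / 2)
    · obtain ⟨⟨y, t⟩, -, rfl⟩ := hp'
      obtain ⟨r, z, rfl⟩ := TruncCone.exists_rep t
      rw [transplant_φ, zero_add, one_mul]
      rw [Ne, c.sdim_eq_iff, not_and_or] at hp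
      rcases hp with hp | hp
      · have : (r : ℝ) = 0 := le_antisymm (not_lt.1 hp) r.2.1
        rw [this, zero_mul, mul_zero]
      · rw [(hG.eq_zero_iff z).2 hp, mul_zero, mul_zero]
    · exact c.transplant_eq_zero hb hp'
  · have hp' : p ∈ c.piece (c.a / 2) := by
      by_contra h
      rw [c.transplant_eq_zero hb h] at hτ
      exact lt_irrefl _ hτ
    obtain ⟨⟨y, t⟩, -, rfl⟩ := hp'
    obtain ⟨r, z, rfl⟩ := TruncCone.exists_rep t
    rw [transplant_φ, zero_mul, add_zero, mul_one] at hτ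
    rw [transplant_φ, zero_add, one_mul]
    obtain ⟨hr, hz⟩ := (c.sdim_eq_iff y r z).1 hp
    refine mul_pos hτ (mul_pos hr ((hG.nonneg z).lt_of_ne fun h => ?_))
    exact (hG.eq_zero_iff z).1 h.symm hz
  -- Where `b > 1/2`, the condition `b r G < ε` forces `r G < 2 ε`.
  · have h4 : K * 4 * ε ^ 2 = K * (2 * ε) ^ 2 := by ring
    rw [h4]
    refine le_trans (measure_mono ?_) (hK (2 * ε) (by positivity))
    rintro p ⟨hp1, hp2⟩
    have hp' : p.1 ∈ c.piece (c.a / 2) := by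
      by_contra h
      rw [c.transplant_eq_zero hb h] at hp1
      linarith
    obtain ⟨y, r, z, hy1, hy, hr, hr1, rfl⟩ := c.exists_of_mem_piece hp'
    rw [c.transplant_ψ hy hr, zero_mul, add_zero, mul_one] at hp1
    rw [c.transplant_ψ hy hr, zero_add, one_mul] at hp2
    refine ⟨(y, r, z), ⟨hy1.trans_lt hρ, ⟨hr.1, hr1.trans_lt hρ⟩, ?_⟩, rfl⟩
    have h5 : 0 ≤ r * G z.1 := mul_nonneg hr.1.le (hG.nonneg _)
    change r * G z.1 < 2 * ε
    nlinarith

end ConeChart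

end StratSpace

/-! ### Global tube functions, by induction on the depth. -/

namespace StratSpace

variable {n : ℕ}

theorem isCompact_reg_ge (X : StratSpace.{u} n) {F : X.carrier → ℝ} (hF : Continuous F)
    (h0 : ∀ x, X.sdim x ≠ n → F x = 0) {ε : ℝ} (hε : 0 < ε) :
    IsCompact {x : X.Reg | ε ≤ F x.1} := by
  have h1 : IsCompact {x : X.carrier | ε ≤ F x} :=
    (isClosed_le continuous_const hF).isCompact
  refine X.isOpenEmbedding_val.isInducing.isCompact_preimage' h1 fun x hx => ?_
  by_contra h
  have h2 : X.sdim x ≠ n := fun h' => h ⟨⟨x, h'⟩, rfl⟩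
  have h3 : ε ≤ F x := hx
  rw [h0 x h2] at h3
  linarith

/-- `{F ≥ ε₀}` is compact in the regular set, so the total volume `V` is finite, and for `ε ≥ ε₀`
the bound holds with constant `V / ε₀²`. -/
theorem regVol_lt_le_of_small {X : StratSpace.{u} n} {F : X.carrier → ℝ} (hF : Continuous F)
    (h0 : ∀ x, X.sdim x ≠ n → F x = 0) {C ε₀ : ℝ} (hC : 0 ≤ C) (hε₀ : 0 < ε₀)
    (h : ∀ ε, 0 < ε → ε ≤ ε₀ → X.regVol {x | F x.1 < ε} ≤ ENNReal.ofReal (C * ε ^ 2)) :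
    X.regVol univ ≠ ⊤ ∧
      ∃ C, 0 ≤ C ∧ ∀ ε, 0 < ε → X.regVol {x | F x.1 < ε} ≤ ENNReal.ofReal (C * ε ^ 2) := by
  have hfin : X.regVol univ ≠ ⊤ := by
    have h1 : (univ : Set X.Reg) = {x | F x.1 < ε₀} ∪ {x | ε₀ ≤ F x.1} := by
      ext x
      simpa using lt_or_ge (F x.1) ε₀
    rw [h1]
    refine ((measure_union_le _ _).trans_lt (ENNReal.add_lt_top.2 ⟨?_, ?_⟩)).ne
    · exact (h ε₀ hε₀ le_rfl).trans_lt ENNReal.ofReal_lt_top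
    · exact (X.isCompact_reg_ge hF h0 hε₀).measure_lt_top
  refine ⟨hfin, C + (X.regVol univ).toReal / ε₀ ^ 2, by positivity, fun ε hε => ?_⟩
  rcases le_total ε ε₀ with hle | hle
  · refine (h ε hε hle).trans (ENNReal.ofReal_le_ofReal ?_)
    have : 0 ≤ (X.regVol univ).toReal / ε₀ ^ 2 := by positivity
    gcongr
    linarith
  · refine (measure_mono (subset_univ _)).trans ?_
    rw [← ENNReal.ofReal_toReal hfin, ENNReal.toReal_ofReal ENNReal.toReal_nonneg]
    refine ENNReal.ofReal_le_ofReal ?_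
    have h1 : (X.regVol univ).toReal = (X.regVol univ).toReal / ε₀ ^ 2 * ε₀ ^ 2 := by field_simp
    have h2 : (X.regVol univ).toReal / ε₀ ^ 2 * ε₀ ^ 2 ≤
        (X.regVol univ).toReal / ε₀ ^ 2 * ε ^ 2 := by gcongr
    nlinarith [mul_nonneg hC (sq_nonneg ε)]

theorem isTubeFunction_one {X : StratSpace.{u} n} (hX : ∀ x, X.sdim x = n) :
    X.IsTubeFunction fun _ => 1 := by
  have h := regVol_lt_le_of_small (X := X) (F := fun _ => 1) (C := 0) (ε₀ := 1) continuous_const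
    (fun x hx => absurd (hX x) hx) le_rfl one_pos fun ε _ hε => by simp [not_lt.2 hε]
  exact
    { isEdgeFunction_const 1 with
      nonneg := fun _ => zero_le_one
      eq_zero_iff := fun x => by simp [hX x]
      regVol_univ := h.1
      regVol_lt_le := h.2 }

/-- Cover the compact singular set by finitely many neighbourhoods and take `∑ Fᵢ + ∏ (1 - τᵢ)`. On
the singular set both terms vanish. At a regular point the product vanishes only if some `τᵢ = 1`,
and there `Fᵢ > 0`. If the value is below `ε ≤ 2 ^ (-|t|)`, some `τᵢ` exceeds `1/2`, so the local
volume bounds add up. -/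
theorem exists_isTubeFunction_of_cone {X : StratSpace.{u} n}
    (h : ∀ x, X.sdim x ≠ n → ∃ τ F : X.carrier → ℝ, X.IsEdgeFunction τ ∧ X.IsEdgeFunction F ∧
      (∀ p, τ p ≤ 1) ∧ (∃ O, IsOpen O ∧ x ∈ O ∧ ∀ p ∈ O, τ p = 1) ∧ (∀ p, 0 ≤ F p) ∧
      (∀ p, X.sdim p ≠ n → F p = 0) ∧ (∀ p, X.sdim p = n → 0 < τ p → 0 < F p) ∧
      ∃ K, 0 ≤ K ∧ ∀ ε, 0 < ε → X.regVol {p | 1 / 2 < τ p.1 ∧ F p.1 < ε} ≤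
        ENNReal.ofReal (K * ε ^ 2)) :
    ∃ F, X.IsTubeFunction F := by
  classical
  have h' := fun x : {x // X.sdim x ≠ n} => h x.1 x.2
  choose τ F hτ hF hτ1 hO' hF0 hFs hFp K hK0 hK using h'
  choose O hO hxO hτO using hO'
  have hcomp : IsCompact {x | X.sdim x ≠ n} := (X.isOpen_reg.isClosed_compl).isCompact
  obtain ⟨t, ht⟩ := hcomp.elim_finite_subcover O hO fun x hx => mem_iUnion.2 ⟨⟨x, hx⟩, hxO _⟩
  set P : X.carrier → ℝ := fun x => ∏ i ∈ t, (1 + (-1) * τ i x) with hP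
  set S : X.carrier → ℝ := fun x => ∑ i ∈ t, F i x with hS
  have hPe : X.IsEdgeFunction P := isEdgeFunction_prod t fun i _ =>
    (isEdgeFunction_const 1).add ((isEdgeFunction_const (-1)).mul (hτ i))
  have hSe : X.IsEdgeFunction S := isEdgeFunction_sum t fun i _ => hF i
  have hP0 : ∀ x, 0 ≤ P x := fun x => Finset.prod_nonneg fun i _ => by linarith [hτ1 i x]
  have hS0 : ∀ x, 0 ≤ S x := fun x => Finset.sum_nonneg fun i _ => hF0 i x
  have hzero : ∀ x, X.sdim x ≠ n → S x + P x = 0 := fun x hx => by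
    obtain ⟨i, hi⟩ := mem_iUnion.1 (ht hx)
    obtain ⟨hit, hi⟩ := mem_iUnion.1 hi
    have h1 : P x = 0 := Finset.prod_eq_zero hit (by rw [hτO i x hi]; norm_num)
    have h2 : S x = 0 := Finset.sum_eq_zero fun i _ => hFs i x hx
    rw [h1, h2, add_zero]
  have hpos : ∀ x, X.sdim x = n → S x + P x ≠ 0 := fun x hx h0 => by
    have h1 : P x = 0 := by linarith [hP0 x, hS0 x]
    have h2 : S x = 0 := by linarith [hP0 x, hS0 x]
    obtain ⟨i, hit, hi⟩ := Finset.prod_eq_zero_iff.1 h1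
    have h3 := (Finset.sum_eq_zero_iff_of_nonneg fun i _ => hF0 i x).1 h2 i hit
    exact (hFp i x hx (by linarith)).ne' h3
  have hsmall : ∀ ε, 0 < ε → ε ≤ (1 / 2) ^ t.card →
      X.regVol {x | S x.1 + P x.1 < ε} ≤ ENNReal.ofReal ((∑ i ∈ t, K i) * ε ^ 2) := by
    intro ε hε hε1
    have hsub : {x : X.Reg | S x.1 + P x.1 < ε} ⊆
        ⋃ i ∈ t, {p : X.Reg | 1 / 2 < τ i p.1 ∧ F i p.1 < ε} := by
      intro x hx
      have hx' : S x.1 + P x.1 < ε := hx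
      by_contra hcon
      simp only [mem_iUnion, not_exists] at hcon
      have h1 : ∀ i ∈ t, τ i x.1 ≤ 1 / 2 := fun i hi => by
        by_contra h2
        refine hcon i hi ⟨not_le.1 h2, ?_⟩
        have h3 : F i x.1 ≤ S x.1 :=
          Finset.single_le_sum (f := fun i => F i x.1) (fun i _ => hF0 i x.1) hi
        linarith [hP0 x.1]
      have h2 : (1 / 2 : ℝ) ^ t.card ≤ P x.1 := by
        rw [← Finset.prod_const]
        exact Finset.prod_le_prod (fun _ _ => by norm_num) fun i hi => by linarith [h1 i hi]
      linarith [hS0 x.1]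
    refine (measure_mono hsub).trans ((measure_biUnion_finset_le _ _).trans ?_)
    rw [Finset.sum_mul, ENNReal.ofReal_sum_of_nonneg fun i _ => mul_nonneg (hK0 i) (sq_nonneg _)]
    exact Finset.sum_le_sum fun i _ => hK i ε hε
  have hfin := regVol_lt_le_of_small (hSe.add hPe).continuous hzero
    (Finset.sum_nonneg fun i _ => hK0 i) (by positivity) hsmall
  exact ⟨fun x => S x + P x,
    { hSe.add hPe with
      nonneg := fun x => add_nonneg (hS0 x) (hP0 x)
      eq_zero_iff := fun x => ⟨fun h1 h2 => hpos x h2 h1, hzero x⟩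
      regVol_univ := hfin.1
      regVol_lt_le := hfin.2 }⟩

/-- Induction on the depth; the tube function of the link feeds the cone construction. Absence of
strata of codimension one makes every link at least one-dimensional. -/
theorem IsIteratedEdge.exists_isTubeFunction {d : ℕ} : ∀ {n : ℕ} {X : StratSpace.{u} n},
    X.IsIteratedEdge d → ∃ F, X.IsTubeFunction F := by
  induction d with
  | zero => exact fun {n X} hX => ⟨_, isTubeFunction_one hX⟩
  | succ d ih =>
    intro n X hX
    refine exists_isTubeFunction_of_cone fun x hx => ?_
    obtain ⟨l, L, hn, hL, hc⟩ := hX x hx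
    obtain ⟨G, hG⟩ := ih hL
    obtain ⟨c⟩ := hc.nonempty hn
    refine c.exists_cutoff_and_tube hG ?_
    have := X.sdim_codim x
    omega

end StratSpace

/-! ### Constants lie in the kernel of the Laplacian -/

theorem Real.deriv_smoothTransition_eq_zero {t : ℝ} (ht : t ∉ Ioo (0 : ℝ) 1) :
    deriv Real.smoothTransition t = 0 := by
  rcases le_or_gt t 0 with h | h
  · refine IsLocalMin.deriv_eq_zero (Eventually.of_forall fun s => ?_)
    rw [Real.smoothTransition.zero_of_nonpos h]
    exact Real.smoothTransition.nonneg s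
  · have h1 : 1 ≤ t := not_lt.1 fun h' => ht ⟨h, h'⟩
    refine IsLocalMax.deriv_eq_zero (Eventually.of_forall fun s => ?_)
    rw [Real.smoothTransition.one_of_one_le h1]
    exact Real.smoothTransition.le_one s

theorem Real.exists_sq_deriv_smoothTransition_le :
    ∃ D, 0 ≤ D ∧ ∀ t, deriv Real.smoothTransition t ^ 2 ≤ D := by
  have hc : Continuous fun t => deriv Real.smoothTransition t ^ 2 :=
    ((Real.smoothTransition.contDiff (n := 1)).continuous_deriv le_rfl).pow 2
  obtain ⟨D, hD⟩ := (isCompact_Icc (a := (0 : ℝ)) (b := 1)).bddAbove_image hc.continuousOn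
  refine ⟨max D 0, le_max_right _ _, fun t => ?_⟩
  by_cases ht : t ∈ Ioo (0 : ℝ) 1
  · exact (hD ⟨t, Ioo_subset_Icc_self ht, rfl⟩).trans (le_max_left _ _)
  · rw [Real.deriv_smoothTransition_eq_zero ht]
    simp

namespace StratSpace

variable {n : ℕ} {X : StratSpace.{u} n}

theorem diffInner_eq_regDeriv (u v : X.Reg → ℝ) (x : X.Reg) : diffInner 𝓘(ℝ, Euc n) X.g u v x =
    X.regDeriv u x (dualVector (X.g x) fun w => X.regDeriv v x w) := rfl

theorem diffInner_self_le {u : X.Reg → ℝ} {x : X.Reg} {M : ℝ} (hM : 0 ≤ M)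
    (h : ∀ v, X.regDeriv u x v ^ 2 ≤ M * X.g x v v) : diffInner 𝓘(ℝ, Euc n) X.g u u x ≤ M :=
  (X.isInnerForm_g x).apply_dualVector_self_le (α := (X.regDeriv u x).toLinearMap) hM h

theorem diffInner_eq_zero_of_regDeriv {u : X.Reg → ℝ} {x : X.Reg} (h : X.regDeriv u x = 0)
    (v : X.Reg → ℝ) : diffInner 𝓘(ℝ, Euc n) X.g u v x = 0 := by
  rw [diffInner_eq_regDeriv, h]
  rfl

theorem regVol_univ_ne_zero (X : StratSpace.{u} n) : X.regVol univ ≠ 0 := by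
  obtain ⟨x, hx⟩ := X.dense_reg.nonempty
  let z : X.Reg := ⟨x, hx⟩
  set e := chartAt (Euc n) z
  have he : e ∈ IsManifold.maximalAtlas 𝓘(ℝ, Euc n) ∞ X.Reg := IsManifold.chart_mem_maximalAtlas z
  intro h0
  have h1 : X.regVol e.source = 0 := measure_mono_null (subset_univ _) h0
  rw [X.regVol_chart he e.open_source.measurableSet subset_rfl, e.image_source_eq_target] at h1
  have hc : ContinuousOn (fun p => ENNReal.ofReal (Real.sqrt (X.gram e p).det)) e.target :=
    ENNReal.continuous_ofReal.comp_continuousOn (Real.continuous_sqrt.comp_continuousOn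
      ((continuous_id.matrix_det).comp_continuousOn (continuousOn_gram he)))
  rw [lintegral_eq_zero_iff' (hc.aemeasurable e.open_target.measurableSet)] at h1
  have h2 : ∀ᵐ p ∂(volume.restrict e.target), False := by
    filter_upwards [h1, ae_restrict_mem e.open_target.measurableSet] with p hp hpt
    have h3 := Real.sqrt_pos.2 (gram_det_pos he hpt)
    simp only [Pi.zero_apply, ENNReal.ofReal_eq_zero] at hp
    linarith
  rw [eventually_false_iff_eq_bot, ae_eq_bot, Measure.restrict_eq_zero] at h2
  exact (e.open_target.measure_pos volume ⟨e z, e.map_source (mem_chart_source _ z)⟩).ne' h2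

/-- The cutoff function vanishing for `F ≤ ε / 2` and equal to one for `F ≥ ε`. -/
noncomputable def tubeCutoff (F : X.carrier → ℝ) (ε : ℝ) (x : X.Reg) : ℝ :=
  Real.smoothTransition (2 / ε * F x.1 - 1)

namespace IsTubeFunction

variable {F : X.carrier → ℝ} (hF : X.IsTubeFunction F) {ε : ℝ}
include hF

theorem isTestFunction_tubeCutoff (hε : 0 < ε) :
    IsTestFunction 𝓘(ℝ, Euc n) univ (tubeCutoff F ε) where
  contMDiff := by
    have h1 : ContDiff ℝ 1 fun t : ℝ => Real.smoothTransition (2 / ε * t - 1) :=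
      Real.smoothTransition.contDiff.comp (by fun_prop)
    exact h1.contMDiff.comp hF.contMDiff
  hasCompactSupport := by
    refine HasCompactSupport.intro
      (X.isCompact_reg_ge hF.continuous (fun x => (hF.eq_zero_iff x).2) (half_pos hε)) fun x hx => ?_
    have h1 : F x.1 < ε / 2 := not_le.1 hx
    refine Real.smoothTransition.zero_of_nonpos ?_
    have h2 : 2 / ε * F x.1 ≤ 2 / ε * (ε / 2) := by gcongr
    have h3 : 2 / ε * (ε / 2) = 1 := by field_simp
    linarith
  tsupport_subset := subset_univ _

theorem regDeriv_tubeCutoff (x : X.Reg) : X.regDeriv (tubeCutoff F ε) x =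
    (deriv Real.smoothTransition (2 / ε * F x.1 - 1) * (2 / ε)) •
      X.regDeriv (fun x => F x.1) x := by
  have h0 : Differentiable ℝ Real.smoothTransition :=
    (Real.smoothTransition.contDiff (n := 1)).differentiable one_ne_zero
  have h1 : ∀ t : ℝ, HasDerivAt (fun t => Real.smoothTransition (2 / ε * t - 1))
      (deriv Real.smoothTransition (2 / ε * t - 1) * (2 / ε)) t := fun t => by
    have h2 : HasDerivAt (fun t : ℝ => 2 / ε * t - 1) (2 / ε) t := by
      simpa using ((hasDerivAt_id t).const_mul (2 / ε)).sub_const 1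
    exact (h0 _).hasDerivAt.comp t h2
  have h2 := regDeriv_comp hF.contMDiff (s := fun t => Real.smoothTransition (2 / ε * t - 1))
    (fun t => (h1 t).differentiableAt) x
  rw [(h1 _).deriv] at h2
  exact h2

theorem regDeriv_tubeCutoff_eq_zero (hε : 0 < ε) {x : X.Reg} (hx : ε ≤ F x.1) :
    X.regDeriv (tubeCutoff F ε) x = 0 := by
  have h2 : 2 / ε * ε ≤ 2 / ε * F x.1 := by gcongr
  have h3 : 2 / ε * ε = 2 := by field_simp
  rw [hF.regDeriv_tubeCutoff, Real.deriv_smoothTransition_eq_zero fun h => by linarith [h.2],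
    zero_mul, zero_smul]

/-- The squared differential is `O(ε⁻²)` and is supported where `F < ε`, a set of volume `O(ε²)`.
Codimension two gives only boundedness, not decay, and boundedness is all that
`IsFormResolvent.weak` asks. -/
theorem exists_dirichletForm_tubeCutoff_le : ∃ C, ∀ ε, 0 < ε →
    dirichletForm 𝓘(ℝ, Euc n) X.g X.regVol (tubeCutoff F ε) (tubeCutoff F ε) ≤ C := by
  obtain ⟨C, hC0, hC⟩ := hF.regVol_lt_le
  obtain ⟨B, hB0, hB⟩ := hF.bound
  obtain ⟨D, hD0, hD⟩ := Real.exists_sq_deriv_smoothTransition_le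
  refine ⟨4 * D * B * C, fun ε hε => ?_⟩
  set A : Set X.Reg := {x | F x.1 < ε} with hA
  have hAm : MeasurableSet A :=
    (isOpen_lt (hF.continuous.comp X.isOpenEmbedding_val.continuous) continuous_const).measurableSet
  have hAf : X.regVol A ≠ ⊤ := ((hC ε hε).trans_lt ENNReal.ofReal_lt_top).ne
  set M := D * (2 / ε) ^ 2 * B with hM
  have hM0 : 0 ≤ M := by positivity
  have hpt : ∀ x, diffInner 𝓘(ℝ, Euc n) X.g (tubeCutoff F ε) (tubeCutoff F ε) x ≤
      A.indicator (fun _ => M) x := fun x => by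
    by_cases hx : x ∈ A
    · rw [indicator_of_mem hx]
      refine diffInner_self_le hM0 fun v => ?_
      rw [hF.regDeriv_tubeCutoff]
      have h1 := hB x v
      have h2 := hD (2 / ε * F x.1 - 1)
      change (deriv Real.smoothTransition (2 / ε * F x.1 - 1) * (2 / ε) *
        X.regDeriv (fun x => F x.1) x v) ^ 2 ≤ _
      rw [mul_pow, mul_pow, hM, mul_assoc _ B]
      exact mul_le_mul (mul_le_mul_of_nonneg_right h2 (sq_nonneg _)) h1 (sq_nonneg _)
        (by positivity)
    · rw [indicator_of_notMem hx,
        diffInner_eq_zero_of_regDeriv (hF.regDeriv_tubeCutoff_eq_zero hε (not_lt.1 hx))]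
  have htest := hF.isTestFunction_tubeCutoff hε
  calc dirichletForm 𝓘(ℝ, Euc n) X.g X.regVol (tubeCutoff F ε) (tubeCutoff F ε)
      ≤ ∫ x, A.indicator (fun _ => M) x ∂X.regVol :=
        integral_mono (X.isDirichletSpace.integrable _ _ htest htest)
          ((integrable_indicator_iff hAm).2 (integrableOn_const hAf)) hpt
    _ = (X.regVol A).toReal * M := by
        rw [integral_indicator hAm, setIntegral_const, smul_eq_mul, measureReal_def]
    _ ≤ C * ε ^ 2 * M := by
        gcongr
        exact ENNReal.toReal_le_of_le_ofReal (by positivity) (hC ε hε)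
    _ = 4 * D * B * C := by
        rw [hM]
        field_simp
        ring

theorem tendsto_eLpNorm_tubeCutoff {ε : ℕ → ℝ} (hε : ∀ i, 0 < ε i)
    (hlim : Tendsto ε atTop (𝓝 0)) :
    Tendsto (fun i => eLpNorm (fun x => tubeCutoff F (ε i) x - 1) 2 X.regVol) atTop (𝓝 0) := by
  obtain ⟨C, hC0, hC⟩ := hF.regVol_lt_le
  have h1 : Tendsto (fun i => ENNReal.ofReal (C * ε i ^ 2) ^ (1 / 2 : ℝ)) atTop (𝓝 0) := by
    have h2 : Tendsto (fun i => ENNReal.ofReal (C * ε i ^ 2)) atTop (𝓝 0) := by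
      have := ENNReal.tendsto_ofReal ((hlim.pow 2).const_mul C)
      simpa using this
    have h3 := (ENNReal.continuous_rpow_const (y := 1 / 2)).tendsto 0
    rw [ENNReal.zero_rpow_of_pos (by norm_num)] at h3
    exact h3.comp h2
  refine tendsto_of_tendsto_of_tendsto_of_le_of_le tendsto_const_nhds h1 (fun _ => zero_le)
    fun i => ?_
  set A : Set X.Reg := {x | F x.1 < ε i} with hA
  have hAm : MeasurableSet A :=
    (isOpen_lt (hF.continuous.comp X.isOpenEmbedding_val.continuous) continuous_const).measurableSet
  calc eLpNorm (fun x => tubeCutoff F (ε i) x - 1) 2 X.regVol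
      ≤ eLpNorm (A.indicator fun _ => (1 : ℝ)) 2 X.regVol := by
        refine eLpNorm_mono fun x => ?_
        by_cases hx : x ∈ A
        · rw [indicator_of_mem hx, norm_one, Real.norm_eq_abs, abs_le]
          have h2 := Real.smoothTransition.nonneg (2 / ε i * F x.1 - 1)
          have h3 := Real.smoothTransition.le_one (2 / ε i * F x.1 - 1)
          unfold tubeCutoff
          constructor <;> linarith
        · have h4 : ε i ≤ F x.1 := not_lt.1 hx
          have h5 : 2 / ε i * ε i ≤ 2 / ε i * F x.1 := by
            have := hε i
            gcongr
          have h6 : 2 / ε i * ε i = 2 := div_mul_cancel₀ _ (hε i).ne'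
          have h7 : tubeCutoff F (ε i) x = 1 := Real.smoothTransition.one_of_one_le (by linarith)
          rw [h7]
          simp
    _ = X.regVol A ^ (1 / 2 : ℝ) := by
        rw [eLpNorm_indicator_const hAm (by norm_num) (by norm_num)]
        simp
    _ ≤ _ := by
        gcongr
        exact hC _ (hε i)

/-- The function is the constant `1`: the cutoffs tend to it in `L²` with bounded energy, and their
form against any test function is eventually zero. -/
theorem exists_resolvent_eq_self : ∃ f : Lp ℝ 2 X.regVol, f ≠ 0 ∧
    X.isDirichletSpace.resolvent f = f := by
  have : IsFiniteMeasure X.regVol := ⟨hF.regVol_univ.lt_top⟩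
  have hone : MemLp (fun _ : X.Reg => (1 : ℝ)) 2 X.regVol := memLp_const 1
  refine ⟨hone.toLp _, fun h0 => ?_, ?_⟩
  · rw [Lp.ext_iff] at h0
    have h2 : ∀ᵐ x ∂X.regVol, False := by
      filter_upwards [h0, hone.coeFn_toLp, Lp.coeFn_zero ℝ 2 X.regVol] with x h1 h2 h3
      rw [h2, h3] at h1
      exact one_ne_zero h1
    rw [eventually_false_iff_eq_bot, ae_eq_bot] at h2
    exact X.regVol_univ_ne_zero (by rw [h2]; rfl)
  · set ε : ℕ → ℝ := fun i => 1 / ((i : ℝ) + 1) with hεd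
    have hε : ∀ i, 0 < ε i := fun i => by positivity
    have hlim : Tendsto ε atTop (𝓝 0) := tendsto_one_div_add_atTop_nhds_zero_nat
    obtain ⟨C, hC⟩ := hF.exists_dirichletForm_tubeCutoff_le
    have htest := fun i => hF.isTestFunction_tubeCutoff (hε i)
    have h1 := X.isDirichletSpace.isFormResolvent.weak (fun i => (htest i).toTest) C
      (hone.toLp _) 0 (fun i => hC _ (hε i)) ?_ fun v => ?_
    · rwa [add_zero] at h1
    · exact (Lp.tendsto_Lp_iff_tendsto_eLpNorm'' (fi := atTop) (p := 2) (μ := X.regVol)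
        (fun i => tubeCutoff F (ε i)) (fun i => X.isDirichletSpace.memLp _ (htest i))
        (fun _ => 1) hone).2 (hF.tendsto_eLpNorm_tubeCutoff hε hlim)
    · rw [inner_zero_left]
      have hK : IsCompact (tsupport v.1) := v.2.hasCompactSupport
      -- `F` is positive on the regular set, hence at least `c₀ > 0` on the compact support of `v`;
      -- for `ε < c₀` the cutoff has zero differential there.
      obtain ⟨c₀, hc₀, hc⟩ := hK.exists_forall_le'
        (f := fun x : X.Reg => F x.1) (a := 0)
        (hF.continuous.comp X.isOpenEmbedding_val.continuous).continuousOn fun x _ =>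
          (hF.nonneg x.1).lt_of_ne fun h => (hF.eq_zero_iff x.1).1 h.symm x.2
      refine tendsto_const_nhds.congr' ?_
      filter_upwards [hlim.eventually (gt_mem_nhds hc₀)] with i hi
      symm
      refine integral_eq_zero_of_ae (ae_of_all _ fun x => ?_)
      by_cases hx : x ∈ tsupport v.1
      · exact diffInner_eq_zero_of_regDeriv
          (hF.regDeriv_tubeCutoff_eq_zero (hε i) (hi.le.trans (hc x hx))) _
      · exact (diffInner_comm (X.isInnerForm_g x) _ _).trans
          (diffInner_eq_zero_of_notMem_left hx _)

end IsTubeFunction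

end StratSpace

/-! ### The first eigenvalue of the suspension -/

theorem ballLp_ne_zero {k m : ℕ} (hm : 1 ≤ m) {φ : Euc k → ℝ} (hφ : Continuous φ) {y₀ : Euc k}
    (hy₀ : y₀ ∈ Metric.ball (0 : Euc k) 1) (h₀ : φ y₀ ≠ 0) : ballLp hm hφ ≠ 0 := by
  intro h
  have h1 : φ =ᵐ[ballVol k m] 0 :=
    (MemLp.coeFn_toLp (memLp_ballVol hm hφ)).symm.trans ((Lp.ext_iff.1 h).trans (Lp.coeFn_zero _ _ _))
  have hmeas : Measurable fun y : Euc k =>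
      ENNReal.ofReal (StratSpace.suspRadius y ^ m / StratSpace.suspRadius y) :=
    ((continuous_suspRadius.measurable.pow_const m).div continuous_suspRadius.measurable).ennreal_ofReal
  have h2 := (ae_withDensity_iff hmeas).1 h1
  have hU : IsOpen (Metric.ball (0 : Euc k) 1 ∩ {y | φ y ≠ 0}) :=
    Metric.isOpen_ball.inter (isOpen_ne_fun hφ continuous_const)
  refine (hU.measure_pos volume ⟨y₀, hy₀, h₀⟩).ne' ?_
  rw [ae_restrict_iff' Metric.isOpen_ball.measurableSet] at h2
  refine measure_mono_null (fun y hy => ?_) (ae_iff.1 h2)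
  have hr := suspRadius_pos hy.1
  exact fun hc => hy.2 (hc hy.1 (ENNReal.ofReal_pos.2 (by positivity)).ne')

namespace StratSpace

variable {k m : ℕ} {Z : StratSpace.{u} m}

/-- The eigenfunction is `r ^ γ ⊗ f` with `f` a first eigenfunction of `Z`. -/
theorem isSuspLambdaOne_of_eq (hm : 1 ≤ m) {lam γ : ℝ} (hlam : Z.IsLambdaOne lam) (hγ0 : 0 < γ)
    (hγ1 : γ ≤ 1) (hγ : lam = γ * (γ + m - 1)) : Z.IsSuspLambdaOne k (γ * (k + m - 1 + γ)) := by
  obtain ⟨-, ⟨f, hf0, hf⟩, -⟩ := Z.isDirichletSpace.gap_of_isFirstNonzeroEigenvalue hlam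
  rw [hγ] at hf
  have hs := isSphSolution_rpow (k := k) m hγ0
  have h1 := resolvent_suspTensor (Z := Z) hm hs hf
  have h2 : ballLp hm hs.continuous_rhs = (γ * (k + m - 1 + γ)) • ballLp hm hs.continuous := rfl
  rw [h2, map_smul, LinearMap.smul_apply, map_add, map_smul] at h1
  refine isSuspLambdaOne_of_eigenfunction hm hlam hγ0 hγ1 hγ.ge
    (f := suspTensor (ballLp hm hs.continuous) f) ?_ ?_
  · rw [← norm_ne_zero_iff, norm_suspTensor]
    refine mul_ne_zero (norm_ne_zero_iff.2 (ballLp_ne_zero hm hs.continuous (y₀ := 0) (by simp) ?_))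
      (norm_ne_zero_iff.2 hf0)
    simp [suspRadius]
  · rw [add_smul, one_smul]
    exact h1

/-- The lower bound is used with `γ = 1`, for which the threshold `γ (γ + m - 1)` is `m`. The
eigenfunction is a coordinate of `ℝᵏ` times an element of the kernel of `Δ_Z`; existence of both
requires `1 ≤ k` and the iterated edge structure. -/
theorem isSuspLambdaOne_of_le (hk : 1 ≤ k) (hm : 1 ≤ m) {d : ℕ} (hZ : Z.IsIteratedEdge d) {lam : ℝ}
    (hlam : Z.IsLambdaOne lam) (h : (m : ℝ) ≤ lam) : Z.IsSuspLambdaOne k (k + m) := by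
  obtain ⟨F, hF⟩ := hZ.exists_isTubeFunction
  obtain ⟨b, hb0, hb⟩ := hF.exists_resolvent_eq_self
  let a : Euc k := EuclideanSpace.single ⟨0, hk⟩ 1
  have h1 := resolvent_ridge (Z := Z) hm 1 a (mem_fixedSpace.2 hb)
  simp only [Nat.cast_one, Nat.sub_self, Nat.cast_zero, mul_zero, zero_mul, zero_smul,
    sub_eq_zero] at h1
  have h2 := isSuspLambdaOne_of_eigenfunction (k := k) hm hlam one_pos le_rfl (by linarith)
    (f := suspTensor (ballLp hm (continuous_ridge a 1)) b) ?_ ?_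
  · convert h2 using 1
    ring
  · rw [← norm_ne_zero_iff, norm_suspTensor]
    refine mul_ne_zero (norm_ne_zero_iff.2 (ballLp_ne_zero hm _ (y₀ := (1 / 2 : ℝ) • a) ?_ ?_))
      (norm_ne_zero_iff.2 hb0)
    · rw [mem_ball_zero_iff, norm_smul]
      simp only [a, PiLp.norm_single]
      norm_num
    · rw [pow_one, inner_smul_right, real_inner_self_eq_norm_sq]
      simp [a]
  · convert h1 using 3
    rw [sphEigenvalue]
    push_cast
    ring

theorem isSuspLambdaOne_iff_eq {Lam : ℝ} (h : Z.IsSuspLambdaOne k Lam) (t : ℝ) :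
    Z.IsSuspLambdaOne k t ↔ t = Lam :=
  ⟨fun ht => ht.2.unique h.2, fun ht => ht ▸ h⟩

end StratSpace

/-! ### The exponent `ν₁` and the quadratic equation for `γ`. -/

theorem isNuOne_iff_of_le {l : ℕ} {lam : ℝ} (h : (l : ℝ) ≤ lam) (t : ℝ) :
    IsNuOne l lam t ↔ t = 1 := by
  constructor
  · rintro (h1 | h1)
    · exact h1.2
    · exact absurd h1.1 (not_lt.2 h)
  · exact fun ht => Or.inl ⟨h, ht⟩

theorem eq_of_mul_add_eq {c s t : ℝ} (hc : 0 ≤ c) (hs : 0 < s) (ht : 0 < t)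
    (h : s * (c + s) = t * (c + t)) : s = t := by
  have h1 : (s - t) * (c + s + t) = 0 := by linarith
  rcases mul_eq_zero.1 h1 with h2 | h2
  · linarith
  · linarith

theorem exists_mul_add_eq {c lam : ℝ} (hc : 0 ≤ c) (hlam : 0 < lam) :
    ∃ γ, 0 < γ ∧ lam = γ * (c + γ) := by
  have h0 : 0 ≤ c ^ 2 + 4 * lam := by positivity
  have h1 : c < √(c ^ 2 + 4 * lam) := Real.lt_sqrt_of_sq_lt (by linarith)
  refine ⟨(√(c ^ 2 + 4 * lam) - c) / 2, by linarith, ?_⟩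
  nlinarith [Real.sq_sqrt h0]

theorem isNuOne_iff_of_eq {l : ℕ} (hl : 1 ≤ l) {lam γ : ℝ} (hγ : γ ∈ Ioo (0 : ℝ) 1)
    (h : lam = γ * (l - 1 + γ)) (t : ℝ) : IsNuOne l lam t ↔ t = γ := by
  have hl' : (1 : ℝ) ≤ l := by exact_mod_cast hl
  have hlt : lam < l := by
    rw [h]
    nlinarith [hγ.1, hγ.2]
  constructor
  · rintro (h1 | ⟨-, h1, h2⟩)
    · exact absurd hlt (not_lt.2 h1.1)
    · exact eq_of_mul_add_eq (sub_nonneg.2 hl') h1.1 hγ.1 (h2.symm.trans h)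
  · rintro rfl
    exact Or.inr ⟨hlt, hγ, h⟩

theorem mainTheorem3 {n k m d : ℕ} (hn : n = k + m + 1) (hk : 1 ≤ k) (hm : 1 ≤ m)
    (Z : StratSpace.{u} m) (hZ : Z.IsIteratedEdge d)
    (lam : ℝ) (hlam : Z.IsLambdaOne lam) :
    ((m : ℝ) ≤ lam → Z.IsSuspLambdaOne k ((n : ℝ) - 1)) ∧
    (lam ≤ (m : ℝ) →
      (∃! γ : ℝ, 0 < γ ∧ lam = γ * (γ + n - k - 2)) ∧
      ∀ γ : ℝ, 0 < γ → lam = γ * (γ + n - k - 2) →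
        Z.IsSuspLambdaOne k (γ * (n - 2 + γ))) ∧
    ∃ Lam ν : ℝ, (∀ t, Z.IsSuspLambdaOne k t ↔ t = Lam) ∧
      (∀ t, IsNuOne m lam t ↔ t = ν) ∧ (∀ t, IsNuOne (n - 1) Lam t ↔ t = ν) := by
  subst hn
  have hlam0 := (Z.isDirichletSpace.gap_of_isFirstNonzeroEigenvalue hlam).1
  have hm' : (1 : ℝ) ≤ m := by exact_mod_cast hm
  have hc : (0 : ℝ) ≤ m - 1 := sub_nonneg.2 hm'
  have hform : ∀ γ : ℝ, γ * (γ + ((k + m + 1 : ℕ) : ℝ) - k - 2) = γ * (m - 1 + γ) := fun γ => by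
    push_cast
    ring
  -- At `γ = 1` the right side equals `m`, and it increases with `γ`.
  have hle1 : ∀ γ : ℝ, 0 < γ → lam ≤ m → lam = γ * (m - 1 + γ) → γ ≤ 1 := fun γ h0 h1 h2 => by
    by_contra! h3
    nlinarith
  obtain ⟨γ, hγ0, hγ⟩ := exists_mul_add_eq hc hlam0
  have hlarge : (m : ℝ) ≤ lam → Z.IsSuspLambdaOne k (k + m) :=
    StratSpace.isSuspLambdaOne_of_le hk hm hZ hlam
  have hsmall : lam ≤ m → Z.IsSuspLambdaOne k (γ * (k + m - 1 + γ)) := fun h =>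
    StratSpace.isSuspLambdaOne_of_eq hm hlam hγ0 (hle1 γ hγ0 h hγ) (hγ.trans (by ring))
  refine ⟨fun h => ?_, fun h => ⟨⟨γ, ⟨hγ0, hγ.trans (hform γ).symm⟩, fun s hs => ?_⟩,
    fun s hs0 hs => ?_⟩, ?_⟩
  · convert hlarge h using 1
    push_cast
    ring
  · exact eq_of_mul_add_eq hc hs.1 hγ0 (((hform s).symm.trans hs.2.symm).trans hγ)
  · obtain rfl : s = γ := eq_of_mul_add_eq hc hs0 hγ0 (((hform s).symm.trans hs.symm).trans hγ)
    convert hsmall h using 2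
    push_cast
    ring
  · have hn1 : k + m + 1 - 1 = k + m := rfl
    rw [hn1]
    -- For `m ≤ lam` both exponents are `1`, since `λ₁(S) = k + m` equals `dim S`. For `lam < m` the
    -- same `γ < 1` solves both equations, with `dim S - 1 = k + m - 1`.
    rcases le_or_gt (m : ℝ) lam with h | h
    · exact ⟨k + m, 1, StratSpace.isSuspLambdaOne_iff_eq (hlarge h), isNuOne_iff_of_le h,
        isNuOne_iff_of_le (by push_cast; exact le_rfl)⟩
    · have hγ1 : γ < 1 := (hle1 γ hγ0 h.le hγ).lt_of_ne fun h1 => by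
        rw [h1] at hγ
        linarith
      exact ⟨γ * (k + m - 1 + γ), γ, StratSpace.isSuspLambdaOne_iff_eq (hsmall h.le),
        isNuOne_iff_of_eq hm ⟨hγ0, hγ1⟩ hγ,
        isNuOne_iff_of_eq (by omega) ⟨hγ0, hγ1⟩ (by push_cast; ring)⟩
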